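/- Let $n\ge 1$ and let $\mu_0,\dots,\mu_n\in(0,1)$ be real numbers whose sum $|\mu|=\mu_0+\cdots+\mu_n$ is not an integer $\ge 2$. Let $V_n=\mathbb C^{n+1}/\mathbb C(1,\dots,1)$ and let $V_n^\circ\subset V_n$ be the set of classes of $(n+1)$-tuples $z=(z_0,\dots,z_n)$ with pairwise distinct components. An *L-arc system* for $z$ is an oriented simple, piecewise $C^1$ regular arc $\delta$ in $\mathbb P^1=\mathbb C\cup\{\infty\}$ from $z_0$ to $z_{n+1}:=\infty$ which passes successively through $z_1,\dots,z_n$ and near $\infty$ follows the real axis in the positive direction; $\delta_k$ is the piece from $z_{k-1}$ to $z_k$. For $1\le k\le n$ put $$F_k(z,\delta)=\int_{\delta_k}(\zeta-z_0)^{-\mu_0}\cdots(\zeta-z_{k-1})^{-\mu_{k-1}}(z_k-\zeta)^{-\mu_k}\cdots(z_n-\zeta)^{-\mu_n}\,d\zeta ,$$ where, for a point $p$ of $\delta$ and a later point $q$ of $\delta$, the power of $q-p$ is formed with the determination of $\arg(q-p)$ that is continuous in $(p,q)$ and tends to $0$ as $q\to\infty$ along $\delta$. Equivalently, $F_k(z,\delta)=\bar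 w_k\int_{\delta_k}\eta_z$ with $w_k=e^{\sqrt{-1}\,\pi(\mu_0+\cdots+\mu_{k-1})}$ and $\eta_z=\prod_j(z_j-\zeta)^{-\mu_j}d\zeta$, where $\eta_z$ has on $\delta$ the limit from the left of the determination on $\mathbb C\smallsetminus\delta$ that is the principal one on a left half plane. A branch of the multivalued *Lauricella map* $F=(F_1,\dots,F_n)$ on an open subset of $V_n^\circ$ is a map that is locally of the form $[z]\mapsto (F_1(z,\delta_z),\dots,F_n(z,\delta_z))$ with $\delta_z$ an L-arc system for $z$ such that $\delta_z$ and the determinations of the logarithms along it depend continuously on $[z]$. Every point of $V_n^\circ$ has an L-arc system, and every L-arc system belongs to such a local continuous family. 1. If $|\mu|\neq 1$, then every branch of $F$ is a local isomorphism (locally biholomorphic) from $V_n^\circ$ to $\mathbb C^n$, and $F(z,\delta)\ne 0$ for all $(z,\delta)$. 2. If $|\mu|=1$ (the parabolic case), then $F$ factors through a multivalued map from $\mathbb P(V_n^\circ)$ to the affine hyperplane $\mathbb A^{n-1}\subset\mathbb C^n$ defined by $\sum_{k=1}^n\operatorname{Im}(w_k)F_k=\pi$, every branch of which is a local isomorphism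 to $\mathbb A^{n-1}$. 3. In all these cases the projectivization of $F$ is a well defined multivalued map $\mathbb PF$ from $\mathbb P(V_n^\circ)$ to $\mathbb P^{n-1}=\mathbb P(\mathbb C^n)$, the *Schwarz map*, every branch of which is a local isomorphism. -/

import Mathlib

noncomputable section

namespace Lauricella

open Set Filter Topology

/-! ### The space `V_n` and the configuration space `V_n°` -/

/-- The main diagonal in `ℂⁿ⁺¹`. -/
def mainDiagonal (n : ℕ) : Submodule ℂ (Fin (n + 1) → ℂ) :=
  Submodule.span ℂ {fun _ => 1}

instance (n : ℕ) : IsClosed (mainDiagonal n : Set (Fin (n + 1) → ℂ)) :=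
  Submodule.closed_of_finiteDimensional _

/-- `V_n = ℂⁿ⁺¹ / main diagonal`. -/
abbrev V (n : ℕ) : Type := (Fin (n + 1) → ℂ) ⧸ mainDiagonal n

/-- The quotient map `ℂⁿ⁺¹ → V_n`. -/
def toV {n : ℕ} (z : Fin (n + 1) → ℂ) : V n := Submodule.Quotient.mk z

/-- `V_n°`: classes of tuples with pairwise distinct components. -/
def VCirc (n : ℕ) : Set (V n) := toV '' {z | Function.Injective z}

/-! ### L-arc systems -/

/-- Piecewise `C¹` regular path on `[0, ∞)` (finitely many break points; on every closed interval
without interior break point it is `C¹` with nowhere vanishing velocity, end points included). -/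
def IsPiecewiseRegular (p : ℝ → ℂ) : Prop :=
  ∃ s : Finset ℝ, ∀ a b : ℝ, 0 ≤ a → a < b → Disjoint (Ioo a b) (s : Set ℝ) →
    ContDiffOn ℝ 1 p (Icc a b) ∧ ∀ t ∈ Icc a b, derivWithin p (Icc a b) t ≠ 0

/-- An L-arc system: a simple, piecewise regular arc `δ : [0, ∞) → ℂ` (the values of `path` at
negative parameters are irrelevant) that runs to `∞` and finally follows the real axis in the
positive direction. It is parametrized so that the marked points `z₀, …, zₙ` through which it passes
successively are its values at the parameters `0, …, n`; thus `δ_k` is its restriction to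
`[k - 1, k]`. -/
structure LArcSystem (n : ℕ) where
  path : ℝ → ℂ
  continuousOn : ContinuousOn path (Ici 0)
  injOn : InjOn path (Ici 0)
  piecewiseRegular : IsPiecewiseRegular path
  eventually_real : ∀ᶠ t in atTop, (path t).im = 0
  tendsto_re : Tendsto (fun t => (path t).re) atTop atTop

/-- The parameter domain of chords of an arc. -/
def chordDomain : Set (ℝ × ℝ) := {q | 0 ≤ q.1 ∧ q.1 < q.2}

/-- `Λ (t, s)`, for `0 ≤ t < s`, is the continuous determination of `log (δ s - δ t)` whose
imaginary part tends to `0` as `s → ∞`. (It is unique, the domain being connected.) -/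
def IsChordLog (p : ℝ → ℂ) (Λ : ℝ × ℝ → ℂ) : Prop :=
  ContinuousOn Λ chordDomain ∧
  (∀ q ∈ chordDomain, Complex.exp (Λ q) = p q.2 - p q.1) ∧
  ∀ t, 0 ≤ t → Tendsto (fun s => (Λ (t, s)).im) atTop (𝓝 0)

theorem LArcSystem.exists_chordLog {n : ℕ} (δ : LArcSystem n) : ∃ Λ, IsChordLog δ.path Λ := by
  have hc := δ.continuousOn
  set p := δ.path with hp
  -- a determination, without the normalization
  obtain ⟨f, hf, hfe⟩ : ∃ f : ℝ × ℝ → ℂ, ContinuousOn f univ ∧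
      EqOn (Complex.exp ∘ f) (fun x => p (|x.1| + Real.exp x.2) - p |x.1|) univ := by
    refine Complex.exists_continuousOn_eqOn_exp_comp ?_ isOpen_univ ?_ ?_
    · exact (Homeomorph.Set.univ (ℝ × ℝ)).toHomotopyEquiv.simplyConnectedSpace
    · refine ContinuousOn.sub (hc.comp (by fun_prop) ?_) (hc.comp (by fun_prop) ?_)
      · intro x _
        exact add_nonneg (abs_nonneg _) (Real.exp_pos _).le
      · intro x _
        exact abs_nonneg x.1
    · rintro ⟨x, -, hx⟩
      have := δ.injOn (show |x.1| + Real.exp x.2 ∈ Ici (0 : ℝ) from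
        add_nonneg (abs_nonneg _) (Real.exp_pos _).le)
        (show |x.1| ∈ Ici (0 : ℝ) from abs_nonneg x.1) (sub_eq_zero.mp hx)
      have h2 := Real.exp_pos x.2
      linarith
  set Λ₀ : ℝ × ℝ → ℂ := fun q => f (q.1, Real.log (q.2 - q.1)) with hΛ₀
  have hΛc : ContinuousOn Λ₀ chordDomain := by
    refine hf.comp (ContinuousOn.prodMk continuousOn_fst ?_) (fun _ _ => mem_univ _)
    refine ContinuousOn.log (by fun_prop) ?_
    rintro q ⟨_, h⟩
    exact (sub_pos.mpr h).ne'
  have hΛe : ∀ q ∈ chordDomain, Complex.exp (Λ₀ q) = p q.2 - p q.1 := by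
    rintro q ⟨h0, h⟩
    have := hfe (mem_univ (q.1, Real.log (q.2 - q.1)))
    simp only [Function.comp_apply, abs_of_nonneg h0, Real.exp_log (sub_pos.mpr h)] at this
    simpa [hΛ₀] using this
  -- comparison with the principal logarithm far out
  have key : ∀ t, 0 ≤ t → ∀ᶠ s in atTop, ∀ u ∈ Icc 0 t,
      Λ₀ (u, s) = Complex.log (p s - p u) +
        (Λ₀ (0, s) - Complex.log (p s - p 0)) ∧ 0 < (p s - p u).re ∧
        ∀ s' ≥ s, Λ₀ (u, s') - Complex.log (p s' - p u) =
          Λ₀ (u, s) - Complex.log (p s - p u) := by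
    intro t ht
    obtain ⟨M, hM⟩ : ∃ M, ∀ u ∈ Icc 0 t, (p u).re ≤ M := by
      have hcomp : ContinuousOn (fun u => (p u).re) (Icc 0 t) :=
        Complex.continuous_re.comp_continuousOn (hc.mono Icc_subset_Ici_self)
      obtain ⟨M, hM⟩ := (isCompact_Icc.image_of_continuousOn hcomp).bddAbove
      exact ⟨M, fun u hu => hM ⟨u, hu, rfl⟩⟩
    obtain ⟨T, hT⟩ := (eventually_atTop.mp (δ.tendsto_re.eventually_gt_atTop M))
    have hpos : ∀ q ∈ Icc 0 t ×ˢ Ici (max T (t + 1)), 0 < (p q.2 - p q.1).re := by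
      rintro q ⟨h1, h2⟩
      have := hM _ h1
      have := hT q.2 (le_trans (le_max_left _ _) h2)
      simp only [Complex.sub_re, ← hp] at *
      linarith
    have hsub : Icc 0 t ×ˢ Ici (max T (t + 1)) ⊆ chordDomain := by
      rintro q ⟨h1, h2⟩
      refine ⟨h1.1, ?_⟩
      have h3 : t + 1 ≤ q.2 := le_trans (le_max_right _ _) h2
      have h4 := h1.2
      linarith
    have hconst : ∀ a ∈ Icc 0 t ×ˢ Ici (max T (t + 1)), ∀ b ∈ Icc 0 t ×ˢ Ici (max T (t + 1)),
        Λ₀ b = Complex.log (p b.2 - p b.1) + (Λ₀ a - Complex.log (p a.2 - p a.1)) := by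
      intro a ha b hb
      have hne : ∀ q ∈ Icc 0 t ×ˢ Ici (max T (t + 1)), p q.2 - p q.1 ≠ 0 := fun q hq h => by
        have := hpos q hq
        simp [h] at this
      refine Complex.isCoveringMap_exp.eqOn_of_comp_eqOn
        (g₂ := fun b => Complex.log (p b.2 - p b.1) + (Λ₀ a - Complex.log (p a.2 - p a.1)))
        ((convex_Icc 0 t).prod (convex_Ici _)).isPreconnected (hΛc.mono hsub) ?_ ?_ ha
        (by ring) hb
      · refine ContinuousOn.add (ContinuousOn.clog ?_ ?_) continuousOn_const
        · refine ContinuousOn.sub (hc.comp continuousOn_snd ?_) (hc.comp continuousOn_fst ?_)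
          · intro q hq
            exact (hsub hq).1.trans (hsub hq).2.le
          · intro q hq
            exact (hsub hq).1
        · intro q hq
          exact Or.inl (hpos q hq)
      · intro q hq
        refine Subtype.ext ?_
        simp only [Function.comp_apply]
        rw [Complex.exp_add, Complex.exp_sub, Complex.exp_log (hne q hq),
          Complex.exp_log (hne a ha), hΛe q (hsub hq), hΛe a (hsub ha), div_self (hne a ha),
          mul_one]
    refine eventually_atTop.mpr ⟨max T (t + 1), fun s hs u hu => ⟨?_, ?_, ?_⟩⟩
    · exact hconst (0, s) ⟨⟨le_rfl, ht⟩, hs⟩ (u, s) ⟨hu, hs⟩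
    · exact hpos (u, s) ⟨hu, hs⟩
    · intro s' hs'
      have := hconst (u, s) ⟨hu, hs⟩ (u, s') ⟨hu, le_trans hs hs'⟩
      simp only at this
      rw [this]
      ring
  obtain ⟨S, hS⟩ := (key 0 le_rfl).exists
  obtain ⟨-, hS0, hS1⟩ := hS 0 ⟨le_rfl, le_rfl⟩
  set c : ℂ := Λ₀ (0, max S 1) - Complex.log (p (max S 1) - p 0) with hcdef
  have hcS := hS1 (max S 1) (le_max_left _ _)
  have hcexp : Complex.exp c = 1 := by
    have hne : p (max S 1) - p 0 ≠ 0 := by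
      intro h
      have := δ.injOn (mem_Ici.mpr (le_trans zero_le_one (le_max_right S 1)))
        (mem_Ici.mpr le_rfl) (sub_eq_zero.mp h)
      have h1 : (1 : ℝ) ≤ max S 1 := le_max_right _ _
      linarith
    rw [hcdef, Complex.exp_sub, Complex.exp_log hne,
      hΛe (0, max S 1) ⟨le_rfl, lt_of_lt_of_le zero_lt_one (le_max_right _ _)⟩, div_self hne]
  refine ⟨fun q => Λ₀ q - c, hΛc.sub continuousOn_const, ?_, ?_⟩
  · intro q hq
    rw [Complex.exp_sub, hcexp, div_one, hΛe q hq]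
  · intro t ht
    have h1 : ∀ᶠ s in atTop, (Λ₀ (t, s) - c).im
        = Real.arcsin ((0 - (p t).im) / ‖p s - p t‖) := by
      filter_upwards [key t ht, δ.eventually_real, eventually_ge_atTop S] with s hs him hsS
      obtain ⟨ha, hb, -⟩ := hs t ⟨ht, le_rfl⟩
      have h2 := hS1 s hsS
      have h3 : Λ₀ (t, s) - c = Complex.log (p s - p t) := by
        rw [ha, h2, hcdef, hcS]
        ring
      rw [h3, Complex.log_im, Complex.arg_of_re_nonneg hb.le, Complex.sub_im, him]
    refine Tendsto.congr' (h1.mono fun s hs => hs.symm) ?_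
    have h4 : Tendsto (fun s => ‖p s - p t‖) atTop atTop := by
      refine tendsto_atTop_mono (fun s => ?_)
        (tendsto_atTop_add_const_right atTop (-(p t).re) δ.tendsto_re)
      have := Complex.re_le_norm (p s - p t)
      simpa [sub_eq_add_neg] using this
    have h5 := (Real.continuous_arcsin.tendsto 0).comp (h4.const_div_atTop (0 - (p t).im))
    simpa [Function.comp_def] using h5

/-- The normalized determination of `log (δ s - δ t)`, `0 ≤ t < s`. -/
def LArcSystem.chordLog {n : ℕ} (δ : LArcSystem n) : ℝ × ℝ → ℂ := δ.exists_chordLog.choose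

theorem LArcSystem.chordLog_spec {n : ℕ} (δ : LArcSystem n) : IsChordLog δ.path δ.chordLog :=
  δ.exists_chordLog.choose_spec

/-- The marked points `z₀, …, zₙ` of an L-arc system. -/
def LArcSystem.points {n : ℕ} (δ : LArcSystem n) : Fin (n + 1) → ℂ := fun j => δ.path (j : ℕ)

/-- The class in `V_n` of the marked points of an L-arc system. -/
def LArcSystem.cls {n : ℕ} (δ : LArcSystem n) : V n := toV δ.points

/-! ### The Lauricella map -/

/-- The integrand of `F_{k+1}` (`0 ≤ k < n`) on the arc `δ_{k+1}`, at the point `ζ = δ t`: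
`∏_{j ≤ k} (ζ - z_j)^{-μ_j} ∏_{j > k} (z_j - ζ)^{-μ_j}`.
For `j > k` the determination of `z_j - ζ = δ j - δ t` is the one on the complement of
`δ [j, ∞)` that is the principal one on a left half plane (at the tail of `δ` the argument of
`δ s - δ t` is near `0`; continue back to `s = j`). For `j ≤ k` the determination of
`ζ - z_j = δ t - δ j` is the one continued along `δ` that has argument near `0` at the tail of `δ`;
it differs from the limit from the left of the previously mentioned determination of
`z_j - ζ` by the factor `-1 = exp (iπ)`, and these factors make up `w̄_{k+1}`. -/
def integrand {n : ℕ} (μ : Fin (n + 1) → ℝ) (δ : LArcSystem n) (k : Fin n) (t : ℝ) : ℂ :=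
  Complex.exp (-∑ j : Fin (n + 1), (μ j : ℂ) *
    (if j ≤ k.castSucc then δ.chordLog (((j : ℕ) : ℝ), t) else δ.chordLog (t, ((j : ℕ) : ℝ))))

/-- `F(z, δ) = (F₁, …, Fₙ)`; the component with index `k : Fin n` is the integral over the arc
`δ_{k+1}` from `z_k` to `z_{k+1}`. -/
def F {n : ℕ} (μ : Fin (n + 1) → ℝ) (δ : LArcSystem n) : Fin n → ℂ := fun k =>
  ∫ t in ((k : ℕ) : ℝ)..((k : ℕ) + 1 : ℝ), integrand μ δ k t * deriv δ.path t

/-- `w_{k+1} = exp (iπ (μ₀ + ⋯ + μ_k))`, for `0 ≤ k < n`. -/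
def w {n : ℕ} (μ : Fin (n + 1) → ℝ) (k : Fin n) : ℂ :=
  Complex.exp (Complex.I * Real.pi * ∑ j ∈ Finset.Iic k.castSucc, (μ j : ℂ))

/-- The affine hyperplane `∑ Im(w_k) F_k = π` in `ℂⁿ`. -/
def parabolicHyperplane {n : ℕ} (μ : Fin (n + 1) → ℝ) : Set (Fin n → ℂ) :=
  {x | ∑ k, ((w μ k).im : ℂ) * x k = Real.pi}

/-- A family of L-arc systems over an open subset `N` of `V_n`, lying over the points of `N`, such
that the arcs and the determinations of the logarithms on them depend continuously on the point. -/
def IsContinuousFamily {n : ℕ} (N : Set (V n)) (δ : V n → LArcSystem n) : Prop :=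
  IsOpen N ∧ (∀ v ∈ N, (δ v).cls = v) ∧
  ContinuousOn (fun x : V n × ℝ => (δ x.1).path x.2) (N ×ˢ Ici 0) ∧
  ContinuousOn (fun x : V n × (ℝ × ℝ) => (δ x.1).chordLog x.2) (N ×ˢ chordDomain)

/-- `f` is a branch of the multivalued Lauricella map on the open set `U`: locally
`f v = F(z, δ_v)` for a continuous family of L-arc systems `δ_v`. -/
def IsBranch {n : ℕ} (μ : Fin (n + 1) → ℝ) (U : Set (V n)) (f : V n → Fin n → ℂ) : Prop :=
  IsOpen U ∧ ∀ v ∈ U, ∃ (N : Set (V n)) (δ : V n → LArcSystem n), v ∈ N ∧ N ⊆ U ∧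
    IsContinuousFamily N δ ∧ ∀ v' ∈ N, f v' = F μ (δ v')

/-! ### Holomorphic maps and local isomorphisms -/

section Holomorphic

variable {E G : Type*} [NormedAddCommGroup E] [NormedSpace ℂ E]
  [NormedAddCommGroup G] [NormedSpace ℂ G]

/-- `f` is a local isomorphism of complex manifolds at every point of the open set `U`. -/
def IsLocalIso (f : E → G) (U : Set E) : Prop :=
  ∀ x ∈ U, ∃ Φ : OpenPartialHomeomorph E G, x ∈ Φ.source ∧ EqOn f Φ Φ.source ∧
    DifferentiableOn ℂ Φ Φ.source ∧ DifferentiableOn ℂ Φ.symm Φ.target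

/-- The punctured cone over a subset of a projective space. -/
def cone (O : Set (Projectivization ℂ E)) : Set E :=
  {v | ∃ hv : v ≠ 0, Projectivization.mk ℂ v hv ∈ O}

/-- Open subsets of a projective space (quotient topology). -/
def IsOpenProj (O : Set (Projectivization ℂ E)) : Prop := IsOpen (cone O)

/-- `g` is holomorphic on the open set `O` of a projective space, with values in a vector space. -/
def HolomorphicOnProj (g : Projectivization ℂ E → G) (O : Set (Projectivization ℂ E)) : Prop :=
  ∃ h : E → G, DifferentiableOn ℂ h (cone O) ∧
    ∀ v ∈ cone O, ∃ hv : v ≠ 0, g (Projectivization.mk ℂ v hv) = h v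

/-- `g` is a holomorphic map from the open set `W` of a vector space to a projective space: locally
it is given by a nowhere zero holomorphic map. -/
def HolomorphicOnToProj (g : E → Projectivization ℂ G) (W : Set E) : Prop :=
  ∀ x ∈ W, ∃ N : Set E, IsOpen N ∧ x ∈ N ∧ ∃ h : E → G, DifferentiableOn ℂ h N ∧
    ∀ y ∈ N, ∃ hy : h y ≠ 0, g y = Projectivization.mk ℂ (h y) hy

/-- `g` is a holomorphic map from the open set `O` of a projective space to a projective space. -/
def HolomorphicOnProjProj (g : Projectivization ℂ E → Projectivization ℂ G)
    (O : Set (Projectivization ℂ E)) : Prop :=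
  ∀ v ∈ cone O, ∃ N : Set E, IsOpen N ∧ v ∈ N ∧ ∃ h : E → G, DifferentiableOn ℂ h N ∧
    ∀ y ∈ N, ∃ (hy : y ≠ 0) (hh : h y ≠ 0),
      g (Projectivization.mk ℂ y hy) = Projectivization.mk ℂ (h y) hh

/-- `g`, defined on the open set `O` of a projective space, takes values in the affine subspace `A`
and is a local isomorphism to `A`: every point of `O` has an open neighborhood that `g` maps
bijectively and holomorphically to an open subset of `A`, with holomorphic inverse. -/
def IsLocalIsoProjAffine (g : Projectivization ℂ E → G) (O : Set (Projectivization ℂ E))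
    (A : Set G) : Prop :=
  MapsTo g O A ∧ ∀ p ∈ O, ∃ O' ⊆ O, p ∈ O' ∧ IsOpenProj O' ∧ HolomorphicOnProj g O' ∧
    ∃ (W : Set G) (σ : G → Projectivization ℂ E), IsOpen W ∧ HolomorphicOnToProj σ W ∧
      g '' O' = W ∩ A ∧ ∀ q ∈ O', σ (g q) = q

/-- `g`, defined on the open set `O` of a projective space, is a local isomorphism to a
projective space. -/
def IsLocalIsoProjProj (g : Projectivization ℂ E → Projectivization ℂ G)
    (O : Set (Projectivization ℂ E)) : Prop :=
  ∀ p ∈ O, ∃ O' ⊆ O, p ∈ O' ∧ IsOpenProj O' ∧ HolomorphicOnProjProj g O' ∧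
    ∃ σ : Projectivization ℂ G → Projectivization ℂ E, IsOpenProj (g '' O') ∧
      HolomorphicOnProjProj σ (g '' O') ∧ ∀ q ∈ O', σ (g q) = q

end Holomorphic

/-! ### Descending to `ℙ(V_n°)` -/

/-- `g` is a branch on the open subset `O` of `ℙ(V_n°)` of the multivalued map obtained from `F` by
factoring through `ℙ(V_n°)`: its pull-back along `V_n° → ℙ(V_n°)` is a branch of `F` near every
point over `O`. -/
def IsDescendedBranch {n : ℕ} (μ : Fin (n + 1) → ℝ) (O : Set (Projectivization ℂ (V n)))
    (g : Projectivization ℂ (V n) → Fin n → ℂ) : Prop :=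
  IsOpenProj O ∧ ∀ v ∈ cone O, ∃ (U : Set (V n)) (f : V n → Fin n → ℂ), v ∈ U ∧ IsBranch μ U f ∧
    ∀ v' ∈ U, ∃ hv : v' ≠ 0, g (Projectivization.mk ℂ v' hv) = f v'

/-- `g` is a branch on the open subset `O` of `ℙ(V_n°)` of the multivalued Schwarz map `ℙF`. -/
def IsSchwarzBranch {n : ℕ} (μ : Fin (n + 1) → ℝ) (O : Set (Projectivization ℂ (V n)))
    (g : Projectivization ℂ (V n) → Projectivization ℂ (Fin n → ℂ)) : Prop :=
  IsOpenProj O ∧ ∀ v ∈ cone O, ∃ (U : Set (V n)) (f : V n → Fin n → ℂ), v ∈ U ∧ IsBranch μ U f ∧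
    ∀ v' ∈ U, ∃ (hv : v' ≠ 0) (hf : f v' ≠ 0),
      g (Projectivization.mk ℂ v' hv) = Projectivization.mk ℂ (f v') hf

end Lauricella

end

noncomputable section

namespace Lauricella

open Set Filter Topology MeasureTheory

/-! ### Continuous determinations of the logarithm -/

/-! The theorem rests on a formula for the differential of `F` and on one nondegeneracy statement.

The differential. Let v be a displacement of the marked points z, and let q be the polynomial of
degree at most n with q(z_j) = v_j. The map ζ ↦ ζ + q(ζ) carries the arcs δ_k to arcs between the
displaced points, and by Cauchy's theorem every sufficiently close arc system through these points,
with close logarithms, gives the same integrals (`IsFamily.eventually_integral_eq`). Because ζ +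
q(ζ) - z_j - v_j is (ζ - z_j) times 1 + (q(ζ) - v_j)/(ζ - z_j), the pull-back multiplies the
integrand by a factor, `deformFactor`, that is holomorphic near the arcs, marked points included. So
`F` is locally an integral over fixed arcs that depends holomorphically on v (`deformIntegral`). Its
derivative at 0 consists of the moments ∫_{δ_k} P η of P = q' - ∑ μ_j (q - v_j)/(ζ - z_j)
(`velocityPoly`). This P has degree < n, and if q has degree d ≥ 1, its coefficient at ζ^(d-1) is d
- |μ| times the leading coefficient of q.

Nondegeneracy. The n × n matrix of the moments ∫_{δ_k} ζ^m η, m < n, is invertible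
(`eq_zero_of_polyIntegral_eq_zero`). For points on the real axis this is elementary: a real
polynomial with vanishing moments against a positive weight has a zero in each of the n gaps, too
many for its degree. For a general arc, a linear relation between the δ_k on polynomials of degree <
n extends to all polynomials, because exact forms lower the degree: the leading coefficients n + 1 +
i - |μ| do not vanish. It then extends to holomorphic functions by Taylor expansion, and hence to
all nearby arc systems. Sliding the marked points along δ towards infinity, where δ is real, carries
the relation to the real case, which forces it to be trivial (`LArcSystem.eq_zero_of_sum_eq_zero`).

Consequences. `F` is the moment vector of the polynomial 1, so it is not zero. If dF(v) = a F then P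
= a, so q has degree at most 1 by the condition on |μ|; thus v = b₀ + b₁ z and a = (1 - |μ|) b₁.
Hence dF is injective on V_n when |μ| ≠ 1, its kernel is the line through [z] when |μ| = 1, and in
every case the differential of the projectivized map has only this line as kernel. The inverse
function theorem, applied on an affine slice of projective space, gives the local isomorphisms.

The parabolic relation. When |μ| = 1 the form is asymptotic to dζ/ζ at infinity, and the imaginary
part of its integral along the real line, taken as boundary of the upper half plane, is the relation
∑ Im(w_k) F_k = π for real points. By the identity theorem it persists under complex displacements,
and again by sliding it reaches all arcs (`parabolicForm_F`).

Descent to projective space. Euler's identity dF(z) = (1 - |μ|) F integrates to local homogeneity.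
For scalars far from 1, the branch is carried along in many small scaling steps
(`IsBranch.exists_scaling`). -/

theorem eq_of_exp_eq_of_norm_lt {x y : ℂ} (h : Complex.exp x = Complex.exp y)
    (hn : ‖x - y‖ < 2 * Real.pi) : x = y := by
  obtain ⟨m, hm⟩ := Complex.exp_eq_exp_iff_exists_int.mp h
  have h1 : x - y = m * (2 * Real.pi * Complex.I) := by rw [hm]; ring
  rw [h1] at hn
  have h2 : |(m : ℝ)| * (2 * Real.pi) < 1 * (2 * Real.pi) := by
    simpa [abs_of_pos Real.pi_pos] using hn
  have h3 : |(m : ℝ)| < 1 := lt_of_mul_lt_mul_right h2 (by positivity)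
  have h4 : m = 0 := Int.abs_lt_one_iff.mp (by exact_mod_cast h3)
  simpa [h4] using hm

/-- Unique lifting along the covering `Complex.exp`. Two determinations of a logarithm are
identified in this way on connected sets, or pointwise when they are known to differ by less than
2π. -/
theorem eqOn_of_exp_eqOn {X : Type*} [TopologicalSpace X] {s : Set X} (hs : IsPreconnected s)
    {f g : X → ℂ} (hf : ContinuousOn f s) (hg : ContinuousOn g s)
    (he : ∀ x ∈ s, Complex.exp (f x) = Complex.exp (g x)) {x₀ : X} (hx : x₀ ∈ s)
    (h0 : f x₀ = g x₀) : EqOn f g s := by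
  refine Complex.isCoveringMap_exp.eqOn_of_comp_eqOn hs hf hg ?_ hx h0
  intro x hx
  exact Subtype.ext (he x hx)

theorem eventuallyEq_of_exp_eq {X : Type*} [TopologicalSpace X] {s : Set X}
    {f g : X → ℂ} {x₀ : X} (hf : ContinuousWithinAt f s x₀) (hg : ContinuousWithinAt g s x₀)
    (he : ∀ᶠ x in 𝓝[s] x₀, Complex.exp (f x) = Complex.exp (g x)) (h0 : f x₀ = g x₀) :
    ∀ᶠ x in 𝓝[s] x₀, f x = g x := by
  have h1 : Tendsto (fun x => ‖f x - g x‖) (𝓝[s] x₀) (𝓝 0) := by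
    have := (hf.sub hg).norm
    simpa [ContinuousWithinAt, h0] using this
  filter_upwards [he, h1.eventually (gt_mem_nhds (by positivity : (0:ℝ) < 2 * Real.pi))] with x h2 h3
  exact eq_of_exp_eq_of_norm_lt h2 h3

theorem one_add_mem_slitPlane {x : ℂ} (h : ‖x‖ < 1) : 1 + x ∈ Complex.slitPlane :=
  Complex.mem_slitPlane_of_norm_lt_one h

/-- A branch of the logarithm on the disc about `b` that does not contain `z`. -/
def localLog (B b z ζ : ℂ) : ℂ := B + Complex.log (1 + (ζ - b) / (b - z))

theorem localLog_self (B b z : ℂ) : localLog B b z b = B := by simp [localLog]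

theorem localLog_mem {b z ζ : ℂ} (h : ‖ζ - b‖ < ‖b - z‖) :
    1 + (ζ - b) / (b - z) ∈ Complex.slitPlane := by
  refine one_add_mem_slitPlane ?_
  rw [norm_div, div_lt_one (lt_of_le_of_lt (norm_nonneg _) h)]
  exact h

theorem hasDerivAt_localLog {B b z ζ : ℂ} (h : ‖ζ - b‖ < ‖b - z‖) :
    HasDerivAt (localLog B b z) (1 / (ζ - z)) ζ := by
  have hb : b - z ≠ 0 := norm_pos_iff.mp (lt_of_le_of_lt (norm_nonneg _) h)
  have hs := localLog_mem h
  have hne := Complex.slitPlane_ne_zero hs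
  have h1 : HasDerivAt (fun ζ => 1 + (ζ - b) / (b - z)) (1 / (b - z)) ζ := by
    simpa using (((hasDerivAt_id ζ).sub_const b).div_const (b - z)).const_add 1
  have h2 := (h1.clog hs).const_add B
  refine h2.congr_deriv ?_
  have h3 : 1 + (ζ - b) / (b - z) = (ζ - z) / (b - z) := by field_simp; ring
  rw [h3] at hne ⊢
  have : ζ - z ≠ 0 := fun h => hne (by simp [h])
  field_simp

theorem exp_localLog {B b z ζ ε : ℂ} (h : ‖ζ - b‖ < ‖b - z‖)
    (hB : Complex.exp B = ε * (b - z)) : Complex.exp (localLog B b z ζ) = ε * (ζ - z) := by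
  have hb : b - z ≠ 0 := norm_pos_iff.mp (lt_of_le_of_lt (norm_nonneg _) h)
  rw [localLog, Complex.exp_add, Complex.exp_log (Complex.slitPlane_ne_zero (localLog_mem h)), hB]
  field_simp
  ring

/-- Near t a continuous logarithm A of g must agree with A(t) + log(g / g(t)), where the principal
logarithm is taken near 1 and is therefore differentiable. -/
theorem hasDerivAt_of_exp_eq {A g : ℝ → ℂ} {t : ℝ} {g' : ℂ} (hA : ContinuousAt A t)
    (he : ∀ᶠ u in 𝓝 t, Complex.exp (A u) = g u) (hg : HasDerivAt g g' t) :
    HasDerivAt A (g' / g t) t := by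
  have hgt : g t = Complex.exp (A t) := he.self_of_nhds.symm
  have hne : g t ≠ 0 := hgt ▸ Complex.exp_ne_zero _
  have h1 : HasDerivAt (fun u => A t + Complex.log (g u / g t)) (g' / g t) t := by
    have h2 : HasDerivAt (fun u => g u / g t) (g' / g t) t := hg.div_const _
    have h3 := (h2.clog_real (by simp [hne])).const_add (A t)
    simpa [hne] using h3
  refine h1.congr_of_eventuallyEq ?_
  have h4 := eventuallyEq_of_exp_eq (s := univ) (f := A)
    (g := fun u => A t + Complex.log (g u / g t)) (x₀ := t)
    (by simpa [continuousWithinAt_univ] using hA)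
    (by simpa [continuousWithinAt_univ] using h1.continuousAt) ?_ (by simp [hne])
  · rwa [nhdsWithin_univ] at h4
  · rw [nhdsWithin_univ]
    filter_upwards [he, hg.continuousAt.eventually_ne hne] with u hu hu'
    rw [Complex.exp_add, Complex.exp_log (div_ne_zero hu' hne), hu, ← hgt]
    field_simp

/-! ### A primitive at a singular end point -/

/-- The differential equation says that (ζ - c)^(1-m) H is a primitive of (ζ - c)^(-m) h. Stated for
H alone it needs no branch of the power, so every determination can be inserted later. The solution
is H(ζ) = ∫₀¹ s^(-m) h(c + s(ζ - c)) ds, which converges because m < 1. -/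
theorem exists_singular_primitive {c : ℂ} {r : ℝ} {h : ℂ → ℂ}
    (hh : DifferentiableOn ℂ h (Metric.ball c r)) {m : ℝ} (hm1 : m < 1) :
    ∃ H : ℂ → ℂ, ∀ ζ ∈ Metric.ball c r, ∃ H' : ℂ, HasDerivAt H H' ζ ∧
      (ζ - c) * H' + (1 - m) * H ζ = h ζ := by
  have hrp : IntervalIntegrable (fun s : ℝ => s ^ (-m)) volume 0 1 :=
    intervalIntegral.intervalIntegrable_rpow' (by linarith)
  have hrpC : IntervalIntegrable (fun s : ℝ => ((s ^ (-m) : ℝ) : ℂ)) volume 0 1 :=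
    ⟨Integrable.ofReal hrp.1, Integrable.ofReal hrp.2⟩
  have hmem : ∀ ζ ∈ Metric.ball c r, ∀ s ∈ Icc (0:ℝ) 1, c + s * (ζ - c) ∈ Metric.ball c r := by
    intro ζ hζ s hs
    rw [mem_ball_iff_norm] at hζ ⊢
    rw [add_sub_cancel_left, norm_mul, Complex.norm_real, Real.norm_of_nonneg hs.1]
    exact lt_of_le_of_lt (mul_le_of_le_one_left (norm_nonneg _) hs.2) hζ
  have hd : DifferentiableOn ℂ (deriv h) (Metric.ball c r) := hh.deriv Metric.isOpen_ball
  have hcont : ∀ (f : ℂ → ℂ), DifferentiableOn ℂ f (Metric.ball c r) → ∀ ζ ∈ Metric.ball c r,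
      ContinuousOn (fun s : ℝ => f (c + s * (ζ - c))) (Icc 0 1) := by
    intro f hf ζ hζ
    exact hf.continuousOn.comp (by fun_prop) (fun s hs => hmem ζ hζ s hs)
  have hInt : ∀ (f : ℂ → ℂ), DifferentiableOn ℂ f (Metric.ball c r) → ∀ ζ ∈ Metric.ball c r,
      IntervalIntegrable (fun s : ℝ => ((s ^ (-m) : ℝ) : ℂ) * f (c + s * (ζ - c))) volume 0 1 := by
    intro f hf ζ hζ
    refine IntervalIntegrable.mul_continuousOn hrpC ?_
    rw [uIcc_of_le zero_le_one]
    exact hcont f hf ζ hζ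
  have hInt' : ∀ ζ ∈ Metric.ball c r, IntervalIntegrable
      (fun s : ℝ => ((s ^ (-m) : ℝ) : ℂ) * (s * deriv h (c + s * (ζ - c)))) volume 0 1 := by
    intro ζ hζ
    refine IntervalIntegrable.mul_continuousOn hrpC ?_
    rw [uIcc_of_le zero_le_one]
    exact (by fun_prop : ContinuousOn (fun s : ℝ => (s:ℂ)) (Icc 0 1)).mul (hcont _ hd ζ hζ)
  refine ⟨fun ζ => ∫ s in (0:ℝ)..1, ((s ^ (-m) : ℝ) : ℂ) * h (c + s * (ζ - c)), fun ζ hζ =>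
    ⟨∫ s in (0:ℝ)..1, ((s ^ (-m) : ℝ) : ℂ) * (s * deriv h (c + s * (ζ - c))), ?_, ?_⟩⟩
  · have hζ' : ‖ζ - c‖ < r := mem_ball_iff_norm.mp hζ
    obtain ⟨ρ, hρ1, hρ2⟩ := exists_between hζ'
    have hsub : Metric.closedBall c ρ ⊆ Metric.ball c r := Metric.closedBall_subset_ball hρ2
    obtain ⟨M, hM⟩ := ((isCompact_closedBall c ρ).image_of_continuousOn
      (hd.continuousOn.mono hsub)).isBounded.exists_norm_le
    have hnb : Metric.ball c ρ ∈ 𝓝 ζ := Metric.isOpen_ball.mem_nhds (mem_ball_iff_norm.mpr hρ1)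
    have hsub' : Metric.ball c ρ ⊆ Metric.ball c r := Metric.ball_subset_ball hρ2.le
    refine (intervalIntegral.hasDerivAt_integral_of_dominated_loc_of_deriv_le
      (F := fun ζ (s : ℝ) => ((s ^ (-m) : ℝ) : ℂ) * h (c + s * (ζ - c)))
      (F' := fun ζ (s : ℝ) => ((s ^ (-m) : ℝ) : ℂ) * (s * deriv h (c + s * (ζ - c))))
      (bound := fun s => s ^ (-m) * M) hnb ?_ (hInt h hh ζ hζ) ?_ ?_ (hrp.mul_const M) ?_).2
    · filter_upwards [hnb] with x hx
      exact (hInt h hh x (hsub' hx)).def'.aestronglyMeasurable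
    · exact (hInt' ζ hζ).def'.aestronglyMeasurable
    · refine Eventually.of_forall fun s hs x hx => ?_
      rw [uIoc_of_le zero_le_one] at hs
      rw [norm_mul, Complex.norm_real, Real.norm_of_nonneg (Real.rpow_nonneg hs.1.le _)]
      refine mul_le_mul_of_nonneg_left ?_ (Real.rpow_nonneg hs.1.le _)
      have h1 : ‖deriv h (c + s * (x - c))‖ ≤ M := by
        refine hM _ ⟨_, ?_, rfl⟩
        rw [mem_closedBall_iff_norm, add_sub_cancel_left, norm_mul, Complex.norm_real,
          Real.norm_of_nonneg hs.1.le]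
        have := mem_ball_iff_norm.mp hx
        exact (mul_le_of_le_one_left (norm_nonneg _) hs.2).trans this.le
      rw [norm_mul, Complex.norm_real, Real.norm_of_nonneg hs.1.le]
      exact (mul_le_of_le_one_left (norm_nonneg _) hs.2).trans h1
    · refine Eventually.of_forall fun s hs x hx => ?_
      rw [uIoc_of_le zero_le_one] at hs
      have h1 : HasDerivAt (fun x : ℂ => c + s * (x - c)) (s * 1) x :=
        (((hasDerivAt_id x).sub_const c).const_mul (s : ℂ)).const_add c
      have hm' := hmem x (hsub' hx) s ⟨hs.1.le, hs.2⟩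
      have h2 := (hh.differentiableAt (Metric.isOpen_ball.mem_nhds hm')).hasDerivAt.comp x h1
      have h3 := h2.const_mul ((s ^ (-m) : ℝ) : ℂ)
      simpa [mul_comm, mul_left_comm, Function.comp_def] using h3
  · have hW : ContinuousOn (fun s : ℝ => ((s ^ (1 - m) : ℝ) : ℂ) * h (c + s * (ζ - c)))
        (uIcc 0 1) := by
      rw [uIcc_of_le zero_le_one]
      refine ContinuousOn.mul ?_ (hcont h hh ζ hζ)
      exact Complex.continuous_ofReal.comp_continuousOn
        (continuousOn_id.rpow_const fun s _ => Or.inr (by linarith))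
    -- The equation is the fundamental theorem of calculus for s^(1-m) h(c + s(ζ - c)) on [0, 1];
    -- the value at s = 0 vanishes since 1 - m > 0.
    have h1 := integral_eq_of_hasDerivAt_off_countable
      (fun s : ℝ => ((s ^ (1 - m) : ℝ) : ℂ) * h (c + s * (ζ - c)))
      (fun s : ℝ => (1 - m) * (((s ^ (-m) : ℝ) : ℂ) * h (c + s * (ζ - c))) +
        (ζ - c) * (((s ^ (-m) : ℝ) : ℂ) * (s * deriv h (c + s * (ζ - c)))))
      countable_empty hW ?_ (((hInt h hh ζ hζ).const_mul _).add ((hInt' ζ hζ).const_mul _))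
    · rw [intervalIntegral.integral_add ((hInt h hh ζ hζ).const_mul _)
        ((hInt' ζ hζ).const_mul _), intervalIntegral.integral_const_mul,
        intervalIntegral.integral_const_mul] at h1
      rw [add_comm, h1, Real.zero_rpow (by linarith)]
      simp
    · intro s hs
      rw [min_eq_left zero_le_one, max_eq_right zero_le_one, sdiff_empty] at hs
      have hm' := hmem ζ hζ s ⟨hs.1.le, hs.2.le⟩
      have h2 : HasDerivAt (fun s : ℝ => ((s ^ (1 - m) : ℝ) : ℂ))
          (((1 - m) * s ^ (1 - m - 1) : ℝ) : ℂ) s :=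
        (Real.hasDerivAt_rpow_const (Or.inl hs.1.ne')).ofReal_comp
      have h3 : HasDerivAt (fun s : ℝ => c + s * (ζ - c)) (1 * (ζ - c)) s :=
        (((hasDerivAt_id s).ofReal_comp).mul_const (ζ - c)).const_add c
      have h4 := (hh.differentiableAt (Metric.isOpen_ball.mem_nhds hm')).hasDerivAt.comp s h3
      refine (h2.mul h4).congr_deriv ?_
      have h5 : s ^ (1 - m) = s ^ (-m) * s := by
        rw [sub_eq_add_neg, add_comm, Real.rpow_add hs.1, Real.rpow_one]
      have h6 : 1 - m - 1 = -m := by ring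
      rw [h6, h5]
      simp only [Function.comp_apply]
      push_cast
      ring

/-! ### Comparison of integrals along nearby paths with the same end points -/

section Compare

variable {ι : Type*} [Fintype ι]

/-- The integral of `φ ∏ (ζ - z_j)^{-μ_j}` over the segment from `b` to `a`, where the logarithms
at `b` are given by `B`. -/
def segmentIntegral (μ : ι → ℝ) (z : ι → ℂ) (φ : ℂ → ℂ) (b a : ℂ) (B : ι → ℂ) : ℂ :=
  ∫ s in (0:ℝ)..1, (φ (b + s * (a - b)) *
    Complex.exp (-∑ j, (μ j : ℂ) * localLog (B j) b (z j) (b + s * (a - b)))) * (a - b)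

/-- Convexity keeps the segment in D. There the local logarithms based at b lift the same functions
as the l j and agree with them at b, hence on the whole segment, and P is a primitive of the
integrand. -/
theorem segmentIntegral_eq {μ : ι → ℝ} {z : ι → ℂ} {φ : ℂ → ℂ} (hφ : Continuous φ) {b a : ℂ}
    {B : ι → ℂ} {ε : ι → ℂ} {D : Set ℂ} (hD : Convex ℝ D) {P : ℂ → ℂ} {l : ι → ℂ → ℂ}
    (hl : ∀ j, ContinuousOn (l j) D)
    (hle : ∀ j, ∀ ζ ∈ D, Complex.exp (l j ζ) = ε j * (ζ - z j))
    (hP : ∀ ζ ∈ D, HasDerivAt P (φ ζ * Complex.exp (-∑ j, (μ j : ℂ) * l j ζ)) ζ)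
    (hb : b ∈ D) (ha : a ∈ D) (hB : ∀ j, l j b = B j) (hc : ∀ j, ‖a - b‖ < ‖b - z j‖) :
    segmentIntegral μ z φ b a B = P a - P b := by
  have hseg : ∀ s ∈ Icc (0:ℝ) 1, b + s * (a - b) ∈ D := by
    intro s hs
    have := hD hb ha (sub_nonneg.mpr hs.2) hs.1 (by ring)
    convert this using 1
    simp only [Complex.real_smul]
    push_cast
    ring
  have hcl : ∀ j, ∀ s ∈ Icc (0:ℝ) 1, ‖b + s * (a - b) - b‖ < ‖b - z j‖ := by
    intro j s hs
    rw [add_sub_cancel_left, norm_mul, Complex.norm_real, Real.norm_of_nonneg hs.1]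
    exact lt_of_le_of_lt (mul_le_of_le_one_left (norm_nonneg _) hs.2) (hc j)
  have hlin : ContinuousOn (fun s : ℝ => b + s * (a - b)) (Icc 0 1) := by fun_prop
  have hll : ∀ j, EqOn (fun s : ℝ => localLog (B j) b (z j) (b + s * (a - b)))
      (fun s : ℝ => l j (b + s * (a - b))) (Icc 0 1) := by
    intro j
    refine eqOn_of_exp_eqOn isPreconnected_Icc ?_ ((hl j).comp hlin hseg) ?_
      (x₀ := 0) (by simp) (by simp [localLog_self, hB])
    · intro s hs
      exact ContinuousAt.comp_continuousWithinAt (f := fun s : ℝ => b + s * (a - b))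
        (hasDerivAt_localLog (hcl j s hs)).continuousAt (hlin s hs)
    · intro s hs
      rw [hle j _ (hseg s hs)]
      refine exp_localLog (hcl j s hs) ?_
      rw [← hB, hle j b hb]
  have hcont : ContinuousOn (fun s : ℝ => (φ (b + s * (a - b)) *
      Complex.exp (-∑ j, (μ j : ℂ) * l j (b + s * (a - b)))) * (a - b)) (Icc 0 1) := by
    refine ContinuousOn.mul (ContinuousOn.mul (hφ.comp_continuousOn hlin) ?_) continuousOn_const
    refine Complex.continuous_exp.comp_continuousOn (ContinuousOn.neg ?_)
    exact continuousOn_finsetSum _ fun j _ => continuousOn_const.mul ((hl j).comp hlin hseg)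
  have h1 : segmentIntegral μ z φ b a B = ∫ s in (0:ℝ)..1, (φ (b + s * (a - b)) *
      Complex.exp (-∑ j, (μ j : ℂ) * l j (b + s * (a - b)))) * (a - b) := by
    refine intervalIntegral.integral_congr fun s hs => ?_
    rw [uIcc_of_le zero_le_one] at hs
    rw [Finset.sum_congr rfl fun j _ => by
      rw [show localLog (B j) b (z j) (b + s * (a - b)) = l j (b + s * (a - b)) from hll j hs]]
  rw [h1, intervalIntegral.integral_eq_sub_of_hasDerivAt (f := fun s : ℝ => P (b + s * (a - b)))]
  · simp
  · intro s hs
    rw [uIcc_of_le zero_le_one] at hs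
    have h3 : HasDerivAt (fun s : ℝ => b + s * (a - b)) (1 * (a - b)) s :=
      (((hasDerivAt_id s).ofReal_comp).mul_const (a - b)).const_add b
    have h4 := (hP _ (hseg s hs)).comp s h3
    rw [one_mul] at h4
    exact h4
  · rw [← uIcc_of_le zero_le_one] at hcont
    exact hcont.intervalIntegrable

/-- The integrand on a path `a` with logarithms `A` and velocity `a'`. -/
def pathIntegrand (μ : ι → ℝ) (φ : ℂ → ℂ) (a a' : ℝ → ℂ) (A : ι → ℝ → ℂ) (t : ℝ) : ℂ :=
  φ (a t) * Complex.exp (-∑ j, (μ j : ℂ) * A j t) * a' t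

theorem norm_sub_pos_of_exp {A ε a z : ℂ} (h : Complex.exp A = ε * (a - z)) : 0 < ‖a - z‖ := by
  rw [norm_pos_iff]
  intro h0
  rw [h0, mul_zero] at h
  exact Complex.exp_ne_zero _ h

/-- The radius is the distance from b to the nearest z j, the largest one for which all the
logarithms based at b live on a common disc; the disc is simply connected, whence the primitive. -/
theorem exists_local_primitive [Nonempty ι] (μ : ι → ℝ) (z : ι → ℂ) {φ : ℂ → ℂ}
    (hφ : Differentiable ℂ φ) (b : ℂ) (B : ι → ℂ) (hb : ∀ j, 0 < ‖b - z j‖) :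
    ∃ ρ > 0, (∀ ζ, ‖ζ - b‖ < ρ ↔ ∀ j, ‖ζ - b‖ < ‖b - z j‖) ∧ ∃ P : ℂ → ℂ,
      ∀ ζ ∈ Metric.ball b ρ, HasDerivAt P (φ ζ * Complex.exp (-∑ j, (μ j : ℂ) *
        localLog (B j) b (z j) ζ)) ζ := by
  obtain ⟨j₀, hj₀⟩ := Finite.exists_min fun j => ‖b - z j‖
  have hiff : ∀ ζ, ‖ζ - b‖ < ‖b - z j₀‖ ↔ ∀ j, ‖ζ - b‖ < ‖b - z j‖ :=
    fun ζ => ⟨fun h j => h.trans_le (hj₀ j), fun h => h j₀⟩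
  refine ⟨‖b - z j₀‖, hb j₀, hiff, ?_⟩
  have hdiff : DifferentiableOn ℂ (fun ζ => φ ζ * Complex.exp (-∑ j, (μ j : ℂ) *
        localLog (B j) b (z j) ζ)) (Metric.ball b ‖b - z j₀‖) := by
    intro ζ hζ
    rw [mem_ball_iff_norm, hiff] at hζ
    refine DifferentiableAt.differentiableWithinAt ?_
    refine (hφ ζ).mul (DifferentiableAt.cexp (DifferentiableAt.neg ?_))
    exact DifferentiableAt.fun_sum fun j _ =>
      (hasDerivAt_localLog (hζ j)).differentiableAt.const_mul _
  exact hdiff.isExactOn_ball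

/-- Cauchy's theorem for the strip swept out by the segments from b(t) to a(t). Locally in t the
segment integral is P(a t) - P(b t) for a fixed primitive P, so it is differentiable in t, off the
break points, and its derivative is the difference of the two integrands. No homotopy and no global
primitive is needed. -/
theorem integral_sub_eq_segmentIntegral_sub [Nonempty ι] {μ : ι → ℝ} {z : ι → ℂ} {φ : ℂ → ℂ}
    (hφ : Differentiable ℂ φ) {ε : ι → ℂ} {α β : ℝ} (hαβ : α ≤ β) {S : Set ℝ} (hS : S.Countable)
    {a a' b b' : ℝ → ℂ} {A B : ι → ℝ → ℂ}
    (ha : ContinuousOn a (Icc α β)) (hb : ContinuousOn b (Icc α β))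
    (hB : ∀ j, ContinuousOn (B j) (Icc α β))
    (hBe : ∀ j, ∀ t ∈ Icc α β, Complex.exp (B j t) = ε j * (b t - z j))
    (had : ∀ t ∈ Ioo α β \ S, HasDerivAt a (a' t) t)
    (hbd : ∀ t ∈ Ioo α β \ S, HasDerivAt b (b' t) t)
    (hai : IntervalIntegrable (pathIntegrand μ φ a a' A) volume α β)
    (hbi : IntervalIntegrable (pathIntegrand μ φ b b' B) volume α β)
    (hc : ∀ t ∈ Icc α β, ∀ j, ‖a t - b t‖ < ‖b t - z j‖)
    (hAB : ∀ t ∈ Icc α β, ∀ j, A j t = localLog (B j t) (b t) (z j) (a t)) :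
    (∫ t in α..β, pathIntegrand μ φ a a' A t) - ∫ t in α..β, pathIntegrand μ φ b b' B t =
      segmentIntegral μ z φ (b β) (a β) (fun j => B j β) -
        segmentIntegral μ z φ (b α) (a α) (fun j => B j α) := by
  have key : ∀ t₀ ∈ Icc α β, ∃ ρ > 0, (∀ j, ρ ≤ ‖b t₀ - z j‖) ∧ ‖a t₀ - b t₀‖ < ρ ∧ ∃ P : ℂ → ℂ,
      (∀ ζ ∈ Metric.ball (b t₀) ρ, HasDerivAt P (φ ζ * Complex.exp (-∑ j, (μ j : ℂ) *
        localLog (B j t₀) (b t₀) (z j) ζ)) ζ) ∧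
      ∀ᶠ t in 𝓝[Icc α β] t₀, segmentIntegral μ z φ (b t) (a t) (fun j => B j t) =
        P (a t) - P (b t) := by
    intro t₀ ht₀
    obtain ⟨ρ, hρ, hiff, P, hP⟩ := exists_local_primitive μ z hφ (b t₀) (fun j => B j t₀)
      (fun j => norm_sub_pos_of_exp (hBe j t₀ ht₀))
    have hat : ‖a t₀ - b t₀‖ < ρ := (hiff _).mpr (hc t₀ ht₀)
    refine ⟨ρ, hρ, fun j => ?_, hat, P, hP, ?_⟩
    · by_contra! hlt
      have h1 := (hiff (b t₀ + (‖b t₀ - z j‖ : ℝ))).mp (by simpa using hlt) j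
      simp at h1
    have hbn : ∀ᶠ t in 𝓝[Icc α β] t₀, b t ∈ Metric.ball (b t₀) ρ :=
      (hb t₀ ht₀).eventually (Metric.ball_mem_nhds _ hρ)
    have han : ∀ᶠ t in 𝓝[Icc α β] t₀, a t ∈ Metric.ball (b t₀) ρ :=
      (ha t₀ ht₀).eventually (Metric.isOpen_ball.mem_nhds (mem_ball_iff_norm.mpr hat))
    have hcl : ∀ ζ ∈ Metric.ball (b t₀) ρ, ∀ j, ‖ζ - b t₀‖ < ‖b t₀ - z j‖ :=
      fun ζ hζ => (hiff ζ).mp (mem_ball_iff_norm.mp hζ)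
    -- The primitive uses the logarithms frozen at t₀; for nearby t they continue to the given
    -- values along b, so one P serves a whole neighbourhood of t₀.
    have hBl : ∀ᶠ t in 𝓝[Icc α β] t₀, ∀ j, localLog (B j t₀) (b t₀) (z j) (b t) = B j t := by
      refine eventually_all.mpr fun j => ?_
      refine eventuallyEq_of_exp_eq ?_ (hB j t₀ ht₀) ?_ (localLog_self _ _ _)
      · exact ContinuousAt.comp_continuousWithinAt (f := b)
          (hasDerivAt_localLog (hcl _ (Metric.mem_ball_self hρ) j)).continuousAt (hb t₀ ht₀)
      · filter_upwards [hbn, self_mem_nhdsWithin] with t ht ht'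
        rw [exp_localLog (hcl _ ht j) (hBe j t₀ ht₀), hBe j t ht']
    filter_upwards [hbn, han, hBl, self_mem_nhdsWithin] with t h1 h2 h3 h4
    refine segmentIntegral_eq hφ.continuous (convex_ball (b t₀) ρ) (ε := ε) (fun j ζ hζ => ?_)
      (fun j ζ hζ => ?_) hP h1 h2 h3 (hc t h4)
    · exact (hasDerivAt_localLog (hcl ζ hζ j)).continuousAt.continuousWithinAt
    · exact exp_localLog (hcl ζ hζ j) (hBe j t₀ ht₀)
  rw [← intervalIntegral.integral_sub hai hbi]
  have := integral_eq_of_hasDerivAt_off_countable (a := α) (b := β)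
    (fun t => segmentIntegral μ z φ (b t) (a t) (fun j => B j t))
    (fun t => pathIntegrand μ φ a a' A t - pathIntegrand μ φ b b' B t) hS ?_ ?_ (hai.sub hbi)
  · exact this
  · rw [uIcc_of_le hαβ]
    intro t₀ ht₀
    obtain ⟨ρ, hρ, -, hat, P, hP, he⟩ := key t₀ ht₀
    refine ContinuousWithinAt.congr_of_eventuallyEq ?_ he (he.self_of_nhdsWithin ht₀)
    refine ContinuousWithinAt.sub ?_ ?_
    · exact ContinuousAt.comp_continuousWithinAt (f := a)
        (hP _ (mem_ball_iff_norm.mpr hat)).continuousAt (ha t₀ ht₀)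
    · exact ContinuousAt.comp_continuousWithinAt (f := b)
        (hP _ (Metric.mem_ball_self hρ)).continuousAt (hb t₀ ht₀)
  · rw [min_eq_left hαβ, max_eq_right hαβ]
    intro t₀ ht₀
    have ht₀' : t₀ ∈ Icc α β := Ioo_subset_Icc_self ht₀.1
    obtain ⟨ρ, hρ, hj, hat, P, hP, he⟩ := key t₀ ht₀'
    rw [nhdsWithin_eq_nhds.mpr (Icc_mem_nhds ht₀.1.1 ht₀.1.2)] at he
    refine HasDerivAt.congr_of_eventuallyEq ?_ he
    have h1 := (hP _ (mem_ball_iff_norm.mpr hat)).comp t₀ (had t₀ ht₀)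
    have h2 := (hP _ (Metric.mem_ball_self hρ)).comp t₀ (hbd t₀ ht₀)
    refine (h1.sub h2).congr_deriv ?_
    simp only [pathIntegrand, localLog_self, ← hAB t₀ ht₀']

/-- The expression on the right is the primitive (ζ - z i₀)^(1-μ) H read along the path with the
logarithm C i₀ as determination; its limit at the marked point is 0. Unordered intervals are used so
that the same argument serves a path that starts at s₀ and one that ends there. -/
theorem integral_eq_of_singular_end [DecidableEq ι] {μ : ι → ℝ}
    {z : ι → ℂ} {φ : ℂ → ℂ} {ε : ι → ℂ} {s₀ α : ℝ} {i₀ : ι}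
    (hμ : μ i₀ < 1) {S : Set ℝ} (hS : S.Countable) {r : ℝ} {l : ι → ℂ → ℂ} {H : ℂ → ℂ}
    (hH : ∀ ζ ∈ Metric.ball (z i₀) r, ∃ H' : ℂ, HasDerivAt H H' ζ ∧
      (ζ - z i₀) * H' + (1 - μ i₀) * H ζ =
        φ ζ * Complex.exp (-∑ j ∈ Finset.univ.erase i₀, (μ j : ℂ) * l j ζ))
    {c c' : ℝ → ℂ} {C : ι → ℝ → ℂ} (hε : ε i₀ ≠ 0) (hsα : s₀ ≠ α)
    (hc : ContinuousOn c (uIcc s₀ α)) (hc0 : c s₀ = z i₀)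
    (hcr : ∀ t ∈ uIcc s₀ α, c t ∈ Metric.ball (z i₀) r)
    (hC0 : ContinuousOn (C i₀) (uIcc s₀ α \ {s₀}))
    (hCe0 : ∀ t ∈ uIcc s₀ α \ {s₀}, Complex.exp (C i₀ t) = ε i₀ * (c t - z i₀))
    (hcd : ∀ t ∈ Ioo (min s₀ α) (max s₀ α) \ S, HasDerivAt c (c' t) t)
    (hci : IntervalIntegrable (pathIntegrand μ φ c c' C) volume s₀ α)
    (hCl : ∀ t ∈ uIcc s₀ α, ∀ j ≠ i₀, C j t = l j (c t)) :
    ∫ t in s₀..α, pathIntegrand μ φ c c' C t =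
      Complex.exp ((1 - μ i₀) * C i₀ α) * H (c α) / ε i₀ := by
  -- The logarithm C i₀ has no meaningful value at s₀, so the primitive is given its limit 0 by
  -- hand; the exponent 1 - μ i₀ > 0 makes it continuous.
  set W : ℝ → ℂ := fun t => if t = s₀ then 0 else
    Complex.exp ((1 - μ i₀) * C i₀ t) * H (c t) / ε i₀ with hW
  have hHc : ContinuousOn (fun t => H (c t)) (uIcc s₀ α) := by
    intro t ht
    obtain ⟨H', hH', -⟩ := hH _ (hcr t ht)
    exact ContinuousAt.comp_continuousWithinAt (f := c) hH'.continuousAt (hc t ht)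
  have hWc : ContinuousOn W (uIcc s₀ α) := by
    intro t ht
    by_cases hts : t = s₀
    · subst hts
      obtain ⟨M, hM⟩ := (isCompact_uIcc.image_of_continuousOn hHc).isBounded.exists_norm_le
      have hbound : ∀ u ∈ uIcc t α, ‖W u‖ ≤
          (‖ε i₀‖ * ‖c u - z i₀‖) ^ (1 - μ i₀) * M / ‖ε i₀‖ := by
        intro u hu
        have hM' : ‖H (c u)‖ ≤ M := hM _ ⟨u, hu, rfl⟩
        have hM0 : 0 ≤ M := (norm_nonneg _).trans hM'
        by_cases hut : u = t
        · simp only [hW, hut, if_true, norm_zero]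
          positivity
        · have hn : ‖Complex.exp ((1 - μ i₀) * C i₀ u)‖ =
              (‖ε i₀‖ * ‖c u - z i₀‖) ^ (1 - μ i₀) := by
            rw [← norm_mul, ← hCe0 u ⟨hu, hut⟩, Complex.norm_exp, Complex.norm_exp,
              ← Real.exp_mul]
            congr 1
            simp only [Complex.mul_re, Complex.sub_re, Complex.one_re, Complex.ofReal_re,
              Complex.sub_im, Complex.one_im, Complex.ofReal_im]
            ring
          simp only [hW, hut, if_false]
          rw [norm_div, norm_mul, hn]
          gcongr
      have h1 : Tendsto (fun u => (‖ε i₀‖ * ‖c u - z i₀‖) ^ (1 - μ i₀) * M / ‖ε i₀‖)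
          (𝓝[uIcc t α] t) (𝓝 0) := by
        have h2 : Tendsto (fun u => ‖ε i₀‖ * ‖c u - z i₀‖) (𝓝[uIcc t α] t) (𝓝 0) := by
          have := ((hc t ht).sub_const (z i₀)).norm.const_mul ‖ε i₀‖
          simpa [ContinuousWithinAt, hc0] using this
        have h3 := (h2.rpow_const (p := 1 - μ i₀) (Or.inr (by linarith)))
        rw [Real.zero_rpow (by linarith)] at h3
        simpa using (h3.mul_const M).div_const ‖ε i₀‖
      have h4 : W t = 0 := by simp [hW]
      rw [ContinuousWithinAt, h4]
      exact squeeze_zero_norm' (eventually_nhdsWithin_of_forall hbound) h1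
    · have h1 : ContinuousWithinAt (fun t => Complex.exp ((1 - μ i₀) * C i₀ t) * H (c t) / ε i₀)
          (uIcc s₀ α) t := by
        have h2 : ContinuousWithinAt (C i₀) (uIcc s₀ α) t := by
          have := hC0 t ⟨ht, hts⟩
          rwa [ContinuousWithinAt, sdiff_eq, nhdsWithin_inter_of_mem' (s := uIcc s₀ α) (t := {s₀}ᶜ)
          (mem_nhdsWithin_of_mem_nhds (isOpen_ne.mem_nhds hts))] at this
        exact ((h2.const_mul _).cexp.mul (hHc t ht)).div_const _
      refine h1.congr_of_eventuallyEq ?_ (by simp [hW, hts])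
      filter_upwards [mem_nhdsWithin_of_mem_nhds (isOpen_ne.mem_nhds hts)] with u hu
      have : u ≠ s₀ := hu
      simp [hW, this]
  have hWα : W α = Complex.exp ((1 - μ i₀) * C i₀ α) * H (c α) / ε i₀ := by
    simp [hW, hsα.symm]
  have hW0 : W s₀ = 0 := by simp [hW]
  rw [integral_eq_of_hasDerivAt_off_countable W _ hS hWc ?_ hci, hWα, hW0, sub_zero]
  intro t ht
  have htI : t ∈ uIcc s₀ α := Ioo_subset_Icc_self ht.1
  have htn : ∀ᶠ u in 𝓝 t, u ∈ uIcc s₀ α \ {s₀} := by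
    filter_upwards [isOpen_Ioo.mem_nhds ht.1] with u hu
    refine ⟨Ioo_subset_Icc_self hu, fun h => ?_⟩
    rw [mem_singleton_iff] at h
    rw [h] at hu
    rcases le_total s₀ α with h' | h'
    · simp [h'] at hu
    · simp [h'] at hu
  have htne := htn.self_of_nhds
  obtain ⟨H', hH', hHe⟩ := hH _ (hcr t htI)
  have hcpos := hCe0 t htne
  have hne : c t - z i₀ ≠ 0 := norm_pos_iff.mp (norm_sub_pos_of_exp hcpos)
  have hCd : HasDerivAt (C i₀) (ε i₀ * c' t / (ε i₀ * (c t - z i₀))) t := by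
    have hcont : ContinuousAt (C i₀) t := (hC0 t htne).continuousAt htn
    have hexp : ∀ᶠ u in 𝓝 t, Complex.exp (C i₀ u) = (fun u => ε i₀ * (c u - z i₀)) u :=
      htn.mono fun u hu => hCe0 u hu
    have hg : HasDerivAt (fun u => ε i₀ * (c u - z i₀)) (ε i₀ * c' t) t :=
      ((hcd t ht).sub_const (z i₀)).const_mul (ε i₀)
    exact hasDerivAt_of_exp_eq (g := fun u => ε i₀ * (c u - z i₀)) hcont hexp hg
  have hd1 : HasDerivAt (fun u => Complex.exp ((1 - μ i₀) * C i₀ u))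
      (Complex.exp ((1 - μ i₀) * C i₀ t) *
        ((1 - μ i₀) * (ε i₀ * c' t / (ε i₀ * (c t - z i₀))))) t :=
    (hCd.const_mul (1 - μ i₀ : ℂ)).cexp
  have hd2 : HasDerivAt (fun u => H (c u)) (H' * c' t) t := hH'.comp t (hcd t ht)
  have hd : HasDerivAt (fun u => Complex.exp ((1 - μ i₀) * C i₀ u) * H (c u) / ε i₀)
      ((Complex.exp ((1 - μ i₀) * C i₀ t) *
        ((1 - μ i₀) * (ε i₀ * c' t / (ε i₀ * (c t - z i₀)))) * H (c t) +
        Complex.exp ((1 - μ i₀) * C i₀ t) * (H' * c' t)) / ε i₀) t :=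
    (hd1.mul hd2).div_const (ε i₀)
  have hd' := hd.congr_of_eventuallyEq (f₁ := W) (by
    filter_upwards [htn] with u hu
    have : u ≠ s₀ := hu.2
    simp [hW, this])
  refine hd'.congr_deriv ?_
  have he1 : Complex.exp ((1 - μ i₀) * C i₀ t) =
      Complex.exp (-(μ i₀ * C i₀ t)) * (ε i₀ * (c t - z i₀)) := by
    rw [← hcpos, ← Complex.exp_add]
    congr 1
    ring
  have he2 : Complex.exp (-∑ j, (μ j : ℂ) * C j t) = Complex.exp (-(μ i₀ * C i₀ t)) *
      Complex.exp (-∑ j ∈ Finset.univ.erase i₀, (μ j : ℂ) * l j (c t)) := by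
    rw [← Finset.add_sum_erase _ _ (Finset.mem_univ i₀), neg_add, Complex.exp_add]
    congr 3
    exact Finset.sum_congr rfl fun j hj => by rw [hCl t htI j (Finset.ne_of_mem_erase hj)]
  rw [pathIntegrand, he2, he1]
  have hHe' : φ (c t) * Complex.exp (-∑ j ∈ Finset.univ.erase i₀, (μ j : ℂ) * l j (c t)) =
    (c t - z i₀) * H' + (1 - μ i₀) * H (c t) := hHe.symm
  calc _ = Complex.exp (-(μ i₀ * C i₀ t)) * ((c t - z i₀) * H' + (1 - μ i₀) * H (c t)) * c' t := by
        field_simp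
        ring
    _ = _ := by rw [← hHe']; ring

/-- Cauchy's theorem for a triangle with vertex at the marked point: both paths start at z i₀, where
the primitive vanishes, so only the segment at the other end contributes. The condition on r keeps
the other marked points out of the disc, so their logarithms are fixed by their common values at s₀.
-/
theorem integral_sub_eq_segmentIntegral_of_singular [Nonempty ι] [DecidableEq ι] {μ : ι → ℝ}
    {z : ι → ℂ} {φ : ℂ → ℂ} (hφ : Differentiable ℂ φ) {ε : ι → ℂ} {s₀ α : ℝ} {i₀ : ι}
    (hμ : μ i₀ < 1) {S : Set ℝ} (hS : S.Countable) {r : ℝ}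
    (hrz : ∀ j ≠ i₀, r ≤ ‖z i₀ - z j‖)
    {a a' b b' : ℝ → ℂ} {A B : ι → ℝ → ℂ} (hε : ε i₀ ≠ 0) (hsα : s₀ ≠ α)
    (ha : ContinuousOn a (uIcc s₀ α)) (hb : ContinuousOn b (uIcc s₀ α))
    (ha0 : a s₀ = z i₀) (hb0 : b s₀ = z i₀)
    (har : ∀ t ∈ uIcc s₀ α, a t ∈ Metric.ball (z i₀) r)
    (hbr : ∀ t ∈ uIcc s₀ α, b t ∈ Metric.ball (z i₀) r)
    (hA0 : ContinuousOn (A i₀) (uIcc s₀ α \ {s₀})) (hB0 : ContinuousOn (B i₀) (uIcc s₀ α \ {s₀}))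
    (hA : ∀ j ≠ i₀, ContinuousOn (A j) (uIcc s₀ α)) (hB : ∀ j ≠ i₀, ContinuousOn (B j) (uIcc s₀ α))
    (hAe0 : ∀ t ∈ uIcc s₀ α \ {s₀}, Complex.exp (A i₀ t) = ε i₀ * (a t - z i₀))
    (hBe0 : ∀ t ∈ uIcc s₀ α \ {s₀}, Complex.exp (B i₀ t) = ε i₀ * (b t - z i₀))
    (hAe : ∀ j ≠ i₀, ∀ t ∈ uIcc s₀ α, Complex.exp (A j t) = ε j * (a t - z j))
    (hBe : ∀ j ≠ i₀, ∀ t ∈ uIcc s₀ α, Complex.exp (B j t) = ε j * (b t - z j))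
    (had : ∀ t ∈ Ioo (min s₀ α) (max s₀ α) \ S, HasDerivAt a (a' t) t)
    (hbd : ∀ t ∈ Ioo (min s₀ α) (max s₀ α) \ S, HasDerivAt b (b' t) t)
    (hai : IntervalIntegrable (pathIntegrand μ φ a a' A) volume s₀ α)
    (hbi : IntervalIntegrable (pathIntegrand μ φ b b' B) volume s₀ α)
    (h0 : ∀ j ≠ i₀, A j s₀ = B j s₀)
    (hc : ∀ j, ‖a α - b α‖ < ‖b α - z j‖)
    (hAB : A i₀ α = localLog (B i₀ α) (b α) (z i₀) (a α)) :
    (∫ t in s₀..α, pathIntegrand μ φ a a' A t) - ∫ t in s₀..α, pathIntegrand μ φ b b' B t =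
      segmentIntegral μ z φ (b α) (a α) (fun j => B j α) := by
  set l : ι → ℂ → ℂ := fun j => localLog (A j s₀) (z i₀) (z j) with hl
  have hlt : ∀ ζ ∈ Metric.ball (z i₀) r, ∀ j ≠ i₀, ‖ζ - z i₀‖ < ‖z i₀ - z j‖ :=
    fun ζ hζ j hj => (mem_ball_iff_norm.mp hζ).trans_le (hrz j hj)
  have hs0 : s₀ ∈ uIcc s₀ α := left_mem_uIcc
  have hle : ∀ ζ ∈ Metric.ball (z i₀) r, ∀ j ≠ i₀, Complex.exp (l j ζ) = ε j * (ζ - z j) := by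
    intro ζ hζ j hj
    refine exp_localLog (hlt ζ hζ j hj) ?_
    rw [hAe j hj s₀ hs0, ha0]
  set h : ℂ → ℂ := fun ζ => φ ζ * Complex.exp (-∑ j ∈ Finset.univ.erase i₀, (μ j : ℂ) * l j ζ)
    with hh
  have hdiff : DifferentiableOn ℂ h (Metric.ball (z i₀) r) := by
    intro ζ hζ
    refine DifferentiableAt.differentiableWithinAt ?_
    refine (hφ ζ).mul (DifferentiableAt.cexp (DifferentiableAt.neg ?_))
    exact DifferentiableAt.fun_sum fun j hj =>
      (hasDerivAt_localLog (hlt ζ hζ j (Finset.ne_of_mem_erase hj))).differentiableAt.const_mul _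
  obtain ⟨H, hH⟩ := exists_singular_primitive hdiff hμ
  have main : ∀ (c : ℝ → ℂ) (C : ι → ℝ → ℂ), ContinuousOn c (uIcc s₀ α) → c s₀ = z i₀ →
      (∀ t ∈ uIcc s₀ α, c t ∈ Metric.ball (z i₀) r) →
      (∀ j ≠ i₀, ContinuousOn (C j) (uIcc s₀ α)) →
      (∀ j ≠ i₀, ∀ t ∈ uIcc s₀ α, Complex.exp (C j t) = ε j * (c t - z j)) →
      (∀ j ≠ i₀, C j s₀ = A j s₀) → ∀ t ∈ uIcc s₀ α, ∀ j ≠ i₀, C j t = l j (c t) := by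
    intro c C hc hc0 hcr hC hCe hinit t ht j hj
    refine eqOn_of_exp_eqOn (g := fun t => l j (c t)) isPreconnected_uIcc (hC j hj) ?_ ?_ hs0 ?_ ht
    · intro t ht
      exact ContinuousAt.comp_continuousWithinAt (f := c)
        (hasDerivAt_localLog (hlt _ (hcr t ht) j hj)).continuousAt (hc t ht)
    · intro t ht
      rw [hle _ (hcr t ht) j hj, hCe j hj t ht]
    · rw [hinit j hj, hc0]
      exact (localLog_self _ _ _).symm
  have hAl := main a A ha ha0 har hA hAe (fun _ _ => rfl)
  have hBl := main b B hb hb0 hbr hB hBe (fun j hj => (h0 j hj).symm)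
  rw [integral_eq_of_singular_end hμ hS hH hε hsα ha ha0 har hA0 hAe0 had hai hAl,
    integral_eq_of_singular_end hμ hS hH hε hsα hb hb0 hbr hB0 hBe0 hbd hbi hBl]
  have hα : α ∈ uIcc s₀ α := right_mem_uIcc
  have hα' : α ∈ uIcc s₀ α \ {s₀} := ⟨hα, hsα.symm⟩
  -- On this intersection of two discs the logarithm for i₀ is the one based at b α and the others
  -- are those based at z i₀. It is convex and contains both a α and b α.
  set D : Set ℂ := Metric.ball (z i₀) r ∩ Metric.ball (b α) ‖b α - z i₀‖ with hD
  have hl0 : ∀ ζ ∈ D, ‖ζ - b α‖ < ‖b α - z i₀‖ := fun ζ hζ => mem_ball_iff_norm.mp hζ.2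
  set L : ι → ℂ → ℂ := fun j => if j = i₀ then localLog (B i₀ α) (b α) (z i₀) else l j with hL
  have hL0 : L i₀ = localLog (B i₀ α) (b α) (z i₀) := by simp [hL]
  have hLj : ∀ j ≠ i₀, L j = l j := fun j hj => by simp [hL, hj]
  have hLd : ∀ j, ∀ ζ ∈ D, ContinuousAt (L j) ζ := by
    intro j ζ hζ
    by_cases hj : j = i₀
    · subst hj
      rw [hL0]
      exact (hasDerivAt_localLog (hl0 ζ hζ)).continuousAt
    · rw [hLj j hj]
      exact (hasDerivAt_localLog (hlt ζ hζ.1 j hj)).continuousAt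
  have hLe : ∀ j, ∀ ζ ∈ D, Complex.exp (L j ζ) = ε j * (ζ - z j) := by
    intro j ζ hζ
    by_cases hj : j = i₀
    · subst hj
      rw [hL0]
      exact exp_localLog (hl0 ζ hζ) (hBe0 α hα')
    · rw [hLj j hj]
      exact hle ζ hζ.1 j hj
  have hfin := segmentIntegral_eq (μ := μ) (z := z) hφ.continuous (b := b α) (a := a α)
    (B := fun j => B j α) (ε := ε) (D := D)
    ((convex_ball _ _).inter (convex_ball _ _))
    (P := fun ζ => Complex.exp ((1 - μ i₀) * L i₀ ζ) * H ζ / ε i₀)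
    (l := L) (fun j ζ hζ => (hLd j ζ hζ).continuousWithinAt) hLe ?_
    ⟨hbr α hα, Metric.mem_ball_self (norm_sub_pos_of_exp (hBe0 α hα'))⟩
    ⟨har α hα, mem_ball_iff_norm.mpr (hc i₀)⟩ ?_ hc
  · rw [hfin]
    simp only [hL0, localLog_self, ← hAB]
  · intro ζ hζ
    obtain ⟨H', hH', hHe⟩ := hH _ hζ.1
    have hd := (((hasDerivAt_localLog (B := B i₀ α) (hl0 ζ hζ)).const_mul
      (1 - μ i₀ : ℂ)).cexp.mul hH').div_const (ε i₀)
    rw [← hL0] at hd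
    refine hd.congr_deriv ?_
    have hLz := hLe i₀ ζ hζ
    have hne : ζ - z i₀ ≠ 0 := norm_pos_iff.mp (norm_sub_pos_of_exp hLz)
    have he1 : Complex.exp ((1 - μ i₀) * L i₀ ζ) =
        Complex.exp (-(μ i₀ * L i₀ ζ)) * (ε i₀ * (ζ - z i₀)) := by
      rw [← hLz, ← Complex.exp_add]
      congr 1
      ring
    have he2 : Complex.exp (-∑ j, (μ j : ℂ) * L j ζ) = Complex.exp (-(μ i₀ * L i₀ ζ)) *
        Complex.exp (-∑ j ∈ Finset.univ.erase i₀, (μ j : ℂ) * l j ζ) := by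
      rw [← Finset.add_sum_erase _ _ (Finset.mem_univ i₀), neg_add, Complex.exp_add]
      congr 3
      exact Finset.sum_congr rfl fun j hj => by rw [hLj j (Finset.ne_of_mem_erase hj)]
    have hHe' : φ ζ * Complex.exp (-∑ j ∈ Finset.univ.erase i₀, (μ j : ℂ) * l j ζ) =
      (ζ - z i₀) * H' + (1 - μ i₀) * H ζ := hHe.symm
    rw [he2, he1]
    calc _ = Complex.exp (-(μ i₀ * L i₀ ζ)) * ((ζ - z i₀) * H' + (1 - μ i₀) * H ζ) := by
          field_simp
          ring
      _ = _ := by rw [← hHe']; ring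
  · intro j
    by_cases hj : j = i₀
    · subst hj
      rw [hL0]
      exact localLog_self _ _ _
    · rw [hLj j hj]
      exact (hBl α hα j hj).symm

end Compare
end Lauricella

namespace Lauricella

open Set Filter Topology MeasureTheory

/-- A path from `z i₀` to `z i₁` on `[s₀, s₁]`, together with continuous determinations `A j` of the
logarithm of `ε j * (a - z j)` along it, that are defined as far as possible. -/
structure IsLogPath {ι : Type*} (z ε : ι → ℂ) (i₀ i₁ : ι) (s₀ s₁ : ℝ) (S : Set ℝ)
    (a a' : ℝ → ℂ) (A : ι → ℝ → ℂ) : Prop where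
  cont : ContinuousOn a (Icc s₀ s₁)
  left : a s₀ = z i₀
  right : a s₁ = z i₁
  deriv : ∀ t ∈ Ioo s₀ s₁ \ S, HasDerivAt a (a' t) t
  log_cont : ∀ j, ContinuousOn (A j) (Ioo s₀ s₁)
  log_cont_left : ∀ j ≠ i₀, ContinuousOn (A j) (Ico s₀ s₁)
  log_cont_right : ∀ j ≠ i₁, ContinuousOn (A j) (Ioc s₀ s₁)
  exp_log : ∀ j, ∀ t ∈ Ioo s₀ s₁, Complex.exp (A j t) = ε j * (a t - z j)
  exp_log_left : ∀ j ≠ i₀, Complex.exp (A j s₀) = ε j * (a s₀ - z j)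
  exp_log_right : ∀ j ≠ i₁, Complex.exp (A j s₁) = ε j * (a s₁ - z j)

/-- Two close paths with the same end points are compared over a disc about each end and over the
strip between. The segment integrals at α and β occur twice with opposite signs and cancel. -/
theorem integral_eq_of_close {ι : Type*} [Fintype ι] [DecidableEq ι] {μ : ι → ℝ}
    (hμ : ∀ i, μ i < 1) {z ε : ι → ℂ} {i₀ i₁ : ι} {s₀ s₁ : ℝ} {S : Set ℝ} (hS : S.Countable)
    {a a' b b' : ℝ → ℂ} {A B : ι → ℝ → ℂ} (hε : ∀ j, ε j ≠ 0) {φ : ℂ → ℂ}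
    (hφ : Differentiable ℂ φ) (ha : IsLogPath z ε i₀ i₁ s₀ s₁ S a a' A)
    (hb : IsLogPath z ε i₀ i₁ s₀ s₁ S b b' B)
    (hai : IntervalIntegrable (pathIntegrand μ φ a a' A) volume s₀ s₁)
    (hbi : IntervalIntegrable (pathIntegrand μ φ b b' B) volume s₀ s₁)
    {α β r : ℝ} (hα : s₀ < α) (hαβ : α ≤ β) (hβ : β < s₁)
    (hr0 : ∀ j ≠ i₀, r ≤ ‖z i₀ - z j‖) (hr1 : ∀ j ≠ i₁, r ≤ ‖z i₁ - z j‖)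
    (har0 : ∀ t ∈ Icc s₀ α, ‖a t - z i₀‖ < r) (hbr0 : ∀ t ∈ Icc s₀ α, ‖b t - z i₀‖ < r)
    (har1 : ∀ t ∈ Icc β s₁, ‖a t - z i₁‖ < r) (hbr1 : ∀ t ∈ Icc β s₁, ‖b t - z i₁‖ < r)
    (h0 : ∀ j ≠ i₀, A j s₀ = B j s₀) (h1 : ∀ j ≠ i₁, A j s₁ = B j s₁)
    (hc : ∀ t ∈ Icc α β, ∀ j, ‖a t - b t‖ < ‖b t - z j‖)
    (hAB : ∀ t ∈ Icc α β, ∀ j, A j t = localLog (B j t) (b t) (z j) (a t)) :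
    ∫ t in s₀..s₁, pathIntegrand μ φ a a' A t = ∫ t in s₀..s₁, pathIntegrand μ φ b b' B t := by
  have : Nonempty ι := ⟨i₀⟩
  have hα1 : α < s₁ := hαβ.trans_lt hβ
  have hβ0 : s₀ < β := hα.trans_le hαβ
  have hαm : α ∈ Icc α β := left_mem_Icc.mpr hαβ
  have hβm : β ∈ Icc α β := right_mem_Icc.mpr hαβ
  have hI0 : uIcc s₀ α = Icc s₀ α := uIcc_of_le hα.le
  have hI1 : uIcc s₁ β = Icc β s₁ := uIcc_of_ge hβ.le
  have hs0 : Icc s₀ α ⊆ Icc s₀ s₁ := Icc_subset_Icc_right hα1.le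
  have hs1 : Icc β s₁ ⊆ Icc s₀ s₁ := Icc_subset_Icc_left hβ0.le
  have hs0' : Icc s₀ α ⊆ Ico s₀ s₁ := fun t ht => ⟨ht.1, ht.2.trans_lt hα1⟩
  have hs1' : Icc β s₁ ⊆ Ioc s₀ s₁ := fun t ht => ⟨hβ0.trans_le ht.1, ht.2⟩
  have hm0 : Icc s₀ α \ {s₀} ⊆ Ioo s₀ s₁ := fun t ht =>
    ⟨lt_of_le_of_ne ht.1.1 (fun h => ht.2 h.symm), ht.1.2.trans_lt hα1⟩
  have hm1 : Icc β s₁ \ {s₁} ⊆ Ioo s₀ s₁ := fun t ht =>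
    ⟨hβ0.trans_le ht.1.1, lt_of_le_of_ne ht.1.2 ht.2⟩
  have hmid : Icc α β ⊆ Ioo s₀ s₁ := Icc_subset_Ioo hα hβ
  have hint : ∀ {c c' : ℝ → ℂ} {C : ι → ℝ → ℂ},
      IntervalIntegrable (pathIntegrand μ φ c c' C) volume s₀ s₁ → ∀ x ∈ Icc s₀ s₁, ∀ y ∈ Icc s₀ s₁,
      IntervalIntegrable (pathIntegrand μ φ c c' C) volume x y := by
    intro c c' C h x hx y hy
    refine h.mono_set (uIcc_subset_uIcc ?_ ?_) <;> rw [uIcc_of_le (hβ0.trans hβ).le] <;> assumption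
  have hexp0 : ∀ {c c' : ℝ → ℂ} {C : ι → ℝ → ℂ}, IsLogPath z ε i₀ i₁ s₀ s₁ S c c' C →
      ∀ j ≠ i₀, ∀ t ∈ Icc s₀ α, Complex.exp (C j t) = ε j * (c t - z j) := by
    intro c c' C h j hj t ht
    rcases eq_or_lt_of_le ht.1 with rfl | h'
    · exact h.exp_log_left j hj
    · exact h.exp_log j t ⟨h', ht.2.trans_lt hα1⟩
  have hexp1 : ∀ {c c' : ℝ → ℂ} {C : ι → ℝ → ℂ}, IsLogPath z ε i₀ i₁ s₀ s₁ S c c' C →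
      ∀ j ≠ i₁, ∀ t ∈ Icc β s₁, Complex.exp (C j t) = ε j * (c t - z j) := by
    intro c c' C h j hj t ht
    rcases eq_or_lt_of_le ht.2 with rfl | h'
    · exact h.exp_log_right j hj
    · exact h.exp_log j t ⟨hβ0.trans_le ht.1, h'⟩
  have e0 := integral_sub_eq_segmentIntegral_of_singular (μ := μ) (z := z) hφ (ε := ε) (s₀ := s₀)
    (α := α) (i₀ := i₀) (hμ i₀) hS hr0 (a := a) (a' := a') (b := b) (b' := b') (A := A) (B := B)
    (hε i₀) hα.ne (hI0 ▸ ha.cont.mono hs0) (hI0 ▸ hb.cont.mono hs0) ha.left hb.left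
    (by rw [hI0]; exact fun t ht => mem_ball_iff_norm.mpr (har0 t ht))
    (by rw [hI0]; exact fun t ht => mem_ball_iff_norm.mpr (hbr0 t ht))
    (hI0 ▸ (ha.log_cont i₀).mono hm0) (hI0 ▸ (hb.log_cont i₀).mono hm0)
    (fun j hj => hI0 ▸ (ha.log_cont_left j hj).mono hs0')
    (fun j hj => hI0 ▸ (hb.log_cont_left j hj).mono hs0')
    (by rw [hI0]; exact fun t ht => ha.exp_log i₀ t (hm0 ht))
    (by rw [hI0]; exact fun t ht => hb.exp_log i₀ t (hm0 ht))
    (by rw [hI0]; exact hexp0 ha) (by rw [hI0]; exact hexp0 hb)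
    (by
      rw [min_eq_left hα.le, max_eq_right hα.le]
      exact fun t ht => ha.deriv t ⟨⟨ht.1.1, ht.1.2.trans hα1⟩, ht.2⟩)
    (by
      rw [min_eq_left hα.le, max_eq_right hα.le]
      exact fun t ht => hb.deriv t ⟨⟨ht.1.1, ht.1.2.trans hα1⟩, ht.2⟩)
    (hint hai _ ⟨le_rfl, (hα.trans hα1).le⟩ _ ⟨hα.le, hα1.le⟩)
    (hint hbi _ ⟨le_rfl, (hα.trans hα1).le⟩ _ ⟨hα.le, hα1.le⟩)
    h0 (hc α hαm) (hAB α hαm i₀)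
  -- The second end is treated as a path that runs backwards from s₁ to β, hence the minus sign when
  -- the three pieces are combined.
  have e1 := integral_sub_eq_segmentIntegral_of_singular (μ := μ) (z := z) hφ (ε := ε) (s₀ := s₁)
    (α := β) (i₀ := i₁) (hμ i₁) hS hr1 (a := a) (a' := a') (b := b) (b' := b') (A := A) (B := B)
    (hε i₁) hβ.ne' (hI1 ▸ ha.cont.mono hs1) (hI1 ▸ hb.cont.mono hs1) ha.right hb.right
    (by rw [hI1]; exact fun t ht => mem_ball_iff_norm.mpr (har1 t ht))
    (by rw [hI1]; exact fun t ht => mem_ball_iff_norm.mpr (hbr1 t ht))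
    (hI1 ▸ (ha.log_cont i₁).mono hm1) (hI1 ▸ (hb.log_cont i₁).mono hm1)
    (fun j hj => hI1 ▸ (ha.log_cont_right j hj).mono hs1')
    (fun j hj => hI1 ▸ (hb.log_cont_right j hj).mono hs1')
    (by rw [hI1]; exact fun t ht => ha.exp_log i₁ t (hm1 ht))
    (by rw [hI1]; exact fun t ht => hb.exp_log i₁ t (hm1 ht))
    (by rw [hI1]; exact hexp1 ha) (by rw [hI1]; exact hexp1 hb)
    (by
      rw [min_eq_right hβ.le, max_eq_left hβ.le]
      exact fun t ht => ha.deriv t ⟨⟨hβ0.trans ht.1.1, ht.1.2⟩, ht.2⟩)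
    (by
      rw [min_eq_right hβ.le, max_eq_left hβ.le]
      exact fun t ht => hb.deriv t ⟨⟨hβ0.trans ht.1.1, ht.1.2⟩, ht.2⟩)
    (hint hai _ ⟨(hα.trans hα1).le, le_rfl⟩ _ ⟨hβ0.le, hβ.le⟩)
    (hint hbi _ ⟨(hα.trans hα1).le, le_rfl⟩ _ ⟨hβ0.le, hβ.le⟩)
    h1 (hc β hβm) (hAB β hβm i₁)
  have e2 := integral_sub_eq_segmentIntegral_sub (μ := μ) (z := z) hφ (ε := ε) hαβ hS
    (ha.cont.mono (hmid.trans Ioo_subset_Icc_self)) (hb.cont.mono (hmid.trans Ioo_subset_Icc_self))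
    (fun j => (hb.log_cont j).mono hmid) (fun j t ht => hb.exp_log j t (hmid ht))
    (fun t ht => ha.deriv t ⟨hmid (Ioo_subset_Icc_self ht.1), ht.2⟩)
    (fun t ht => hb.deriv t ⟨hmid (Ioo_subset_Icc_self ht.1), ht.2⟩)
    (hint hai _ ⟨hα.le, hα1.le⟩ _ ⟨hβ0.le, hβ.le⟩)
    (hint hbi _ ⟨hα.le, hα1.le⟩ _ ⟨hβ0.le, hβ.le⟩) hc hAB
  have hsplit : ∀ {c c' : ℝ → ℂ} {C : ι → ℝ → ℂ},
      IntervalIntegrable (pathIntegrand μ φ c c' C) volume s₀ s₁ →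
      ∫ t in s₀..s₁, pathIntegrand μ φ c c' C t = (∫ t in s₀..α, pathIntegrand μ φ c c' C t) +
        (∫ t in α..β, pathIntegrand μ φ c c' C t) - ∫ t in s₁..β, pathIntegrand μ φ c c' C t := by
    intro c c' C h
    have i1 := hint h s₀ ⟨le_rfl, (hα.trans hα1).le⟩ α ⟨hα.le, hα1.le⟩
    have i2 := hint h α ⟨hα.le, hα1.le⟩ β ⟨hβ0.le, hβ.le⟩
    have i3 := hint h β ⟨hβ0.le, hβ.le⟩ s₁ ⟨(hα.trans hα1).le, le_rfl⟩
    rw [intervalIntegral.integral_symm β s₁, sub_neg_eq_add,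
      intervalIntegral.integral_add_adjacent_intervals i1 i2,
      intervalIntegral.integral_add_adjacent_intervals (i1.trans i2) i3]
  rw [hsplit hai, hsplit hbi]
  linear_combination e0 + e2 - e1

/-! ### Arc systems: images, translates and continuous families -/

theorem convex_chordDomain : Convex ℝ chordDomain := by
  rintro ⟨a, b⟩ ⟨h1, h2⟩ ⟨c, d⟩ ⟨h3, h4⟩ u v hu hv huv
  simp only at h1 h2 h3 h4
  refine ⟨?_, ?_⟩
  · simp only [Prod.smul_mk, Prod.mk_add_mk, smul_eq_mul]
    positivity
  · simp only [Prod.smul_mk, Prod.mk_add_mk, smul_eq_mul]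
    rcases hu.eq_or_lt with rfl | hu
    · have : v = 1 := by linarith
      subst this
      linarith
    · nlinarith

/-- Two determinations differ by a constant on the connected domain, and this constant is a multiple
of 2πi. The normalization at infinity makes its imaginary part zero. -/
theorem IsChordLog.eqOn {p : ℝ → ℂ} {L L' : ℝ × ℝ → ℂ} (h : IsChordLog p L)
    (h' : IsChordLog p L') : EqOn L L' chordDomain := by
  intro q hq
  have h1 : EqOn L (fun x => L' x + (L q - L' q)) chordDomain := by
    refine eqOn_of_exp_eqOn convex_chordDomain.isPreconnected h.1
      (h'.1.add continuousOn_const) (fun x hx => ?_) hq (by ring)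
    have : Complex.exp (L' q) ≠ 0 := Complex.exp_ne_zero _
    rw [Complex.exp_add, Complex.exp_sub, h.2.1 q hq, ← h'.2.1 q hq, div_self this, mul_one,
      h.2.1 x hx, h'.2.1 x hx]
  have h2 : Tendsto (fun s => (L (q.1, s)).im - (L' (q.1, s)).im) atTop (𝓝 (0 - 0)) :=
    (h.2.2 q.1 hq.1).sub (h'.2.2 q.1 hq.1)
  have h3 : Tendsto (fun _ : ℝ => (L q - L' q).im) atTop (𝓝 (0 - 0)) := by
    refine h2.congr' ?_
    filter_upwards [eventually_gt_atTop q.1] with s hs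
    have := h1 (show (q.1, s) ∈ chordDomain from ⟨hq.1, hs⟩)
    simp only [this, Complex.add_im]
    ring
  have h4 : (L q - L' q).im = 0 := by
    have := tendsto_nhds_unique tendsto_const_nhds h3
    simpa using this
  obtain ⟨m, hm⟩ := Complex.exp_eq_exp_iff_exists_int.mp ((h.2.1 q hq).trans (h'.2.1 q hq).symm)
  rw [hm] at h4 ⊢
  have h5 : (m : ℝ) * (2 * Real.pi) = 0 := by simpa using h4
  have h6 : (m : ℝ) = 0 := by
    rcases mul_eq_zero.mp h5 with h | h
    · exact h
    · exact absurd h (by positivity)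
  have h7 : m = 0 := by exact_mod_cast h6
  simp [h7]

theorem LArcSystem.ext_path {n : ℕ} {δ δ' : LArcSystem n} (h : δ.path = δ'.path) : δ = δ' := by
  cases δ
  cases δ'
  simpa using h

/-- The image of an L-arc system under a `C¹` diffeomorphism that is a translation on a tail of
the real axis. -/
def LArcSystem.map {n : ℕ} (δ : LArcSystem n) (f : ℂ → ℂ) (hf : ContDiff ℝ 1 f)
    (hinj : Function.Injective f) (hd : ∀ ζ, Function.Injective (fderiv ℝ f ζ))
    (hR : ∃ R c : ℝ, ∀ x : ℝ, R ≤ x → f x = x + c) : LArcSystem n where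
  path := f ∘ δ.path
  continuousOn := hf.continuous.comp_continuousOn δ.continuousOn
  injOn := hinj.injOn.comp δ.injOn (mapsTo_univ _ _)
  piecewiseRegular := by
    obtain ⟨s, hs⟩ := δ.piecewiseRegular
    refine ⟨s, fun a b ha hab hd' => ?_⟩
    obtain ⟨h1, h2⟩ := hs a b ha hab hd'
    refine ⟨hf.comp_contDiffOn h1, fun t ht => ?_⟩
    have h3 : HasDerivWithinAt δ.path (derivWithin δ.path (Icc a b) t) (Icc a b) t :=
      ((h1.differentiableOn one_ne_zero) t ht).hasDerivWithinAt
    have h4 := ((hf.differentiable one_ne_zero) (δ.path t)).hasFDerivAt.comp_hasDerivWithinAt t h3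
    rw [h4.derivWithin (uniqueDiffOn_Icc hab t ht)]
    exact fun h => h2 t ht (hd _ (by rw [h, map_zero]))
  eventually_real := by
    obtain ⟨R, c, hR⟩ := hR
    filter_upwards [δ.eventually_real, δ.tendsto_re.eventually_ge_atTop R] with t h1 h2
    have h3 : δ.path t = ((δ.path t).re : ℂ) := Complex.ext (by simp) (by simp [h1])
    rw [Function.comp_apply, h3, hR _ h2]
    simp
  tendsto_re := by
    obtain ⟨R, c, hR⟩ := hR
    refine Tendsto.congr' ?_ (tendsto_atTop_add_const_right atTop c δ.tendsto_re)
    filter_upwards [δ.eventually_real, δ.tendsto_re.eventually_ge_atTop R] with t h1 h2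
    have h3 : δ.path t = ((δ.path t).re : ℂ) := Complex.ext (by simp) (by simp [h1])
    rw [Function.comp_apply, h3, hR _ h2]
    simp

/-- A `C¹` map of the plane that is the identity near `∞` and `C¹`-close to the identity. -/
structure IsSmallPerturbation (f : ℂ → ℂ) : Prop where
  contDiff : ContDiff ℝ 1 f
  lip : ∀ p q, ‖(f q - f p) - (q - p)‖ ≤ 1 / 2 * ‖q - p‖
  eq_far : ∃ R : ℝ, ∀ ζ, R ≤ ‖ζ‖ → f ζ = ζ

theorem isSmallPerturbation_id : IsSmallPerturbation id :=
  ⟨contDiff_id, fun p q => by simp, 0, fun _ _ => rfl⟩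

theorem IsSmallPerturbation.injective {f : ℂ → ℂ} (h : IsSmallPerturbation f) :
    Function.Injective f := by
  intro p q hpq
  have h1 := h.lip p q
  rw [hpq, sub_self, zero_sub, norm_neg] at h1
  have h2 : ‖q - p‖ = 0 := by
    have := norm_nonneg (q - p)
    linarith
  exact (sub_eq_zero.mp (norm_eq_zero.mp h2)).symm

/-- The derivative lies within 1/2 of the identity in operator norm, so a vector in its kernel would
satisfy ‖w‖ ≤ ‖w‖/2. -/
theorem IsSmallPerturbation.fderiv_injective {f : ℂ → ℂ} (h : IsSmallPerturbation f) (ζ : ℂ) :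
    Function.Injective (fderiv ℝ f ζ) := by
  rw [injective_iff_map_eq_zero]
  intro w hw
  have hf : HasFDerivAt f (fderiv ℝ f ζ) ζ :=
    (h.contDiff.differentiable one_ne_zero ζ).hasFDerivAt
  have h1 : HasFDerivAt (fun x => f x - x) (fderiv ℝ f ζ - ContinuousLinearMap.id ℝ ℂ) ζ :=
    hf.sub (hasFDerivAt_id ζ)
  have h2 : ‖fderiv ℝ f ζ - ContinuousLinearMap.id ℝ ℂ‖ ≤ 1 / 2 := by
    refine h1.le_of_lip' (by norm_num) (Eventually.of_forall fun x => ?_)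
    have h3 : f x - x - (f ζ - ζ) = (f x - f ζ) - (x - ζ) := by ring
    rw [h3]
    exact h.lip ζ x
  have h3 := (fderiv ℝ f ζ - ContinuousLinearMap.id ℝ ℂ).le_of_opNorm_le h2 w
  rw [sub_apply, hw, zero_sub, norm_neg] at h3
  simp only [ContinuousLinearMap.coe_id', id_eq] at h3
  have h4 : ‖w‖ = 0 := by
    have := norm_nonneg w
    linarith
  exact norm_eq_zero.mp h4

theorem IsSmallPerturbation.norm_ratio {f : ℂ → ℂ} (h : IsSmallPerturbation f) {p q : ℂ}
    (hpq : q - p ≠ 0) : ‖(f q - f p) / (q - p) - 1‖ < 1 := by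
  have h1 : (f q - f p) / (q - p) - 1 = ((f q - f p) - (q - p)) / (q - p) := by field_simp
  have h2 : 0 < ‖q - p‖ := norm_pos_iff.mpr hpq
  rw [h1, norm_div, div_lt_one h2]
  have := h.lip p q
  linarith

/-- The image of an L-arc system under a small perturbation of the identity. -/
def LArcSystem.perturb {n : ℕ} (δ : LArcSystem n) {f : ℂ → ℂ} (h : IsSmallPerturbation f) :
    LArcSystem n :=
  δ.map f h.contDiff h.injective h.fderiv_injective (by
    obtain ⟨R, hR⟩ := h.eq_far
    refine ⟨max R 0, 0, fun x hx => ?_⟩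
    rw [hR x]
    · simp
    · rw [Complex.norm_real, Real.norm_of_nonneg (le_trans (le_max_right _ _) hx)]
      exact le_trans (le_max_left _ _) hx)

theorem LArcSystem.perturb_path {n : ℕ} (δ : LArcSystem n) {f : ℂ → ℂ}
    (h : IsSmallPerturbation f) (t : ℝ) : (δ.perturb h).path t = f (δ.path t) := rfl

theorem LArcSystem.path_sub_ne_zero {n : ℕ} (δ : LArcSystem n) {q : ℝ × ℝ}
    (hq : q ∈ chordDomain) : δ.path q.2 - δ.path q.1 ≠ 0 := by
  rw [← δ.chordLog_spec.2.1 q hq]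
  exact Complex.exp_ne_zero _

theorem LArcSystem.tendsto_norm {n : ℕ} (δ : LArcSystem n) :
    Tendsto (fun t => ‖δ.path t‖) atTop atTop :=
  tendsto_atTop_mono (fun _ => Complex.re_le_norm _) δ.tendsto_re

/-- The continuous determination of `log ((f q - f p) / (q - p))` for a small perturbation. -/
def ratioLog (f : ℂ → ℂ) (p q : ℂ) : ℂ := Complex.log ((f q - f p) / (q - p))

theorem IsSmallPerturbation.ratio_mem {f : ℂ → ℂ} (h : IsSmallPerturbation f) {p q : ℂ}
    (hpq : q - p ≠ 0) : (f q - f p) / (q - p) ∈ Complex.slitPlane := by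
  have := one_add_mem_slitPlane (h.norm_ratio hpq)
  rwa [add_sub_cancel] at this

theorem ContinuousOn.ratioLog_comp {X : Type*} [TopologicalSpace X] {N : Set X} {f : X → ℂ → ℂ}
    (hf : ∀ x, IsSmallPerturbation (f x))
    (hfc : ContinuousOn (fun y : X × ℂ => f y.1 y.2) (N ×ˢ univ)) {Y : Type*} [TopologicalSpace Y]
    {M : Set Y} {g : Y → X} {a b : Y → ℂ} (hg : ContinuousOn g M) (hgN : MapsTo g M N)
    (ha : ContinuousOn a M) (hb : ContinuousOn b M) (hab : ∀ y ∈ M, b y - a y ≠ 0) :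
    ContinuousOn (fun y => ratioLog (f (g y)) (a y) (b y)) M := by
  refine ContinuousOn.clog (ContinuousOn.div (ContinuousOn.sub ?_ ?_) (hb.sub ha) hab)
    fun y hy => (hf _).ratio_mem (hab y hy)
  · exact hfc.comp (hg.prodMk hb) fun y hy => ⟨hgN hy, mem_univ _⟩
  · exact hfc.comp (hg.prodMk ha) fun y hy => ⟨hgN hy, mem_univ _⟩

/-- The chord ratios stay in the unit disc about 1, so their principal logarithm is a continuous
correction. It tends to 0 far out, where the map is the identity, so the normalization at infinity
is preserved. -/
theorem LArcSystem.chordLog_perturb {n : ℕ} (δ : LArcSystem n) {f : ℂ → ℂ}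
    (h : IsSmallPerturbation f) {q : ℝ × ℝ} (hq : q ∈ chordDomain) :
    (δ.perturb h).chordLog q = δ.chordLog q + ratioLog f (δ.path q.1) (δ.path q.2) := by
  have hc1 : ContinuousOn (fun q : ℝ × ℝ => δ.path q.1) chordDomain :=
    δ.continuousOn.comp continuousOn_fst fun q hq => hq.1
  have hc2 : ContinuousOn (fun q : ℝ × ℝ => δ.path q.2) chordDomain :=
    δ.continuousOn.comp continuousOn_snd fun q hq => hq.1.trans hq.2.le
  refine (δ.perturb h).chordLog_spec.eqOn
    (L' := fun q => δ.chordLog q + ratioLog f (δ.path q.1) (δ.path q.2)) ⟨?_, ?_, ?_⟩ hq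
  · refine δ.chordLog_spec.1.add ?_
    exact ContinuousOn.ratioLog_comp (X := Unit) (N := univ) (f := fun _ => f) (fun _ => h)
      (h.contDiff.continuous.comp continuous_snd).continuousOn (g := fun _ => ())
      continuousOn_const (mapsTo_univ _ _) hc1 hc2 fun q hq => δ.path_sub_ne_zero hq
  · intro q hq
    have hne := δ.path_sub_ne_zero hq
    rw [Complex.exp_add, δ.chordLog_spec.2.1 q hq, ratioLog,
      Complex.exp_log (Complex.slitPlane_ne_zero (h.ratio_mem hne)), mul_div_cancel₀ _ hne]
    rfl
  · intro t ht
    have h1 : Tendsto (fun s => ratioLog f (δ.path t) (δ.path s)) atTop (𝓝 0) := by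
      have h2 : Tendsto (fun s => (δ.path s - f (δ.path t)) / (δ.path s - δ.path t)) atTop
          (𝓝 1) := by
        have h3 : Tendsto (fun s => (δ.path t - f (δ.path t)) / (δ.path s - δ.path t)) atTop
            (𝓝 0) := by
          rw [tendsto_zero_iff_norm_tendsto_zero]
          simp only [norm_div]
          refine Tendsto.const_div_atTop ?_ _
          refine tendsto_atTop_mono (fun s => ?_)
            (tendsto_atTop_add_const_right atTop (-‖δ.path t‖) δ.tendsto_norm)
          rw [← sub_eq_add_neg]
          exact norm_sub_norm_le _ _
        have h4 := h3.const_add 1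
        rw [add_zero] at h4
        refine h4.congr' ?_
        filter_upwards [eventually_gt_atTop t] with s hs
        have hne := δ.path_sub_ne_zero (q := (t, s)) ⟨ht, hs⟩
        simp only at hne
        field_simp
        ring
      have h5 := h2.clog (by simp)
      rw [Complex.log_one] at h5
      refine h5.congr' ?_
      obtain ⟨R, hR⟩ := h.eq_far
      filter_upwards [δ.tendsto_norm.eventually_ge_atTop R] with s hs
      rw [ratioLog, hR _ hs]
    have h6 := (δ.chordLog_spec.2.2 t ht).add (Complex.continuous_im.continuousAt.tendsto.comp h1)
    simpa using h6

/-- A family of L-arc systems, continuous together with the determinations of the logarithms. -/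
def IsFamily {n : ℕ} {X : Type*} [TopologicalSpace X] (N : Set X) (δ : X → LArcSystem n) : Prop :=
  ContinuousOn (fun x : X × ℝ => (δ x.1).path x.2) (N ×ˢ Ici 0) ∧
  ContinuousOn (fun x : X × (ℝ × ℝ) => (δ x.1).chordLog x.2) (N ×ˢ chordDomain)

theorem IsFamily.comp {n : ℕ} {X Y : Type*} [TopologicalSpace X] [TopologicalSpace Y] {N : Set X}
    {δ : X → LArcSystem n} (h : IsFamily N δ) {M : Set Y} {g : Y → X} (hg : ContinuousOn g M)
    (hgN : MapsTo g M N) : IsFamily M (fun y => δ (g y)) :=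
  ⟨h.1.comp (f := fun y : Y × ℝ => (g y.1, y.2))
    ((hg.comp continuousOn_fst fun _ hy => hy.1).prodMk continuousOn_snd)
    (fun _ hy => ⟨hgN hy.1, hy.2⟩),
  h.2.comp (f := fun y : Y × (ℝ × ℝ) => (g y.1, y.2))
    ((hg.comp continuousOn_fst fun _ hy => hy.1).prodMk continuousOn_snd)
    (fun _ hy => ⟨hgN hy.1, hy.2⟩)⟩

theorem IsFamily.perturb {n : ℕ} {X : Type*} [TopologicalSpace X] {N : Set X}
    {δ : X → LArcSystem n} (h : IsFamily N δ) {f : X → ℂ → ℂ}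
    (hf : ∀ x, IsSmallPerturbation (f x))
    (hfc : ContinuousOn (fun y : X × ℂ => f y.1 y.2) (N ×ˢ univ)) :
    IsFamily N (fun x => (δ x).perturb (hf x)) := by
  have hp1 : ContinuousOn (fun x : X × (ℝ × ℝ) => (δ x.1).path x.2.1) (N ×ˢ chordDomain) :=
    h.1.comp (f := fun x : X × (ℝ × ℝ) => (x.1, x.2.1)) (by fun_prop) fun x hx => ⟨hx.1, hx.2.1⟩
  have hp2 : ContinuousOn (fun x : X × (ℝ × ℝ) => (δ x.1).path x.2.2) (N ×ˢ chordDomain) :=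
    h.1.comp (f := fun x : X × (ℝ × ℝ) => (x.1, x.2.2)) (by fun_prop)
      fun x hx => ⟨hx.1, hx.2.1.trans hx.2.2.le⟩
  refine ⟨?_, ?_⟩
  · exact hfc.comp (continuousOn_fst.prodMk h.1) fun x hx => ⟨hx.1, mem_univ _⟩
  · have h1 := h.2.add (ContinuousOn.ratioLog_comp hf hfc (M := N ×ˢ chordDomain)
      (g := fun x => x.1) continuousOn_fst (fun x hx => hx.1) hp1 hp2
      fun x hx => (δ x.1).path_sub_ne_zero hx.2)
    exact h1.congr fun x hx => (δ x.1).chordLog_perturb (hf x.1) hx.2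

/-- The part of an arc beyond the parameter `|τ|`, as an L-arc system. -/
def LArcSystem.slide {n : ℕ} (δ : LArcSystem n) (τ : ℝ) : LArcSystem n where
  -- The absolute value makes all of ℝ the parameter space, so that connectedness of ℝ can be used
  -- without restricting to a half line.
  path t := δ.path (t + |τ|)
  continuousOn := δ.continuousOn.comp (by fun_prop) fun t ht =>
    add_nonneg (mem_Ici.mp ht) (abs_nonneg τ)
  injOn := fun s hs t ht hst => by
    have := δ.injOn (add_nonneg (mem_Ici.mp hs) (abs_nonneg τ))
      (add_nonneg (mem_Ici.mp ht) (abs_nonneg τ)) hst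
    linarith
  piecewiseRegular := by
    classical
    obtain ⟨s, hs⟩ := δ.piecewiseRegular
    refine ⟨s.image fun t => t - |τ|, fun a b ha hab hd => ?_⟩
    have hmaps : MapsTo (fun t => t + |τ|) (Icc a b) (Icc (a + |τ|) (b + |τ|)) := fun t ht =>
      ⟨by linarith [ht.1], by linarith [ht.2]⟩
    obtain ⟨h1, h2⟩ := hs (a + |τ|) (b + |τ|) (add_nonneg ha (abs_nonneg τ)) (by linarith) (by
      rw [Set.disjoint_left] at hd ⊢
      intro t ht hts
      refine hd (a := t - |τ|) ⟨by linarith [ht.1], by linarith [ht.2]⟩ ?_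
      exact Finset.mem_coe.mpr (Finset.mem_image_of_mem _ hts))
    refine ⟨h1.comp (by fun_prop) hmaps, fun t ht => ?_⟩
    have h3 : HasDerivWithinAt δ.path (derivWithin δ.path (Icc (a + |τ|) (b + |τ|)) (t + |τ|))
        (Icc (a + |τ|) (b + |τ|)) (t + |τ|) :=
      ((h1.differentiableOn one_ne_zero) _ (hmaps ht)).hasDerivWithinAt
    have h4 := h3.scomp t ((hasDerivWithinAt_id t (Icc a b)).add_const |τ|) hmaps
    rw [one_smul] at h4
    have h5 := h4.derivWithin (uniqueDiffOn_Icc hab t ht)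
    have h6 : (δ.path ∘ fun t => id t + |τ|) = fun t => δ.path (t + |τ|) := rfl
    rw [h6] at h5
    rw [h5]
    exact h2 _ (hmaps ht)
  eventually_real := (tendsto_atTop_add_const_right atTop |τ| tendsto_id).eventually
    δ.eventually_real
  tendsto_re := δ.tendsto_re.comp (tendsto_atTop_add_const_right atTop |τ| tendsto_id)

theorem LArcSystem.slide_zero {n : ℕ} (δ : LArcSystem n) : δ.slide 0 = δ :=
  LArcSystem.ext_path (by funext t; simp [slide])

theorem LArcSystem.chordLog_slide {n : ℕ} (δ : LArcSystem n) (τ : ℝ) {q : ℝ × ℝ}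
    (hq : q ∈ chordDomain) :
    (δ.slide τ).chordLog q = δ.chordLog (q.1 + |τ|, q.2 + |τ|) := by
  have hm : ∀ q ∈ chordDomain, (q.1 + |τ|, q.2 + |τ|) ∈ chordDomain := fun q hq =>
    ⟨add_nonneg hq.1 (abs_nonneg τ), by simpa using hq.2⟩
  refine (δ.slide τ).chordLog_spec.eqOn (L' := fun q => δ.chordLog (q.1 + |τ|, q.2 + |τ|))
    ⟨δ.chordLog_spec.1.comp (by fun_prop) hm, fun q hq => δ.chordLog_spec.2.1 _ (hm q hq),
      fun t ht => ?_⟩ hq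
  exact (δ.chordLog_spec.2.2 (t + |τ|) (add_nonneg ht (abs_nonneg τ))).comp
    (tendsto_atTop_add_const_right atTop |τ| tendsto_id)

theorem LArcSystem.isFamily_slide {n : ℕ} (δ : LArcSystem n) : IsFamily univ δ.slide := by
  refine ⟨δ.continuousOn.comp (by fun_prop) fun x hx =>
    add_nonneg (mem_Ici.mp hx.2) (abs_nonneg x.1), ?_⟩
  refine (δ.chordLog_spec.1.comp (f := fun x : ℝ × (ℝ × ℝ) => (x.2.1 + |x.1|, x.2.2 + |x.1|))
    (s := univ ×ˢ chordDomain) (by fun_prop) fun x hx =>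
      ⟨add_nonneg hx.2.1 (abs_nonneg x.1), by simpa using hx.2.2⟩).congr
      fun x hx => δ.chordLog_slide x.1 hx.2

/-- The bumps are locally constant near every z i, not only correct at the points themselves. A
system made for one configuration therefore still separates the points of nearby configurations. -/
theorem exists_bumps {n : ℕ} {E : Type*} [NormedAddCommGroup E] [NormedSpace ℝ E]
    [FiniteDimensional ℝ E] {z : Fin (n + 1) → E} (hz : Function.Injective z) :
    ∃ χ : Fin (n + 1) → E → ℝ, (∀ j, ContDiff ℝ 1 (χ j)) ∧ (∀ j, HasCompactSupport (χ j)) ∧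
      ∀ i j, ∀ᶠ ζ in 𝓝 (z i), χ j ζ = if i = j then 1 else 0 := by
  obtain ⟨r, hr, hrz⟩ : ∃ r > 0, ∀ i j, i ≠ j → 2 * r ≤ dist (z i) (z j) := by
    have h1 : ∀ q : Fin (n + 1) × Fin (n + 1), ∃ r > 0, q.1 ≠ q.2 → 2 * r ≤ dist (z q.1) (z q.2) := by
      intro q
      by_cases hq : q.1 = q.2
      · exact ⟨1, one_pos, fun h => absurd hq h⟩
      · refine ⟨dist (z q.1) (z q.2) / 2, half_pos (dist_pos.mpr (hz.ne hq)), fun _ => ?_⟩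
        linarith
    choose ρ hρ hρz using h1
    obtain ⟨q₀, hq₀⟩ := Finite.exists_min ρ
    exact ⟨ρ q₀, hρ q₀, fun i j hij => le_trans (by linarith [hq₀ (i, j)]) (hρz (i, j) hij)⟩
  have hb : 0 < r / 2 ∧ r / 2 < r := ⟨half_pos hr, half_lt_self hr⟩
  refine ⟨fun j => (⟨r / 2, r, hb.1, hb.2⟩ : ContDiffBump (z j)), fun j => ContDiffBump.contDiff _,
    fun j => ContDiffBump.hasCompactSupport _, fun i j => ?_⟩
  filter_upwards [Metric.ball_mem_nhds (z i) hb.1] with ζ hζ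
  split_ifs with hij
  · subst hij
    exact ContDiffBump.one_of_mem_closedBall _ (Metric.ball_subset_closedBall hζ)
  · refine ContDiffBump.zero_of_le_dist _ ?_
    have h2 := hrz i j hij
    have h3 := dist_triangle (z i) ζ (z j)
    rw [dist_comm (z i) ζ] at h3
    have h4 : dist ζ (z i) < r / 2 := hζ
    change r ≤ dist ζ (z j)
    linarith

/-- These functions define shears of the plane. Vanishing far to the right is what leaves the real
tail of an arc untouched. -/
theorem exists_contDiff_interpolation {n : ℕ} {x : Fin (n + 1) → ℝ} (hx : Function.Injective x)
    (y : Fin (n + 1) → ℝ) : ∃ f : ℝ → ℝ, ContDiff ℝ 1 f ∧ (∀ j, f (x j) = y j) ∧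
      ∃ R, ∀ t, R ≤ t → f t = 0 := by
  obtain ⟨χ, h1, h2, h3⟩ := exists_bumps hx
  refine ⟨fun t => ∑ j, χ j t * y j, ContDiff.sum fun j _ => (h1 j).mul contDiff_const,
    fun i => ?_, ?_⟩
  · have : ∀ j, χ j (x i) = if i = j then 1 else 0 := fun j => (h3 i j).self_of_nhds
    simp [this]
  · have h4 : ∀ j, ∃ R, ∀ t, R ≤ t → χ j t = 0 := by
      intro j
      obtain ⟨R, hR⟩ := (h2 j).isBounded.subset_closedBall 0
      refine ⟨R + 1, fun t ht => ?_⟩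
      by_contra hne
      have := hR (subset_tsupport _ hne)
      rw [mem_closedBall_zero_iff, Real.norm_eq_abs] at this
      linarith [le_abs_self t]
    choose R hR using h4
    obtain ⟨j₀, hj₀⟩ := Finite.exists_max R
    exact ⟨R j₀, fun t ht => Finset.sum_eq_zero fun j _ => by
      rw [hR j t ((hj₀ j).trans ht), zero_mul]⟩

/-! ### Existence of arc systems -/

/-- The positive real axis as an L-arc system. -/
def realArc (n : ℕ) : LArcSystem n where
  path t := t
  continuousOn := Complex.continuous_ofReal.continuousOn
  injOn := Complex.ofReal_injective.injOn
  piecewiseRegular := by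
    refine ⟨∅, fun a b ha hab _ => ⟨Complex.ofRealCLM.contDiff.contDiffOn, fun t ht => ?_⟩⟩
    have h : HasDerivWithinAt (fun t : ℝ => (t : ℂ)) 1 (Icc a b) t :=
      (hasDerivAt_id t).ofReal_comp.hasDerivWithinAt
    rw [h.derivWithin (uniqueDiffOn_Icc hab t ht)]
    exact one_ne_zero
  eventually_real := by simp
  tendsto_re := by simpa using! tendsto_id

/-- The shear `x + iy ↦ x + i(y + f x)`. -/
def vShear (f : ℝ → ℝ) (ζ : ℂ) : ℂ := ζ + Complex.I * (f ζ.re : ℝ)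

/-- The shear `x + iy ↦ (x + f y) + iy`. -/
def hShear (f : ℝ → ℝ) (ζ : ℂ) : ℂ := ζ + (f ζ.im : ℝ)

theorem injective_fderiv_of_leftInverse {f g : ℂ → ℂ} (hf : ContDiff ℝ 1 f) (hg : ContDiff ℝ 1 g)
    (h : Function.LeftInverse g f) (ζ : ℂ) : Function.Injective (fderiv ℝ f ζ) := by
  have h1 := (hg.differentiable one_ne_zero (f ζ)).hasFDerivAt.comp ζ
    (hf.differentiable one_ne_zero ζ).hasFDerivAt
  have h2 : g ∘ f = id := h.comp_eq_id
  rw [h2] at h1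
  have h3 := h1.unique (hasFDerivAt_id ζ)
  intro u v huv
  have h4 : ∀ w, fderiv ℝ g (f ζ) (fderiv ℝ f ζ w) = w := fun w => by
    simpa using DFunLike.congr_fun h3 w
  rw [← h4 u, ← h4 v, huv]

theorem contDiff_vShear {f : ℝ → ℝ} (hf : ContDiff ℝ 1 f) : ContDiff ℝ 1 (vShear f) :=
  contDiff_id.add (contDiff_const.mul
    (Complex.ofRealCLM.contDiff.comp (hf.comp Complex.reCLM.contDiff)))

theorem contDiff_hShear {f : ℝ → ℝ} (hf : ContDiff ℝ 1 f) : ContDiff ℝ 1 (hShear f) :=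
  contDiff_id.add (Complex.ofRealCLM.contDiff.comp (hf.comp Complex.imCLM.contDiff))

theorem leftInverse_vShear (f : ℝ → ℝ) :
    Function.LeftInverse (vShear fun x => -f x) (vShear f) := by
  intro ζ
  simp [vShear]

theorem leftInverse_hShear (f : ℝ → ℝ) :
    Function.LeftInverse (hShear fun x => -f x) (hShear f) := by
  intro ζ
  simp [hShear]

theorem exists_map_vShear {n : ℕ} (δ : LArcSystem n) {f : ℝ → ℝ} (hf : ContDiff ℝ 1 f)
    (hR : ∃ R, ∀ t, R ≤ t → f t = 0) :
    ∃ δ' : LArcSystem n, ∀ t, δ'.path t = vShear f (δ.path t) := by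
  refine ⟨δ.map (vShear f) (contDiff_vShear hf) (leftInverse_vShear f).injective
    (injective_fderiv_of_leftInverse (contDiff_vShear hf) (contDiff_vShear hf.neg)
      (leftInverse_vShear f)) ?_, fun t => rfl⟩
  obtain ⟨R, hR⟩ := hR
  exact ⟨R, 0, fun x hx => by simp [vShear, hR x hx]⟩

theorem exists_map_hShear {n : ℕ} (δ : LArcSystem n) {f : ℝ → ℝ} (hf : ContDiff ℝ 1 f) :
    ∃ δ' : LArcSystem n, ∀ t, δ'.path t = hShear f (δ.path t) := by
  refine ⟨δ.map (hShear f) (contDiff_hShear hf) (leftInverse_hShear f).injective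
    (injective_fderiv_of_leftInverse (contDiff_hShear hf) (contDiff_hShear hf.neg)
      (leftInverse_hShear f)) ?_, fun t => rfl⟩
  exact ⟨0, f 0, fun x _ => by simp [hShear]⟩

/-- The positive real axis with marks at 0, …, n is moved to the prescribed points by shears, which
are diffeomorphisms of the plane, so simplicity and regularity of the arc are automatic. -/
theorem exists_points_eq {n : ℕ} {z : Fin (n + 1) → ℂ} (hz : Function.Injective z) :
    ∃ δ : LArcSystem n, δ.points = z := by
  -- A vertical shear can only prescribe imaginary parts of points with distinct real parts. Points
  -- with equal real parts are first separated by a slant c; only finitely many slants are bad.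
  obtain ⟨c, hc⟩ : ∃ c : ℝ, Function.Injective fun j => (z j).re - c * (z j).im := by
    have h1 : (⋃ q : Fin (n + 1) × Fin (n + 1),
        {((z q.1).re - (z q.2).re) / ((z q.1).im - (z q.2).im)} : Set ℝ).Finite :=
      finite_iUnion fun _ => finite_singleton _
    obtain ⟨c, hc⟩ := h1.infinite_compl.nonempty
    refine ⟨c, fun i j hij => ?_⟩
    by_contra hne
    simp only [mem_compl_iff, mem_iUnion, mem_singleton_iff, not_exists] at hc
    have h2 := hc (i, j)
    simp only at h2 hij
    by_cases him : (z i).im = (z j).im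
    · rw [him] at hij
      exact hne (hz (Complex.ext (by linarith) him))
    · refine h2 ((eq_div_iff (sub_ne_zero.mpr him)).mpr ?_)
      linarith
  have hj : Function.Injective fun j : Fin (n + 1) => ((j : ℕ) : ℝ) := fun i j hij => by
    simpa [Fin.ext_iff] using hij
  obtain ⟨f₁, hf₁, he₁, hR₁⟩ := exists_contDiff_interpolation hj fun j => ((j : ℕ) : ℝ)
  obtain ⟨f₂, hf₂, he₂, -⟩ := exists_contDiff_interpolation hj
    fun j => (z j).re - c * (z j).im - ((j : ℕ) : ℝ)
  obtain ⟨f₃, hf₃, he₃, hR₃⟩ := exists_contDiff_interpolation hc fun j => (z j).im - ((j : ℕ) : ℝ)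
  -- The mark j travels from (j, 0) to (j, j), then to (x_j - c y_j, j), then to (x_j - c y_j, y_j),
  -- and the last shear restores the real part x_j.
  obtain ⟨δ₁, h₁⟩ := exists_map_vShear (realArc n) hf₁ hR₁
  obtain ⟨δ₂, h₂⟩ := exists_map_hShear δ₁ hf₂
  obtain ⟨δ₃, h₃⟩ := exists_map_vShear δ₂ hf₃ hR₃
  obtain ⟨δ₄, h₄⟩ := exists_map_hShear δ₃ (f := fun y => c * y) (contDiff_const.mul contDiff_id)
  refine ⟨δ₄, funext fun j => ?_⟩
  have e1 : δ₁.path ((j : ℕ) : ℝ) = ⟨((j : ℕ) : ℝ), ((j : ℕ) : ℝ)⟩ := by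
    rw [h₁]
    apply Complex.ext <;> simp [vShear, realArc, he₁]
  have e2 : δ₂.path ((j : ℕ) : ℝ) = ⟨(z j).re - c * (z j).im, ((j : ℕ) : ℝ)⟩ := by
    rw [h₂, e1]
    apply Complex.ext <;> simp [hShear, he₂]
  have e3 : δ₃.path ((j : ℕ) : ℝ) = ⟨(z j).re - c * (z j).im, (z j).im⟩ := by
    rw [h₃, e2]
    apply Complex.ext <;> simp [vShear, he₃]
  rw [LArcSystem.points, h₄, e3]
  apply Complex.ext <;> simp [hShear]

theorem LArcSystem.points_injective {n : ℕ} (δ : LArcSystem n) : Function.Injective δ.points := by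
  intro i j hij
  have h : (((i : ℕ) : ℝ)) = ((j : ℕ) : ℝ) :=
    δ.injOn (mem_Ici.mpr (Nat.cast_nonneg _)) (mem_Ici.mpr (Nat.cast_nonneg _)) hij
  exact Fin.ext (by exact_mod_cast h)

/-! ### Moving the marked points -/

theorem exists_norm_bound_of_hasCompactSupport {E : Type*} [Zero E] {f : ℂ → E} (h : HasCompactSupport f) :
    ∃ R, ∀ ζ, R ≤ ‖ζ‖ → f ζ = 0 := by
  obtain ⟨R, hR⟩ := h.isBounded.subset_closedBall 0
  refine ⟨R + 1, fun ζ hζ => ?_⟩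
  by_contra hne
  have := hR (subset_tsupport _ hne)
  rw [mem_closedBall_zero_iff] at this
  linarith

/-- Near `x₀`, the marked points of a continuous family can be moved independently. -/
theorem IsFamily.exists_move {n : ℕ} {X : Type*} [TopologicalSpace X] {N : Set X}
    {δ : X → LArcSystem n} (h : IsFamily N δ) {x₀ : X} (hx₀ : x₀ ∈ N) :
    ∃ (r : ℝ) (δ' : X × (Fin (n + 1) → ℂ) → LArcSystem n), 0 < r ∧
      IsFamily (N ×ˢ Metric.ball 0 r) δ' ∧ (∀ x, δ' (x, 0) = δ x) ∧
      (∀ᶠ x in 𝓝[N] x₀, ∀ v ∈ Metric.ball (0 : Fin (n + 1) → ℂ) r,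
        (δ' (x, v)).points = (δ x).points + v) ∧
      ∀ x v, (∀ j, (v j).im = 0) → (∀ t, 0 ≤ t → ((δ x).path t).im = 0) →
        ∀ t, 0 ≤ t → ((δ' (x, v)).path t).im = 0 := by
  classical
  obtain ⟨χ, hχ, hχc, hχe⟩ := exists_bumps (δ x₀).points_injective
  have hl : ∀ j, ∃ K, LipschitzWith K (χ j) := fun j =>
    ⟨_, (hχ j).lipschitzWith_of_hasCompactSupport (hχc j) one_ne_zero |>.choose_spec⟩
  choose K hK using hl
  set k : ℝ := ∑ j, (K j : ℝ) with hk
  have hk0 : 0 ≤ k := Finset.sum_nonneg fun j _ => (K j).2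
  -- With displacements of size at most r the total displacement field has Lipschitz constant at
  -- most k r ≤ 1/2.
  set r : ℝ := 1 / (2 * (k + 1)) with hr
  have hr0 : 0 < r := by positivity
  -- Large v are sent to the identity map, so that every parameter gives a small perturbation and
  -- the family is total; continuity is only claimed over the ball.
  set f : (Fin (n + 1) → ℂ) → ℂ → ℂ := fun v ζ =>
    if v ∈ Metric.ball 0 r then ζ + ∑ j, (χ j ζ : ℂ) * v j else ζ with hf
  have hfs : ∀ v, IsSmallPerturbation (f v) := by
    intro v
    by_cases hv : v ∈ Metric.ball 0 r
    · have hfv : f v = fun ζ => ζ + ∑ j, (χ j ζ : ℂ) * v j := by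
        funext ζ
        simp only [hf, hv, if_true]
      rw [hfv]
      refine ⟨?_, fun p q => ?_, ?_⟩
      · exact contDiff_id.add (ContDiff.sum fun j _ =>
          (Complex.ofRealCLM.contDiff.comp (hχ j)).mul contDiff_const)
      · have h1 : (q + ∑ j, (χ j q : ℂ) * v j) - (p + ∑ j, (χ j p : ℂ) * v j) - (q - p) =
            ∑ j, ((χ j q - χ j p : ℝ) : ℂ) * v j := by
          have : ∀ j, ((χ j q - χ j p : ℝ) : ℂ) * v j = (χ j q : ℂ) * v j - (χ j p : ℂ) * v j := by
            intro j
            push_cast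
            ring
          rw [Finset.sum_congr rfl fun j _ => this j, Finset.sum_sub_distrib]
          ring
        rw [h1]
        have hvr : ∀ j, ‖v j‖ ≤ r := fun j =>
          (norm_le_pi_norm v j).trans (mem_ball_zero_iff.mp hv).le
        calc ‖∑ j, ((χ j q - χ j p : ℝ) : ℂ) * v j‖ ≤ ∑ j, (K j * ‖q - p‖) * r := by
              refine norm_sum_le_of_le _ fun j _ => ?_
              rw [norm_mul, Complex.norm_real]
              have h2 := (hK j).dist_le_mul q p
              rw [dist_eq_norm, dist_eq_norm] at h2
              exact mul_le_mul h2 (hvr j) (norm_nonneg _) (by positivity)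
          _ = k * r * ‖q - p‖ := by
              rw [hk, Finset.sum_mul, Finset.sum_mul]
              exact Finset.sum_congr rfl fun j _ => by ring
          _ ≤ 1 / 2 * ‖q - p‖ := by
              refine mul_le_mul_of_nonneg_right ?_ (norm_nonneg _)
              rw [hr, mul_one_div, div_le_div_iff₀ (by positivity) (by norm_num)]
              linarith
      · have h4 := fun j => exists_norm_bound_of_hasCompactSupport (hχc j)
        choose R hR using h4
        obtain ⟨j₀, hj₀⟩ := Finite.exists_max R
        refine ⟨R j₀, fun ζ hζ => ?_⟩
        rw [Finset.sum_eq_zero fun j _ => by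
          rw [hR j ζ ((hj₀ j).trans hζ), Complex.ofReal_zero, zero_mul], add_zero]
    · have hfv : f v = id := by
        funext ζ
        simp only [hf, hv, if_false, id]
      rw [hfv]
      exact isSmallPerturbation_id
  refine ⟨r, fun y => (δ y.1).perturb (hfs y.2), hr0, ?_, fun x => ?_, ?_, ?_⟩
  · refine IsFamily.perturb (f := fun y : X × (Fin (n + 1) → ℂ) => f y.2)
      (h.comp (g := Prod.fst) (M := N ×ˢ Metric.ball 0 r) continuousOn_fst fun y hy => hy.1)
      (fun y => hfs y.2) ?_
    have hcont : ContinuousOn (fun y : (X × (Fin (n + 1) → ℂ)) × ℂ =>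
        y.2 + ∑ j, (χ j y.2 : ℂ) * y.1.2 j) ((N ×ˢ Metric.ball 0 r) ×ˢ univ) := by
      refine Continuous.continuousOn ?_
      refine continuous_snd.add (continuous_finsetSum _ fun j _ => ?_)
      exact (Complex.continuous_ofReal.comp ((hχ j).continuous.comp continuous_snd)).mul
        (by fun_prop)
    refine hcont.congr fun y hy => ?_
    have hy2 : y.1.2 ∈ Metric.ball (0 : Fin (n + 1) → ℂ) r := hy.1.2
    simp only [hf, hy2, if_true]
  · refine LArcSystem.ext_path (funext fun t => ?_)
    rw [LArcSystem.perturb_path]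
    simp [hf]
  · have h1 : ∀ i : Fin (n + 1), ∀ᶠ x in 𝓝[N] x₀, ∀ j,
        χ j ((δ x).points i) = if i = j then 1 else 0 := by
      intro i
      have h2 : ContinuousWithinAt (fun x => (δ x).points i) N x₀ := by
        have h3 : ContinuousOn (fun x => (δ x).points i) N :=
          h.1.comp (f := fun x => (x, ((i : ℕ) : ℝ))) (by fun_prop)
            fun x hx => ⟨hx, mem_Ici.mpr (Nat.cast_nonneg _)⟩
        exact h3 x₀ hx₀
      exact eventually_all.mpr fun j => h2.eventually (hχe i j)
    filter_upwards [eventually_all.mpr h1] with x hx v hv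
    funext i
    change f v ((δ x).points i) = _
    simp only [hf, hv, if_true, hx i]
    simp [apply_ite Complex.ofReal]
  · intro x v hv hδ t ht
    rw [LArcSystem.perturb_path]
    simp only [hf]
    split_ifs
    · rw [Complex.add_im, hδ t ht, zero_add, Complex.im_sum]
      exact Finset.sum_eq_zero fun j _ => by simp [hv]
    · exact hδ t ht

/-- Multiplication by scalars near `1`, on a bounded part of the plane. -/
theorem exists_scaling : ∃ ε > 0, ∀ R > 0, ∃ f : ℂ → ℂ → ℂ,
    (∀ c, IsSmallPerturbation (f c)) ∧
    ContinuousOn (fun y : ℂ × ℂ => f y.1 y.2) (Metric.ball 1 ε ×ˢ univ) ∧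
    ∀ c ∈ Metric.ball (1:ℂ) ε, ∀ ζ, ‖ζ‖ < R → f c ζ = c * ζ := by
  classical
  set χ : ContDiffBump (0 : ℂ) := ⟨1, 2, one_pos, by norm_num⟩ with hχ
  set k : ℂ → ℂ := fun ζ => (χ ζ : ℂ) * ζ with hk
  have hkd : ContDiff ℝ 1 k := (Complex.ofRealCLM.contDiff.comp χ.contDiff).mul contDiff_id
  have hkc : HasCompactSupport k := by
    refine HasCompactSupport.mul_right ?_
    exact χ.hasCompactSupport.comp_left Complex.ofReal_zero
  obtain ⟨K, hK⟩ := hkd.lipschitzWith_of_hasCompactSupport hkc one_ne_zero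
  set ε : ℝ := 1 / (2 * (K + 1)) with hε
  have hε0 : 0 < ε := by positivity
  refine ⟨ε, hε0, fun R hR => ?_⟩
  have hRc : (R : ℂ) ≠ 0 := by exact_mod_cast hR.ne'
  -- Rescaling by R enlarges the region where the cut-off is 1 but does not change the Lipschitz
  -- constant; this is why ε can be chosen before R.
  set g : ℂ → ℂ := fun ζ => R * k (ζ / R) with hg
  have hgd : ContDiff ℝ 1 g := contDiff_const.mul (hkd.comp (contDiff_id.div_const _))
  have hgl : ∀ p q, ‖g q - g p‖ ≤ K * ‖q - p‖ := by
    intro p q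
    have h1 := hK.dist_le_mul (q / R) (p / R)
    rw [dist_eq_norm, dist_eq_norm, ← sub_div, norm_div, Complex.norm_real,
      Real.norm_of_nonneg hR.le] at h1
    rw [hg, ← mul_sub, norm_mul, Complex.norm_real, Real.norm_of_nonneg hR.le]
    calc R * ‖k (q / R) - k (p / R)‖ ≤ R * (K * (‖q - p‖ / R)) := by gcongr
      _ = K * ‖q - p‖ := by field_simp
  refine ⟨fun c ζ => if c ∈ Metric.ball 1 ε then ζ + (c - 1) * g ζ else ζ, fun c => ?_, ?_, ?_⟩
  · by_cases hc : c ∈ Metric.ball 1 ε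
    · simp only [hc, if_true]
      refine ⟨contDiff_id.add (contDiff_const.mul hgd), fun p q => ?_, ?_⟩
      · have h1 : (q + (c - 1) * g q) - (p + (c - 1) * g p) - (q - p) = (c - 1) * (g q - g p) := by
          ring
        rw [h1, norm_mul]
        have h2 : ‖c - 1‖ ≤ ε := (mem_ball_iff_norm.mp hc).le
        calc ‖c - 1‖ * ‖g q - g p‖ ≤ ε * (K * ‖q - p‖) :=
              mul_le_mul h2 (hgl p q) (norm_nonneg _) hε0.le
          _ = ε * K * ‖q - p‖ := by ring
          _ ≤ 1 / 2 * ‖q - p‖ := by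
              refine mul_le_mul_of_nonneg_right ?_ (norm_nonneg _)
              rw [hε, one_div_mul_eq_div, div_le_div_iff₀ (by positivity) (by norm_num)]
              linarith
      · obtain ⟨M, hM⟩ := exists_norm_bound_of_hasCompactSupport hkc
        refine ⟨R * M, fun ζ hζ => ?_⟩
        have : k (ζ / R) = 0 := by
          refine hM _ ?_
          rw [norm_div, Complex.norm_real, Real.norm_of_nonneg hR.le, le_div_iff₀ hR]
          linarith
        simp [hg, this]
    · simp only [hc, if_false]
      exact isSmallPerturbation_id
  · have hcont : ContinuousOn (fun y : ℂ × ℂ => y.2 + (y.1 - 1) * g y.2)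
        (Metric.ball 1 ε ×ˢ univ) := by
      have := hgd.continuous
      fun_prop
    refine hcont.congr fun y hy => ?_
    have hy1 : y.1 ∈ Metric.ball (1:ℂ) ε := hy.1
    simp only [hy1, if_true]
  · intro c hc ζ hζ
    have h1 : χ (ζ / R) = 1 := by
      refine χ.one_of_mem_closedBall ?_
      rw [mem_closedBall_zero_iff, norm_div, Complex.norm_real, Real.norm_of_nonneg hR.le,
        div_le_one hR]
      exact hζ.le
    simp only [hc, if_true, hg, hk, h1]
    field_simp
    push_cast
    ring

/-! ### Integrability -/

theorem intervalIntegrable_abs_sub_rpow {m : ℝ} (hm : m < 1) (x a b : ℝ) :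
    IntervalIntegrable (fun t => |t - x| ^ (-m)) volume a b := by
  have h0 : ∀ y z : ℝ, IntervalIntegrable (fun t : ℝ => |t| ^ (-m)) volume y z := by
    intro y z
    refine intervalIntegrable_of_even (fun t => by rw [abs_neg]) (fun u hu => ?_) (by simp) (by simp)
    refine (intervalIntegral.intervalIntegrable_rpow' (r := -m) (by linarith)).congr ?_
    intro t ht
    rw [uIoc_of_le hu.le] at ht
    simp only [abs_of_pos ht.1]
  have := (h0 (a - x) (b - x)).comp_sub_right x
  simpa using this

theorem exists_separation {n : ℕ} {E : Type*} [MetricSpace E] {z : Fin (n + 1) → E}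
    (hz : Function.Injective z) : ∃ r > 0, r ≤ 1 ∧ ∀ i j, i ≠ j → 4 * r ≤ dist (z i) (z j) := by
  have h1 : ∀ q : Fin (n + 1) × Fin (n + 1), ∃ r > 0, r ≤ 1 ∧
      (q.1 ≠ q.2 → 4 * r ≤ dist (z q.1) (z q.2)) := by
    intro q
    by_cases hq : q.1 = q.2
    · exact ⟨1, one_pos, le_rfl, fun h => absurd hq h⟩
    · have h := dist_pos.mpr (hz.ne hq)
      refine ⟨min 1 (dist (z q.1) (z q.2) / 4), by positivity, min_le_left _ _, fun _ => ?_⟩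
      have := min_le_right 1 (dist (z q.1) (z q.2) / 4)
      linarith
  choose ρ hρ hρ1 hρz using h1
  obtain ⟨q₀, hq₀⟩ := Finite.exists_min ρ
  exact ⟨ρ q₀, hρ q₀, hρ1 q₀, fun i j hij => le_trans (by linarith [hq₀ (i, j)]) (hρz (i, j) hij)⟩

/-- At most one factor is large at any t, because the x j are separated; the others are at most r⁻¹.
So the product is dominated by a constant times 1 plus the sum of its factors, each of which is
integrable. -/
theorem intervalIntegrable_prod_abs_sub_rpow {n : ℕ} {μ : Fin (n + 1) → ℝ}
    (hμ : ∀ j, 0 < μ j ∧ μ j < 1) {x : Fin (n + 1) → ℝ} (hx : Function.Injective x) (a b : ℝ) :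
    IntervalIntegrable (fun t => ∏ j, |t - x j| ^ (-μ j)) volume a b := by
  obtain ⟨r, hr, hr1, hrx⟩ := exists_separation hx
  have hL : 1 ≤ r⁻¹ := (one_le_inv₀ hr).mpr hr1
  have hfar : ∀ t j, r ≤ |t - x j| → |t - x j| ^ (-μ j) ≤ r⁻¹ := by
    intro t j h
    calc |t - x j| ^ (-μ j) ≤ r ^ (-μ j) :=
          Real.rpow_le_rpow_of_nonpos hr h (by linarith [(hμ j).1])
      _ ≤ r ^ (-1 : ℝ) := Real.rpow_le_rpow_of_exponent_ge hr hr1 (by linarith [(hμ j).2])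
      _ = r⁻¹ := Real.rpow_neg_one r
  have hnn : ∀ t j, 0 ≤ |t - x j| ^ (-μ j) := fun t j => Real.rpow_nonneg (abs_nonneg _) _
  have hint : IntervalIntegrable (fun t => (r⁻¹) ^ (n + 1) * (1 + ∑ j, |t - x j| ^ (-μ j)))
      volume a b := by
    refine IntervalIntegrable.const_mul (intervalIntegrable_const.add ?_) _
    have := IntervalIntegrable.sum (μ := volume) (a := a) (b := b) Finset.univ
      (f := fun j t => |t - x j| ^ (-μ j))
      fun j _ => intervalIntegrable_abs_sub_rpow (hμ j).2 (x j) a b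
    simpa [Finset.sum_fn] using this
  refine hint.mono_fun' ?_ (ae_of_all _ fun t => ?_)
  · refine Measurable.aestronglyMeasurable ?_
    exact Finset.measurable_fun_prod _ fun j _ => by fun_prop
  · beta_reduce
    rw [Real.norm_of_nonneg (Finset.prod_nonneg fun j _ => hnn t j)]
    by_cases h : ∃ i, |t - x i| < r
    · obtain ⟨i, hi⟩ := h
      have hj : ∀ j ≠ i, r ≤ |t - x j| := by
        intro j hj
        have h1 := hrx i j hj.symm
        rw [Real.dist_eq] at h1
        have h2 := abs_sub_le (x i) t (x j)
        rw [abs_sub_comm (x i) t] at h2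
        linarith
      rw [← Finset.mul_prod_erase _ _ (Finset.mem_univ i)]
      calc |t - x i| ^ (-μ i) * ∏ j ∈ Finset.univ.erase i, |t - x j| ^ (-μ j)
          ≤ |t - x i| ^ (-μ i) * ∏ j ∈ Finset.univ.erase i, r⁻¹ := by
            refine mul_le_mul_of_nonneg_left (Finset.prod_le_prod (fun j _ => hnn t j) ?_) (hnn t i)
            exact fun j hj' => hfar t j (hj j (Finset.ne_of_mem_erase hj'))
        _ = r⁻¹ ^ n * |t - x i| ^ (-μ i) := by
            rw [Finset.prod_const, Finset.card_erase_of_mem (Finset.mem_univ i)]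
            simp [mul_comm]
        _ ≤ r⁻¹ ^ (n + 1) * (1 + ∑ j, |t - x j| ^ (-μ j)) := by
            refine mul_le_mul (pow_le_pow_right₀ hL (Nat.le_succ n)) ?_ (hnn t i) (by positivity)
            have := Finset.single_le_sum (fun j _ => hnn t j) (Finset.mem_univ i)
            linarith
    · push Not at h
      calc ∏ j, |t - x j| ^ (-μ j) ≤ ∏ _j : Fin (n + 1), r⁻¹ :=
            Finset.prod_le_prod (fun j _ => hnn t j) fun j _ => hfar t j (h j)
        _ = r⁻¹ ^ (n + 1) * 1 := by simp
        _ ≤ _ := by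
            refine mul_le_mul_of_nonneg_left ?_ (by positivity)
            have := Finset.sum_nonneg fun j (_ : j ∈ Finset.univ) => hnn t j
            linarith

/-! ### Size and integrability of the integrand along the arcs δ_k. -/

section Arc

variable {n : ℕ} (δ : LArcSystem n)

theorem LArcSystem.exists_avoid (s : Finset ℝ) (u : ℝ) :
    ∃ η > 0, ∀ t, |t - u| < η → t ≠ u → t ∉ s := by
  have h1 : ((s.erase u : Finset ℝ) : Set ℝ)ᶜ ∈ 𝓝 u :=
    (s.erase u).finite_toSet.isClosed.isOpen_compl.mem_nhds (by simp)
  obtain ⟨η, hη, h2⟩ := Metric.mem_nhds_iff.mp h1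
  refine ⟨η, hη, fun t ht htu hts => ?_⟩
  have h3 := h2 (show t ∈ Metric.ball u η by rwa [Metric.mem_ball, Real.dist_eq])
  exact h3 (by simp [htu, hts])

/-- Near each parameter there are at most two pieces, one on each side, and on each the velocity
extends continuously to the closed interval. Compactness turns the local bounds into one. -/
theorem LArcSystem.exists_finset : ∃ s : Finset ℝ,
    (∀ t, 0 < t → t ∉ s → HasDerivAt δ.path (deriv δ.path t) t) ∧
    ∀ M, ∃ C, ∀ t, 0 < t → t < M → t ∉ s → ‖deriv δ.path t‖ ≤ C := by
  obtain ⟨s, hs⟩ := δ.piecewiseRegular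
  have hI : ∀ t, 0 < t → t ∉ s → ∃ a b, 0 ≤ a ∧ t ∈ Ioo a b ∧ Disjoint (Ioo a b) (s : Set ℝ) := by
    intro t ht hts
    obtain ⟨η, hη, h⟩ := LArcSystem.exists_avoid s t
    refine ⟨max 0 (t - η), t + η, le_max_left _ _, ⟨max_lt ht (by linarith), by linarith⟩, ?_⟩
    rw [Set.disjoint_left]
    intro u hu hus
    by_cases hut : u = t
    · exact hts (hut ▸ hus)
    · have h1 := (le_max_right _ _).trans_lt hu.1
      exact h u (abs_lt.mpr ⟨by linarith, by linarith [hu.2]⟩) hut hus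
  refine ⟨s, fun t ht hts => ?_, fun M => ?_⟩
  · obtain ⟨a, b, ha, htab, hd⟩ := hI t ht hts
    obtain ⟨h1, -⟩ := hs a b ha (htab.1.trans htab.2) hd
    exact ((h1.differentiableOn one_ne_zero).differentiableAt
      (Icc_mem_nhds htab.1 htab.2)).hasDerivAt
  · have hloc : ∀ u ∈ Icc 0 M, ∃ t ∈ 𝓝[Icc 0 M] u, ∃ C, ∀ x ∈ t, 0 < x → x ∉ s →
        ‖deriv δ.path x‖ ≤ C := by
      intro u hu
      obtain ⟨η, hη, h⟩ := LArcSystem.exists_avoid s u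
      have hpiece : ∀ a b, 0 ≤ a → a < b → (∀ x ∈ Ioo a b, |x - u| < η ∧ x ≠ u) →
          ∃ C, ∀ x ∈ Ioo a b, ‖deriv δ.path x‖ ≤ C := by
        intro a b ha hab hx
        obtain ⟨h1, -⟩ := hs a b ha hab (Set.disjoint_left.mpr fun x hx' =>
          h x (hx x hx').1 (hx x hx').2)
        have h2 := h1.continuousOn_derivWithin (uniqueDiffOn_Icc hab) le_rfl
        obtain ⟨C, hC⟩ := (isCompact_Icc.image_of_continuousOn h2).isBounded.exists_norm_le
        refine ⟨C, fun x hx => ?_⟩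
        rw [← derivWithin_of_mem_nhds (Icc_mem_nhds hx.1 hx.2)]
        exact hC _ ⟨x, Ioo_subset_Icc_self hx, rfl⟩
      obtain ⟨C₁, hC₁⟩ := hpiece u (u + η) hu.1 (by linarith) fun x hx =>
        ⟨by rw [abs_of_pos] <;> linarith [hx.1, hx.2], hx.1.ne'⟩
      have h2 : ∃ C, ∀ x, 0 < x → u - η < x → x < u → ‖deriv δ.path x‖ ≤ C := by
        by_cases hu0 : u = 0
        · exact ⟨0, fun x hx _ hxu => absurd hx (by linarith)⟩
        · have hu' : 0 < u := lt_of_le_of_ne hu.1 (Ne.symm hu0)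
          obtain ⟨C, hC⟩ := hpiece (max 0 (u - η)) u (le_max_left _ _)
            (max_lt hu' (by linarith)) fun x hx => by
              have := (le_max_right _ _).trans_lt hx.1
              exact ⟨by rw [abs_of_neg] <;> linarith [hx.2], hx.2.ne⟩
          exact ⟨C, fun x h0 h1 h2 => hC x ⟨max_lt h0 h1, h2⟩⟩
      obtain ⟨C₂, hC₂⟩ := h2
      refine ⟨Metric.ball u η, mem_nhdsWithin_of_mem_nhds (Metric.ball_mem_nhds u hη),
        max (max C₁ C₂) ‖deriv δ.path u‖, fun x hx hx0 _ => ?_⟩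
      rw [Metric.mem_ball, Real.dist_eq, abs_lt] at hx
      rcases lt_trichotomy x u with h' | h' | h'
      · exact (hC₂ x hx0 (by linarith) h').trans ((le_max_right _ _).trans (le_max_left _ _))
      · rw [h']
        exact le_max_right _ _
      · exact (hC₁ x ⟨h', by linarith⟩).trans ((le_max_left _ _).trans (le_max_left _ _))
    obtain ⟨C, hC⟩ := isCompact_Icc.induction_on (s := Icc 0 M)
      (p := fun t => ∃ C, ∀ x ∈ t, 0 < x → x ∉ s → ‖deriv δ.path x‖ ≤ C)
      ⟨0, by simp⟩ (fun s t hst ⟨C, hC⟩ => ⟨C, fun x hx => hC x (hst hx)⟩)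
      (fun s t ⟨C, hC⟩ ⟨C', hC'⟩ => ⟨max C C', fun x hx h0 h1 => by
        rcases hx with hx | hx
        · exact (hC x hx h0 h1).trans (le_max_left _ _)
        · exact (hC' x hx h0 h1).trans (le_max_right _ _)⟩) hloc
    exact ⟨C, fun t h0 h1 h2 => hC t ⟨h0.le, h1.le⟩ h0 h2⟩

/-- Near u the bound comes from the nonzero one-sided velocities, away from u from injectivity and
compactness. It converts the singularity at a marked point into a power of |t - u|. -/
theorem LArcSystem.exists_lower_bound (M : ℝ) {u : ℝ} (hu : 0 ≤ u) :
    ∃ c > 0, ∀ t ∈ Icc 0 M, c * |t - u| ≤ ‖δ.path t - δ.path u‖ := by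
  obtain ⟨s, hs⟩ := δ.piecewiseRegular
  have hloc : ∃ c > 0, ∃ η > 0, ∀ t, 0 ≤ t → |t - u| < η →
      c * |t - u| ≤ ‖δ.path t - δ.path u‖ := by
    obtain ⟨η, hη, h⟩ := LArcSystem.exists_avoid s u
    have hpiece : ∀ a b, 0 ≤ a → a < b → u ∈ Icc a b → (∀ x ∈ Ioo a b, |x - u| < η ∧ x ≠ u) →
        ∃ c > 0, ∀ᶠ t in 𝓝[Icc a b] u, c * |t - u| ≤ ‖δ.path t - δ.path u‖ := by
      intro a b ha hab huab hx
      obtain ⟨h1, h2⟩ := hs a b ha hab (Set.disjoint_left.mpr fun x hx' =>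
        h x (hx x hx').1 (hx x hx').2)
      have h3 := ((h1.differentiableOn one_ne_zero) u huab).hasDerivWithinAt
      have hd : 0 < ‖derivWithin δ.path (Icc a b) u‖ := norm_pos_iff.mpr (h2 u huab)
      refine ⟨‖derivWithin δ.path (Icc a b) u‖ / 2, by positivity, ?_⟩
      have h4 := (hasDerivWithinAt_iff_isLittleO.mp h3).def (half_pos hd)
      filter_upwards [h4] with t ht
      have h5 : ‖(t - u) • derivWithin δ.path (Icc a b) u‖ =
          |t - u| * ‖derivWithin δ.path (Icc a b) u‖ := by rw [norm_smul, Real.norm_eq_abs]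
      have h6 := norm_sub_norm_le ((t - u) • derivWithin δ.path (Icc a b) u)
        ((t - u) • derivWithin δ.path (Icc a b) u - (δ.path t - δ.path u))
      rw [sub_sub_cancel, norm_sub_rev _ (δ.path t - δ.path u), h5] at h6
      rw [Real.norm_eq_abs] at ht
      linarith
    obtain ⟨c₁, hc₁, hr⟩ := hpiece u (u + η) hu (by linarith) ⟨le_rfl, by linarith⟩ fun x hx =>
      ⟨by rw [abs_of_pos] <;> linarith [hx.1, hx.2], hx.1.ne'⟩
    have hl : ∃ c > 0, ∀ᶠ t in 𝓝[Icc 0 u] u, c * |t - u| ≤ ‖δ.path t - δ.path u‖ := by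
      by_cases hu0 : u = 0
      · refine ⟨1, one_pos, eventually_nhdsWithin_of_forall fun t ht => ?_⟩
        have : t = u := le_antisymm ht.2 (hu0 ▸ ht.1)
        simp [this]
      · have hu' : 0 < u := lt_of_le_of_ne hu (Ne.symm hu0)
        have hm : max 0 (u - η) < u := max_lt hu' (by linarith)
        obtain ⟨c, hc, h⟩ := hpiece (max 0 (u - η)) u (le_max_left _ _) hm ⟨hm.le, le_rfl⟩
          fun x hx => by
            have := (le_max_right _ _).trans_lt hx.1
            exact ⟨by rw [abs_of_neg] <;> linarith [hx.2], hx.2.ne⟩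
        refine ⟨c, hc, ?_⟩
        rw [nhdsWithin_Icc_eq_nhdsLE hm] at h
        rwa [nhdsWithin_Icc_eq_nhdsLE hu']
    obtain ⟨c₂, hc₂, hl⟩ := hl
    obtain ⟨η₁, hη₁, h₁⟩ := Metric.mem_nhdsWithin_iff.mp hr
    obtain ⟨η₂, hη₂, h₂⟩ := Metric.mem_nhdsWithin_iff.mp hl
    refine ⟨min c₁ c₂, lt_min hc₁ hc₂, min η (min η₁ η₂), by positivity, fun t ht0 ht => ?_⟩
    have hta := lt_of_lt_of_le ht (min_le_left _ _)
    have htb := lt_of_lt_of_le ht ((min_le_right _ _).trans (min_le_left _ _))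
    have htc := lt_of_lt_of_le ht ((min_le_right _ _).trans (min_le_right _ _))
    rcases le_total u t with h' | h'
    · have h3 := h₁ ⟨show t ∈ Metric.ball u η₁ by rwa [Metric.mem_ball, Real.dist_eq],
        ⟨h', by linarith [(abs_lt.mp hta).2]⟩⟩
      exact (mul_le_mul_of_nonneg_right (min_le_left _ _) (abs_nonneg _)).trans h3
    · have h3 := h₂ ⟨show t ∈ Metric.ball u η₂ by rwa [Metric.mem_ball, Real.dist_eq],
        ⟨ht0, h'⟩⟩
      exact (mul_le_mul_of_nonneg_right (min_le_right _ _) (abs_nonneg _)).trans h3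
  obtain ⟨c, hc, η, hη, hloc⟩ := hloc
  set K : Set ℝ := Icc 0 M ∩ {t | η ≤ |t - u|} with hK
  have hKc : IsCompact K := isCompact_Icc.inter_right
    (isClosed_le continuous_const (by fun_prop))
  have hcont : ContinuousOn (fun t => ‖δ.path t - δ.path u‖ / |t - u|) K := by
    refine ContinuousOn.div ?_ (by fun_prop) fun t ht => (hη.trans_le ht.2).ne'
    exact ((δ.continuousOn.mono fun t ht => ht.1.1).sub continuousOn_const).norm
  obtain ⟨c', hc', hc'K⟩ : ∃ c' > 0, ∀ t ∈ K, c' ≤ ‖δ.path t - δ.path u‖ / |t - u| := by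
    rcases K.eq_empty_or_nonempty with he | hne
    · exact ⟨1, one_pos, by simp [he]⟩
    · obtain ⟨t₀, ht₀, hmin⟩ := hKc.exists_isMinOn hne hcont
      refine ⟨_, ?_, fun t ht => hmin ht⟩
      have hpos : 0 < |t₀ - u| := hη.trans_le ht₀.2
      refine div_pos (norm_pos_iff.mpr (sub_ne_zero.mpr fun h => ?_)) hpos
      rw [δ.injOn ht₀.1.1 hu h] at hpos
      simp at hpos
  refine ⟨min c c', lt_min hc hc', fun t ht => ?_⟩
  by_cases hta : |t - u| < η
  · exact (mul_le_mul_of_nonneg_right (min_le_left _ _) (abs_nonneg _)).trans (hloc t ht.1 hta)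
  · push Not at hta
    have h3 := hc'K t ⟨ht, hta⟩
    rw [le_div_iff₀ (hη.trans_le hta)] at h3
    exact (mul_le_mul_of_nonneg_right (min_le_right _ _) (abs_nonneg _)).trans h3

/-- The logarithms that enter the integrand on the arc with index `k`. -/
def arcLog (k : Fin n) (j : Fin (n + 1)) (t : ℝ) : ℂ :=
  if j ≤ k.castSucc then δ.chordLog (((j : ℕ) : ℝ), t) else δ.chordLog (t, ((j : ℕ) : ℝ))

/-- The sign of `ζ - z_j` in the integrand. -/
def arcSign (k : Fin n) (j : Fin (n + 1)) : ℂ := if j ≤ k.castSucc then 1 else -1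

theorem arcSign_ne_zero (k : Fin n) (j : Fin (n + 1)) : arcSign k j ≠ 0 := by
  unfold arcSign
  split_ifs <;> simp

theorem integrand_eq (μ : Fin (n + 1) → ℝ) (k : Fin n) (t : ℝ) :
    integrand μ δ k t = Complex.exp (-∑ j, (μ j : ℂ) * arcLog δ k j t) := rfl

theorem cast_le_of_le {k : Fin n} {j : Fin (n + 1)} (h : j ≤ k.castSucc) :
    ((j : ℕ) : ℝ) ≤ ((k : ℕ) : ℝ) := by
  exact_mod_cast (Fin.le_def.mp h)

theorem le_cast_of_not_le {k : Fin n} {j : Fin (n + 1)} (h : ¬ j ≤ k.castSucc) :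
    ((k : ℕ) : ℝ) + 1 ≤ ((j : ℕ) : ℝ) := by
  have : (k : ℕ) + 1 ≤ (j : ℕ) := by
    have := Fin.lt_def.mp (not_le.mp h)
    simpa using this
  exact_mod_cast this

theorem cast_lt_of_ne {k : Fin n} {j : Fin (n + 1)} (h : j ≤ k.castSucc) (hne : j ≠ k.castSucc) :
    ((j : ℕ) : ℝ) < ((k : ℕ) : ℝ) := by
  exact_mod_cast (Fin.lt_def.mp (lt_of_le_of_ne h hne))

theorem lt_cast_of_ne {k : Fin n} {j : Fin (n + 1)} (h : ¬ j ≤ k.castSucc) (hne : j ≠ k.succ) :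
    ((k : ℕ) : ℝ) + 1 < ((j : ℕ) : ℝ) := by
  have h1 : (k : ℕ) < (j : ℕ) := by simpa using Fin.lt_def.mp (not_le.mp h)
  have h2 : (j : ℕ) ≠ (k : ℕ) + 1 := fun h => hne (Fin.ext (by simpa using h))
  have : (k : ℕ) + 1 < (j : ℕ) := by omega
  exact_mod_cast this

/-- The parameters at which the logarithm `arcLog δ k j` is defined. -/
def arcLogDomain (k : Fin n) (j : Fin (n + 1)) : Set ℝ :=
  if j ≤ k.castSucc then Ioi ((j : ℕ) : ℝ) else Ico 0 ((j : ℕ) : ℝ)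

theorem Ioo_subset_arcLogDomain (k : Fin n) (j : Fin (n + 1)) :
    Ioo ((k : ℕ) : ℝ) ((k : ℕ) + 1) ⊆ arcLogDomain k j := by
  intro t ht
  unfold arcLogDomain
  split_ifs with h
  · exact (cast_le_of_le h).trans_lt ht.1
  · exact ⟨(Nat.cast_nonneg _).trans ht.1.le, ht.2.trans_le (le_cast_of_not_le h)⟩

theorem Ico_subset_arcLogDomain {k : Fin n} {j : Fin (n + 1)} (hj : j ≠ k.castSucc) :
    Ico ((k : ℕ) : ℝ) ((k : ℕ) + 1) ⊆ arcLogDomain k j := by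
  intro t ht
  unfold arcLogDomain
  split_ifs with h
  · exact (cast_lt_of_ne h hj).trans_le ht.1
  · exact ⟨(Nat.cast_nonneg _).trans ht.1, ht.2.trans_le (le_cast_of_not_le h)⟩

theorem Ioc_subset_arcLogDomain {k : Fin n} {j : Fin (n + 1)} (hj : j ≠ k.succ) :
    Ioc ((k : ℕ) : ℝ) ((k : ℕ) + 1) ⊆ arcLogDomain k j := by
  intro t ht
  unfold arcLogDomain
  split_ifs with h
  · exact (cast_le_of_le h).trans_lt ht.1
  · exact ⟨(Nat.cast_nonneg _).trans ht.1.le, ht.2.trans_lt (lt_cast_of_ne h hj)⟩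

theorem IsFamily.continuousOn_arcLog {X : Type*} [TopologicalSpace X] {N : Set X}
    {δ : X → LArcSystem n} (h : IsFamily N δ) (k : Fin n) (j : Fin (n + 1)) :
    ContinuousOn (fun y : X × ℝ => arcLog (δ y.1) k j y.2) (N ×ˢ arcLogDomain k j) := by
  unfold arcLog arcLogDomain
  split_ifs with hj
  · exact h.2.comp (f := fun y : X × ℝ => (y.1, ((j : ℕ) : ℝ), y.2)) (by fun_prop)
      fun y hy => ⟨hy.1, Nat.cast_nonneg _, hy.2⟩
  · exact h.2.comp (f := fun y : X × ℝ => (y.1, y.2, ((j : ℕ) : ℝ))) (by fun_prop)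
      fun y hy => ⟨hy.1, hy.2.1, hy.2.2⟩

theorem isFamily_const {X : Type*} [TopologicalSpace X] (N : Set X) :
    IsFamily N (fun _ : X => δ) :=
  ⟨δ.continuousOn.comp (f := fun x : X × ℝ => x.2) continuousOn_snd fun _ hx => hx.2,
    δ.chordLog_spec.1.comp (f := fun x : X × (ℝ × ℝ) => x.2) continuousOn_snd fun _ hx => hx.2⟩

theorem continuousOn_arcLog (k : Fin n) (j : Fin (n + 1)) :
    ContinuousOn (arcLog δ k j) (arcLogDomain k j) :=
  ((isFamily_const δ (univ : Set Unit)).continuousOn_arcLog k j).comp (f := fun t => ((), t))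
    (by fun_prop) fun _ ht => ⟨mem_univ _, ht⟩

theorem exp_arcLog {k : Fin n} {j : Fin (n + 1)} {t : ℝ} (ht : t ∈ arcLogDomain k j) :
    Complex.exp (arcLog δ k j t) = arcSign k j * (δ.path t - δ.points j) := by
  unfold arcLogDomain at ht
  unfold arcLog arcSign LArcSystem.points
  split_ifs at ht ⊢ with h
  · rw [δ.chordLog_spec.2.1 (((j : ℕ) : ℝ), t) ⟨Nat.cast_nonneg _, ht⟩]
    ring
  · rw [δ.chordLog_spec.2.1 (t, ((j : ℕ) : ℝ)) ⟨ht.1, ht.2⟩]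
    ring

theorem points_castSucc (k : Fin n) : δ.points k.castSucc = δ.path ((k : ℕ) : ℝ) := rfl

theorem points_succ (k : Fin n) : δ.points k.succ = δ.path (((k : ℕ) : ℝ) + 1) := by
  simp [LArcSystem.points]

theorem arc_Icc_subset (k : Fin n) : Icc ((k : ℕ) : ℝ) ((k : ℕ) + 1) ⊆ Ici 0 := fun _ ht =>
  (Nat.cast_nonneg _).trans ht.1

theorem isLogPath_arc {s : Finset ℝ}
    (hs : ∀ t, 0 < t → t ∉ s → HasDerivAt δ.path (deriv δ.path t) t) (k : Fin n) :
    IsLogPath δ.points (arcSign k) k.castSucc k.succ ((k : ℕ) : ℝ) ((k : ℕ) + 1) s δ.path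
      (deriv δ.path) (arcLog δ k) where
  cont := δ.continuousOn.mono (arc_Icc_subset k)
  left := rfl
  right := (points_succ δ k).symm
  deriv := fun t ht => hs t ((Nat.cast_nonneg _).trans_lt ht.1.1) ht.2
  log_cont := fun j => (continuousOn_arcLog δ k j).mono (Ioo_subset_arcLogDomain k j)
  log_cont_left := fun j hj => (continuousOn_arcLog δ k j).mono (Ico_subset_arcLogDomain hj)
  log_cont_right := fun j hj => (continuousOn_arcLog δ k j).mono (Ioc_subset_arcLogDomain hj)
  exp_log := fun j t ht => exp_arcLog δ (Ioo_subset_arcLogDomain k j ht)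
  exp_log_left := fun j hj => exp_arcLog δ (Ico_subset_arcLogDomain hj ⟨le_rfl, by linarith⟩)
  exp_log_right := fun j hj => exp_arcLog δ (Ioc_subset_arcLogDomain hj ⟨by linarith, le_rfl⟩)

theorem norm_integrand (μ : Fin (n + 1) → ℝ) {k : Fin n} {t : ℝ}
    (ht : t ∈ Ioo ((k : ℕ) : ℝ) ((k : ℕ) + 1)) :
    ‖integrand μ δ k t‖ = ∏ j, ‖δ.path t - δ.points j‖ ^ (-μ j) := by
  rw [integrand_eq, Complex.norm_exp, Complex.neg_re, Complex.re_sum, ← Finset.sum_neg_distrib,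
    Real.exp_sum]
  refine Finset.prod_congr rfl fun j _ => ?_
  have h1 : ‖δ.path t - δ.points j‖ = Real.exp (arcLog δ k j t).re := by
    rw [← Complex.norm_exp, exp_arcLog δ (Ioo_subset_arcLogDomain k j ht), norm_mul]
    have : ‖arcSign k j‖ = 1 := by
      unfold arcSign
      split_ifs <;> simp
    rw [this, one_mul]
  rw [h1, ← Real.exp_mul, Complex.re_ofReal_mul]
  congr 1
  ring

theorem continuousOn_integrand (μ : Fin (n + 1) → ℝ) (k : Fin n) :
    ContinuousOn (integrand μ δ k) (Ioo ((k : ℕ) : ℝ) ((k : ℕ) + 1)) := by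
  refine Complex.continuous_exp.comp_continuousOn (ContinuousOn.neg ?_)
  exact continuousOn_finsetSum _ fun j _ => continuousOn_const.mul
    ((continuousOn_arcLog δ k j).mono (Ioo_subset_arcLogDomain k j))

/-- By the linear lower bounds at the marked parameters the integrand is dominated by a product of
powers |t - j|^(-μ_j), and the velocity is bounded. -/
theorem intervalIntegrable_integrand {μ : Fin (n + 1) → ℝ} (hμ : ∀ j, 0 < μ j ∧ μ j < 1)
    (k : Fin n) : IntervalIntegrable (fun t => integrand μ δ k t * deriv δ.path t) volume
      ((k : ℕ) : ℝ) ((k : ℕ) + 1) := by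
  obtain ⟨s, hs, hb⟩ := δ.exists_finset
  obtain ⟨C, hC⟩ := hb ((k : ℕ) + 1)
  have hlow := fun j : Fin (n + 1) => δ.exists_lower_bound ((k : ℕ) + 1)
    (u := ((j : ℕ) : ℝ)) (Nat.cast_nonneg _)
  choose c hc hcl using hlow
  have hinj : Function.Injective fun j : Fin (n + 1) => ((j : ℕ) : ℝ) := fun i j hij => by
    simpa [Fin.ext_iff] using hij
  have hle : ((k : ℕ) : ℝ) ≤ (k : ℕ) + 1 := by linarith
  have hint := ((intervalIntegrable_prod_abs_sub_rpow hμ hinj ((k : ℕ) : ℝ)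
    ((k : ℕ) + 1)).const_mul ((∏ j, c j ^ (-μ j)))).mul_const C
  rw [intervalIntegrable_iff_integrableOn_Ioo_of_le hle] at hint ⊢
  refine Integrable.mono' hint ?_ ?_
  · exact ((continuousOn_integrand δ μ k).aestronglyMeasurable measurableSet_Ioo).mul
      (measurable_deriv _).aestronglyMeasurable
  · have h1 : ∀ᵐ t ∂(volume.restrict (Ioo ((k : ℕ) : ℝ) ((k : ℕ) + 1))), t ∉ (s : Set ℝ) :=
      ae_restrict_of_ae (measure_eq_zero_iff_ae_notMem.mp
        (s.countable_toSet.measure_zero volume))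
    filter_upwards [h1, ae_restrict_mem measurableSet_Ioo] with t hts ht
    have ht0 : 0 < t := (Nat.cast_nonneg _).trans_lt ht.1
    rw [norm_mul, norm_integrand δ μ ht, ← Finset.prod_mul_distrib]
    refine mul_le_mul ?_ (hC t ht0 ht.2 hts) (norm_nonneg _) ?_
    · refine Finset.prod_le_prod (fun j _ => Real.rpow_nonneg (norm_nonneg _) _) fun j _ => ?_
      rw [← Real.mul_rpow (hc j).le (abs_nonneg _)]
      have hne : t ≠ ((j : ℕ) : ℝ) := by
        intro h
        have h2 := exp_arcLog δ (Ioo_subset_arcLogDomain k j ht)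
        rw [h] at h2
        exact Complex.exp_ne_zero _ (h2.trans (by simp [LArcSystem.points]))
      refine Real.rpow_le_rpow_of_nonpos
        (mul_pos (hc j) (abs_pos.mpr (sub_ne_zero.mpr hne))) ?_ (by linarith [(hμ j).1])
      exact hcl j t ⟨ht0.le, ht.2.le⟩
    · exact Finset.prod_nonneg fun j _ => mul_nonneg (Real.rpow_nonneg (hc j).le _)
        (Real.rpow_nonneg (abs_nonneg _) _)

end Arc

/-! ### Deforming the integrals by interpolation polynomials -/

section Deform

open Polynomial

variable {n : ℕ}

/-- The interpolation polynomial with values `v j` at the points `z j`. -/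
def interp (z v : Fin (n + 1) → ℂ) : ℂ[X] := Lagrange.interpolate Finset.univ z v

/-- The divided difference `(interp z v - v j) / (X - z j)`. -/
def divDiff (z : Fin (n + 1) → ℂ) (j : Fin (n + 1)) (v : Fin (n + 1) → ℂ) : ℂ[X] :=
  ∑ i, C (v i) * (Lagrange.basis Finset.univ z i /ₘ (X - C (z j)))

theorem interp_eq_sum (z v : Fin (n + 1) → ℂ) :
    interp z v = ∑ i, C (v i) * Lagrange.basis Finset.univ z i := Lagrange.interpolate_apply _ _ _

theorem eval_interp {z : Fin (n + 1) → ℂ} (hz : Function.Injective z) (v : Fin (n + 1) → ℂ)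
    (j : Fin (n + 1)) : (interp z v).eval (z j) = v j :=
  Lagrange.eval_interpolate_at_node v hz.injOn (Finset.mem_univ j)

/-- With q the interpolation polynomial, this identity turns ζ + q(ζ) - (z_j + v_j) into (ζ - z_j)(1
+ `divDiff`). The deformed logarithm is thus the old one plus a principal logarithm near 1, also at
the marked points. -/
theorem X_sub_C_mul_divDiff {z : Fin (n + 1) → ℂ} (hz : Function.Injective z)
    (v : Fin (n + 1) → ℂ) (j : Fin (n + 1)) :
    (X - C (z j)) * divDiff z j v = interp z v - C (v j) := by
  have h1 : ∀ i, (X - C (z j)) * (C (v i) * (Lagrange.basis Finset.univ z i /ₘ (X - C (z j)))) =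
      C (v i) * Lagrange.basis Finset.univ z i -
        C (v i) * C ((Lagrange.basis Finset.univ z i).eval (z j)) := by
    intro i
    have h2 := modByMonic_add_div (Lagrange.basis Finset.univ z i) (X - C (z j))
    rw [modByMonic_X_sub_C_eq_C_eval] at h2
    linear_combination C (v i) * h2
  rw [divDiff, Finset.mul_sum, Finset.sum_congr rfl fun i _ => h1 i, Finset.sum_sub_distrib,
    ← interp_eq_sum]
  congr 1
  rw [← eval_interp hz v j, interp_eq_sum, eval_finsetSum, map_sum]
  exact Finset.sum_congr rfl fun i _ => by rw [eval_mul, eval_C, C_mul]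

theorem sub_mul_eval_divDiff {z : Fin (n + 1) → ℂ} (hz : Function.Injective z)
    (v : Fin (n + 1) → ℂ) (j : Fin (n + 1)) (ζ : ℂ) :
    (ζ - z j) * (divDiff z j v).eval ζ = (interp z v).eval ζ - v j := by
  have := congrArg (eval ζ) (X_sub_C_mul_divDiff hz v j)
  simpa using this

theorem contDiff_sum_eval {ι E : Type*} [Fintype ι] [NormedAddCommGroup E] [NormedSpace ℂ E]
    (p : ι → ℂ[X]) {v : E → ι → ℂ} (hv : ContDiff ℂ 1 v) {f : E → ℂ} (hf : ContDiff ℂ 1 f) :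
    ContDiff ℂ 1 fun y => (∑ i, C (v y i) * p i).eval (f y) := by
  simp only [eval_finsetSum, eval_mul, eval_C]
  refine ContDiff.sum fun i _ => ContDiff.mul (contDiff_pi.mp hv i) ?_
  have := ((p i).contDiff_aeval (𝕜 := ℂ) 1).comp hf
  simpa [Function.comp_def, coe_aeval_eq_eval] using this

theorem contDiff_eval_interp (z : Fin (n + 1) → ℂ) :
    ContDiff ℂ 1 fun y : (Fin (n + 1) → ℂ) × ℂ => (interp z y.1).eval y.2 := by
  simp only [interp_eq_sum]
  exact contDiff_sum_eval _ contDiff_fst contDiff_snd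

theorem contDiff_eval_derivative_interp (z : Fin (n + 1) → ℂ) :
    ContDiff ℂ 1 fun y : (Fin (n + 1) → ℂ) × ℂ => (derivative (interp z y.1)).eval y.2 := by
  simp only [interp_eq_sum, derivative_sum, derivative_C_mul]
  exact contDiff_sum_eval _ contDiff_fst contDiff_snd

theorem contDiff_eval_divDiff (z : Fin (n + 1) → ℂ) (j : Fin (n + 1)) :
    ContDiff ℂ 1 fun y : (Fin (n + 1) → ℂ) × ℂ => (divDiff z j y.1).eval y.2 :=
  contDiff_sum_eval _ contDiff_fst contDiff_snd

theorem interp_zero (z : Fin (n + 1) → ℂ) : interp z 0 = 0 := by simp [interp]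

theorem divDiff_zero (z : Fin (n + 1) → ℂ) (j : Fin (n + 1)) : divDiff z j 0 = 0 := by
  simp [divDiff]

/-- Both polynomials vanish for v = 0 and depend continuously on (v, ζ); compactness of the disc
makes the smallness uniform in ζ. -/
theorem eventually_small (z : Fin (n + 1) → ℂ) (R : ℝ) {η : ℝ} (hη : 0 < η) :
    ∀ᶠ v in 𝓝 (0 : Fin (n + 1) → ℂ), ∀ ζ ∈ Metric.closedBall (0:ℂ) R,
      (∀ j, ‖(divDiff z j v).eval ζ‖ < η) ∧ ‖(interp z v).eval ζ‖ < η := by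
  refine (isCompact_closedBall _ _).eventually_forall_of_forall_eventually fun ζ _ => ?_
  refine Eventually.and (eventually_all.mpr fun j => ?_) ?_
  · have h := (contDiff_eval_divDiff z j).continuous.norm.tendsto ((0 : Fin (n + 1) → ℂ), ζ)
    refine h.eventually (gt_mem_nhds ?_)
    simpa [divDiff_zero] using hη
  · have h := (contDiff_eval_interp z).continuous.norm.tendsto ((0 : Fin (n + 1) → ℂ), ζ)
    refine h.eventually (gt_mem_nhds ?_)
    simpa [interp_zero] using hη

/-- The factor by which `∏ (ζ - z_j)^{-μ_j} dζ` changes under `ζ ↦ ζ + interp z v ζ`. -/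
def deformFactor (μ : Fin (n + 1) → ℝ) (z v : Fin (n + 1) → ℂ) (ζ : ℂ) : ℂ :=
  (1 + (derivative (interp z v)).eval ζ) *
    Complex.exp (-∑ j, (μ j : ℂ) * Complex.log (1 + (divDiff z j v).eval ζ))

theorem contDiffAt_deformFactor (μ : Fin (n + 1) → ℝ) (z : Fin (n + 1) → ℂ)
    {y : (Fin (n + 1) → ℂ) × ℂ} (hy : ∀ j, ‖(divDiff z j y.1).eval y.2‖ < 1) :
    ContDiffAt ℂ 1 (fun y : (Fin (n + 1) → ℂ) × ℂ => deformFactor μ z y.1 y.2) y := by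
  refine ContDiffAt.mul (contDiffAt_const.add (contDiff_eval_derivative_interp z).contDiffAt) ?_
  refine ContDiffAt.cexp (ContDiffAt.neg (ContDiffAt.sum fun j _ => contDiffAt_const.mul ?_))
  exact ContDiffAt.comp y (g := Complex.log)
    (Complex.contDiffAt_log (one_add_mem_slitPlane (hy j)))
    (contDiffAt_const.add (contDiff_eval_divDiff z j).contDiffAt)

theorem continuousOn_deformFactor (μ : Fin (n + 1) → ℝ) (z v : Fin (n + 1) → ℂ) {K : Set ℂ}
    (hK : ∀ ζ ∈ K, ∀ j, ‖(divDiff z j v).eval ζ‖ < 1) : ContinuousOn (deformFactor μ z v) K := by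
  intro ζ hζ
  have h := (contDiffAt_deformFactor μ z (y := (v, ζ)) (hK ζ hζ)).continuousAt
  exact (ContinuousAt.comp (f := fun ζ => (v, ζ)) h (by fun_prop)).continuousWithinAt

theorem norm_log_one_add_lt_one {w : ℂ} (h : ‖w‖ < 1 / 2) : ‖Complex.log (1 + w)‖ < 1 := by
  have := Complex.norm_log_one_add_half_le_self h.le
  linarith

end Deform

/-! ### Nearby arc systems have the integrals of the polynomially deformed arc. -/

section Compare

variable {n : ℕ}

theorem pathIntegrand_deform {μ : Fin (n + 1) → ℝ} (δ : LArcSystem n) (φ : ℂ → ℂ) (k : Fin n)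
    (v : Fin (n + 1) → ℂ) (t : ℝ) :
    pathIntegrand μ φ (fun t => δ.path t + (interp δ.points v).eval (δ.path t))
      (fun t => (1 + (Polynomial.derivative (interp δ.points v)).eval (δ.path t)) *
        deriv δ.path t)
      (fun j t => arcLog δ k j t + Complex.log (1 + (divDiff δ.points j v).eval (δ.path t))) t =
    φ (δ.path t + (interp δ.points v).eval (δ.path t)) * deformFactor μ δ.points v (δ.path t) *
      (integrand μ δ k t * deriv δ.path t) := by
  simp only [pathIntegrand, deformFactor, integrand_eq, mul_add, Finset.sum_add_distrib, neg_add,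
    Complex.exp_add]
  ring

/-- The deformed arc need not be simple, so it is not presented as an arc system; only its end
points and the logarithms along it matter for the comparison. -/
theorem isLogPath_deform (δ : LArcSystem n) {s : Finset ℝ}
    (hs : ∀ t, 0 < t → t ∉ s → HasDerivAt δ.path (deriv δ.path t) t) (k : Fin n)
    {v : Fin (n + 1) → ℂ}
    (hv : ∀ t ∈ Icc ((k : ℕ) : ℝ) ((k : ℕ) + 1), ∀ j, ‖(divDiff δ.points j v).eval (δ.path t)‖ < 1) :
    IsLogPath (δ.points + v) (arcSign k) k.castSucc k.succ ((k : ℕ) : ℝ) ((k : ℕ) + 1) s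
      (fun t => δ.path t + (interp δ.points v).eval (δ.path t))
      (fun t => (1 + (Polynomial.derivative (interp δ.points v)).eval (δ.path t)) *
        deriv δ.path t)
      (fun j t => arcLog δ k j t + Complex.log (1 + (divDiff δ.points j v).eval (δ.path t))) := by
  have hp := isLogPath_arc δ hs k
  have hz := δ.points_injective
  have hlogc : ∀ j, ContinuousOn
      (fun t => Complex.log (1 + (divDiff δ.points j v).eval (δ.path t)))
      (Icc ((k : ℕ) : ℝ) ((k : ℕ) + 1)) := fun j =>
    ContinuousOn.clog (continuousOn_const.add
      ((divDiff δ.points j v).continuous.comp_continuousOn hp.cont))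
      fun t ht => one_add_mem_slitPlane (hv t ht j)
  have hexp : ∀ j, ∀ t ∈ Icc ((k : ℕ) : ℝ) ((k : ℕ) + 1), t ∈ arcLogDomain k j →
      Complex.exp (arcLog δ k j t + Complex.log (1 + (divDiff δ.points j v).eval (δ.path t))) =
      arcSign k j * (δ.path t + (interp δ.points v).eval (δ.path t) - (δ.points + v) j) := by
    intro j t ht htd
    rw [Complex.exp_add, exp_arcLog δ htd, Complex.exp_log
      (Complex.slitPlane_ne_zero (one_add_mem_slitPlane (hv t ht j))), Pi.add_apply]
    linear_combination arcSign k j * sub_mul_eval_divDiff hz v j (δ.path t)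
  have hk : ((k : ℕ) : ℝ) ≤ (k : ℕ) + 1 := by linarith
  refine ⟨?_, ?_, ?_, ?_, fun j => ?_, fun j hj => ?_, fun j hj => ?_, fun j t ht => ?_,
    fun j hj => ?_, fun j hj => ?_⟩
  · exact hp.cont.add ((interp δ.points v).continuous.comp_continuousOn hp.cont)
  · rw [hp.left, eval_interp hz]
    rfl
  · rw [hp.right, eval_interp hz]
    rfl
  · intro t ht
    have h1 := hp.deriv t ht
    have h2 := ((interp δ.points v).hasDerivAt (δ.path t)).comp t h1
    refine (h1.add h2).congr_deriv ?_
    ring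
  · exact (hp.log_cont j).add ((hlogc j).mono Ioo_subset_Icc_self)
  · exact (hp.log_cont_left j hj).add ((hlogc j).mono Ico_subset_Icc_self)
  · exact (hp.log_cont_right j hj).add ((hlogc j).mono Ioc_subset_Icc_self)
  · exact hexp j t (Ioo_subset_Icc_self ht) (Ioo_subset_arcLogDomain k j ht)
  · exact hexp j _ (left_mem_Icc.mpr hk) (Ico_subset_arcLogDomain hj ⟨le_rfl, by linarith⟩)
  · exact hexp j _ (right_mem_Icc.mpr hk) (Ioc_subset_arcLogDomain hj ⟨by linarith, le_rfl⟩)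

theorem exists_pos_lower_bound {f : ℝ → ℂ} {a b : ℝ} (hab : a ≤ b) (hf : ContinuousOn f (Icc a b))
    (h0 : ∀ t ∈ Icc a b, f t ≠ 0) : ∃ m > 0, ∀ t ∈ Icc a b, m ≤ ‖f t‖ := by
  obtain ⟨t₀, ht₀, hmin⟩ := isCompact_Icc.exists_isMinOn (nonempty_Icc.mpr hab) hf.norm
  exact ⟨_, norm_pos_iff.mpr (h0 t₀ ht₀), fun t ht => hmin ht⟩

theorem eventually_uniformly_close {X : Type*} [TopologicalSpace X] {N : Set X} {x₀ : X}
    (hx₀ : x₀ ∈ N) {f : X → ℝ → ℂ} {K : Set ℝ} (hK : IsCompact K)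
    (hf : ContinuousOn (fun y : X × ℝ => f y.1 y.2) (N ×ˢ K)) {η : ℝ} (hη : 0 < η) :
    ∀ᶠ x in 𝓝[N] x₀, ∀ t ∈ K, ‖f x t - f x₀ t‖ < η := by
  obtain ⟨u, hu, h⟩ := hK.mem_uniformity_of_prod (f := f) hf hx₀ (Metric.dist_mem_uniformity hη)
  filter_upwards [hu] with x hx t ht
  have := h x hx t ht
  rwa [mem_ofPred_eq, dist_eq_norm] at this

theorem IsFamily.continuousOn_points {X : Type*} [TopologicalSpace X] {N : Set X}
    {δ : X → LArcSystem n} (h : IsFamily N δ) : ContinuousOn (fun x => (δ x).points) N :=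
  continuousOn_pi.mpr fun i => h.1.comp (f := fun x => (x, ((i : ℕ) : ℝ))) (by fun_prop)
    fun _ hx => ⟨hx, mem_Ici.mpr (Nat.cast_nonneg _)⟩

/-- For x near x₀ the arc of x and the image of the arc of x₀ under ζ ↦ ζ + q(ζ) have the same end
points and are uniformly close, as are their logarithms, so `integral_eq_of_close` applies. The
neighbourhood of x₀ is independent of φ, which is needed when relations for all polynomials are
propagated. -/
theorem IsFamily.eventually_integral_eq_aux {X : Type*} [TopologicalSpace X] {N : Set X}
    {δ : X → LArcSystem n} (h : IsFamily N δ) {x₀ : X} (hx₀ : x₀ ∈ N) {μ : Fin (n + 1) → ℝ}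
    (hμ : ∀ j, 0 < μ j ∧ μ j < 1) (k : Fin n) :
    ∀ᶠ x in 𝓝[N] x₀, ∀ φ : ℂ → ℂ, Differentiable ℂ φ →
      ∫ t in ((k : ℕ) : ℝ)..((k : ℕ) + 1 : ℝ),
        φ ((δ x).path t) * (integrand μ (δ x) k t * deriv (δ x).path t) =
      ∫ t in ((k : ℕ) : ℝ)..((k : ℕ) + 1 : ℝ),
        φ ((δ x₀).path t + (interp (δ x₀).points ((δ x).points - (δ x₀).points)).eval
          ((δ x₀).path t)) *
        deformFactor μ (δ x₀).points ((δ x).points - (δ x₀).points) ((δ x₀).path t) *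
        (integrand μ (δ x₀) k t * deriv (δ x₀).path t) := by
  set p := (δ x₀).path with hp
  set z := (δ x₀).points with hz
  obtain ⟨s₀, hs₀, -⟩ := (δ x₀).exists_finset
  have hpath := isLogPath_arc (δ x₀) hs₀ k
  have hkk : ((k : ℕ) : ℝ) < (k : ℕ) + 1 := by linarith
  obtain ⟨R, hR⟩ := (isCompact_Icc.image_of_continuousOn hpath.cont).isBounded.exists_norm_le
  have hR' : ∀ t ∈ Icc ((k : ℕ) : ℝ) ((k : ℕ) + 1), p t ∈ Metric.closedBall (0:ℂ) R :=
    fun t ht => mem_closedBall_zero_iff.mpr (hR _ ⟨t, ht, rfl⟩)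
  obtain ⟨r, hr, -, hrz⟩ := exists_separation (δ x₀).points_injective
  simp only [dist_eq_norm] at hrz
  obtain ⟨α, hα, hαp⟩ : ∃ α : ℝ, (((k : ℕ) : ℝ) < α ∧ α < (k : ℕ) + 1 / 2) ∧
      ∀ t ∈ Icc ((k : ℕ) : ℝ) α, ‖p t - z k.castSucc‖ < r / 4 := by
    have h1 := hpath.cont _ (left_mem_Icc.mpr hkk.le)
    obtain ⟨η, hη, h2⟩ := Metric.continuousWithinAt_iff.mp h1 (r / 4) (by positivity)
    refine ⟨(k : ℕ) + min (η / 2) (1 / 4), ⟨by linarith [show 0 < min (η / 2) (1 / 4) by positivity],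
      by linarith [min_le_right (η / 2) (1 / 4)]⟩, fun t ht => ?_⟩
    have h3 := h2 (x := t) ⟨ht.1, by linarith [ht.2, min_le_right (η / 2) (1 / 4)]⟩ (by
      rw [Real.dist_eq, abs_of_nonneg (by linarith [ht.1])]
      linarith [ht.2, min_le_left (η / 2) (1 / 4)])
    rw [dist_eq_norm] at h3
    exact h3
  obtain ⟨β, hβ, hβp⟩ : ∃ β : ℝ, ((k : ℕ) + 1 / 2 < β ∧ β < ((k : ℕ) : ℝ) + 1) ∧
      ∀ t ∈ Icc β (((k : ℕ) : ℝ) + 1), ‖p t - z k.succ‖ < r / 4 := by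
    have h1 := hpath.cont _ (right_mem_Icc.mpr hkk.le)
    obtain ⟨η, hη, h2⟩ := Metric.continuousWithinAt_iff.mp h1 (r / 4) (by positivity)
    refine ⟨(k : ℕ) + 1 - min (η / 2) (1 / 4), ⟨by linarith [min_le_right (η / 2) (1 / 4)],
      by linarith [show 0 < min (η / 2) (1 / 4) by positivity]⟩, fun t ht => ?_⟩
    have h3 := h2 (x := t) ⟨by linarith [ht.1, min_le_right (η / 2) (1 / 4)], ht.2⟩ (by
      rw [Real.dist_eq, abs_of_nonpos (by linarith [ht.2])]
      linarith [ht.1, min_le_left (η / 2) (1 / 4)])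
    rw [dist_eq_norm] at h3
    rw [hz, points_succ]
    exact h3
  have hαβ : α ≤ β := by linarith [hα.2, hβ.1]
  have hmid : Icc α β ⊆ Ioo ((k : ℕ) : ℝ) ((k : ℕ) + 1) := Icc_subset_Ioo hα.1 hβ.2
  obtain ⟨m, hm, hmz⟩ : ∃ m > 0, ∀ j, ∀ t ∈ Icc α β, m ≤ ‖p t - z j‖ := by
    have h1 := fun j => exists_pos_lower_bound (f := fun t => p t - z j) hαβ
      ((hpath.cont.mono (hmid.trans Ioo_subset_Icc_self)).sub continuousOn_const)
      fun t ht => norm_pos_iff.mp (norm_sub_pos_of_exp (hpath.exp_log j t (hmid ht)))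
    choose m hm hmz using h1
    obtain ⟨j₀, hj₀⟩ := Finite.exists_min m
    exact ⟨m j₀, hm j₀, fun j t ht => (hj₀ j).trans (hmz j t ht)⟩
  -- With this bound three errors of size at most r/4 stay below r near the ends. On the middle
  -- piece the two paths are less than m/4 apart, while their distance to the displaced points
  -- remains at least 3m/4.
  set η := min (r / 4) (m / 8) with hη
  have hη0 : 0 < η := by positivity
  have hηr : η ≤ r / 4 := min_le_left _ _
  have hηm : η ≤ m / 8 := min_le_right _ _
  have hv0 : Tendsto (fun x => (δ x).points - z) (𝓝[N] x₀) (𝓝 0) := by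
    have := (h.continuousOn_points x₀ hx₀).sub_const z
    simpa [ContinuousWithinAt, ← hz] using this
  have E1 := eventually_uniformly_close hx₀ (f := fun x t => (δ x).path t)
    (isCompact_Icc (a := ((k : ℕ) : ℝ)) (b := ((k : ℕ) : ℝ) + 1))
    (h.1.mono (prod_mono le_rfl (arc_Icc_subset k))) hη0
  have E2 := (hv0.eventually (eventually_small z R one_half_pos)).and
    (hv0.eventually (eventually_small z R hη0))
  have E3 : ∀ᶠ x in 𝓝[N] x₀, ‖(δ x).points - z‖ < η := by
    have := hv0.norm
    rw [norm_zero] at this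
    exact this.eventually (gt_mem_nhds hη0)
  have E4 : ∀ᶠ x in 𝓝[N] x₀, ∀ j, ∀ t ∈ Icc α β,
      ‖arcLog (δ x) k j t - arcLog (δ x₀) k j t‖ < 1 :=
    eventually_all.mpr fun j => eventually_uniformly_close hx₀ (f := fun x t => arcLog (δ x) k j t)
      isCompact_Icc ((h.continuousOn_arcLog k j).mono
        (prod_mono le_rfl (hmid.trans (Ioo_subset_arcLogDomain k j)))) one_pos
  -- At an end point only the logarithms that are not singular there are defined and compared, hence
  -- the intersection with the domain.
  have E5 : ∀ᶠ x in 𝓝[N] x₀, ∀ j, ∀ t ∈ ({((k : ℕ) : ℝ), ((k : ℕ) : ℝ) + 1} : Set ℝ) ∩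
      arcLogDomain k j, ‖arcLog (δ x) k j t - arcLog (δ x₀) k j t‖ < 1 :=
    eventually_all.mpr fun j => eventually_uniformly_close hx₀ (f := fun x t => arcLog (δ x) k j t)
      ((Set.toFinite _).subset inter_subset_left).isCompact
      ((h.continuousOn_arcLog k j).mono (prod_mono le_rfl inter_subset_right)) one_pos
  filter_upwards [E1, E2, E3, E4, E5, self_mem_nhdsWithin] with x e1 e2 e3 e4 e5 hxN φ hφ
  set v := (δ x).points - z with hv
  have hzv : (δ x).points = z + v := by rw [hv]; abel
  obtain ⟨s₁, hs₁, -⟩ := (δ x).exists_finset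
  have hdd : ∀ t ∈ Icc ((k : ℕ) : ℝ) ((k : ℕ) + 1), ∀ j, ‖(divDiff z j v).eval (p t)‖ < 1 / 2 :=
    fun t ht j => (e2.1 _ (hR' t ht)).1 j
  have hdd1 : ∀ t ∈ Icc ((k : ℕ) : ℝ) ((k : ℕ) + 1), ∀ j, ‖(divDiff z j v).eval (p t)‖ < 1 :=
    fun t ht j => (hdd t ht j).trans (by norm_num)
  have hqt : ∀ t ∈ Icc ((k : ℕ) : ℝ) ((k : ℕ) + 1), ‖(interp z v).eval (p t)‖ < η :=
    fun t ht => (e2.2 _ (hR' t ht)).2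
  have hvj : ∀ j, ‖v j‖ < η := fun j => (norm_le_pi_norm v j).trans_lt e3
  classical
  have ha : IsLogPath (z + v) (arcSign k) k.castSucc k.succ ((k : ℕ) : ℝ) ((k : ℕ) + 1)
      (s₀ ∪ s₁ : Finset ℝ) (δ x).path (deriv (δ x).path) (arcLog (δ x) k) := by
    rw [← hzv]
    exact isLogPath_arc (δ x) (fun t ht hts => hs₁ t ht fun h => hts (Finset.mem_union_right _ h)) k
  have hb := isLogPath_deform (δ x₀) (s := s₀ ∪ s₁)
    (fun t ht hts => hs₀ t ht fun h => hts (Finset.mem_union_left _ h)) k hdd1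
  set b : ℝ → ℂ := fun t => (δ x₀).path t + (interp (δ x₀).points v).eval ((δ x₀).path t) with hbdef
  set B : Fin (n + 1) → ℝ → ℂ := fun j t => arcLog (δ x₀) k j t +
    Complex.log (1 + (divDiff (δ x₀).points j v).eval ((δ x₀).path t)) with hB
  have hpab : ∀ t ∈ Icc ((k : ℕ) : ℝ) ((k : ℕ) + 1), ‖b t - p t‖ < η := by
    intro t ht
    have : b t - p t = (interp z v).eval (p t) := by simp only [hbdef, ← hp, ← hz]; ring
    rw [this]
    exact hqt t ht
  have hsub0 : Icc ((k : ℕ) : ℝ) α ⊆ Icc ((k : ℕ) : ℝ) ((k : ℕ) + 1) :=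
    Icc_subset_Icc_right (by linarith [hα.2])
  have hsub1 : Icc β (((k : ℕ) : ℝ) + 1) ⊆ Icc ((k : ℕ) : ℝ) ((k : ℕ) + 1) :=
    Icc_subset_Icc_left (by linarith [hβ.1])
  have hsubm : Icc α β ⊆ Icc ((k : ℕ) : ℝ) ((k : ℕ) + 1) := hmid.trans Ioo_subset_Icc_self
  have hnear : ∀ (c : ℝ → ℂ) (i : Fin (n + 1)) (t : ℝ), ‖c t - p t‖ < η → ‖p t - z i‖ < r / 4 →
      ‖c t - (z + v) i‖ < r := by
    intro c i t h1 h2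
    have h3 : c t - (z + v) i = (c t - p t) + (p t - z i) - v i := by
      rw [Pi.add_apply]; ring
    rw [h3]
    calc _ ≤ ‖c t - p t‖ + ‖p t - z i‖ + ‖v i‖ :=
          (norm_sub_le _ _).trans (add_le_add_left (norm_add_le _ _) _)
      _ < r := by linarith [hvj i]
  have hsep : ∀ i j, i ≠ j → r ≤ ‖(z + v) i - (z + v) j‖ := by
    intro i j hij
    have h1 := hrz i j hij
    have h2 : z i - z j = ((z + v) i - (z + v) j) - v i + v j := by
      simp only [Pi.add_apply]; ring
    rw [← hz, h2] at h1
    have h3 := norm_add_le (((z + v) i - (z + v) j) - v i) (v j)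
    have h4 := norm_sub_le ((z + v) i - (z + v) j) (v i)
    linarith [hvj i, hvj j]
  have hclose : ∀ t ∈ Icc α β, ∀ j, ‖(δ x).path t - b t‖ < 1 / 2 * ‖b t - (z + v) j‖ := by
    intro t ht j
    have h1 : (δ x).path t - b t = ((δ x).path t - p t) - (b t - p t) := by ring
    have h2 : ‖(δ x).path t - b t‖ < 2 * η := by
      rw [h1]
      have := norm_sub_le ((δ x).path t - p t) (b t - p t)
      linarith [e1 t (hsubm ht), hpab t (hsubm ht)]
    have h3 := hmz j t ht
    have h4 : p t - z j = (b t - (z + v) j) - (b t - p t) + v j := by rw [Pi.add_apply]; ring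
    rw [h4] at h3
    have h5 := norm_add_le ((b t - (z + v) j) - (b t - p t)) (v j)
    have h6 := norm_sub_le (b t - (z + v) j) (b t - p t)
    linarith [hvj j, hpab t (hsubm ht)]
  have hlt : ∀ t ∈ Icc α β, ∀ j, ‖(δ x).path t - b t‖ < ‖b t - (z + v) j‖ := by
    intro t ht j
    have h1 := hclose t ht j
    have h2 := norm_nonneg (b t - (z + v) j)
    linarith
  -- Each comparison of logarithms below involves at most three differences of norm less than 1, so
  -- equality of the exponentials forces equality.
  have hpi : (3 : ℝ) < 2 * Real.pi := by linarith [Real.pi_gt_three]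
  have hend : ∀ j, ∀ t ∈ ({((k : ℕ) : ℝ), ((k : ℕ) : ℝ) + 1} : Set ℝ), t ∈ arcLogDomain k j →
      Complex.exp (arcLog (δ x) k j t) = Complex.exp (B j t) → arcLog (δ x) k j t = B j t := by
    intro j t ht htd he
    have htI : t ∈ Icc ((k : ℕ) : ℝ) ((k : ℕ) + 1) := by
      rcases ht with rfl | rfl
      · exact left_mem_Icc.mpr hkk.le
      · exact right_mem_Icc.mpr hkk.le
    refine eq_of_exp_eq_of_norm_lt he ?_
    have h1 : arcLog (δ x) k j t - B j t = (arcLog (δ x) k j t - arcLog (δ x₀) k j t) -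
        Complex.log (1 + (divDiff z j v).eval (p t)) := by simp only [hB, ← hp, ← hz]; ring
    rw [h1]
    have h2 := norm_sub_le (arcLog (δ x) k j t - arcLog (δ x₀) k j t)
      (Complex.log (1 + (divDiff z j v).eval (p t)))
    linarith [e5 j t ⟨ht, htd⟩, norm_log_one_add_lt_one (hdd t htI j)]
  have hkl : ((k : ℕ) : ℝ) ∈ Ico ((k : ℕ) : ℝ) ((k : ℕ) + 1) := ⟨le_rfl, hkk⟩
  have hkr : ((k : ℕ) : ℝ) + 1 ∈ Ioc ((k : ℕ) : ℝ) ((k : ℕ) + 1) := ⟨hkk, le_rfl⟩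
  have hexpeq : ∀ (j : Fin (n + 1)) (t : ℝ) (A C a c : ℂ), a = c → Complex.exp A =
      arcSign k j * (a - (z + v) j) → Complex.exp C = arcSign k j * (c - (z + v) j) →
      Complex.exp A = Complex.exp C := by
    rintro j t A C a c rfl h1 h2
    rw [h1, h2]
  have hai : IntervalIntegrable (pathIntegrand μ φ (δ x).path (deriv (δ x).path) (arcLog (δ x) k))
      volume ((k : ℕ) : ℝ) ((k : ℕ) + 1) := by
    have h1 := (intervalIntegrable_integrand (δ x) hμ k).continuousOn_mul
      (g := fun t => φ ((δ x).path t)) (by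
        rw [uIcc_of_le hkk.le]
        exact hφ.continuous.comp_continuousOn ha.cont)
    refine h1.congr fun t _ => ?_
    simp only [pathIntegrand, integrand_eq]
    ring
  have hbi : IntervalIntegrable (pathIntegrand μ φ b
      (fun t => (1 + (Polynomial.derivative (interp (δ x₀).points v)).eval ((δ x₀).path t)) *
        deriv (δ x₀).path t) B) volume ((k : ℕ) : ℝ) ((k : ℕ) + 1) := by
    have h1 := (intervalIntegrable_integrand (δ x₀) hμ k).continuousOn_mul
      (g := fun t => φ (b t) * deformFactor μ z v (p t)) (by
        rw [uIcc_of_le hkk.le]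
        refine (hφ.continuous.comp_continuousOn hb.cont).mul ?_
        exact (continuousOn_deformFactor μ z v (K := p '' Icc ((k : ℕ) : ℝ) ((k : ℕ) + 1)) (by
          rintro _ ⟨t, ht, rfl⟩
          exact hdd1 t ht)).comp hpath.cont (mapsTo_image _ _))
    refine h1.congr fun t _ => ?_
    rw [pathIntegrand_deform]
  have hmain := integral_eq_of_close (fun i => (hμ i).2) (s₀ ∪ s₁).countable_toSet
    (arcSign_ne_zero k) hφ ha hb hai hbi hα.1 hαβ hβ.2
    (fun j hj => hsep _ _ hj.symm) (fun j hj => hsep _ _ hj.symm)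
    (fun t ht => hnear _ _ t (e1 t (hsub0 ht)) (hαp t ht))
    (fun t ht => hnear _ _ t (hpab t (hsub0 ht)) (hαp t ht))
    (fun t ht => hnear _ _ t (e1 t (hsub1 ht)) (hβp t ht))
    (fun t ht => hnear _ _ t (hpab t (hsub1 ht)) (hβp t ht))
    (fun j hj => hend j _ (Or.inl rfl) (Ico_subset_arcLogDomain hj hkl)
      (hexpeq j 0 _ _ _ _ (ha.left.trans hb.left.symm) (ha.exp_log_left j hj)
        (hb.exp_log_left j hj)))
    (fun j hj => hend j _ (Or.inr rfl) (Ioc_subset_arcLogDomain hj hkr)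
      (hexpeq j 0 _ _ _ _ (ha.right.trans hb.right.symm) (ha.exp_log_right j hj)
        (hb.exp_log_right j hj)))
    hlt (by
      intro t ht j
      refine eq_of_exp_eq_of_norm_lt ?_ ?_
      · rw [ha.exp_log j t (hmid ht), exp_localLog (hlt t ht j) (hb.exp_log j t (hmid ht))]
      · have h1 : arcLog (δ x) k j t - localLog (B j t) (b t) ((z + v) j) ((δ x).path t) =
            (arcLog (δ x) k j t - arcLog (δ x₀) k j t) -
            Complex.log (1 + (divDiff z j v).eval (p t)) -
            Complex.log (1 + ((δ x).path t - b t) / (b t - (z + v) j)) := by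
          simp only [hB, ← hp, ← hz, localLog]; ring
        have h3 : ‖((δ x).path t - b t) / (b t - (z + v) j)‖ < 1 / 2 := by
          have h4 := hclose t ht j
          have h5 : 0 < ‖b t - (z + v) j‖ := (norm_nonneg _).trans_lt (hlt t ht j)
          rwa [norm_div, div_lt_iff₀ h5]
        rw [h1]
        refine lt_of_le_of_lt ((norm_sub_le _ _).trans (add_le_add_left (norm_sub_le _ _) _)) ?_
        linarith [e4 j t ht, norm_log_one_add_lt_one (hdd t (hsubm ht) j),
          norm_log_one_add_lt_one h3])
  calc _ = ∫ t in ((k : ℕ) : ℝ)..((k : ℕ) + 1 : ℝ), pathIntegrand μ φ (δ x).path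
          (deriv (δ x).path) (arcLog (δ x) k) t := by
        refine intervalIntegral.integral_congr fun t _ => ?_
        simp only [pathIntegrand, integrand_eq]
        ring
    _ = _ := hmain
    _ = _ := intervalIntegral.integral_congr fun t _ => pathIntegrand_deform (δ x₀) φ k v t

/-- The integrals along the members of a continuous family near `x₀`, as integrals along the
member at `x₀`. -/
theorem IsFamily.eventually_integral_eq {X : Type*} [TopologicalSpace X] {N : Set X}
    {δ : X → LArcSystem n} (h : IsFamily N δ) {x₀ : X} (hx₀ : x₀ ∈ N) {μ : Fin (n + 1) → ℝ}
    (hμ : ∀ j, 0 < μ j ∧ μ j < 1) :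
    ∀ᶠ x in 𝓝[N] x₀, ∀ k : Fin n, ∀ φ : ℂ → ℂ, Differentiable ℂ φ →
      ∫ t in ((k : ℕ) : ℝ)..((k : ℕ) + 1 : ℝ),
        φ ((δ x).path t) * (integrand μ (δ x) k t * deriv (δ x).path t) =
      ∫ t in ((k : ℕ) : ℝ)..((k : ℕ) + 1 : ℝ),
        φ ((δ x₀).path t + (interp (δ x₀).points ((δ x).points - (δ x₀).points)).eval
          ((δ x₀).path t)) *
        deformFactor μ (δ x₀).points ((δ x).points - (δ x₀).points) ((δ x₀).path t) *
        (integrand μ (δ x₀) k t * deriv (δ x₀).path t) :=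
  eventually_all.mpr fun k => h.eventually_integral_eq_aux hx₀ hμ k

end Compare

/-! ### Holomorphic dependence of an integral on parameters. -/

section Parametric

open scoped Interval

variable {E : Type*} [NormedAddCommGroup E] [NormedSpace ℂ E] [ProperSpace E]

/-- The singular factor g does not depend on the parameter and is only integrable; the other factor
is C¹ with derivative bounded on a compact set, so C‖g‖ dominates and one may differentiate under
the integral. -/
theorem contDiffAt_integral_param {H : E × ℂ → ℂ} {K : Set ℂ} {x₀ : E} {ε : ℝ} (hε : 0 < ε)
    (hK : IsCompact K) (hH : ∀ y ∈ Metric.closedBall x₀ ε ×ˢ K, ContDiffAt ℂ 1 H y)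
    {p g : ℝ → ℂ} {a b : ℝ} (hp : ContinuousOn p (uIcc a b)) (hpK : MapsTo p (uIcc a b) K)
    (hg : IntervalIntegrable g volume a b) :
    ContDiffAt ℂ 1 (fun v => ∫ t in a..b, H (v, p t) * g t) x₀ ∧
      ∀ w, fderiv ℂ (fun v => ∫ t in a..b, H (v, p t) * g t) x₀ w =
        ∫ t in a..b, fderiv ℂ H (x₀, p t) (w, 0) * g t := by
  set D : E → ℝ → E →L[ℂ] ℂ := fun v t =>
    g t • (fderiv ℂ H (v, p t)).comp (ContinuousLinearMap.inl ℂ E ℂ) with hD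
  have hbc : Metric.ball x₀ ε ⊆ Metric.closedBall x₀ ε := Metric.ball_subset_closedBall
  have hfd : ContinuousOn (fun y => (fderiv ℂ H y).comp (ContinuousLinearMap.inl ℂ E ℂ))
      (Metric.closedBall x₀ ε ×ˢ K) := fun y hy =>
    (((hH y hy).fderiv_right (m := 0) (by norm_num)).continuousAt.clm_comp
      continuousAt_const).continuousWithinAt
  obtain ⟨C, hC⟩ := ((isCompact_closedBall x₀ ε).prod hK).exists_bound_of_continuousOn hfd
  have hFint : ∀ v ∈ Metric.closedBall x₀ ε,
      IntervalIntegrable (fun t => H (v, p t) * g t) volume a b := by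
    intro v hv
    refine hg.continuousOn_mul fun t ht => ?_
    exact ContinuousAt.comp_continuousWithinAt (f := fun t => (v, p t))
      (hH (v, p t) ⟨hv, hpK ht⟩).continuousAt (continuousWithinAt_const.prodMk (hp t ht))
  have hDint : ∀ v ∈ Metric.closedBall x₀ ε, IntervalIntegrable (D v) volume a b := by
    intro v hv
    refine hg.smul_continuousOn (g := fun t => (fderiv ℂ H (v, p t)).comp
      (ContinuousLinearMap.inl ℂ E ℂ)) ?_
    exact hfd.comp (f := fun t => (v, p t)) (continuousOn_const.prodMk hp)
      fun t ht => ⟨hv, hpK ht⟩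
  have hbound : ∀ v ∈ Metric.closedBall x₀ ε, ∀ t ∈ Ι a b, ‖D v t‖ ≤ C * ‖g t‖ := by
    intro v hv t ht
    rw [hD, norm_smul, mul_comm]
    exact mul_le_mul_of_nonneg_right (hC (v, p t) ⟨hv, hpK (uIoc_subset_uIcc ht)⟩) (norm_nonneg _)
  have hder : ∀ v ∈ Metric.closedBall x₀ ε, ∀ t ∈ Ι a b,
      HasFDerivAt (fun v => H (v, p t) * g t) (D v t) v := by
    intro v hv t ht
    have h1 := ((hH (v, p t) ⟨hv, hpK (uIoc_subset_uIcc ht)⟩).differentiableAt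
      one_ne_zero).hasFDerivAt
    have h2 : HasFDerivAt (fun v : E => (v, p t)) (ContinuousLinearMap.inl ℂ E ℂ) v :=
      hasFDerivAt_prodMk_left v (p t)
    exact (HasFDerivAt.comp v (f := fun v => (v, p t)) h1 h2).mul_const (g t)
  have hmain : ∀ v ∈ Metric.ball x₀ ε,
      HasFDerivAt (fun v => ∫ t in a..b, H (v, p t) * g t) (∫ t in a..b, D v t) v := by
    intro v hv
    have hn : Metric.ball x₀ ε ∈ 𝓝 v := Metric.isOpen_ball.mem_nhds hv
    refine intervalIntegral.hasFDerivAt_integral_of_dominated_of_fderiv_le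
      (bound := fun t => C * ‖g t‖) hn ?_ (hFint v (hbc hv)) ?_ ?_ (hg.norm.const_mul C) ?_
    · filter_upwards [hn] with u hu
      exact (hFint u (hbc hu)).def'.aestronglyMeasurable
    · exact (hDint v (hbc hv)).def'.aestronglyMeasurable
    · exact .of_forall fun t ht u hu => hbound u (hbc hu) t ht
    · exact .of_forall fun t ht u hu => hder u (hbc hu) t ht
  have hcont : ContinuousOn (fun v => ∫ t in a..b, D v t) (Metric.ball x₀ ε) := by
    intro v hv
    refine intervalIntegral.continuousWithinAt_of_dominated_interval (bound := fun t => C * ‖g t‖)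
      ?_ ?_ (hg.norm.const_mul C) ?_
    · filter_upwards [self_mem_nhdsWithin] with u hu
      exact (hDint u (hbc hu)).def'.aestronglyMeasurable
    · filter_upwards [self_mem_nhdsWithin] with u hu
      exact .of_forall fun t ht => hbound u (hbc hu) t ht
    · refine .of_forall fun t ht => ContinuousWithinAt.const_smul ?_ (g t)
      exact hfd.comp (f := fun v => (v, p t)) (by fun_prop)
        (fun u hu => ⟨hbc hu, hpK (uIoc_subset_uIcc ht)⟩) v hv
  refine ⟨contDiffAt_one_iff.mpr ⟨_, _, Metric.ball_mem_nhds x₀ hε, hcont, hmain⟩, fun w => ?_⟩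
  rw [(hmain x₀ (Metric.mem_ball_self hε)).fderiv, ContinuousLinearMap.intervalIntegral_apply
    (hDint x₀ (Metric.mem_closedBall_self hε.le))]
  refine intervalIntegral.integral_congr fun t _ => ?_
  simp [hD, mul_comm]

end Parametric

/-! ### The local form of the Lauricella map, its derivative and the moments of polynomials. -/

section DeformIntegral

open Polynomial

variable {n : ℕ} (μ : Fin (n + 1) → ℝ) (δ : LArcSystem n)

/-- The local form of the Lauricella map, as a function of the displacement of the points. -/
def deformIntegral (v : Fin (n + 1) → ℂ) (k : Fin n) : ℂ :=
  ∫ t in ((k : ℕ) : ℝ)..((k : ℕ) + 1 : ℝ),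
    deformFactor μ δ.points v (δ.path t) * (integrand μ δ k t * deriv δ.path t)

/-- The moments of a polynomial against the integrand. -/
def polyIntegral (p : ℂ[X]) (k : Fin n) : ℂ :=
  ∫ t in ((k : ℕ) : ℝ)..((k : ℕ) + 1 : ℝ),
    p.eval (δ.path t) * (integrand μ δ k t * deriv δ.path t)

/-- The polynomial `p` such that the derivative of the form `∏ (ζ - z_j)^{-μ_j} dζ` in the
direction `v` is its product with `p`, after pull-back along the deformation. -/
def velocityPoly (z v : Fin (n + 1) → ℂ) : ℂ[X] :=
  derivative (interp z v) - ∑ j, C (μ j : ℂ) * divDiff z j v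

theorem deformFactor_zero (z : Fin (n + 1) → ℂ) (ζ : ℂ) : deformFactor μ z 0 ζ = 1 := by
  simp [deformFactor, interp_zero, divDiff_zero]

theorem deformIntegral_zero : deformIntegral μ δ 0 = F μ δ := by
  funext k
  simp [deformIntegral, F, deformFactor_zero]

theorem polyIntegral_one : polyIntegral μ δ 1 = F μ δ := by
  funext k
  simp [polyIntegral, F]

theorem interp_smul (z v : Fin (n + 1) → ℂ) (s : ℂ) : interp z (s • v) = C s * interp z v := by
  rw [interp_eq_sum, interp_eq_sum, Finset.mul_sum]
  exact Finset.sum_congr rfl fun i _ => by simp [mul_assoc]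

theorem divDiff_smul (z v : Fin (n + 1) → ℂ) (j : Fin (n + 1)) (s : ℂ) :
    divDiff z j (s • v) = C s * divDiff z j v := by
  rw [divDiff, divDiff, Finset.mul_sum]
  exact Finset.sum_congr rfl fun i _ => by simp [mul_assoc]

/-- At s = 0 the factor 1 + s q' contributes q', and each power (1 + s d_j)^(-μ_j) contributes -μ_j
d_j, where d_j is the divided difference. -/
theorem hasDerivAt_deformFactor_smul (z v : Fin (n + 1) → ℂ) (ζ : ℂ) :
    HasDerivAt (fun s : ℂ => deformFactor μ z (s • v) ζ) ((velocityPoly μ z v).eval ζ) 0 := by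
  have h0 : ∀ b : ℂ, HasDerivAt (fun s : ℂ => Complex.log (1 + s * b)) b 0 := by
    intro b
    have h1 : HasDerivAt (fun s : ℂ => 1 + s * b) b 0 := by
      simpa using ((hasDerivAt_id (0:ℂ)).mul_const b).const_add 1
    have h2 := h1.clog (by simp)
    simpa using h2
  have h1 : HasDerivAt (fun s : ℂ => 1 + s * (derivative (interp z v)).eval ζ)
      ((derivative (interp z v)).eval ζ) 0 := by
    simpa using ((hasDerivAt_id (0:ℂ)).mul_const ((derivative (interp z v)).eval ζ)).const_add 1
  have h2 : HasDerivAt (fun s : ℂ => -∑ j, (μ j : ℂ) *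
      Complex.log (1 + s * (divDiff z j v).eval ζ)) (-∑ j, (μ j : ℂ) * (divDiff z j v).eval ζ) 0 :=
    (HasDerivAt.fun_sum fun j _ => (h0 _).const_mul _).neg
  have h3 := h1.mul h2.cexp
  have h4 : (fun s : ℂ => deformFactor μ z (s • v) ζ) = fun s : ℂ =>
      (1 + s * (derivative (interp z v)).eval ζ) * Complex.exp (-∑ j, (μ j : ℂ) *
      Complex.log (1 + s * (divDiff z j v).eval ζ)) := by
    funext s
    simp [deformFactor, interp_smul, divDiff_smul]
  rw [h4]
  refine h3.congr_deriv ?_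
  simp [velocityPoly, eval_finsetSum]
  ring

theorem exists_deform_bound : ∃ R, ∀ k : Fin n, ∀ t ∈ Icc ((k : ℕ) : ℝ) ((k : ℕ) + 1),
    δ.path t ∈ Metric.closedBall (0:ℂ) R := by
  have h1 : ContinuousOn δ.path (Icc 0 n) := δ.continuousOn.mono Icc_subset_Ici_self
  obtain ⟨R, hR⟩ := (isCompact_Icc.image_of_continuousOn h1).isBounded.exists_norm_le
  refine ⟨R, fun k t ht => mem_closedBall_zero_iff.mpr (hR _ ⟨t, ⟨arc_Icc_subset k ht, ?_⟩, rfl⟩)⟩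
  refine ht.2.trans ?_
  exact_mod_cast k.2

/-- Differentiation under the integral gives the derivative as an integral of partial derivatives;
restricted to the line s ↦ s w these are the values of `velocityPoly`. -/
theorem contDiffAt_deformIntegral_aux (hμ : ∀ j, 0 < μ j ∧ μ j < 1) :
    (∀ᶠ v in 𝓝 0, ContDiffAt ℂ 1 (deformIntegral μ δ) v) ∧
      ∀ w k, fderiv ℂ (deformIntegral μ δ) 0 w k = polyIntegral μ δ (velocityPoly μ δ.points w) k := by
  obtain ⟨R, hR⟩ := exists_deform_bound δ
  have hsm := eventually_small δ.points R one_half_pos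
  obtain ⟨ε, hε, hb⟩ := Metric.eventually_nhds_iff_ball.mp hsm
  have hH : ∀ y ∈ Metric.ball (0 : Fin (n + 1) → ℂ) ε ×ˢ Metric.closedBall (0:ℂ) R,
      ContDiffAt ℂ 1 (fun y : (Fin (n + 1) → ℂ) × ℂ => deformFactor μ δ.points y.1 y.2) y :=
    fun y hy => contDiffAt_deformFactor μ δ.points fun j =>
      ((hb y.1 hy.1 y.2 hy.2).1 j).trans (by norm_num)
  have hk : ∀ k : Fin n, ((k : ℕ) : ℝ) ≤ (k : ℕ) + 1 := fun k => by linarith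
  have hmain : ∀ v ∈ Metric.ball (0 : Fin (n + 1) → ℂ) ε, ∀ k : Fin n,
      ContDiffAt ℂ 1 (fun v => deformIntegral μ δ v k) v ∧
      ∀ w, fderiv ℂ (fun v => deformIntegral μ δ v k) v w =
        ∫ t in ((k : ℕ) : ℝ)..((k : ℕ) + 1 : ℝ), fderiv ℂ
          (fun y : (Fin (n + 1) → ℂ) × ℂ => deformFactor μ δ.points y.1 y.2) (v, δ.path t) (w, 0) *
          (integrand μ δ k t * deriv δ.path t) := by
    intro v hv k
    obtain ⟨r, hr, hrb⟩ := Metric.nhds_basis_closedBall.mem_iff.mp (Metric.isOpen_ball.mem_nhds hv)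
    refine contDiffAt_integral_param hr (isCompact_closedBall (0:ℂ) R)
      (fun y hy => hH y ⟨hrb hy.1, hy.2⟩) (p := δ.path) ?_ ?_ (intervalIntegrable_integrand δ hμ k)
    · rw [uIcc_of_le (hk k)]
      exact δ.continuousOn.mono (arc_Icc_subset k)
    · rw [uIcc_of_le (hk k)]
      exact hR k
  have hdiff : ∀ v ∈ Metric.ball (0 : Fin (n + 1) → ℂ) ε, ContDiffAt ℂ 1 (deformIntegral μ δ) v :=
    fun v hv => contDiffAt_pi.mpr fun k => (hmain v hv k).1
  refine ⟨eventually_of_mem (Metric.ball_mem_nhds 0 hε) hdiff, fun w k => ?_⟩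
  have h0 := Metric.mem_ball_self (x := (0 : Fin (n + 1) → ℂ)) hε
  have h2 : fderiv ℂ (deformIntegral μ δ) 0 w k =
      fderiv ℂ (fun v => deformIntegral μ δ v k) 0 w := by
    rw [(hasFDerivAt_pi'.mp ((hdiff 0 h0).differentiableAt one_ne_zero).hasFDerivAt k).fderiv]
    rfl
  rw [h2, (hmain 0 h0 k).2 w]
  refine intervalIntegral.integral_congr fun t ht => ?_
  rw [uIcc_of_le (hk k)] at ht
  have h3 := ((hH (0, δ.path t) ⟨h0, hR k t ht⟩).differentiableAt one_ne_zero).hasFDerivAt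
  have h4 : HasDerivAt (fun s : ℂ => (s • w, δ.path t)) (w, (0 : ℂ)) 0 := by
    have := ((hasDerivAt_id (0:ℂ)).smul_const w).prodMk (hasDerivAt_const (0:ℂ) (δ.path t))
    simpa using this
  have h5 := HasFDerivAt.comp_hasDerivAt_of_eq (0:ℂ) (f := fun s : ℂ => (s • w, δ.path t)) h3 h4
    (by simp)
  have h6 := h5.unique (hasDerivAt_deformFactor_smul μ δ.points w (δ.path t))
  simp only [h6]

variable {μ}

theorem contDiffAt_deformIntegral (hμ : ∀ j, 0 < μ j ∧ μ j < 1) :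
    ContDiffAt ℂ 1 (deformIntegral μ δ) 0 :=
  (contDiffAt_deformIntegral_aux μ δ hμ).1.self_of_nhds

theorem fderiv_deformIntegral (hμ : ∀ j, 0 < μ j ∧ μ j < 1) (w : Fin (n + 1) → ℂ) :
    fderiv ℂ (deformIntegral μ δ) 0 w = polyIntegral μ δ (velocityPoly μ δ.points w) :=
  funext fun k => (contDiffAt_deformIntegral_aux μ δ hμ).2 w k

theorem intervalIntegrable_polyIntegral (hμ : ∀ j, 0 < μ j ∧ μ j < 1) (p : ℂ[X]) (k : Fin n) :
    IntervalIntegrable (fun t => p.eval (δ.path t) * (integrand μ δ k t * deriv δ.path t)) volume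
      ((k : ℕ) : ℝ) ((k : ℕ) + 1) := by
  refine (intervalIntegrable_integrand δ hμ k).continuousOn_mul ?_
  rw [uIcc_of_le (by linarith)]
  exact p.continuous.comp_continuousOn (δ.continuousOn.mono (arc_Icc_subset k))

/-- The moments as a linear map. -/
def polyIntegralMap (hμ : ∀ j, 0 < μ j ∧ μ j < 1) : ℂ[X] →ₗ[ℂ] Fin n → ℂ where
  toFun := polyIntegral μ δ
  map_add' p q := by
    funext k
    simp only [polyIntegral, eval_add, add_mul, Pi.add_apply]
    exact intervalIntegral.integral_add (intervalIntegrable_polyIntegral δ hμ p k)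
      (intervalIntegrable_polyIntegral δ hμ q k)
  map_smul' c p := by
    funext k
    simp only [polyIntegral, eval_smul, smul_eq_mul, mul_assoc, Pi.smul_apply, RingHom.id_apply]
    exact intervalIntegral.integral_const_mul _ _

theorem IsFamily.eventually_F_eq {X : Type*} [TopologicalSpace X] {N : Set X}
    {δ : X → LArcSystem n} (h : IsFamily N δ) {x₀ : X} (hx₀ : x₀ ∈ N)
    (hμ : ∀ j, 0 < μ j ∧ μ j < 1) :
    ∀ᶠ x in 𝓝[N] x₀, F μ (δ x) = deformIntegral μ (δ x₀) ((δ x).points - (δ x₀).points) := by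
  filter_upwards [h.eventually_integral_eq hx₀ hμ] with x hx
  funext k
  have := hx k (fun _ => 1) (differentiable_const _)
  simpa [F, deformIntegral] using this

theorem degree_interp_lt (z v : Fin (n + 1) → ℂ) (hz : Function.Injective z) :
    (interp z v).degree < (n + 1 : ℕ) := by
  have := Lagrange.degree_interpolate_lt v hz.injOn (s := Finset.univ)
  rwa [Finset.card_univ, Fintype.card_fin] at this

theorem divDiff_eq {z : Fin (n + 1) → ℂ} (hz : Function.Injective z)
    (v : Fin (n + 1) → ℂ) (j : Fin (n + 1)) :
    divDiff z j v = interp z v /ₘ (X - C (z j)) := by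
  have h1 := modByMonic_add_div (interp z v) (X - C (z j))
  rw [modByMonic_X_sub_C_eq_C_eval, eval_interp hz] at h1
  have h2 := X_sub_C_mul_divDiff hz v j
  refine mul_left_cancel₀ (X_sub_C_ne_zero (z j)) ?_
  rw [h2]
  linear_combination -h1

theorem coeff_divDiff {z : Fin (n + 1) → ℂ} (hz : Function.Injective z)
    (v : Fin (n + 1) → ℂ) (j : Fin (n + 1)) {d : ℕ} (hd : (interp z v).natDegree = d + 1) :
    (divDiff z j v).coeff d = (interp z v).coeff (d + 1) := by
  have h1 := congrArg (fun p => p.coeff (d + 1)) (X_sub_C_mul_divDiff hz v j)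
  have h2 : (divDiff z j v).coeff (d + 1) = 0 := by
    rw [divDiff_eq hz]
    refine coeff_eq_zero_of_natDegree_lt ?_
    rw [natDegree_divByMonic _ (monic_X_sub_C _), natDegree_X_sub_C]
    omega
  simpa [sub_mul, coeff_X_mul, coeff_C_mul, h2, coeff_C] using h1

/-- With leading coefficient c and degree d + 1 of q, q' contributes (d + 1) c and each divided
difference contributes c in degree d. This is where the exclusion of integral |μ| ≥ 2 enters the
study of the differential. -/
theorem coeff_velocityPoly {z : Fin (n + 1) → ℂ} (hz : Function.Injective z)
    (v : Fin (n + 1) → ℂ) {d : ℕ} (hd : (interp z v).natDegree = d + 1) :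
    (velocityPoly μ z v).coeff d = ((d + 1 : ℕ) - ∑ j, (μ j : ℂ)) * (interp z v).coeff (d + 1) := by
  simp only [velocityPoly, coeff_sub, coeff_derivative, finsetSum_coeff, coeff_C_mul,
    coeff_divDiff hz v _ hd, ← Finset.sum_mul]
  push_cast
  ring

theorem degree_velocityPoly_lt {z : Fin (n + 1) → ℂ} (hz : Function.Injective z)
    (v : Fin (n + 1) → ℂ) : (velocityPoly μ z v).degree < n := by
  have hq : (interp z v).natDegree ≤ n := by
    refine natDegree_le_of_degree_le (Order.le_of_lt_succ ?_)
    exact degree_interp_lt z v hz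
  have hc : ∀ m, n ≤ m → (interp z v).coeff (m + 1) = 0 := fun m hm =>
    coeff_eq_zero_of_natDegree_lt (by omega)
  rw [degree_lt_iff_coeff_zero]
  intro m hm
  have h1 : ∀ j, (divDiff z j v).coeff m = 0 := by
    intro j
    have h1 := congrArg (fun p => p.coeff (m + 1)) (X_sub_C_mul_divDiff hz v j)
    have h2 : (divDiff z j v).coeff (m + 1) = 0 := by
      rw [divDiff_eq hz]
      refine coeff_eq_zero_of_natDegree_lt ?_
      rw [natDegree_divByMonic _ (monic_X_sub_C _), natDegree_X_sub_C]
      omega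
    simpa [sub_mul, coeff_X_mul, coeff_C_mul, h2, coeff_C, hc m hm] using h1
  simp [velocityPoly, coeff_derivative, hc m hm, h1]

end DeformIntegral

/-! ### Arc systems contained in the real axis. -/

section RealArc

variable {n : ℕ} {δ : LArcSystem n}

/-- The arc runs in the real axis. -/
def LArcSystem.IsReal (δ : LArcSystem n) : Prop := ∀ t, 0 ≤ t → (δ.path t).im = 0

theorem LArcSystem.IsReal.path_eq (h : δ.IsReal) {t : ℝ} (ht : 0 ≤ t) :
    δ.path t = ((δ.path t).re : ℂ) :=
  Complex.ext rfl (by simpa using h t ht)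

theorem LArcSystem.continuousOn_re (δ : LArcSystem n) :
    ContinuousOn (fun t => (δ.path t).re) (Ici 0) :=
  Complex.continuous_re.comp_continuousOn δ.continuousOn

theorem LArcSystem.IsReal.injOn_re (h : δ.IsReal) : InjOn (fun t => (δ.path t).re) (Ici 0) := by
  intro s hs t ht hst
  refine δ.injOn hs ht ?_
  rw [h.path_eq hs, h.path_eq ht]
  exact congrArg _ hst

/-- An injective continuous real function on an interval is strictly monotone; divergence to +∞
excludes the decreasing case. -/
theorem LArcSystem.IsReal.strictMonoOn (h : δ.IsReal) :
    StrictMonoOn (fun t => (δ.path t).re) (Ici 0) := by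
  intro a ha b hb hab
  obtain ⟨M, hM1, hM2⟩ := ((δ.tendsto_re.eventually_gt_atTop (δ.path a).re).and
    (eventually_ge_atTop b)).exists
  have hsub : Icc a M ⊆ Ici 0 := fun x hx => (mem_Ici.mp ha).trans hx.1
  have haM : a < M := hab.trans_le hM2
  rcases ContinuousOn.strictMonoOn_of_injOn_Icc' haM.le (δ.continuousOn_re.mono hsub)
    (h.injOn_re.mono hsub) with h1 | h1
  · exact h1 ⟨le_rfl, haM.le⟩ ⟨hab.le, hM2⟩ hab
  · exact absurd (h1 ⟨le_rfl, haM.le⟩ ⟨haM.le, le_rfl⟩ haM) (not_lt.mpr hM1.le)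

/-- Along a real arc all chords are positive, so the real logarithm is already normalized at
infinity and no phase occurs. -/
theorem LArcSystem.IsReal.chordLog_eq (h : δ.IsReal) {q : ℝ × ℝ} (hq : q ∈ chordDomain) :
    δ.chordLog q = (Real.log ((δ.path q.2).re - (δ.path q.1).re) : ℂ) := by
  have hpos : ∀ q ∈ chordDomain, 0 < (δ.path q.2).re - (δ.path q.1).re := fun q hq =>
    sub_pos.mpr (h.strictMonoOn hq.1 (hq.1.trans hq.2.le) hq.2)
  refine δ.chordLog_spec.eqOn
    (L' := fun q => (Real.log ((δ.path q.2).re - (δ.path q.1).re) : ℂ)) ⟨?_, ?_, ?_⟩ hq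
  · refine Complex.continuous_ofReal.comp_continuousOn (ContinuousOn.log ?_ fun q hq =>
      (hpos q hq).ne')
    exact (δ.continuousOn_re.comp continuousOn_snd fun q hq => hq.1.trans hq.2.le).sub
      (δ.continuousOn_re.comp continuousOn_fst fun q hq => hq.1)
  · intro q hq
    rw [← Complex.ofReal_exp, Real.exp_log (hpos q hq), h.path_eq hq.1,
      h.path_eq (hq.1.trans hq.2.le)]
    simp
  · intro t _
    simp only [Complex.ofReal_im]
    exact tendsto_const_nhds

/-- The weight `∏ |u - x_j|^{-μ_j}`. -/
def realWeight (μ x : Fin (n + 1) → ℝ) (u : ℝ) : ℝ := ∏ j, |u - x j| ^ (-μ j)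

theorem LArcSystem.IsReal.integrand_eq (h : δ.IsReal) (μ : Fin (n + 1) → ℝ) {k : Fin n} {t : ℝ}
    (ht : t ∈ Ioo ((k : ℕ) : ℝ) ((k : ℕ) + 1)) :
    integrand μ δ k t =
      (realWeight μ (fun j => (δ.points j).re) (δ.path t).re : ℂ) := by
  have ht0 : 0 ≤ t := (Nat.cast_nonneg _).trans ht.1.le
  have h1 : ∀ j, ∃ r : ℝ, arcLog δ k j t = r := by
    intro j
    unfold arcLog
    split_ifs with hj
    · exact ⟨_, h.chordLog_eq ⟨Nat.cast_nonneg _, (cast_le_of_le hj).trans_lt ht.1⟩⟩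
    · exact ⟨_, h.chordLog_eq ⟨ht0, ht.2.trans_le (le_cast_of_not_le hj)⟩⟩
  choose r hr using h1
  have h2 : integrand μ δ k t = (Real.exp (-∑ j, μ j * r j) : ℂ) := by
    rw [Lauricella.integrand_eq]
    simp only [hr]
    push_cast
    rfl
  have h3 := norm_integrand δ μ ht
  rw [h2, Complex.norm_real, Real.norm_of_nonneg (Real.exp_pos _).le] at h3
  rw [h2, h3]
  congr 1
  refine Finset.prod_congr rfl fun j _ => ?_
  rw [h.path_eq ht0, LArcSystem.points, h.path_eq (Nat.cast_nonneg _), ← Complex.ofReal_sub,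
    Complex.norm_real, Real.norm_eq_abs]
  simp [LArcSystem.points]

/-- Substitution u = Re δ(t). The parametrization is increasing but only piecewise differentiable,
so the change of variables is done off the finite set of break points, which is null on both sides.
-/
theorem LArcSystem.IsReal.integral_eq (h : δ.IsReal) (μ : Fin (n + 1) → ℝ) (k : Fin n)
    (g : ℝ → ℂ) :
    ∫ t in ((k : ℕ) : ℝ)..((k : ℕ) + 1 : ℝ),
      g (δ.path t).re * (integrand μ δ k t * deriv δ.path t) =
    ∫ u in (δ.points k.castSucc).re..(δ.points k.succ).re,
      g u * (realWeight μ (fun j => (δ.points j).re) u : ℂ) := by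
  obtain ⟨s, hs, -⟩ := δ.exists_finset
  set f : ℝ → ℝ := fun t => (δ.path t).re with hf
  set f' : ℝ → ℝ := fun t => (deriv δ.path t).re with hf'
  have hkk : ((k : ℕ) : ℝ) ≤ (k : ℕ) + 1 := by linarith
  have hk0 : (0 : ℝ) ≤ ((k : ℕ) : ℝ) := Nat.cast_nonneg _
  have hIoo : Ioo ((k : ℕ) : ℝ) ((k : ℕ) + 1) ⊆ Ioi 0 := fun t ht => hk0.trans_lt ht.1
  have hIoo' : Ioo ((k : ℕ) : ℝ) ((k : ℕ) + 1) ⊆ Ici 0 := fun t ht => hk0.trans ht.1.le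
  have hx0 : (δ.points k.castSucc).re = f k := rfl
  have hx1 : (δ.points k.succ).re = f (k + 1) := by rw [points_succ]
  have hmono : f k < f (k + 1) := h.strictMonoOn hk0 (by simpa using by linarith) (by linarith)
  set A := Ioo ((k : ℕ) : ℝ) ((k : ℕ) + 1) \ (s : Set ℝ) with hA
  have hAm : MeasurableSet A := measurableSet_Ioo.diff s.measurableSet
  have hder : ∀ t ∈ A, HasDerivAt f (f' t) t := fun t ht => by
    have := (hs t (hIoo ht.1) ht.2)
    exact (hasDerivAt_iff_hasFDerivAt.mp this |>.restrictScalars ℝ |> fun h =>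
      (Complex.reCLM.hasFDerivAt.comp t h)).hasDerivAt.congr_deriv (by simp [hf'])
  have hder' : ∀ t ∈ A, deriv δ.path t = (f' t : ℂ) := fun t ht => by
    have h1 : δ.path =ᶠ[𝓝 t] fun u => (f u : ℂ) := by
      filter_upwards [Ioi_mem_nhds (hIoo ht.1)] with u hu
      exact h.path_eq (le_of_lt hu)
    exact ((hder t ht).ofReal_comp.congr_of_eventuallyEq h1).deriv
  have hnn : ∀ t ∈ A, 0 ≤ f' t := fun t ht => by
    have h1 := (h.strictMonoOn.monotoneOn).derivWithin_nonneg (x := t)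
    rw [derivWithin_of_mem_nhds (Ici_mem_nhds (hIoo ht.1))] at h1
    rwa [(hder t ht).deriv] at h1
  have himg := integral_image_eq_integral_abs_deriv_smul hAm
    (fun t ht => (hder t ht).hasDerivWithinAt) (h.injOn_re.mono (sdiff_subset.trans hIoo'))
    fun u => g u * (realWeight μ (fun j => (δ.points j).re) u : ℂ)
  have hae : A =ᵐ[volume] Ioo ((k : ℕ) : ℝ) ((k : ℕ) + 1) := sdiff_null_ae_eq_self
    (s.countable_toSet.measure_zero _)
  have himgae : f '' A =ᵐ[volume] Ioo (f k) (f (k + 1)) := by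
    have hsub : f '' A ⊆ Ioo (f k) (f (k + 1)) := by
      rintro _ ⟨t, ht, rfl⟩
      exact ⟨h.strictMonoOn hk0 (hIoo' ht.1) ht.1.1,
        h.strictMonoOn (hIoo' ht.1) (by simpa using by linarith) ht.1.2⟩
    refine (LE.le.eventuallyLE hsub).antisymm ?_
    refine ((sdiff_null_ae_eq_self ((s.image f).countable_toSet.measure_zero _)).symm.le).trans
      (LE.le.eventuallyLE (s := Ioo (f k) (f (k + 1)) \ (s.image f : Finset ℝ)) ?_)
    rintro u ⟨hu, hus⟩
    obtain ⟨t, ht, rfl⟩ := intermediate_value_Ioo hkk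
      (δ.continuousOn_re.mono (arc_Icc_subset k)) hu
    exact ⟨t, ⟨ht, fun hts => hus (by simpa using ⟨t, hts, rfl⟩)⟩, rfl⟩
  rw [intervalIntegral.integral_of_le hkk, integral_Ioc_eq_integral_Ioo,
    hx0, hx1, intervalIntegral.integral_of_le hmono.le, integral_Ioc_eq_integral_Ioo,
    ← setIntegral_congr_set himgae, ← setIntegral_congr_set hae, himg]
  refine setIntegral_congr_fun hAm fun t ht => ?_
  simp only [h.integrand_eq μ ht.1, hder' t ht, abs_of_nonneg (hnn t ht), Complex.real_smul]
  ring

theorem LArcSystem.IsReal.polyIntegral_eq (h : δ.IsReal) (μ : Fin (n + 1) → ℝ) (k : Fin n)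
    (p : Polynomial ℂ) :
    polyIntegral μ δ p k = ∫ u in (δ.points k.castSucc).re..(δ.points k.succ).re,
      p.eval (u : ℂ) * (realWeight μ (fun j => (δ.points j).re) u : ℂ) := by
  rw [← h.integral_eq μ k fun u => p.eval (u : ℂ)]
  refine intervalIntegral.integral_congr fun t ht => ?_
  rw [uIcc_of_le (by linarith)] at ht
  simp only [← h.path_eq (arc_Icc_subset k ht)]

theorem LArcSystem.IsReal.points_lt (h : δ.IsReal) :
    StrictMono fun j => (δ.points j).re := fun i j hij =>
  h.strictMonoOn (mem_Ici.mpr (Nat.cast_nonneg _)) (mem_Ici.mpr (Nat.cast_nonneg _))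
    (by exact_mod_cast hij)

end RealArc

end Lauricella

namespace Lauricella

open Set Filter Topology MeasureTheory Polynomial

/-! ### Nondegeneracy of the moments for real points. -/

section RealMoments

variable {n : ℕ}

theorem intervalIntegrable_realWeight {μ : Fin (n + 1) → ℝ} (hμ : ∀ j, 0 < μ j ∧ μ j < 1)
    {x : Fin (n + 1) → ℝ} (hx : Function.Injective x) (a b : ℝ) :
    IntervalIntegrable (realWeight μ x) volume a b :=
  intervalIntegrable_prod_abs_sub_rpow hμ hx a b

theorem realWeight_pos {μ x : Fin (n + 1) → ℝ} {u : ℝ} (hu : ∀ j, u ≠ x j) :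
    0 < realWeight μ x u :=
  Finset.prod_pos fun j _ => Real.rpow_pos_of_pos (abs_pos.mpr (sub_ne_zero.mpr (hu j))) _

theorem ne_of_mem_Ioo {x : Fin (n + 1) → ℝ} (hx : StrictMono x) {k : Fin n} {u : ℝ}
    (hu : u ∈ Ioo (x k.castSucc) (x k.succ)) (j : Fin (n + 1)) : u ≠ x j := by
  rintro rfl
  have h1 := hx.lt_iff_lt.mp hu.1
  have h2 := hx.lt_iff_lt.mp hu.2
  simp only [Fin.lt_def, Fin.val_castSucc, Fin.val_succ] at h1 h2
  omega

/-- A nonzero real polynomial of degree `< n` has a nonzero moment. -/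
theorem eq_zero_of_realMoments {μ : Fin (n + 1) → ℝ} (hμ : ∀ j, 0 < μ j ∧ μ j < 1)
    {x : Fin (n + 1) → ℝ} (hx : StrictMono x) {p : ℝ[X]} (hp : p.degree < n)
    (h : ∀ k : Fin n, ∫ u in x k.castSucc..x k.succ, p.eval u * realWeight μ x u = 0) : p = 0 := by
  -- A vanishing integral against a positive weight forces a zero inside each gap: without one, p
  -- would have constant sign there. The n gaps are disjoint, so p would have n distinct roots.
  have hroot : ∀ k : Fin n, ∃ u ∈ Ioo (x k.castSucc) (x k.succ), p.eval u = 0 := by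
    intro k
    by_contra! hne
    have hk : x k.castSucc < x k.succ := hx (Fin.castSucc_lt_succ)
    have hint : IntervalIntegrable (fun u => p.eval u * realWeight μ x u) volume
        (x k.castSucc) (x k.succ) :=
      (intervalIntegrable_realWeight hμ hx.injective _ _).continuousOn_mul p.continuous.continuousOn
    have hw : ∀ u ∈ Ioo (x k.castSucc) (x k.succ), 0 < realWeight μ x u := fun u hu =>
      realWeight_pos (ne_of_mem_Ioo hx hu)
    have hsign : (∀ u ∈ Ioo (x k.castSucc) (x k.succ), 0 < p.eval u) ∨
        ∀ u ∈ Ioo (x k.castSucc) (x k.succ), p.eval u < 0 := by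
      by_contra! hcon
      obtain ⟨⟨a, ha, ha'⟩, b, hb, hb'⟩ := hcon
      obtain ⟨u, hu, hu0⟩ := isPreconnected_Ioo.intermediate_value ha hb
        p.continuous.continuousOn ⟨ha', hb'⟩
      exact hne u hu hu0
    rcases hsign with hs | hs
    · have := intervalIntegral.intervalIntegral_pos_of_pos_on hint
        (fun u hu => mul_pos (hs u hu) (hw u hu)) hk
      exact this.ne' (h k)
    · have := intervalIntegral.intervalIntegral_pos_of_pos_on hint.neg
        (fun u hu => neg_pos.mpr (mul_neg_of_neg_of_pos (hs u hu) (hw u hu))) hk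
      have h0 : ∫ u in x k.castSucc..x k.succ, (-fun u => p.eval u * realWeight μ x u) u = 0 := by
        simp only [Pi.neg_apply, intervalIntegral.integral_neg, h k, neg_zero]
      exact this.ne' h0
  choose u hu hu0 using hroot
  refine Polynomial.eq_zero_of_degree_lt_of_eval_index_eq_zero (s := Finset.univ) (v := u) ?_
    (by simpa using hp) fun k _ => hu0 k
  refine StrictMono.injective (fun i j hij => ?_) |>.injOn
  have : x i.succ ≤ x j.castSucc := hx.monotone (by
    rw [Fin.le_def]; simpa using hij)
  exact (hu i).2.trans_le (this.trans (hu j).1.le)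

/-- On the real axis, no nontrivial combination of the cycles kills all polynomials of degree
`< n`. -/
theorem LArcSystem.IsReal.eq_zero_of_sum_eq_zero {δ : LArcSystem n} (h : δ.IsReal)
    {μ : Fin (n + 1) → ℝ} (hμ : ∀ j, 0 < μ j ∧ μ j < 1) {c : Fin n → ℂ}
    (hc : ∀ m < n, ∑ k, c k * polyIntegral μ δ (X ^ m) k = 0) : c = 0 := by
  set x : Fin (n + 1) → ℝ := fun j => (δ.points j).re with hx
  have hxm : StrictMono x := h.points_lt
  set M : Matrix (Fin n) (Fin n) ℝ := fun k m =>
    ∫ u in x k.castSucc..x k.succ, u ^ (m : ℕ) * realWeight μ x u with hM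
  have hMc : ∀ k m : Fin n, polyIntegral μ δ (X ^ (m : ℕ)) k = (M k m : ℂ) := by
    intro k m
    rw [h.polyIntegral_eq, hM]
    simp only [← hx]
    rw [← intervalIntegral.integral_ofReal]
    refine intervalIntegral.integral_congr fun u _ => ?_
    simp
  by_contra hc0
  -- The relation c is complex, but the moment matrix is real. Its determinant vanishes, so it also
  -- has a real right kernel vector, that is, a real polynomial with zero moments.
  have hdet : (M.map (Complex.ofRealHom : ℝ → ℂ)).det = 0 := by
    refine Matrix.exists_vecMul_eq_zero_iff.mp ⟨c, hc0, ?_⟩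
    funext m
    have := hc m m.2
    simp only [hMc] at this
    simpa [Matrix.vecMul, dotProduct] using this
  have hdet' : M.det = 0 := by
    rw [← RingHom.mapMatrix_apply, ← RingHom.map_det] at hdet
    simpa using hdet
  obtain ⟨v, hv0, hv⟩ := Matrix.exists_mulVec_eq_zero_iff.mpr hdet'
  set p : ℝ[X] := ∑ m : Fin n, C (v m) * X ^ (m : ℕ) with hp
  have hpd : p.degree < n := by
    refine (Polynomial.degree_sum_le _ _).trans_lt ?_
    refine (Finset.sup_lt_iff (WithBot.bot_lt_coe n)).mpr fun m _ => ?_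
    exact (degree_C_mul_X_pow_le _ _).trans_lt (WithBot.coe_lt_coe.mpr m.2)
  have hp0 : p = 0 := by
    refine eq_zero_of_realMoments hμ hxm hpd fun k => ?_
    have h1 : ∀ u, p.eval u * realWeight μ x u =
        ∑ m : Fin n, v m * (u ^ (m : ℕ) * realWeight μ x u) := by
      intro u
      rw [hp, eval_finsetSum, Finset.sum_mul]
      exact Finset.sum_congr rfl fun m _ => by simp [mul_assoc]
    simp only [h1]
    rw [intervalIntegral.integral_finsetSum]
    · have := congrFun hv k
      simp only [Matrix.mulVec, dotProduct, Pi.zero_apply] at this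
      rw [← this]
      refine Finset.sum_congr rfl fun m _ => ?_
      rw [intervalIntegral.integral_const_mul, mul_comm]
    · intro m _
      refine ((intervalIntegrable_realWeight hμ hxm.injective _ _).continuousOn_mul ?_).const_mul _
      fun_prop
  refine hv0 (funext fun m => ?_)
  have h2 := congrArg (fun q : ℝ[X] => q.coeff m) hp0
  simp only [hp, finsetSum_coeff, coeff_C_mul_X_pow, coeff_zero] at h2
  rw [Finset.sum_eq_single m] at h2
  · simpa using h2
  · intro b _ hb
    rw [if_neg]
    exact fun h => hb (Fin.ext h.symm)
  · simp

end RealMoments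

/-! ### Exact forms that lower the degree of a polynomial modulo zero moments. -/

section ExactForms

variable {n : ℕ}

/-- The polynomial `r` with `d (q ∏ (ζ - z_j) · ∏ (ζ - z_j)^{-μ_j}) = r ∏ (ζ - z_j)^{-μ_j} dζ`. -/
def exactPoly (μ : Fin (n + 1) → ℝ) (z : Fin (n + 1) → ℂ) (q : ℂ[X]) : ℂ[X] :=
  derivative q * Lagrange.nodal Finset.univ z +
    q * ∑ j, C (1 - μ j : ℂ) * Lagrange.nodal (Finset.univ.erase j) z

/-- The derivative of ζ^i contributes i to the top coefficient and the n + 1 terms with 1 - μ_j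
contribute n + 1 - |μ|. Thus the coefficient vanishes only if |μ| is the integer n + 1 + i. -/
theorem exactPoly_degree_lt (μ : Fin (n + 1) → ℝ) (z : Fin (n + 1) → ℂ) (i : ℕ) :
    (exactPoly μ z (X ^ i)).natDegree ≤ n + i ∧
      (exactPoly μ z (X ^ i)).coeff (n + i) = ((n + 1 + i : ℕ) : ℂ) - ∑ j, (μ j : ℂ) := by
  have hN : (Lagrange.nodal Finset.univ z).natDegree = n + 1 := by
    rw [Lagrange.natDegree_nodal, Finset.card_univ, Fintype.card_fin]
  have hE : ∀ j, (Lagrange.nodal (Finset.univ.erase j) z).natDegree = n := fun j => by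
    rw [Lagrange.natDegree_nodal, Finset.card_erase_of_mem (Finset.mem_univ j), Finset.card_univ,
      Fintype.card_fin, Nat.add_sub_cancel]
  have hNc : (Lagrange.nodal Finset.univ z).coeff (n + 1) = 1 := by
    have := Lagrange.nodal_monic (s := Finset.univ) (v := z)
    rwa [Monic, leadingCoeff, hN] at this
  have hEc : ∀ j, (Lagrange.nodal (Finset.univ.erase j) z).coeff n = 1 := fun j => by
    have := Lagrange.nodal_monic (s := Finset.univ.erase j) (v := z)
    rwa [Monic, leadingCoeff, hE] at this
  have hS : (∑ j, C (1 - μ j : ℂ) * Lagrange.nodal (Finset.univ.erase j) z).natDegree ≤ n :=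
    natDegree_sum_le_of_forall_le _ _ fun j _ => (natDegree_C_mul_le _ _).trans (hE j).le
  have hSc : (∑ j, C (1 - μ j : ℂ) * Lagrange.nodal (Finset.univ.erase j) z).coeff n =
      (n + 1 : ℕ) - ∑ j, (μ j : ℂ) := by
    simp only [finsetSum_coeff, coeff_C_mul, hEc, mul_one, Finset.sum_sub_distrib]
    simp
  have h2 : ((X ^ i : ℂ[X]) * ∑ j, C (1 - μ j : ℂ) *
      Lagrange.nodal (Finset.univ.erase j) z).coeff (n + i) = (n + 1 : ℕ) - ∑ j, (μ j : ℂ) := by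
    rw [coeff_X_pow_mul, hSc]
  rcases i with _ | i
  · refine ⟨?_, ?_⟩
    · simpa [exactPoly] using hS
    · simpa [exactPoly] using hSc
  · have h3 : (derivative (X ^ (i + 1) : ℂ[X]) * Lagrange.nodal Finset.univ z).coeff
        (n + (i + 1)) = ((i + 1 : ℕ) : ℂ) := by
      rw [derivative_X_pow, mul_assoc, coeff_C_mul, show n + (i + 1) = (n + 1) + i by ring,
        Nat.add_sub_cancel, coeff_X_pow_mul, hNc, mul_one]
    refine ⟨?_, ?_⟩
    · refine (natDegree_add_le _ _).trans (max_le ?_ ?_)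
      · refine natDegree_mul_le.trans ?_
        rw [hN, derivative_X_pow]
        have := natDegree_C_mul_X_pow_le ((i + 1 : ℕ) : ℂ) (i + 1 - 1)
        omega
      · refine natDegree_mul_le.trans ?_
        rw [natDegree_X_pow]
        omega
    · rw [exactPoly, coeff_add, h2, h3]
      push_cast
      ring

/-- Stokes' theorem: the primitive q ∏ (ζ - z_j)^(1-μ_j) vanishes at both ends of δ_k because 1 -
μ_j > 0. -/
theorem polyIntegral_exactPoly {μ : Fin (n + 1) → ℝ} (hμ : ∀ j, 0 < μ j ∧ μ j < 1)
    (δ : LArcSystem n) (q : ℂ[X]) : polyIntegral μ δ (exactPoly μ δ.points q) = 0 := by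
  funext k
  obtain ⟨s, hs, -⟩ := δ.exists_finset
  set N := Lagrange.nodal Finset.univ δ.points with hN
  have hkk : ((k : ℕ) : ℝ) ≤ (k : ℕ) + 1 := by linarith
  have hk0 : (0 : ℝ) ≤ ((k : ℕ) : ℝ) := Nat.cast_nonneg _
  have hp := isLogPath_arc δ hs k
  -- At an end point one of the logarithms is undefined, but the nodal polynomial vanishes there, so
  -- G has the correct value 0 whatever the default value is.
  set G : ℝ → ℂ := fun t => (q * N).eval (δ.path t) * integrand μ δ k t with hG
  have hN0 : ∀ j, N.eval (δ.points j) = 0 := fun j =>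
    Lagrange.eval_nodal_at_node (Finset.mem_univ j)
  have hGl : G k = 0 := by
    have := hN0 k.castSucc
    rw [points_castSucc] at this
    simp [hG, this]
  have hGr : G ((k : ℕ) + 1) = 0 := by
    have := hN0 k.succ
    rw [points_succ] at this
    simp [hG, this]
  have hqc : ContinuousOn (fun t => (q * N).eval (δ.path t)) (Icc ((k : ℕ) : ℝ) ((k : ℕ) + 1)) :=
    (q * N).continuous.comp_continuousOn hp.cont
  have hin : ContinuousOn G (Ioo ((k : ℕ) : ℝ) ((k : ℕ) + 1)) :=
    (hqc.mono Ioo_subset_Icc_self).mul (continuousOn_integrand δ μ k)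
  -- A continuous majorant of ‖G‖, equal to it inside the interval; it vanishes at the ends and so
  -- yields continuity of G there.
  set b : ℝ → ℝ := fun t => ‖q.eval (δ.path t)‖ * ∏ j, ‖δ.path t - δ.points j‖ ^ (1 - μ j) with hb
  have hbc : ContinuousOn b (Icc ((k : ℕ) : ℝ) ((k : ℕ) + 1)) := by
    refine ((q.continuous.comp_continuousOn hp.cont).norm).mul
      (continuousOn_finsetProd _ fun j _ => ?_)
    exact ((hp.cont.sub continuousOn_const).norm).rpow_const fun t _ =>
      Or.inr (by linarith [(hμ j).2])
  have hbG : ∀ t ∈ Ioo ((k : ℕ) : ℝ) ((k : ℕ) + 1), ‖G t‖ = b t := by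
    intro t ht
    simp only [hG, hb, norm_mul, norm_integrand δ μ ht, eval_mul, hN, Lagrange.eval_nodal,
      norm_prod]
    rw [mul_assoc, ← Finset.prod_mul_distrib]
    congr 1
    refine Finset.prod_congr rfl fun j _ => ?_
    have h1 := norm_sub_pos_of_exp (hp.exp_log j t ht)
    rw [Real.rpow_sub h1, Real.rpow_one, Real.rpow_neg h1.le]
    rfl
  have hend : ∀ t₀ ∈ Icc ((k : ℕ) : ℝ) ((k : ℕ) + 1), G t₀ = 0 → (∃ j, δ.path t₀ = δ.points j) →
      (∀ t ∈ Icc ((k : ℕ) : ℝ) ((k : ℕ) + 1), ‖G t‖ ≤ b t) →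
      ContinuousWithinAt G (Icc ((k : ℕ) : ℝ) ((k : ℕ) + 1)) t₀ := by
    intro t₀ ht₀ h0 ⟨j, hj⟩ hle
    have hb0 : b t₀ = 0 := by
      refine mul_eq_zero_of_right _ (Finset.prod_eq_zero (Finset.mem_univ j) ?_)
      rw [hj, sub_self, norm_zero, Real.zero_rpow (by linarith [(hμ j).2])]
    have h1 := hbc t₀ ht₀
    rw [ContinuousWithinAt, hb0] at h1
    rw [ContinuousWithinAt, h0]
    exact squeeze_zero_norm' (eventually_mem_nhdsWithin.mono fun t ht => hle t ht) h1
  have hb_nonneg : ∀ t, 0 ≤ b t := fun t => mul_nonneg (norm_nonneg _)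
    (Finset.prod_nonneg fun j _ => Real.rpow_nonneg (norm_nonneg _) _)
  have hle : ∀ t ∈ Icc ((k : ℕ) : ℝ) ((k : ℕ) + 1), ‖G t‖ ≤ b t := by
    intro t ht
    rcases eq_endpoints_or_mem_Ioo_of_mem_Icc ht with rfl | rfl | ht
    · rw [hGl, norm_zero]; exact hb_nonneg _
    · rw [hGr, norm_zero]; exact hb_nonneg _
    · exact (hbG t ht).le
  have hGc : ContinuousOn G (Icc ((k : ℕ) : ℝ) ((k : ℕ) + 1)) := by
    intro t ht
    rcases eq_endpoints_or_mem_Ioo_of_mem_Icc ht with rfl | rfl | ht'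
    · exact hend _ ht hGl ⟨_, (points_castSucc δ k).symm⟩ hle
    · exact hend _ ht hGr ⟨_, (points_succ δ k).symm⟩ hle
    · exact (hin.continuousAt (isOpen_Ioo.mem_nhds ht')).continuousWithinAt
  have hder : ∀ t ∈ Ioo ((k : ℕ) : ℝ) ((k : ℕ) + 1) \ (s : Set ℝ), HasDerivAt G
      ((exactPoly μ δ.points q).eval (δ.path t) * (integrand μ δ k t * deriv δ.path t)) t := by
    intro t ht
    have hpt := hs t (hk0.trans_lt ht.1.1) ht.2
    have hne : ∀ j, δ.path t - δ.points j ≠ 0 := fun j =>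
      norm_pos_iff.mp (norm_sub_pos_of_exp (hp.exp_log j t ht.1))
    have hA : ∀ j, HasDerivAt (arcLog δ k j)
        (deriv δ.path t / (δ.path t - δ.points j)) t := by
      intro j
      have h1 := hasDerivAt_of_exp_eq (A := arcLog δ k j)
        (g := fun t => arcSign k j * (δ.path t - δ.points j))
        ((hp.log_cont j).continuousAt (isOpen_Ioo.mem_nhds ht.1))
        (eventually_of_mem (isOpen_Ioo.mem_nhds ht.1) (hp.exp_log j))
        ((hpt.sub_const _).const_mul _)
      refine h1.congr_deriv ?_
      rw [mul_div_mul_left _ _ (arcSign_ne_zero k j)]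
    have h1 : HasDerivAt (integrand μ δ k) (integrand μ δ k t *
        -∑ j, (μ j : ℂ) * (deriv δ.path t / (δ.path t - δ.points j))) t :=
      ((HasDerivAt.fun_sum fun j _ => (hA j).const_mul (μ j : ℂ)).neg).cexp
    have h2 := (((q * N).hasDerivAt (δ.path t)).comp t hpt).mul h1
    refine h2.congr_deriv ?_
    have h3 : ∀ j, N.eval (δ.path t) = (δ.path t - δ.points j) *
        (Lagrange.nodal (Finset.univ.erase j) δ.points).eval (δ.path t) := by
      intro j
      rw [hN, Lagrange.nodal_eq_mul_nodal_erase (Finset.mem_univ j)]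
      simp
    have h4 : N.eval (δ.path t) * ∑ j, (μ j : ℂ) * (deriv δ.path t / (δ.path t - δ.points j)) =
        deriv δ.path t * ∑ j, (μ j : ℂ) *
          (Lagrange.nodal (Finset.univ.erase j) δ.points).eval (δ.path t) := by
      rw [Finset.mul_sum, Finset.mul_sum]
      refine Finset.sum_congr rfl fun j _ => ?_
      rw [h3 j]
      field_simp [hne j]
    have h5 : N.derivative.eval (δ.path t) =
        ∑ j, (Lagrange.nodal (Finset.univ.erase j) δ.points).eval (δ.path t) := by
      rw [hN, Lagrange.derivative_nodal, eval_finsetSum]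
    have h6 : (exactPoly μ δ.points q).eval (δ.path t) = q.derivative.eval (δ.path t) *
        N.eval (δ.path t) + q.eval (δ.path t) * (N.derivative.eval (δ.path t) - ∑ j, (μ j : ℂ) *
          (Lagrange.nodal (Finset.univ.erase j) δ.points).eval (δ.path t)) := by
      rw [h5, ← Finset.sum_sub_distrib]
      simp only [exactPoly, eval_add, eval_mul, eval_finsetSum, eval_C, ← hN]
      simp only [sub_mul, one_mul]
    rw [h6]
    simp only [derivative_mul, eval_add, eval_mul, Function.comp_apply]
    linear_combination (-(q.eval (δ.path t)) * integrand μ δ k t) * h4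
  have hint := intervalIntegrable_polyIntegral δ hμ (exactPoly μ δ.points q) k
  have := integral_eq_of_hasDerivAt_off_countable G _ s.countable_toSet
    (by rwa [uIcc_of_le hkk]) (by rwa [min_eq_left hkk, max_eq_right hkk]) hint
  rw [polyIntegral, this, hGl, hGr, sub_self]
  rfl

end ExactForms

/-! ### Extending a linear relation between the δ_k from low degree to holomorphic functions. -/

section RowRelations

variable {n : ℕ}

/-- A linear relation between the moments of all polynomials of degree `< n` is a relation
between the moments of all polynomials. -/
theorem sum_polyIntegral_eq_zero {μ : Fin (n + 1) → ℝ} (hn : 0 < n)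
    (hμ : ∀ j, 0 < μ j ∧ μ j < 1) (hint : ∀ m : ℕ, 2 ≤ m → ∑ j, μ j ≠ (m : ℝ))
    (δ : LArcSystem n) {c : Fin n → ℂ}
    (hc : ∀ m < n, ∑ k, c k * polyIntegral μ δ (X ^ m) k = 0) (p : ℂ[X]) :
    ∑ k, c k * polyIntegral μ δ p k = 0 := by
  set ℓ : ℂ[X] →ₗ[ℂ] ℂ :=
    (∑ k, c k • LinearMap.proj k) ∘ₗ polyIntegralMap δ hμ with hℓ
  have hℓa : ∀ p, ℓ p = ∑ k, c k * polyIntegral μ δ p k := fun p => by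
    simp [hℓ, polyIntegralMap]
  rw [← hℓa]
  have hmono : ∀ m, ℓ (X ^ m) = 0 := by
    intro m
    induction m using Nat.strong_induction_on with
    | _ m ih =>
      have hlow : ∀ r : ℂ[X], r.degree < m → ℓ r = 0 := by
        intro r hr
        by_cases hr0 : r = 0
        · rw [hr0, map_zero]
        have hr' : r.natDegree < m := (natDegree_lt_iff_degree_lt hr0).mpr hr
        rw [as_sum_range' r m hr', map_sum]
        refine Finset.sum_eq_zero fun i hi => ?_
        rw [← C_mul_X_pow_eq_monomial, ← smul_eq_C_mul, map_smul, ih i (Finset.mem_range.mp hi),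
          smul_zero]
      by_cases hmn : m < n
      · rw [hℓa]; exact hc m hmn
      obtain ⟨i, rfl⟩ := Nat.exists_eq_add_of_le (not_lt.mp hmn)
      obtain ⟨hd, hcf⟩ := exactPoly_degree_lt μ δ.points i
      set R := exactPoly μ δ.points (X ^ i) with hR
      -- The coefficient is n + 1 + i - |μ|, and n + 1 + i is at least 2 because n is positive; so
      -- it is one of the excluded integers. Hence ζ^(n+i) is a combination of lower powers modulo
      -- an exact form.
      have ha : R.coeff (n + i) ≠ 0 := by
        rw [hcf, sub_ne_zero]
        intro h
        refine hint (n + 1 + i) (by omega) ?_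
        exact_mod_cast h.symm
      have hRz : ℓ R = 0 := by
        rw [hℓa, hR, polyIntegral_exactPoly hμ]
        simp
      have hsub : ℓ (R - C (R.coeff (n + i)) * X ^ (n + i)) = 0 := by
        refine hlow _ ((degree_lt_iff_coeff_zero _ _).mpr fun j hj => ?_)
        rw [coeff_sub, coeff_C_mul_X_pow]
        split_ifs with h
        · rw [h, sub_self]
        · rw [coeff_eq_zero_of_natDegree_lt (by omega), sub_zero]
      rw [map_sub, hRz, ← smul_eq_C_mul, map_smul, zero_sub, neg_eq_zero, smul_eq_mul] at hsub
      exact (mul_eq_zero.mp hsub).resolve_left ha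
  rw [as_sum_range_C_mul_X_pow p, map_sum]
  refine Finset.sum_eq_zero fun i _ => ?_
  rw [← smul_eq_C_mul, map_smul, hmono, smul_zero]

/-- Such a relation extends to holomorphic functions. -/
theorem sum_integral_eq_zero {μ : Fin (n + 1) → ℝ} (hμ : ∀ j, 0 < μ j ∧ μ j < 1)
    (δ : LArcSystem n) {c : Fin n → ℂ} (hc : ∀ p, ∑ k, c k * polyIntegral μ δ p k = 0)
    {R R' : ℝ} (hR : ∀ k : Fin n, ∀ t ∈ Icc ((k : ℕ) : ℝ) ((k : ℕ) + 1),
      δ.path t ∈ Metric.closedBall (0:ℂ) R) (hRR : R < R') {φ : ℂ → ℂ}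
    (hφ : DifferentiableOn ℂ φ (Metric.closedBall 0 R')) :
    ∑ k : Fin n, c k * ∫ t in ((k : ℕ) : ℝ)..((k : ℕ) + 1 : ℝ),
      φ (δ.path t) * (integrand μ δ k t * deriv δ.path t) = 0 := by
  rcases n with _ | n
  · simp
  have hR0 : 0 ≤ R := by
    have := hR 0 0 (by simp)
    exact (norm_nonneg _).trans (mem_closedBall_zero_iff.mp this)
  lift R to NNReal using hR0
  lift R' to NNReal using (R.2.trans hRR.le)
  have hR'0 : 0 < R' := lt_of_le_of_lt R.2 (by exact_mod_cast hRR)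
  have hps := hφ.hasFPowerSeriesOnBall hR'0
  set P := cauchyPowerSeries φ 0 R' with hP
  set S : ℕ → ℂ[X] := fun N => ∑ i ∈ Finset.range N, C (P.coeff i) * X ^ i with hS
  have hSe : ∀ N ζ, (S N).eval ζ = P.partialSum N ζ := by
    intro N ζ
    simp only [hS, eval_finsetSum, eval_mul, eval_C, eval_pow, eval_X,
      FormalMultilinearSeries.partialSum]
    refine Finset.sum_congr rfl fun i _ => ?_
    rw [FormalMultilinearSeries.apply_eq_pow_smul_coeff, smul_eq_mul, mul_comm]
  -- A radius strictly between the two gives an open disc that contains all the arcs and on which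
  -- the Taylor polynomials converge uniformly; dominated convergence passes the relation to the
  -- limit.
  obtain ⟨R₁, hR₁, hR₁'⟩ := exists_between (show R < R' by exact_mod_cast hRR)
  have hunif := hps.tendstoUniformlyOn (r' := R₁) (by exact_mod_cast hR₁')
  rw [Metric.tendstoUniformlyOn_iff] at hunif
  simp only [zero_add] at hunif
  have hlim : ∀ k : Fin (n + 1), Tendsto (fun N => polyIntegral μ δ (S N) k) atTop
      (𝓝 (∫ t in ((k : ℕ) : ℝ)..((k : ℕ) + 1 : ℝ),
        φ (δ.path t) * (integrand μ δ k t * deriv δ.path t))) := by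
    intro k
    have hkk : ((k : ℕ) : ℝ) ≤ (k : ℕ) + 1 := by linarith
    have hball : ∀ t ∈ Icc ((k : ℕ) : ℝ) ((k : ℕ) + 1), δ.path t ∈ Metric.ball (0:ℂ) R₁ :=
      fun t ht => Metric.closedBall_subset_ball (by exact_mod_cast hR₁) (hR k t ht)
    have hφc : ContinuousOn (fun t => φ (δ.path t)) (Icc ((k : ℕ) : ℝ) ((k : ℕ) + 1)) :=
      hφ.continuousOn.comp (δ.continuousOn.mono (arc_Icc_subset k)) fun t ht =>
        Metric.closedBall_subset_closedBall hRR.le (hR k t ht)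
    obtain ⟨C, hC⟩ := isCompact_Icc.exists_bound_of_continuousOn hφc
    have hg := intervalIntegrable_integrand δ hμ k
    refine intervalIntegral.tendsto_integral_filter_of_dominated_convergence
      (fun t => (C + 1) * ‖integrand μ δ k t * deriv δ.path t‖) ?_ ?_ (hg.norm.const_mul _) ?_
    · exact .of_forall fun N => (intervalIntegrable_polyIntegral δ hμ (S N) k).def'.aestronglyMeasurable
    · filter_upwards [hunif 1 one_pos] with N hN
      refine .of_forall fun t ht => ?_
      have ht' : t ∈ Icc ((k : ℕ) : ℝ) ((k : ℕ) + 1) := by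
        rw [uIoc_of_le hkk] at ht
        exact Ioc_subset_Icc_self ht
      rw [norm_mul]
      refine mul_le_mul_of_nonneg_right ?_ (norm_nonneg _)
      have h1 := hN _ (hball t ht')
      rw [← hSe, dist_eq_norm] at h1
      have h2 := norm_sub_norm_le ((S N).eval (δ.path t)) (φ (δ.path t))
      rw [norm_sub_rev] at h2
      linarith [hC t ht']
    · refine .of_forall fun t ht => ?_
      have ht' : t ∈ Icc ((k : ℕ) : ℝ) ((k : ℕ) + 1) := by
        rw [uIoc_of_le hkk] at ht
        exact Ioc_subset_Icc_self ht
      refine Tendsto.mul_const _ ?_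
      rw [Metric.tendsto_nhds]
      intro ε hε
      filter_upwards [hunif ε hε] with N hN
      rw [hSe, dist_comm]
      exact hN _ (hball t ht')
  have h1 : Tendsto (fun N => ∑ k, c k * polyIntegral μ δ (S N) k) atTop
      (𝓝 (∑ k : Fin (n + 1), c k * ∫ t in ((k : ℕ) : ℝ)..((k : ℕ) + 1 : ℝ),
        φ (δ.path t) * (integrand μ δ k t * deriv δ.path t))) :=
    tendsto_finsetSum _ fun k _ => (hlim k).const_mul (c k)
  simp only [hc] at h1
  exact tendsto_nhds_unique h1 tendsto_const_nhds

end RowRelations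

/-! ### Propagation of relations along the arc and invertibility of the moment matrix. -/

section Propagation

variable {n : ℕ} {μ : Fin (n + 1) → ℝ} {Y : Type*} [TopologicalSpace Y] {N : Set Y}
  {δ : Y → LArcSystem n}

theorem contDiffAt_eval_mul_deformFactor (p : ℂ[X]) (z : Fin (n + 1) → ℂ)
    {y : (Fin (n + 1) → ℂ) × ℂ} (hy : ∀ j, ‖(divDiff z j y.1).eval y.2‖ < 1) :
    ContDiffAt ℂ 1 (fun y : (Fin (n + 1) → ℂ) × ℂ =>
      p.eval (y.2 + (interp z y.1).eval y.2) * deformFactor μ z y.1 y.2) y := by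
  refine ContDiffAt.mul ?_ (contDiffAt_deformFactor μ z hy)
  have := (p.contDiff_aeval (𝕜 := ℂ) 1).comp (contDiff_snd.add (contDiff_eval_interp z))
  simp only [Function.comp_def, coe_aeval_eq_eval] at this
  exact this.contDiffAt

theorem IsFamily.tendsto_points_sub (h : IsFamily N δ) {x₀ : Y} (hx₀ : x₀ ∈ N) :
    Tendsto (fun x => (δ x).points - (δ x₀).points) (𝓝[N] x₀) (𝓝 0) := by
  have := (h.continuousOn_points x₀ hx₀).sub_const (δ x₀).points
  simpa [ContinuousWithinAt] using this

/-- Near a given parameter the moments are integrals over one fixed arc whose integrand depends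
differentiably on the displacement of the points. -/
theorem IsFamily.continuousOn_polyIntegral (h : IsFamily N δ) (hμ : ∀ j, 0 < μ j ∧ μ j < 1)
    (p : ℂ[X]) (k : Fin n) : ContinuousOn (fun x => polyIntegral μ (δ x) p k) N := by
  intro x₀ hx₀
  obtain ⟨R, hR⟩ := exists_deform_bound (δ x₀)
  obtain ⟨ε, hε, hb⟩ := Metric.nhds_basis_closedBall.eventually_iff.mp
    (eventually_small (δ x₀).points R one_half_pos)
  have hkk : ((k : ℕ) : ℝ) ≤ (k : ℕ) + 1 := by linarith
  have h1 := (contDiffAt_integral_param (H := fun y : (Fin (n + 1) → ℂ) × ℂ =>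
      p.eval (y.2 + (interp (δ x₀).points y.1).eval y.2) * deformFactor μ (δ x₀).points y.1 y.2)
    hε (isCompact_closedBall (0:ℂ) R)
    (fun y hy => contDiffAt_eval_mul_deformFactor p _ fun j =>
      ((hb hy.1 y.2 hy.2).1 j).trans (by norm_num))
    (p := (δ x₀).path) (by
      rw [uIcc_of_le hkk]; exact (δ x₀).continuousOn.mono (arc_Icc_subset k))
    (by rw [uIcc_of_le hkk]; exact hR k) (intervalIntegrable_integrand (δ x₀) hμ k)).1.continuousAt
  have h2 := h1.tendsto.comp (h.tendsto_points_sub hx₀)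
  have h3 := (h.eventually_integral_eq hx₀ hμ).mono fun x hx => hx k p.eval p.differentiable
  refine Tendsto.congr' (h3.mono fun x hx => hx.symm) ?_
  have h4 : polyIntegral μ (δ x₀) p k = _ := h3.self_of_nhdsWithin hx₀
  beta_reduce
  rw [h4]
  simp only [sub_self]
  exact h2

/-- A moment on a nearby arc is an integral over the arcs of x₀ of p(ζ + q(ζ)) times `deformFactor`.
That function is no longer a polynomial in ζ but is holomorphic on a large disc, so the relation
applies to it. -/
theorem IsFamily.eventually_sum_polyIntegral_eq_zero (h : IsFamily N δ)
    (hμ : ∀ j, 0 < μ j ∧ μ j < 1) {x₀ : Y} (hx₀ : x₀ ∈ N) {c : Fin n → ℂ}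
    (hc : ∀ p, ∑ k, c k * polyIntegral μ (δ x₀) p k = 0) :
    ∀ᶠ x in 𝓝[N] x₀, ∀ p, ∑ k, c k * polyIntegral μ (δ x) p k = 0 := by
  obtain ⟨R, hR⟩ := exists_deform_bound (δ x₀)
  filter_upwards [h.eventually_integral_eq hx₀ hμ, (h.tendsto_points_sub hx₀).eventually
    (eventually_small (δ x₀).points (R + 1) one_half_pos)] with x hx hs p
  set v := (δ x).points - (δ x₀).points with hv
  have h1 : ∀ k, polyIntegral μ (δ x) p k = _ := fun k => hx k p.eval p.differentiable
  simp only [h1]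
  refine sum_integral_eq_zero hμ (δ x₀) hc hR (lt_add_one R)
    (φ := fun ζ => p.eval (ζ + (interp (δ x₀).points v).eval ζ) *
      deformFactor μ (δ x₀).points v ζ) fun ζ hζ => ?_
  have h2 := (contDiffAt_eval_mul_deformFactor (μ := μ) p (δ x₀).points (y := (v, ζ))
    fun j => ((hs ζ hζ).1 j).trans (by norm_num)).differentiableAt one_ne_zero
  exact (DifferentiableAt.comp ζ (f := fun ζ => (v, ζ)) h2 (by fun_prop)).differentiableWithinAt

theorem LArcSystem.exists_isReal_slide (δ : LArcSystem n) : ∃ T, ∀ τ ≥ T, (δ.slide τ).IsReal := by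
  obtain ⟨T, hT⟩ := eventually_atTop.mp δ.eventually_real
  exact ⟨T, fun τ hτ t ht => hT _ (by linarith [le_abs_self τ])⟩

/-- The cycles are linearly independent on polynomials of degree `< n`. -/
theorem LArcSystem.eq_zero_of_sum_eq_zero (hn : 0 < n) (hμ : ∀ j, 0 < μ j ∧ μ j < 1)
    (hint : ∀ m : ℕ, 2 ≤ m → ∑ j, μ j ≠ (m : ℝ)) (δ : LArcSystem n) {c : Fin n → ℂ}
    (hc : ∀ m < n, ∑ k, c k * polyIntegral μ δ (X ^ m) k = 0) : c = 0 := by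
  -- The relation is required for all polynomials, not just those of degree < n, because only this
  -- form is visibly an open condition on τ.
  set S : Set ℝ := {τ | ∀ p, ∑ k, c k * polyIntegral μ (δ.slide τ) p k = 0} with hS
  have hfam := δ.isFamily_slide
  have hopen : IsOpen S := isOpen_iff_mem_nhds.mpr fun τ hτ => by
    have := hfam.eventually_sum_polyIntegral_eq_zero hμ (mem_univ τ) hτ
    rwa [nhdsWithin_univ] at this
  have hclosed : IsClosed S := by
    simp only [hS, ofPred_forall]
    refine isClosed_iInter fun p => isClosed_eq ?_ continuous_const
    exact continuous_finsetSum _ fun k _ => continuous_const.mul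
      (continuousOn_univ.mp (hfam.continuousOn_polyIntegral hμ p k))
  have hne : S.Nonempty := ⟨0, fun p => by
    rw [δ.slide_zero]
    exact sum_polyIntegral_eq_zero hn hμ hint δ hc p⟩
  -- By connectedness of ℝ the relation with the same coefficients c holds after sliding past T,
  -- where the arc is real.
  obtain ⟨T, hT⟩ := δ.exists_isReal_slide
  have hTS : T ∈ S := (IsClopen.eq_univ ⟨hclosed, hopen⟩ hne) ▸ mem_univ T
  exact (hT T le_rfl).eq_zero_of_sum_eq_zero hμ fun m _ => hTS (X ^ m)

/-- A polynomial of degree `< n` is determined by its moments. -/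
theorem eq_zero_of_polyIntegral_eq_zero (hn : 0 < n) (hμ : ∀ j, 0 < μ j ∧ μ j < 1)
    (hint : ∀ m : ℕ, 2 ≤ m → ∑ j, μ j ≠ (m : ℝ)) (δ : LArcSystem n) {p : ℂ[X]}
    (hp : p.degree < n) (h : polyIntegral μ δ p = 0) : p = 0 := by
  by_contra hp0
  set M : Matrix (Fin n) (Fin n) ℂ := fun k m => polyIntegral μ δ (X ^ (m : ℕ)) k with hM
  have hsum : p = ∑ m : Fin n, C (p.coeff m) * X ^ (m : ℕ) := by
    rw [Fin.sum_univ_eq_sum_range (fun i => C (p.coeff i) * X ^ i) n]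
    simp only [C_mul_X_pow_eq_monomial]
    exact as_sum_range' p n ((natDegree_lt_iff_degree_lt hp0).mpr hp)
  have hv0 : (fun m : Fin n => p.coeff m) ≠ 0 := by
    intro h0
    refine hp0 (hsum.trans (Finset.sum_eq_zero fun m _ => ?_))
    rw [show p.coeff m = 0 from congrFun h0 m, C_0, zero_mul]
  have hdet : M.det = 0 := Matrix.exists_mulVec_eq_zero_iff.mp ⟨_, hv0, by
    funext k
    have h1 : polyIntegralMap δ hμ p = 0 := h
    rw [hsum, map_sum] at h1
    have h2 := congrFun h1 k
    rw [Finset.sum_apply] at h2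
    simp only [← smul_eq_C_mul, map_smul, Pi.smul_apply, smul_eq_mul] at h2
    simp only [Matrix.mulVec, dotProduct, Pi.zero_apply]
    rw [← h2.trans (Pi.zero_apply k)]
    exact Finset.sum_congr rfl fun m _ => mul_comm _ _⟩
  obtain ⟨c, hc0, hc⟩ := Matrix.exists_vecMul_eq_zero_iff.mpr hdet
  exact hc0 (δ.eq_zero_of_sum_eq_zero hn hμ hint fun m hm => congrFun hc ⟨m, hm⟩)

theorem F_ne_zero (hn : 0 < n) (hμ : ∀ j, 0 < μ j ∧ μ j < 1)
    (hint : ∀ m : ℕ, 2 ≤ m → ∑ j, μ j ≠ (m : ℝ)) (δ : LArcSystem n) : F μ δ ≠ 0 := by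
  rw [← polyIntegral_one]
  intro h
  refine one_ne_zero (eq_zero_of_polyIntegral_eq_zero hn hμ hint δ ?_ h)
  rw [degree_one]
  exact_mod_cast hn

theorem polyIntegral_C (δ : LArcSystem n) (a : ℂ) : polyIntegral μ δ (C a) = a • F μ δ := by
  funext k
  simp only [polyIntegral, F, eval_C, Pi.smul_apply, smul_eq_mul]
  exact intervalIntegral.integral_const_mul _ _

/-- If q had degree at least 2, the coefficient of `velocityPoly` one degree lower would be (deg q -
|μ|) times a nonzero number, hence nonzero, contradicting constancy. So q is affine and v is its
restriction to the points. -/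
theorem velocityPoly_eq_C {z v : Fin (n + 1) → ℂ} (hz : Function.Injective z)
    (hint : ∀ m : ℕ, 2 ≤ m → ∑ j, μ j ≠ (m : ℝ)) {a : ℂ} (h : velocityPoly μ z v = C a) :
    ∃ b₀ b₁ : ℂ, (v = fun j => b₀ + b₁ * z j) ∧ a = (1 - ∑ j, (μ j : ℂ)) * b₁ := by
  have hd : (interp z v).natDegree ≤ 1 := by
    by_contra hlt
    obtain ⟨d, hd⟩ : ∃ d, (interp z v).natDegree = d + 1 + 1 :=
      ⟨(interp z v).natDegree - 2, by omega⟩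
    have h1 := coeff_velocityPoly (μ := μ) hz v hd
    rw [h, coeff_C, if_neg (Nat.succ_ne_zero d)] at h1
    have h2 : (interp z v).coeff (d + 1 + 1) ≠ 0 := by
      rw [← hd, coeff_natDegree, leadingCoeff_ne_zero]
      rintro h0
      simp [h0] at hd
    have h3 := (mul_eq_zero.mp h1.symm).resolve_right h2
    refine hint (d + 1 + 1) (by omega) ?_
    exact_mod_cast (sub_eq_zero.mp h3).symm
  refine ⟨(interp z v).coeff 0, (interp z v).coeff 1, ?_, ?_⟩
  · funext j
    rw [← eval_interp hz v j, eq_X_add_C_of_natDegree_le_one hd]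
    simp
    ring
  · rcases Nat.lt_or_ge (interp z v).natDegree 1 with h0 | h1
    · have h2 : interp z v = C ((interp z v).coeff 0) := eq_C_of_natDegree_le_zero (by omega)
      have h3 : ∀ j, divDiff z j v = 0 := fun j => by
        rw [divDiff_eq hz, h2]
        exact divByMonic_eq_zero_iff (monic_X_sub_C _) |>.mpr
          (degree_C_le.trans_lt (by simp))
      have h4 : velocityPoly μ z v = 0 := by
        simp only [velocityPoly, h3, mul_zero, Finset.sum_const_zero, sub_zero]
        rw [h2, derivative_C]
      rw [h4] at h
      rw [coeff_eq_zero_of_natDegree_lt h0, mul_zero]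
      exact (C_eq_zero.mp h.symm)
    · have h2 := coeff_velocityPoly (μ := μ) hz v (d := 0) (by omega)
      rw [h, coeff_C_zero] at h2
      simpa using h2

/-- For v = z the interpolation polynomial is ζ itself and all divided differences are 1. The
resulting derivative is Euler's identity for `F`. -/
theorem velocityPoly_self {z : Fin (n + 1) → ℂ} (hz : Function.Injective z) (hn : 0 < n) :
    velocityPoly μ z z = C (1 - ∑ j, (μ j : ℂ)) := by
  have hi : interp z z = X := by
    have : (interp z z : ℂ[X]) = Lagrange.interpolate Finset.univ z (fun i => X.eval (z i)) := by
      simp [interp]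
    rw [this, ← Lagrange.eq_interpolate_of_eval_eq (fun i => (X : ℂ[X]).eval (z i)) hz.injOn ?_
      (fun i _ => rfl)]
    rw [degree_X, Finset.card_univ, Fintype.card_fin]
    exact_mod_cast (by omega : 1 < n + 1)
  have hd : ∀ j, divDiff z j z = 1 := fun j => by
    refine mul_left_cancel₀ (X_sub_C_ne_zero (z j)) ?_
    rw [X_sub_C_mul_divDiff hz, hi, mul_one]
  simp [velocityPoly, hi, hd]

theorem interp_const {z : Fin (n + 1) → ℂ} (hz : Function.Injective z) (b : ℂ) :
    interp z (fun _ => b) = C b := by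
  have : (interp z (fun _ => b) : ℂ[X]) = Lagrange.interpolate Finset.univ z
      (fun i => (C b).eval (z i)) := by simp [interp]
  rw [this, ← Lagrange.eq_interpolate_of_eval_eq
    (fun i => (C b : ℂ[X]).eval (z i)) hz.injOn ?_ (fun i _ => rfl)]
  refine degree_C_le.trans_lt ?_
  rw [Finset.card_univ, Fintype.card_fin]
  exact_mod_cast Nat.succ_pos n

theorem divDiff_const {z : Fin (n + 1) → ℂ} (hz : Function.Injective z) (j : Fin (n + 1)) (b : ℂ) :
    divDiff z j (fun _ => b) = 0 := by
  refine mul_left_cancel₀ (X_sub_C_ne_zero (z j)) ?_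
  rw [X_sub_C_mul_divDiff hz, interp_const hz, mul_zero, sub_self]

theorem velocityPoly_const {z : Fin (n + 1) → ℂ} (hz : Function.Injective z) (b : ℂ) :
    velocityPoly μ z (fun _ => b) = 0 := by
  simp [velocityPoly, interp_const hz, divDiff_const hz]

variable (δ₀ : LArcSystem n)

/-- If the derivative of `F` in the direction `v` is a multiple of `F`, then `v` is an affine
function of the marked points. -/
theorem fderiv_deformIntegral_eq_smul (hn : 0 < n) (hμ : ∀ j, 0 < μ j ∧ μ j < 1)
    (hint : ∀ m : ℕ, 2 ≤ m → ∑ j, μ j ≠ (m : ℝ)) {v : Fin (n + 1) → ℂ} {a : ℂ}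
    (h : fderiv ℂ (deformIntegral μ δ₀) 0 v = a • F μ δ₀) :
    ∃ b₀ b₁ : ℂ, (v = fun j => b₀ + b₁ * δ₀.points j) ∧ a = (1 - ∑ j, (μ j : ℂ)) * b₁ := by
  refine velocityPoly_eq_C δ₀.points_injective hint ?_
  rw [fderiv_deformIntegral _ hμ, ← polyIntegral_C] at h
  have h1 : polyIntegralMap δ₀ hμ (velocityPoly μ δ₀.points v - C a) = 0 := by
    rw [map_sub, sub_eq_zero]
    exact h
  refine sub_eq_zero.mp (eq_zero_of_polyIntegral_eq_zero hn hμ hint δ₀ ?_ h1)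
  refine (degree_sub_le _ _).trans_lt (max_lt (degree_velocityPoly_lt δ₀.points_injective v) ?_)
  exact degree_C_le.trans_lt (by exact_mod_cast hn)

theorem fderiv_deformIntegral_points (hn : 0 < n) (hμ : ∀ j, 0 < μ j ∧ μ j < 1) :
    fderiv ℂ (deformIntegral μ δ₀) 0 δ₀.points = (1 - ∑ j, (μ j : ℂ)) • F μ δ₀ := by
  rw [fderiv_deformIntegral _ hμ, velocityPoly_self δ₀.points_injective hn, polyIntegral_C]

theorem fderiv_deformIntegral_const (hμ : ∀ j, 0 < μ j ∧ μ j < 1) (b : ℂ) :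
    fderiv ℂ (deformIntegral μ δ₀) 0 (fun _ => b) = 0 := by
  rw [fderiv_deformIntegral _ hμ, velocityPoly_const δ₀.points_injective]
  exact (polyIntegralMap δ₀ hμ).map_zero

end Propagation

end Lauricella

namespace Lauricella

open Set Filter Topology MeasureTheory

/-! ### The form in the upper half plane, for the parabolic case. -/

section HalfPlane

variable {n : ℕ} (μ x : Fin (n + 1) → ℝ)

/-- A determination of `∏ (ζ - x_j)^{-μ_j}` in the closed upper half plane, when `∑ μ_j = 1`. -/
def halfPlaneFun (ζ : ℂ) : ℂ :=
  (ζ + Complex.I)⁻¹ * Complex.exp (-∑ j, (μ j : ℂ) * Complex.log ((ζ - x j) / (ζ + Complex.I)))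

theorem add_I_ne_zero {ζ : ℂ} (hζ : 0 ≤ ζ.im) : ζ + Complex.I ≠ 0 := by
  intro h
  have := congrArg Complex.im h
  simp at this
  linarith

/-- If the quotient were a nonpositive real s, then ζ - a = s(ζ + i), whose imaginary part gives Im
ζ = s(Im ζ + 1) ≤ 0; this forces s = 0 and ζ = a. Hence principal logarithms are holomorphic on the
closed half plane apart from the marked points. -/
theorem div_mem_slitPlane {ζ : ℂ} (hζ : 0 ≤ ζ.im) {a : ℝ} (ha : ζ ≠ a) :
    (ζ - a) / (ζ + Complex.I) ∈ Complex.slitPlane := by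
  by_contra h
  rw [Complex.mem_slitPlane_iff_not_le_zero, not_not] at h
  set s := (ζ - a) / (ζ + Complex.I) with hs
  have h1 : ζ - a = s * (ζ + Complex.I) := by rw [hs, div_mul_cancel₀ _ (add_I_ne_zero hζ)]
  obtain ⟨hre, him⟩ := Complex.le_def.mp h
  simp only [Complex.zero_re, Complex.zero_im] at hre him
  have h2 := congrArg Complex.im h1
  simp [him] at h2
  have h3 : s.re = 0 := by nlinarith
  have h4 : s = 0 := Complex.ext h3 him
  rw [h4, zero_mul, sub_eq_zero] at h1
  exact ha h1

theorem differentiableAt_halfPlaneFun {ζ : ℂ} (hζ : 0 ≤ ζ.im) (hx : ∀ j, ζ ≠ x j) :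
    DifferentiableAt ℂ (halfPlaneFun μ x) ζ := by
  have h0 := add_I_ne_zero hζ
  unfold halfPlaneFun
  refine DifferentiableAt.mul (DifferentiableAt.inv (by fun_prop) h0) ?_
  refine DifferentiableAt.cexp (DifferentiableAt.neg (DifferentiableAt.fun_sum fun j _ =>
    DifferentiableAt.const_mul (DifferentiableAt.clog
      (f := fun ζ => (ζ - x j) / (ζ + Complex.I)) ?_ (div_mem_slitPlane hζ (hx j))) _))
  exact DifferentiableAt.div (by fun_prop) (by fun_prop) h0

variable {μ}

/-- The auxiliary powers of ζ + i have total exponent ∑ μ_j = 1 and cancel the prefactor. -/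
theorem norm_halfPlaneFun (h1 : ∑ j, μ j = 1) {ζ : ℂ} (hζ : 0 ≤ ζ.im) (hx : ∀ j, ζ ≠ x j) :
    ‖halfPlaneFun μ x ζ‖ = ∏ j, ‖ζ - x j‖ ^ (-μ j) := by
  have h0 : 0 < ‖ζ + Complex.I‖ := norm_pos_iff.mpr (add_I_ne_zero hζ)
  have h2 : ∀ j, 0 < ‖ζ - x j‖ := fun j => norm_pos_iff.mpr (sub_ne_zero.mpr (hx j))
  have h3 : ∀ j, Real.exp (-(μ j * Real.log (‖ζ - x j‖ / ‖ζ + Complex.I‖))) =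
      ‖ζ - x j‖ ^ (-μ j) * ‖ζ + Complex.I‖ ^ (μ j) := by
    intro j
    rw [Real.log_div (h2 j).ne' h0.ne', Real.rpow_def_of_pos (h2 j), Real.rpow_def_of_pos h0,
      ← Real.exp_add]
    congr 1
    ring
  rw [halfPlaneFun, norm_mul, Complex.norm_exp, norm_inv, Complex.neg_re, Complex.re_sum,
    ← Finset.sum_neg_distrib, Real.exp_sum]
  simp only [Complex.re_ofReal_mul, Complex.log_re, norm_div, h3]
  rw [Finset.prod_mul_distrib, ← Real.rpow_sum_of_pos h0, h1, Real.rpow_one]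
  field_simp

/-- On the real line ζ - x_j has argument 0 to the right of x_j and π to the left. Subtracting the
logarithm of u + i, whose argument lies strictly between 0 and π, keeps the result in the principal
range. -/
theorem halfPlaneFun_ofReal (h1 : ∑ j, μ j = 1) {u : ℝ} (hx : ∀ j, u ≠ x j) :
    halfPlaneFun μ x u = realWeight μ x u *
      Complex.exp (-(Real.pi * ∑ j, if u < x j then μ j else 0 : ℝ) * Complex.I) := by
  have h0 : (u : ℂ) + Complex.I ≠ 0 := add_I_ne_zero (by simp)
  have hlog : ∀ j, Complex.log (((u : ℂ) - x j) / (u + Complex.I)) =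
      (Real.log |u - x j| : ℂ) + (if u < x j then Real.pi else 0 : ℝ) * Complex.I -
        Complex.log (u + Complex.I) := by
    intro j
    have hne : u - x j ≠ 0 := sub_ne_zero.mpr (hx j)
    have harg : 0 < (Complex.log (u + Complex.I)).im ∧ (Complex.log (u + Complex.I)).im < Real.pi := by
      rw [Complex.log_im]
      refine ⟨lt_of_le_of_ne (Complex.arg_nonneg_iff.mpr (by simp)) fun h => ?_,
        lt_of_le_of_ne (Complex.arg_le_pi _) fun h => ?_⟩
      · have := Complex.arg_eq_zero_iff.mp h.symm
        simp at this
      · have := Complex.arg_eq_pi_iff.mp h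
        simp at this
    rw [← Complex.log_exp (x := (Real.log |u - x j| : ℂ) +
      (if u < x j then Real.pi else 0 : ℝ) * Complex.I - Complex.log (u + Complex.I))]
    · congr 1
      rw [Complex.exp_sub, Complex.exp_log h0, Complex.exp_add, ← Complex.ofReal_exp,
        Real.exp_log (abs_pos.mpr hne)]
      congr 1
      split_ifs with h
      · rw [Complex.exp_pi_mul_I, abs_of_neg (by linarith)]
        push_cast
        ring
      · have : 0 < u - x j := lt_of_le_of_ne (by linarith [not_lt.mp h]) hne.symm
        rw [abs_of_pos this]
        simp
    · simp only [Complex.sub_im, Complex.add_im, Complex.ofReal_im, Complex.mul_I_im,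
        Complex.ofReal_re]
      split_ifs <;> linarith [Real.pi_pos]
    · simp only [Complex.sub_im, Complex.add_im, Complex.ofReal_im, Complex.mul_I_im,
        Complex.ofReal_re]
      split_ifs <;> linarith [Real.pi_pos]
  have hs : ∑ j, (μ j : ℂ) * Complex.log (((u : ℂ) - x j) / (u + Complex.I)) =
      ((∑ j, μ j * Real.log |u - x j| : ℝ) : ℂ) +
        (Real.pi * ∑ j, if u < x j then μ j else 0 : ℝ) * Complex.I -
        Complex.log (u + Complex.I) := by
    have h2 : (∑ j, (μ j : ℂ)) = 1 := by exact_mod_cast h1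
    have h3 : ∀ j, (μ j : ℂ) * Complex.log (((u : ℂ) - x j) / (u + Complex.I)) =
        ((μ j * Real.log |u - x j| : ℝ) : ℂ) + ((Real.pi * if u < x j then μ j else 0 : ℝ) : ℂ) *
          Complex.I - μ j * Complex.log (u + Complex.I) := by
      intro j
      rw [hlog j]
      split_ifs <;> push_cast <;> ring
    rw [Finset.sum_congr rfl fun j _ => h3 j, Finset.sum_sub_distrib, Finset.sum_add_distrib,
      ← Finset.sum_mul, ← Finset.sum_mul, h2, one_mul, Finset.mul_sum]
    push_cast
    rfl
  have hw : Real.exp (-∑ j, μ j * Real.log |u - x j|) = realWeight μ x u := by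
    rw [← Finset.sum_neg_distrib, Real.exp_sum]
    refine Finset.prod_congr rfl fun j _ => ?_
    rw [Real.rpow_def_of_pos (abs_pos.mpr (sub_ne_zero.mpr (hx j)))]
    congr 1
    ring
  rw [halfPlaneFun, hs, ← hw, Complex.ofReal_exp, ← Complex.exp_add]
  rw [show -(((∑ j, μ j * Real.log |u - x j| : ℝ) : ℂ) +
      (Real.pi * ∑ j, if u < x j then μ j else 0 : ℝ) * Complex.I - Complex.log (u + Complex.I)) =
    Complex.log (u + Complex.I) + (((-∑ j, μ j * Real.log |u - x j| : ℝ) : ℂ) +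
      -((Real.pi * ∑ j, if u < x j then μ j else 0 : ℝ) : ℂ) * Complex.I) by push_cast; ring,
    Complex.exp_add, Complex.exp_log h0, inv_mul_cancel_left₀ h0]

/-- Each quotient (ζ - x_j)/(ζ + i) is 1 + O(1/|ζ|), so the exponential is 1 + O(1/|ζ|). Subtracting
(ζ + i)⁻¹ removes the part of the form that has a residue at infinity. -/
theorem exists_halfPlaneFun_bound (μ x : Fin (n + 1) → ℝ) : ∃ C R : ℝ, 0 < R ∧ ∀ ζ : ℂ, 0 ≤ ζ.im → R ≤ ‖ζ‖ →
    ‖halfPlaneFun μ x ζ - (ζ + Complex.I)⁻¹‖ ≤ C / ‖ζ‖ ^ 2 := by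
  set B : ℝ := ∑ j, |μ j| * (3 / 2 * ‖(x j : ℂ) + Complex.I‖) with hB
  have hB0 : 0 ≤ B := Finset.sum_nonneg fun j _ => by positivity
  set D : ℝ := ∑ j, ‖(x j : ℂ) + Complex.I‖ with hD
  have hDj : ∀ j, ‖(x j : ℂ) + Complex.I‖ ≤ D := fun j =>
    Finset.single_le_sum (f := fun j => ‖(x j : ℂ) + Complex.I‖) (fun _ _ => norm_nonneg _)
      (Finset.mem_univ j)
  have hD0 : 0 ≤ D := Finset.sum_nonneg fun j _ => norm_nonneg _
  refine ⟨8 * B, 2 * (1 + 2 * D + B), by positivity, fun ζ hζ hR => ?_⟩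
  have hz0 : 0 < ‖ζ‖ := by linarith
  have h0 := add_I_ne_zero hζ
  have hhalf : ‖ζ‖ / 2 ≤ ‖ζ + Complex.I‖ := by
    have := norm_sub_le (ζ + Complex.I) Complex.I
    rw [add_sub_cancel_right, Complex.norm_I] at this
    linarith
  have hw0 : 0 < ‖ζ + Complex.I‖ := norm_pos_iff.mpr h0
  have hlog : ∀ j, ‖Complex.log ((ζ - x j) / (ζ + Complex.I))‖ ≤
      3 / 2 * ‖(x j : ℂ) + Complex.I‖ / ‖ζ + Complex.I‖ := by
    intro j
    have h1 : (ζ - x j) / (ζ + Complex.I) = 1 + -((x j : ℂ) + Complex.I) / (ζ + Complex.I) := by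
      field_simp
      ring
    have h2 : ‖-((x j : ℂ) + Complex.I) / (ζ + Complex.I)‖ =
        ‖(x j : ℂ) + Complex.I‖ / ‖ζ + Complex.I‖ := by rw [norm_div, norm_neg]
    rw [h1, mul_div_assoc, ← h2]
    refine Complex.norm_log_one_add_half_le_self ?_
    rw [h2, div_le_iff₀ hw0]
    linarith [hDj j]
  set S := ∑ j, (μ j : ℂ) * Complex.log ((ζ - x j) / (ζ + Complex.I)) with hS
  have hSn : ‖S‖ ≤ B / ‖ζ + Complex.I‖ := by
    refine (norm_sum_le _ _).trans ?_
    rw [hB, Finset.sum_div]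
    refine Finset.sum_le_sum fun j _ => ?_
    rw [norm_mul, Complex.norm_real, Real.norm_eq_abs, mul_div_assoc]
    exact mul_le_mul_of_nonneg_left (hlog j) (abs_nonneg _)
  have hS1 : ‖-S‖ ≤ 1 := by
    rw [norm_neg]
    refine hSn.trans ((div_le_one hw0).mpr ?_)
    linarith
  have h3 : halfPlaneFun μ x ζ - (ζ + Complex.I)⁻¹ =
      (ζ + Complex.I)⁻¹ * (Complex.exp (-S) - 1) := by
    rw [halfPlaneFun, ← hS]
    ring
  rw [h3, norm_mul, norm_inv]
  have h4 := Complex.norm_exp_sub_one_le hS1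
  rw [norm_neg] at h4
  calc ‖ζ + Complex.I‖⁻¹ * ‖Complex.exp (-S) - 1‖
      ≤ ‖ζ + Complex.I‖⁻¹ * (2 * (B / ‖ζ + Complex.I‖)) := by gcongr; linarith
    _ = 2 * B / ‖ζ + Complex.I‖ ^ 2 := by field_simp
    _ ≤ 2 * B / (‖ζ‖ / 2) ^ 2 := by gcongr
    _ = 8 * B / ‖ζ‖ ^ 2 := by field_simp; ring

end HalfPlane

/-! ### The integral along the real line and the relation ∑ Im(w_k) F_k = π for real points. -/

section HalfPlaneIntegral

variable {n : ℕ} {μ x : Fin (n + 1) → ℝ}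

theorem norm_inv_add_I_le {ζ : ℂ} (hζ : 0 ≤ ζ.im) : ‖(ζ + Complex.I)⁻¹‖ ≤ 1 := by
  rw [norm_inv]
  refine inv_le_one_of_one_le₀ (le_trans ?_ (Complex.abs_im_le_norm _))
  simp only [Complex.add_im, Complex.I_im]
  exact (by linarith : (1:ℝ) ≤ ζ.im + 1).trans (le_abs_self _)

theorem ofReal_add_im (u ε : ℝ) : ((u : ℂ) + ε * Complex.I).im = ε := by simp

/-- Cauchy's theorem on the rectangle with corners -T + iε and T + iT: the top side contributes at
most 2C/T and the vertical sides at most C/T each. -/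
theorem norm_rect_integral_le {g : ℂ → ℂ} {C T ε : ℝ} (hε : 0 < ε) (hT : ε < T)
    (hg : ∀ ζ : ℂ, 0 < ζ.im → DifferentiableAt ℂ g ζ)
    (hb : ∀ ζ : ℂ, 0 ≤ ζ.im → T ≤ ‖ζ‖ → ‖g ζ‖ ≤ C / ‖ζ‖ ^ 2) :
    ‖∫ u in (-T)..T, g (u + ε * Complex.I)‖ ≤ 4 * C / T := by
  have hT0 : 0 < T := hε.trans hT
  have hC : 0 ≤ C := by
    have h1 := (norm_nonneg _).trans (hb (T : ℂ) (by simp)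
      (by rw [Complex.norm_real, Real.norm_of_nonneg hT0.le]))
    rw [Complex.norm_real, Real.norm_of_nonneg hT0.le] at h1
    by_contra hneg
    have := div_neg_of_neg_of_pos (not_le.mp hneg) (by positivity : 0 < T ^ 2)
    linarith
  have hb' : ∀ ζ : ℂ, 0 ≤ ζ.im → T ≤ ‖ζ‖ → ‖g ζ‖ ≤ C / T ^ 2 := fun ζ h1 h2 =>
    (hb ζ h1 h2).trans (by gcongr)
  have hrect := Complex.integral_boundary_rect_eq_zero_of_differentiableOn g
    (⟨-T, ε⟩ : ℂ) ⟨T, T⟩ (by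
      intro ζ hζ
      have h1 : ζ.im ∈ uIcc ε T := hζ.2
      rw [uIcc_of_le hT.le] at h1
      exact (hg ζ (hε.trans_le h1.1)).differentiableWithinAt)
  simp only at hrect
  have htop : ‖∫ u in (-T)..T, g (u + T * Complex.I)‖ ≤ C / T ^ 2 * |T - -T| := by
    refine intervalIntegral.norm_integral_le_of_norm_le_const fun u _ => ?_
    refine hb' _ (by simpa using hT0.le) (le_trans ?_ (Complex.abs_im_le_norm _))
    rw [ofReal_add_im]
    exact le_abs_self T
  have hside : ∀ s : ℝ, |s| = T → ‖∫ y in ε..T, g (s + y * Complex.I)‖ ≤ C / T ^ 2 * |T - ε| := by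
    intro s hs
    refine intervalIntegral.norm_integral_le_of_norm_le_const fun y hy => ?_
    rw [uIoc_of_le hT.le] at hy
    refine hb' _ (by rw [ofReal_add_im]; linarith [hy.1]) (le_trans ?_ (Complex.abs_re_le_norm _))
    simp [hs]
  have h1 := hside T (abs_of_pos hT0)
  have h2 := hside (-T) (by rw [abs_neg, abs_of_pos hT0])
  have h3 : (∫ u in (-T)..T, g (u + ε * Complex.I)) = (∫ u in (-T)..T, g (u + T * Complex.I)) -
      Complex.I • (∫ y in ε..T, g (T + y * Complex.I)) +
      Complex.I • ∫ y in ε..T, g ((-T : ℝ) + y * Complex.I) := by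
    linear_combination hrect
  have h4 : C / T ^ 2 * |T - -T| = 2 * C / T := by
    rw [abs_of_pos (by linarith)]
    field_simp
    ring
  have h5 : C / T ^ 2 * |T - ε| ≤ C / T := by
    rw [abs_of_pos (by linarith), div_mul_eq_mul_div, div_le_div_iff₀ (by positivity) hT0]
    nlinarith [mul_nonneg hC hε.le, mul_nonneg (mul_nonneg hC hε.le) hT0.le]
  rw [h3]
  refine (norm_add_le _ _).trans ((add_le_add_left (norm_sub_le _ _) _).trans ?_)
  rw [norm_smul, norm_smul, Complex.norm_I, one_mul, one_mul]
  have h6 : 4 * C / T = 2 * C / T + C / T + C / T := by ring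
  linarith

theorem norm_halfPlaneFun_le (hμ : ∀ j, 0 < μ j ∧ μ j < 1) (h1 : ∑ j, μ j = 1) {u ε : ℝ}
    (hε : 0 ≤ ε) (hu : ∀ j, u ≠ x j) :
    ‖halfPlaneFun μ x (u + ε * Complex.I)‖ ≤ realWeight μ x u := by
  have hre : ∀ j, |u - x j| ≤ ‖(u : ℂ) + ε * Complex.I - x j‖ := fun j => by
    refine le_trans (le_of_eq ?_) (Complex.abs_re_le_norm _)
    simp
  have hpos : ∀ j, 0 < |u - x j| := fun j => abs_pos.mpr (sub_ne_zero.mpr (hu j))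
  rw [norm_halfPlaneFun x h1 (by rwa [ofReal_add_im]) fun j h =>
    norm_pos_iff.mp ((hpos j).trans_le (hre j)) (sub_eq_zero.mpr h)]
  exact Finset.prod_le_prod (fun j _ => Real.rpow_nonneg (norm_nonneg _) _) fun j _ =>
    Real.rpow_le_rpow_of_nonpos (hpos j) (hre j) (by linarith [(hμ j).1])

theorem ae_ne (x : Fin (n + 1) → ℝ) : ∀ᵐ u : ℝ, ∀ j, u ≠ x j :=
  ae_all_iff.mpr fun j => (measure_eq_zero_iff_ae_notMem.mp (Real.volume_singleton (a := x j)))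

theorem measurable_halfPlaneFun (μ x : Fin (n + 1) → ℝ) : Measurable (halfPlaneFun μ x) := by
  unfold halfPlaneFun
  fun_prop

theorem intervalIntegrable_halfPlaneFun_sub (hμ : ∀ j, 0 < μ j ∧ μ j < 1) (h1 : ∑ j, μ j = 1)
    (hx : Function.Injective x) (a b : ℝ) {ε : ℝ} (hε : 0 ≤ ε) :
    IntervalIntegrable (fun u : ℝ => halfPlaneFun μ x (u + ε * Complex.I) -
      ((u : ℂ) + ε * Complex.I + Complex.I)⁻¹) volume a b := by
  have hm := measurable_halfPlaneFun μ x
  refine ((intervalIntegrable_realWeight hμ hx a b).add (intervalIntegrable_const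
    (c := (1:ℝ)))).mono_fun' (Measurable.aestronglyMeasurable (by fun_prop)) ?_
  refine ae_restrict_of_ae ((ae_ne x).mono fun u hu => ?_)
  exact (norm_sub_le _ _).trans (add_le_add (norm_halfPlaneFun_le hμ h1 hε hu)
    (norm_inv_add_I_le (by rwa [ofReal_add_im])))

/-- The estimate holds on every line of small height ε > 0. Moving off the axis only increases the
distances to the x_j, so the real weight dominates and ε may tend to 0 across the singularities. -/
theorem norm_integral_halfPlaneFun_le (hμ : ∀ j, 0 < μ j ∧ μ j < 1) (h1 : ∑ j, μ j = 1)
    (hx : Function.Injective x) : ∃ C R : ℝ, ∀ T ≥ R,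
      ‖∫ u in (-T)..T, (halfPlaneFun μ x u - ((u : ℂ) + Complex.I)⁻¹)‖ ≤ 4 * C / T := by
  obtain ⟨C, R, hR, hb⟩ := exists_halfPlaneFun_bound μ x
  refine ⟨C, R, fun T hT => ?_⟩
  have hT0 : 0 < T := hR.trans_le hT
  set g : ℂ → ℂ := fun ζ => halfPlaneFun μ x ζ - (ζ + Complex.I)⁻¹ with hg
  have hgd : ∀ ζ : ℂ, 0 ≤ ζ.im → (∀ j, ζ ≠ x j) → DifferentiableAt ℂ g ζ := fun ζ hζ hzx =>
    (differentiableAt_halfPlaneFun μ x hζ hzx).sub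
      (DifferentiableAt.inv (by fun_prop) (add_I_ne_zero hζ))
  have hlim : Tendsto (fun ε : ℝ => ∫ u in (-T)..T, g (u + ε * Complex.I)) (𝓝[>] 0)
      (𝓝 (∫ u in (-T)..T, g u)) := by
    refine intervalIntegral.tendsto_integral_filter_of_dominated_convergence
      (fun u => realWeight μ x u + 1) ?_ ?_ ((intervalIntegrable_realWeight hμ hx _ _).add
        intervalIntegrable_const) ?_
    · filter_upwards [self_mem_nhdsWithin] with ε hε
      exact (intervalIntegrable_halfPlaneFun_sub hμ h1 hx _ _
        (le_of_lt hε)).def'.aestronglyMeasurable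
    · filter_upwards [self_mem_nhdsWithin] with ε hε
      refine (ae_ne x).mono fun u hu _ => ?_
      exact (norm_sub_le _ _).trans (add_le_add (norm_halfPlaneFun_le hμ h1 (le_of_lt hε) hu)
        (norm_inv_add_I_le (by rw [ofReal_add_im]; exact le_of_lt hε)))
    · refine (ae_ne x).mono fun u hu _ => ?_
      have hc : ContinuousAt g ((u : ℂ) + (0:ℝ) * Complex.I) := by
        refine (hgd _ (by simp) fun j h => hu j ?_).continuousAt
        simpa using h
      have h2 : ContinuousAt (fun ε : ℝ => g (u + ε * Complex.I)) 0 :=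
        ContinuousAt.comp (f := fun ε : ℝ => (u : ℂ) + ε * Complex.I) hc (by fun_prop)
      have h3 := h2.tendsto.mono_left (nhdsWithin_le_nhds (s := Ioi 0))
      simpa using h3
  refine le_of_tendsto hlim.norm ?_
  filter_upwards [Ioo_mem_nhdsGT hT0] with ε hε
  refine norm_rect_integral_le hε.1 hε.2 (fun ζ hζ => hgd ζ hζ.le fun j h => ?_) fun ζ h2 h3 =>
    hb ζ h2 (hT.trans h3)
  rw [h] at hζ
  simp at hζ

theorem sum_integral_succ {h : ℝ → ℝ} (hh : ∀ a b, IntervalIntegrable h volume a b)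
    (x : Fin (n + 1) → ℝ) : ∑ k : Fin n, ∫ u in x k.castSucc..x k.succ, h u =
      ∫ u in x 0..x (Fin.last n), h u := by
  set a : ℕ → ℝ := fun i => if hi : i < n + 1 then x ⟨i, hi⟩ else 0 with ha
  have h1 := intervalIntegral.sum_integral_adjacent_intervals (f := h) (μ := volume) (a := a)
    (n := n) fun k _ => hh _ _
  rw [← Fin.sum_univ_eq_sum_range (fun k => ∫ u in a k..a (k + 1), h u)] at h1
  have h2 : a 0 = x 0 := by simp [ha]
  have h3 : a n = x (Fin.last n) := by simp [ha, Fin.last]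
  rw [h2, h3] at h1
  rw [← h1]
  refine Finset.sum_congr rfl fun k _ => ?_
  have h4 : a k = x k.castSucc := by
    simp only [ha]; rw [dif_pos (by omega)]; rfl
  have h5 : a (k + 1) = x k.succ := by
    simp only [ha]; rw [dif_pos (by omega)]; rfl
  rw [h4, h5]

theorem w_im (k : Fin n) : (w μ k).im = Real.sin (Real.pi * ∑ j ∈ Finset.Iic k.castSucc, μ j) := by
  rw [w, show Complex.I * Real.pi * ∑ j ∈ Finset.Iic k.castSucc, (μ j : ℂ) =
    ((Real.pi * ∑ j ∈ Finset.Iic k.castSucc, μ j : ℝ) : ℂ) * Complex.I by push_cast; ring,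
    Complex.exp_ofReal_mul_I_im]

/-- The linear relation between the integrals along the real axis when `∑ μ_j = 1`. -/
theorem sum_im_w_mul_integral (hμ : ∀ j, 0 < μ j ∧ μ j < 1) (h1 : ∑ j, μ j = 1)
    (hx : StrictMono x) :
    ∑ k : Fin n, (w μ k).im * ∫ u in x k.castSucc..x k.succ, realWeight μ x u = Real.pi := by
  set S := ∑ k : Fin n, (w μ k).im * ∫ u in x k.castSucc..x k.succ, realWeight μ x u with hS
  -- The total weight to the right of u; -π s(u) is the argument of the boundary value at u, so h is
  -- minus its imaginary part.
  set s : ℝ → ℝ := fun u => ∑ j, if u < x j then μ j else 0 with hs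
  set h : ℝ → ℝ := fun u => realWeight μ x u * Real.sin (Real.pi * s u) with hh
  have hsm : Measurable s := Finset.measurable_fun_sum _ fun j _ =>
    Measurable.ite (measurableSet_lt measurable_id measurable_const) measurable_const
      measurable_const
  have hint : ∀ a b, IntervalIntegrable h volume a b := by
    intro a b
    have hw := intervalIntegrable_realWeight hμ hx.injective a b
    refine hw.norm.mono_fun (hw.def'.aestronglyMeasurable.mul
      (by fun_prop : Measurable fun u => Real.sin (Real.pi * s u)).aestronglyMeasurable) ?_
    refine .of_forall fun u => ?_
    simp only [hh, norm_mul, norm_norm]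
    exact mul_le_of_le_one_right (norm_nonneg _) (Real.abs_sin_le_one _)
  have hmid : ∀ k : Fin n, (w μ k).im * ∫ u in x k.castSucc..x k.succ, realWeight μ x u =
      ∫ u in x k.castSucc..x k.succ, h u := by
    intro k
    rw [← intervalIntegral.integral_const_mul]
    have hk : x k.castSucc ≤ x k.succ := (hx Fin.castSucc_lt_succ).le
    rw [intervalIntegral.integral_of_le hk, intervalIntegral.integral_of_le hk,
      integral_Ioc_eq_integral_Ioo, integral_Ioc_eq_integral_Ioo]
    refine setIntegral_congr_fun measurableSet_Ioo fun u hu => ?_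
    -- In the k-th gap s is complementary to the sum in w_k, and sin(π(1 - σ)) = sin(πσ) produces Im
    -- w_k. Outside the gaps s is 0 or 1 and h vanishes.
    have h2 : s u = 1 - ∑ j ∈ Finset.Iic k.castSucc, μ j := by
      have h3 : ∀ j, (if u < x j then μ j else 0) = μ j - if j ∈ Finset.Iic k.castSucc then μ j else 0 := by
        intro j
        by_cases hj : j ≤ k.castSucc
        · rw [if_neg (not_lt.mpr ((hx.monotone hj).trans hu.1.le)),
            if_pos (Finset.mem_Iic.mpr hj), sub_self]
        · have hj' : k.succ ≤ j := by
            rw [← Fin.castSucc_lt_iff_succ_le]; exact not_le.mp hj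
          rw [if_pos (hu.2.trans_le (hx.monotone hj')),
            if_neg (fun h => hj (Finset.mem_Iic.mp h)), sub_zero]
      simp only [hs]
      rw [Finset.sum_congr rfl fun j _ => h3 j, Finset.sum_sub_distrib, h1, Finset.sum_ite_mem,
        Finset.univ_inter]
    simp only [hh, h2, w_im]
    rw [mul_sub, mul_one, Real.sin_pi_sub, mul_comm]
  have hS' : S = ∫ u in x 0..x (Fin.last n), h u := by
    rw [hS, Finset.sum_congr rfl fun k _ => hmid k, sum_integral_succ hint]
  have hout : ∀ u, u < x 0 ∨ x (Fin.last n) < u → h u = 0 := by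
    rintro u (hu | hu)
    · have : s u = 1 := by
        simp only [hs]
        rw [← h1]
        exact Finset.sum_congr rfl fun j _ => if_pos (hu.trans_le (hx.monotone (Fin.zero_le j)))
      simp [hh, this]
    · have : s u = 0 := Finset.sum_eq_zero fun j _ =>
        if_neg (not_lt.mpr ((hx.monotone (Fin.le_last j)).trans hu.le))
      simp [hh, this]
  obtain ⟨C, R, hC⟩ := norm_integral_halfPlaneFun_le hμ h1 hx.injective
  -- The imaginary part of (u + i)⁻¹ is -1/(1 + u²), which integrates to -2 arctan T; in the limit
  -- this is the source of π.
  have hkey : ∀ T, R ≤ T → -T < x 0 → x (Fin.last n) < T → |2 * Real.arctan T - S| ≤ 4 * C / T := by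
    intro T hT hT0 hTn
    refine le_trans (le_of_eq ?_) ((Complex.abs_im_le_norm _).trans (hC T hT))
    have hI : IntervalIntegrable (fun u : ℝ => halfPlaneFun μ x u - ((u : ℂ) + Complex.I)⁻¹)
        volume (-T) T := by
      simpa using intervalIntegrable_halfPlaneFun_sub hμ h1 hx.injective (-T) T le_rfl
    have him : (∫ u in (-T)..T, (halfPlaneFun μ x u - ((u : ℂ) + Complex.I)⁻¹)).im =
        ∫ u in (-T)..T, (halfPlaneFun μ x u - ((u : ℂ) + Complex.I)⁻¹).im :=
      (Complex.imCLM.intervalIntegral_comp_comm hI).symm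
    have hval : ∫ u in (-T)..T, (halfPlaneFun μ x u - ((u : ℂ) + Complex.I)⁻¹).im =
        ∫ u in (-T)..T, (1 / (1 + u ^ 2) - h u) := by
      refine intervalIntegral.integral_congr_ae ((ae_ne x).mono fun u hu _ => ?_)
      rw [Complex.sub_im, halfPlaneFun_ofReal x h1 hu, Complex.im_ofReal_mul,
        ← Complex.ofReal_neg, Complex.exp_ofReal_mul_I_im, Real.sin_neg, Complex.inv_im]
      simp only [hh, hs, Complex.normSq_apply, Complex.add_re, Complex.add_im, Complex.ofReal_re,
        Complex.ofReal_im, Complex.I_re, Complex.I_im]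
      ring
    have h2 : ∫ u in (-T)..T, h u = S := by
      rw [← intervalIntegral.integral_add_adjacent_intervals (hint (-T) (x 0)) (hint (x 0) T),
        ← intervalIntegral.integral_add_adjacent_intervals (hint (x 0) (x (Fin.last n)))
          (hint (x (Fin.last n)) T), ← hS']
      rw [intervalIntegral.integral_of_le hT0.le, intervalIntegral.integral_of_le hTn.le,
        integral_Ioc_eq_integral_Ioo, setIntegral_eq_zero_of_forall_eq_zero fun u hu =>
          hout u (Or.inl hu.2), setIntegral_eq_zero_of_forall_eq_zero fun u hu =>
          hout u (Or.inr hu.1)]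
      ring
    rw [him, hval, intervalIntegral.integral_sub _ (hint _ _), h2, integral_one_div_one_add_sq,
      Real.arctan_neg]
    · congr 1; ring
    · exact (Continuous.div continuous_const (by fun_prop) fun u => by positivity).intervalIntegrable _ _
  have hlim : Tendsto (fun T => |2 * Real.arctan T - S|) atTop (𝓝 0) := by
    refine squeeze_zero' (.of_forall fun T => abs_nonneg _) ?_
      (tendsto_id.const_div_atTop (4 * C))
    filter_upwards [eventually_ge_atTop R, eventually_gt_atTop (-x 0),
      eventually_gt_atTop (x (Fin.last n))] with T h2 h3 h4
    exact hkey T h2 (by linarith) h4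
  have hlim' : Tendsto (fun T => |2 * Real.arctan T - S|) atTop (𝓝 |2 * (Real.pi / 2) - S|) :=
    (((Real.tendsto_arctan_atTop.mono_right nhdsWithin_le_nhds).const_mul 2).sub_const S).abs
  have h3 := tendsto_nhds_unique hlim' hlim
  have := abs_eq_zero.mp h3
  linarith

end HalfPlaneIntegral

/-! ### The parabolic relation for arbitrary arcs. -/

section Parabolic

variable {n : ℕ} {μ : Fin (n + 1) → ℝ}

/-- The linear form defining the parabolic hyperplane. -/
def parabolicForm (μ : Fin (n + 1) → ℝ) : (Fin n → ℂ) →L[ℂ] ℂ :=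
  ∑ k, ((w μ k).im : ℂ) • ContinuousLinearMap.proj k

theorem parabolicForm_apply (y : Fin n → ℂ) :
    parabolicForm μ y = ∑ k, ((w μ k).im : ℂ) * y k := by
  simp [parabolicForm, sum_apply]

theorem mem_parabolicHyperplane {y : Fin n → ℂ} :
    y ∈ parabolicHyperplane μ ↔ parabolicForm μ y = Real.pi := by
  rw [parabolicForm_apply]
  rfl

theorem LArcSystem.IsReal.parabolicForm_F {δ : LArcSystem n} (h : δ.IsReal)
    (hμ : ∀ j, 0 < μ j ∧ μ j < 1) (h1 : ∑ j, μ j = 1) : parabolicForm μ (F μ δ) = Real.pi := by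
  rw [parabolicForm_apply, ← sum_im_w_mul_integral hμ h1 h.points_lt]
  push_cast
  refine Finset.sum_congr rfl fun k _ => ?_
  rw [← polyIntegral_one, h.polyIntegral_eq, ← intervalIntegral.integral_ofReal]
  simp

/-- Change of base point in the local form of the Lauricella map. -/
theorem IsFamily.eventually_deformIntegral_eq {X : Type*} [TopologicalSpace X] {N : Set X}
    {δ : X → LArcSystem n} (h : IsFamily N δ) {x₀ : X} (hx₀ : x₀ ∈ N)
    (hμ : ∀ j, 0 < μ j ∧ μ j < 1) :
    ∀ᶠ x in 𝓝[N] x₀, ∀ᶠ v in 𝓝 0, deformIntegral μ (δ x) v =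
      deformIntegral μ (δ x₀) ((δ x).points - (δ x₀).points + v) := by
  obtain ⟨r, δ', hr, hfam, h0, hpt, -⟩ := h.exists_move hx₀
  have hmem : ∀ x ∈ N, (x, (0 : Fin (n + 1) → ℂ)) ∈ N ×ˢ Metric.ball 0 r := fun x hx =>
    ⟨hx, Metric.mem_ball_self hr⟩
  have hball : 𝓝[Metric.ball (0 : Fin (n + 1) → ℂ) r] 0 = 𝓝 0 :=
    Metric.isOpen_ball.nhdsWithin_eq (Metric.mem_ball_self hr)
  -- The same moved arc over (x, v) is expressed twice through the local form, once with base point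
  -- x₀ and once with base point x; comparing the two gives the claim.
  have E := fun x hx => hfam.eventually_F_eq (hmem x hx) hμ
  simp only [nhdsWithin_prod_eq, hball, h0] at E
  filter_upwards [(E x₀ hx₀).curry, hpt, self_mem_nhdsWithin] with x e1 e2 hxN
  have e3 := (E x hxN).curry.self_of_nhdsWithin hxN
  filter_upwards [e1, e3, Metric.ball_mem_nhds 0 hr] with v e4 e5 hv
  rw [e2 v hv] at e4 e5
  rw [← show F μ (δ' (x, v)) = deformIntegral μ (δ x) v by
    rw [e5]; congr 1; abel, e4]
  congr 1
  abel

/-- On the complex line through a and b the set U cuts out a convex, hence connected, open set, so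
the identity theorem in one variable suffices. -/
theorem eqOn_of_eventuallyEq_of_convex {E : Type*} [NormedAddCommGroup E] [NormedSpace ℂ E]
    {f : E → ℂ} {U : Set E} (hU : IsOpen U) (hc : Convex ℝ U) (hf : DifferentiableOn ℂ f U)
    {a : E} {c : ℂ} (ha : a ∈ U) (hfa : ∀ᶠ x in 𝓝 a, f x = c) : ∀ x ∈ U, f x = c := by
  intro b hb
  set ℓ : ℂ → E := fun s => a + s • (b - a) with hℓ
  have hℓd : Differentiable ℂ ℓ := by simp only [hℓ]; fun_prop
  have hℓc : Continuous ℓ := hℓd.continuous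
  have hconv : Convex ℝ (ℓ ⁻¹' U) := by
    intro s hs t ht p q hp hq hpq
    have : ℓ (p • s + q • t) = p • ℓ s + q • ℓ t := by
      simp only [hℓ, smul_add, add_smul, smul_assoc]
      nth_rewrite 1 [← one_smul ℝ a, ← hpq]
      rw [add_smul]
      abel
    rw [mem_preimage, this]
    exact hc hs ht hp hq hpq
  have han : AnalyticOnNhd ℂ (f ∘ ℓ) (ℓ ⁻¹' U) :=
    (hf.comp hℓd.differentiableOn fun _ h => h).analyticOnNhd (hU.preimage hℓc)
  have h0 : ℓ 0 = a := by simp [hℓ]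
  have h1 : ℓ 1 = b := by simp [hℓ]
  have hev : f ∘ ℓ =ᶠ[𝓝 0] fun _ => c := by
    have : Tendsto ℓ (𝓝 0) (𝓝 a) := h0 ▸ hℓc.tendsto 0
    exact this.eventually hfa
  have := han.eqOn_of_preconnected_of_eventuallyEq analyticOnNhd_const hconv.isPreconnected
    (by rw [mem_preimage, h0]; exact ha) hev (x := 1) (by rw [mem_preimage, h1]; exact hb)
  simpa [h1] using this

/-- Write v = a + i b with a and b real. The function s ↦ f(a + s b) is constant at the real points
s = 1/(m + 1), which accumulate at 0, hence also at s = i. -/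
theorem eq_of_eq_on_real {f : (Fin (n + 1) → ℂ) → ℂ} {r : ℝ} (hr : 0 < r)
    (hf : DifferentiableOn ℂ f (Metric.ball 0 r)) {c : ℂ}
    (h : ∀ v ∈ Metric.ball (0 : Fin (n + 1) → ℂ) r, (∀ j, (v j).im = 0) → f v = c) :
    ∀ᶠ v in 𝓝 0, f v = c := by
  filter_upwards [Metric.ball_mem_nhds 0 (by positivity : 0 < r / 4)] with v hv
  set a : Fin (n + 1) → ℂ := fun j => ((v j).re : ℂ) with ha
  set b : Fin (n + 1) → ℂ := fun j => ((v j).im : ℂ) with hb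
  have hvn : ‖v‖ < r / 4 := mem_ball_zero_iff.mp hv
  have han : ‖a‖ ≤ ‖v‖ := (pi_norm_le_iff_of_nonneg (norm_nonneg _)).mpr fun j => by
    rw [ha, Complex.norm_real]
    exact (Complex.abs_re_le_norm _).trans (norm_le_pi_norm v j)
  have hbn : ‖b‖ ≤ ‖v‖ := (pi_norm_le_iff_of_nonneg (norm_nonneg _)).mpr fun j => by
    rw [hb, Complex.norm_real]
    exact (Complex.abs_im_le_norm _).trans (norm_le_pi_norm v j)
  set ℓ : ℂ → Fin (n + 1) → ℂ := fun s => a + s • b with hℓ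
  have hℓd : Differentiable ℂ ℓ := by simp only [hℓ]; fun_prop
  have hmaps : MapsTo ℓ (Metric.ball 0 2) (Metric.ball 0 r) := by
    intro s hs
    rw [mem_ball_zero_iff] at hs ⊢
    refine (norm_add_le _ _).trans_lt ?_
    rw [norm_smul]
    have : ‖s‖ * ‖b‖ ≤ 2 * ‖v‖ := by gcongr
    linarith
  have hA : AnalyticOnNhd ℂ (f ∘ ℓ) (Metric.ball 0 2) :=
    (hf.comp hℓd.differentiableOn hmaps).analyticOnNhd Metric.isOpen_ball
  have hfreq : ∃ᶠ s in 𝓝[≠] (0:ℂ), (f ∘ ℓ) s = (fun _ => c) s := by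
    have h1 : Tendsto (fun m : ℕ => (((m : ℝ) + 1)⁻¹ : ℂ)) atTop (𝓝[≠] (0:ℂ)) := by
      refine tendsto_nhdsWithin_iff.mpr ⟨?_, .of_forall fun m => ?_⟩
      · have h2 := (tendsto_one_div_add_atTop_nhds_zero_nat (𝕜 := ℝ)).ofReal
        simpa using h2
      · have : ((m : ℝ) + 1 : ℂ) ≠ 0 := by exact_mod_cast Nat.succ_ne_zero m
        exact inv_ne_zero this
    refine h1.frequently (Frequently.of_forall fun m => ?_)
    have hn : ‖(((m : ℝ) + 1)⁻¹ : ℂ)‖ < 2 := by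
      have h3 : (((m : ℝ) + 1)⁻¹ : ℂ) = (((m : ℝ) + 1)⁻¹ : ℝ) := by push_cast; rfl
      rw [h3, Complex.norm_real, Real.norm_of_nonneg (by positivity)]
      have : ((m : ℝ) + 1)⁻¹ ≤ 1 := inv_le_one_of_one_le₀ (by
        have := Nat.cast_nonneg (α := ℝ) m
        linarith)
      linarith
    refine h _ (hmaps (mem_ball_zero_iff.mpr hn)) fun j => ?_
    have h3 : (((m : ℝ) + 1)⁻¹ : ℂ) = (((m : ℝ) + 1)⁻¹ : ℝ) := by push_cast; rfl
    simp only [hℓ, ha, hb, h3, Pi.add_apply, Pi.smul_apply, smul_eq_mul, Complex.add_im,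
      Complex.ofReal_im, Complex.im_ofReal_mul]
    simp
  have := hA.eqOn_of_preconnected_of_frequently_eq analyticOnNhd_const
    (convex_ball 0 2).isPreconnected (Metric.mem_ball_self two_pos) hfreq
    (x := Complex.I) (by rw [mem_ball_zero_iff, Complex.norm_I]; norm_num)
  have hv' : ℓ Complex.I = v := by
    funext j
    simp only [hℓ, ha, hb, Pi.add_apply, Pi.smul_apply, smul_eq_mul]
    rw [mul_comm]
    exact Complex.re_add_im (v j)
  rw [← hv']
  exact this

/-- The linear relation holds for all arcs near `δ`. -/
def IsGood (μ : Fin (n + 1) → ℝ) (δ : LArcSystem n) : Prop :=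
  ∀ᶠ v in 𝓝 0, parabolicForm μ (deformIntegral μ δ v) = Real.pi

/-- Real displacements of the marks of a real arc give real arcs, for which the relation is already
known; holomorphy then extends it to complex displacements. -/
theorem LArcSystem.IsReal.isGood {δ : LArcSystem n} (h : δ.IsReal)
    (hμ : ∀ j, 0 < μ j ∧ μ j < 1) (h1 : ∑ j, μ j = 1) : IsGood μ δ := by
  obtain ⟨r, δ', hr, hfam, h0, hpt, hreal⟩ :=
    (isFamily_const δ (univ : Set Unit)).exists_move (mem_univ ())
  have hpt' := hpt.self_of_nhdsWithin (mem_univ ())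
  have hmem : ((), (0 : Fin (n + 1) → ℂ)) ∈ (univ : Set Unit) ×ˢ Metric.ball 0 r :=
    ⟨mem_univ _, Metric.mem_ball_self hr⟩
  have E := hfam.eventually_F_eq hmem hμ
  simp only [nhdsWithin_prod_eq, h0, nhdsWithin_univ,
    Metric.isOpen_ball.nhdsWithin_eq (Metric.mem_ball_self hr)] at E
  have E1 := E.curry.self_of_nhds
  have E2 := ((contDiffAt_deformIntegral_aux μ δ hμ).1.and E1).and (Metric.ball_mem_nhds 0 hr)
  obtain ⟨ρ, hρ, hb⟩ := Metric.eventually_nhds_iff_ball.mp E2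
  refine eq_of_eq_on_real hρ (fun v hv => ?_) fun v hv him => ?_
  · exact ((parabolicForm μ).differentiableAt.comp v
      ((hb v hv).1.1.differentiableAt one_ne_zero)).differentiableWithinAt
  · obtain ⟨⟨-, h2⟩, h3⟩ := hb v hv
    rw [hpt' v h3, add_sub_cancel_left] at h2
    rw [← h2]
    exact LArcSystem.IsReal.parabolicForm_F (hreal () v him h) hμ h1

/-- Goodness of two nearby arcs says that one and the same holomorphic function on a ball equals π
near 0, respectively near the displacement between the arcs. The identity theorem makes these
equivalent, so goodness is both open and closed in families. -/
theorem IsFamily.eventually_isGood_iff {X : Type*} [TopologicalSpace X] {N : Set X}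
    {δ : X → LArcSystem n} (h : IsFamily N δ) {x₀ : X} (hx₀ : x₀ ∈ N)
    (hμ : ∀ j, 0 < μ j ∧ μ j < 1) : ∀ᶠ x in 𝓝[N] x₀, IsGood μ (δ x) ↔ IsGood μ (δ x₀) := by
  obtain ⟨ρ, hρ, hb⟩ := Metric.eventually_nhds_iff_ball.mp
    (contDiffAt_deformIntegral_aux μ (δ x₀) hμ).1
  have hd : DifferentiableOn ℂ (fun v => parabolicForm μ (deformIntegral μ (δ x₀) v))
      (Metric.ball 0 ρ) := fun v hv => ((parabolicForm μ).differentiableAt.comp v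
      ((hb v hv).differentiableAt one_ne_zero)).differentiableWithinAt
  filter_upwards [h.eventually_deformIntegral_eq hx₀ hμ,
    (h.tendsto_points_sub hx₀).eventually (Metric.ball_mem_nhds 0 hρ)] with x hx hxρ
  set a := (δ x).points - (δ x₀).points with ha
  have h1 : IsGood μ (δ x) ↔ ∀ᶠ u in 𝓝 a, parabolicForm μ (deformIntegral μ (δ x₀) u) = Real.pi := by
    have h2 : IsGood μ (δ x) ↔ ∀ᶠ v in 𝓝 0,
        parabolicForm μ (deformIntegral μ (δ x₀) (a + v)) = Real.pi :=
      eventually_congr (hx.mono fun v hv => by rw [hv])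
    rw [h2, ← map_add_left_nhds_zero a, eventually_map]
  rw [h1]
  constructor
  · intro h2
    exact eventually_of_mem (Metric.ball_mem_nhds 0 hρ)
      (eqOn_of_eventuallyEq_of_convex Metric.isOpen_ball (convex_ball 0 ρ) hd hxρ h2)
  · intro h2
    exact eventually_of_mem (Metric.isOpen_ball.mem_nhds hxρ)
      (eqOn_of_eventuallyEq_of_convex Metric.isOpen_ball (convex_ball 0 ρ) hd
        (Metric.mem_ball_self hρ) h2)

/-- Goodness is clopen along the slide and holds far out, where the arc is real; hence it holds for
the original arc. -/
theorem parabolicForm_F (δ : LArcSystem n) (hμ : ∀ j, 0 < μ j ∧ μ j < 1) (h1 : ∑ j, μ j = 1) :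
    parabolicForm μ (F μ δ) = Real.pi := by
  set S : Set ℝ := {τ | IsGood μ (δ.slide τ)} with hS
  have hev : ∀ τ : ℝ, ∀ᶠ τ' in 𝓝 τ, τ' ∈ S ↔ τ ∈ S := fun τ => by
    have := δ.isFamily_slide.eventually_isGood_iff (mem_univ τ) hμ
    rwa [nhdsWithin_univ] at this
  have hopen : IsOpen S := isOpen_iff_mem_nhds.mpr fun τ hτ => (hev τ).mono fun τ' h => h.mpr hτ
  have hclosed : IsClosed S := isOpen_compl_iff.mp (isOpen_iff_mem_nhds.mpr fun τ hτ =>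
    (hev τ).mono fun τ' h h' => hτ (h.mp h'))
  obtain ⟨T, hT⟩ := δ.exists_isReal_slide
  have huniv : S = univ := IsClopen.eq_univ ⟨hclosed, hopen⟩ ⟨T, (hT T le_rfl).isGood hμ h1⟩
  have h0 : IsGood μ (δ.slide 0) := by
    have : (0 : ℝ) ∈ S := huniv ▸ mem_univ 0
    exact this
  rw [δ.slide_zero] at h0
  have := h0.self_of_nhds
  rwa [deformIntegral_zero] at this

end Parabolic

end Lauricella

namespace Lauricella

open Set Filter Topology Module

/-! ### Holomorphic inverse function theorem. -/

section LocalInverse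

variable {E G : Type*} [NormedAddCommGroup E] [NormedSpace ℂ E] [FiniteDimensional ℂ E]
  [NormedAddCommGroup G] [NormedSpace ℂ G] [FiniteDimensional ℂ G]

theorem exists_openPartialHomeomorph {Ψ : E → G} {x : E} (hΨ : ContDiffAt ℂ 1 Ψ x)
    (hdim : finrank ℂ E = finrank ℂ G) (hinj : ∀ w, fderiv ℂ Ψ x w = 0 → w = 0)
    {S : Set E} (hS : S ∈ 𝓝 x) :
    ∃ Φ : OpenPartialHomeomorph E G, x ∈ Φ.source ∧ (∀ y, Φ y = Ψ y) ∧ Φ.source ⊆ S ∧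
      DifferentiableOn ℂ Φ Φ.source ∧ DifferentiableOn ℂ Φ.symm Φ.target := by
  have := FiniteDimensional.complete ℂ E
  set e : E ≃L[ℂ] G := (LinearMap.linearEquivOfInjective (fderiv ℂ Ψ x : E →ₗ[ℂ] G)
    (LinearMap.ker_eq_bot.mp (LinearMap.ker_eq_bot'.mpr hinj)) hdim).toContinuousLinearEquiv with he
  have hd : HasFDerivAt Ψ (e : E →L[ℂ] G) x := by
    have h1 : (e : E →L[ℂ] G) = fderiv ℂ Ψ x := by
      ext w
      rfl
    rw [h1]
    exact (hΨ.differentiableAt one_ne_zero).hasFDerivAt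
  set Φ := hΨ.toOpenPartialHomeomorph Ψ hd one_ne_zero with hΦ
  have hx : x ∈ Φ.source := hΨ.mem_toOpenPartialHomeomorph_source hd one_ne_zero
  have hinv : ContDiffAt ℂ 1 Φ.symm (Φ x) := hΨ.to_localInverse hd one_ne_zero
  have h1 : ∀ᶠ y in 𝓝 x, DifferentiableAt ℂ Ψ y :=
    (hΨ.eventually (by simp)).mono fun y hy => hy.differentiableAt one_ne_zero
  have h2 : ∀ᶠ y in 𝓝 (Φ x), DifferentiableAt ℂ Φ.symm y :=
    (hinv.eventually (by simp)).mono fun y hy => hy.differentiableAt one_ne_zero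
  obtain ⟨A, hA, hAo, hxA⟩ := eventually_nhds_iff.mp
    (h1.and (((Φ.continuousAt hx).eventually h2).and hS))
  refine ⟨Φ.restrOpen A hAo, ⟨hx, hxA⟩, fun y => rfl, fun y hy => (hA y hy.2).2.2,
    fun y hy => (hA y hy.2).1.differentiableWithinAt, fun z hz => ?_⟩
  have h3 := (Φ.restrOpen A hAo).map_target hz
  have h4 := (hA _ h3.2).2.1
  have h5 : Φ ((Φ.restrOpen A hAo).symm z) = z := (Φ.restrOpen A hAo).right_inv hz
  rw [h5] at h4
  exact h4.differentiableWithinAt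

end LocalInverse

/-! ### Affine slices of projective space. -/

section Slice

variable {E : Type*} [NormedAddCommGroup E] [NormedSpace ℂ E] (l : E →L[ℂ] ℂ)

/-- The representative of a point of projective space in the slice `l = 1`. -/
def normRep (p : Projectivization ℂ E) : E := (l p.rep)⁻¹ • p.rep

theorem normRep_mk {y : E} (hy : y ≠ 0) :
    normRep l (Projectivization.mk ℂ y hy) = (l y)⁻¹ • y := by
  obtain ⟨a, ha⟩ := Projectivization.exists_smul_eq_mk_rep ℂ y hy
  have ha0 : (a : ℂ) ≠ 0 := a.ne_zero
  rw [normRep, ← ha, Units.smul_def, map_smul, smul_eq_mul, mul_inv, smul_smul]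
  congr 1
  field_simp

variable {l}

theorem ne_zero_of_apply_ne_zero {y : E} (hy : l y ≠ 0) : y ≠ 0 := by
  rintro rfl
  exact hy (map_zero l)

theorem apply_normalize {y : E} (hy : l y ≠ 0) : l ((l y)⁻¹ • y) = 1 := by
  rw [map_smul, smul_eq_mul, inv_mul_cancel₀ hy]

theorem mk_smul {a : ℂ} {y z : E} (hz : z ≠ 0) (hy : y ≠ 0) (h : z = a • y) :
    Projectivization.mk ℂ z hz = Projectivization.mk ℂ y hy :=
  (Projectivization.mk_eq_mk_iff' ℂ _ _ hz hy).mpr ⟨a, h.symm⟩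

variable (l)

/-- The image in projective space of the intersection of a set with the slice `l = 1`. -/
def sliceProj (S : Set E) : Set (Projectivization ℂ E) :=
  {p | ∃ y ∈ S, l y = 1 ∧ ∃ hy : y ≠ 0, p = Projectivization.mk ℂ y hy}

theorem mem_cone_sliceProj {S : Set E} {y : E} :
    y ∈ cone (sliceProj l S) ↔ l y ≠ 0 ∧ (l y)⁻¹ • y ∈ S := by
  constructor
  · rintro ⟨hy, z, hzS, hz1, hz, hyz⟩
    have h1 := congrArg (normRep l) hyz
    rw [normRep_mk, normRep_mk, hz1, inv_one, one_smul] at h1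
    have h2 : l y ≠ 0 := by
      intro h
      rw [h, inv_zero, zero_smul] at h1
      exact hz h1.symm
    exact ⟨h2, h1 ▸ hzS⟩
  · rintro ⟨h1, h2⟩
    have h3 := apply_normalize h1
    refine ⟨ne_zero_of_apply_ne_zero h1, _, h2, h3, ne_zero_of_apply_ne_zero (l := l) (by
      rw [h3]; exact one_ne_zero), (mk_smul _ _ rfl).symm⟩

theorem isOpenProj_sliceProj {S : Set E} (hS : IsOpen S) : IsOpenProj (sliceProj l S) := by
  have h1 : cone (sliceProj l S) = {y | l y ≠ 0} ∩ (fun y => (l y)⁻¹ • y) ⁻¹' S :=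
    ext fun y => mem_cone_sliceProj l
  rw [IsOpenProj, h1]
  have h2 : IsOpen {y | l y ≠ 0} := isOpen_ne_fun l.continuous continuous_const
  refine ContinuousOn.isOpen_inter_preimage ?_ h2 hS
  exact (l.continuous.continuousOn.inv₀ fun y hy => hy).smul continuousOn_id

theorem sliceProj_subset {S : Set E} {O : Set (Projectivization ℂ E)} (h : S ⊆ cone O) :
    sliceProj l S ⊆ O := by
  rintro _ ⟨y, hyS, -, hy, rfl⟩
  exact (h hyS).choose_spec

theorem differentiableAt_normalize {y : E} (hy : l y ≠ 0) :
    DifferentiableAt ℂ (fun y => (l y)⁻¹ • y) y :=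
  (l.differentiableAt.inv hy).smul differentiableAt_id

end Slice

/-! ### Local isomorphisms out of projective space, from a lift with one-dimensional kernel. -/

section ProjectiveLocalIso

variable {E G : Type*} [NormedAddCommGroup E] [NormedSpace ℂ E] [FiniteDimensional ℂ E]
  [NormedAddCommGroup G] [NormedSpace ℂ G] [FiniteDimensional ℂ G]

/-- The lift f is degenerate along the line of v₀ and misses the direction transversal to ψ = c. The
map Ψ = f + (l - 1) e with ψ(e) = 1 repairs both: ψ ∘ Ψ = c + l - 1, so a kernel vector of dΨ has l
= 0, lies in the kernel of df, and vanishes. Ψ agrees with f on the slice l = 1 and matches this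
slice with the hyperplane ψ = c. -/
theorem exists_localIso_affine (hdim : finrank ℂ E = finrank ℂ G)
    {g : Projectivization ℂ E → G} {O : Set (Projectivization ℂ E)} (hO : IsOpenProj O)
    {f : E → G} {U : Set E} (hU : IsOpen U) {v₀ : E} (hv₀ : v₀ ≠ 0) (hvU : v₀ ∈ U)
    (hvO : v₀ ∈ cone O) (hg : ∀ v ∈ U, ∃ hv : v ≠ 0, g (Projectivization.mk ℂ v hv) = f v)
    (hf : ∀ v ∈ U, ContDiffAt ℂ 1 f v) {ψ : G →L[ℂ] ℂ} {c : ℂ} (hc : c ≠ 0)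
    (hψ : ∀ v ∈ U, ψ (f v) = c) (hD : ∀ w, fderiv ℂ f v₀ w = 0 → ∃ b : ℂ, w = b • v₀) :
    ∃ O' ⊆ O, Projectivization.mk ℂ v₀ hv₀ ∈ O' ∧ IsOpenProj O' ∧ HolomorphicOnProj g O' ∧
      ∃ (W : Set G) (σ : G → Projectivization ℂ E), IsOpen W ∧ HolomorphicOnToProj σ W ∧
        g '' O' = W ∩ {x | ψ x = c} ∧ ∀ q ∈ O', σ (g q) = q := by
  classical
  obtain ⟨l, hl⟩ := SeparatingDual.exists_eq_one (R := ℂ) hv₀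
  set e : G := c⁻¹ • f v₀ with he
  have hψe : ψ e = 1 := by rw [he, map_smul, hψ v₀ hvU, smul_eq_mul, inv_mul_cancel₀ hc]
  set Ψ : E → G := fun y => f y + (l y - 1) • e with hΨ
  have hUn : U ∈ 𝓝 v₀ := hU.mem_nhds hvU
  have hfd := ((hf v₀ hvU).differentiableAt one_ne_zero).hasFDerivAt
  have hΨd : HasFDerivAt Ψ (fderiv ℂ f v₀ + l.smulRight e) v₀ :=
    hfd.add ((l.hasFDerivAt.sub_const 1).smul_const e)
  have hΨc : ContDiffAt ℂ 1 Ψ v₀ := (hf v₀ hvU).add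
    ((l.contDiff.contDiffAt.sub contDiffAt_const).smul contDiffAt_const)
  have hψf : ∀ w, ψ (fderiv ℂ f v₀ w) = 0 := by
    intro w
    have h1 : HasFDerivAt (fun y => ψ (f y)) (ψ.comp (fderiv ℂ f v₀)) v₀ :=
      ψ.hasFDerivAt.comp v₀ hfd
    have h2 : HasFDerivAt (fun y => ψ (f y)) (0 : E →L[ℂ] ℂ) v₀ :=
      (hasFDerivAt_const c v₀).congr_of_eventuallyEq (eventually_of_mem hUn hψ)
    exact congrArg (fun L : E →L[ℂ] ℂ => L w) (h1.unique h2)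
  have hinj : ∀ w, fderiv ℂ Ψ v₀ w = 0 → w = 0 := by
    intro w hw
    rw [hΨd.fderiv] at hw
    have hw' : fderiv ℂ f v₀ w + l w • e = 0 := hw
    have h1 := congrArg ψ hw'
    rw [map_add, hψf, map_smul, hψe, map_zero, zero_add, smul_eq_mul, mul_one] at h1
    rw [h1, zero_smul, add_zero] at hw'
    obtain ⟨b, rfl⟩ := hD w hw'
    rw [map_smul, hl, smul_eq_mul, mul_one] at h1
    rw [h1, zero_smul]
  obtain ⟨Φ, hvΦ, hΦΨ, hΦS, hΦd, hΦs⟩ := exists_openPartialHomeomorph hΨc hdim hinj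
    (inter_mem hUn (IsOpen.mem_nhds hO hvO))
  have hΨ1 : ∀ y, l y = 1 → Ψ y = f y := fun y hy => by
    simp only [hΨ, hy, sub_self, zero_smul, add_zero]
  refine ⟨sliceProj l Φ.source, sliceProj_subset l fun y hy => (hΦS hy).2,
    ⟨v₀, hvΦ, hl, hv₀, rfl⟩, isOpenProj_sliceProj l Φ.open_source,
    ⟨fun y => f ((l y)⁻¹ • y), fun y hy => ?_, fun y hy => ?_⟩, Φ.target,
    fun x => if h : Φ.symm x ≠ 0 then Projectivization.mk ℂ (Φ.symm x) h
      else Projectivization.mk ℂ v₀ hv₀, Φ.open_target, fun x hx => ?_, ?_, ?_⟩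
  · obtain ⟨h1, h2⟩ := (mem_cone_sliceProj l).mp hy
    exact (DifferentiableAt.comp y (g := f) (f := fun y => (l y)⁻¹ • y)
          ((hf _ (hΦS h2).1).differentiableAt one_ne_zero)
      (differentiableAt_normalize l h1)).differentiableWithinAt
  · obtain ⟨h1, h2⟩ := (mem_cone_sliceProj l).mp hy
    obtain ⟨h3, h4⟩ := hg _ (hΦS h2).1
    refine ⟨ne_zero_of_apply_ne_zero h1, ?_⟩
    exact (congrArg g (mk_smul _ _ rfl).symm).trans h4
  · refine ⟨Φ.target, Φ.open_target, hx, Φ.symm, hΦs, fun y hy => ?_⟩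
    obtain ⟨h3, -⟩ := hg _ (hΦS (Φ.map_target hy)).1
    exact ⟨h3, dif_pos h3⟩
  · ext x
    constructor
    · rintro ⟨_, ⟨y, hyS, hy1, hy, rfl⟩, rfl⟩
      obtain ⟨h3, h4⟩ := hg _ (hΦS hyS).1
      rw [h4]
      refine ⟨?_, hψ y (hΦS hyS).1⟩
      rw [← hΨ1 y hy1, ← hΦΨ]
      exact Φ.map_source hyS
    · rintro ⟨hxT, hxA⟩
      have h1 := Φ.right_inv hxT
      have h2 := Φ.map_target hxT
      set y := Φ.symm x with hy
      rw [hΦΨ] at h1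
      have h3 : l y = 1 := by
        have h4 := congrArg ψ h1
        rw [show ψ x = c from hxA, hΨ, map_add, hψ y (hΦS h2).1, map_smul, hψe, smul_eq_mul,
          mul_one, add_eq_left, sub_eq_zero] at h4
        exact h4
      obtain ⟨h5, h6⟩ := hg _ (hΦS h2).1
      exact ⟨_, ⟨y, h2, h3, h5, rfl⟩, by rw [h6, ← hΨ1 y h3, h1]⟩
  · rintro _ ⟨y, hyS, hy1, hy, rfl⟩
    obtain ⟨h3, h4⟩ := hg _ (hΦS hyS).1
    have h5 : Φ.symm (g (Projectivization.mk ℂ y hy)) = y := by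
      rw [h4, ← hΨ1 y hy1, ← hΦΨ, Φ.left_inv hyS]
    simp only [h5]
    exact dif_pos hy

/-- The rescaling Ψ = (l / ν(f)) f represents the same projective point as f, off the zeros of l and
of ν(f), and satisfies ν ∘ Ψ = l, so it matches the slices l = 1 and ν = 1. A kernel vector w of dΨ
has l(w) = 0, and differentiating ν(f) Ψ = l f shows that df(w) is a multiple of f(v₀), so w is a
multiple of v₀ and hence 0. -/
theorem exists_localIso_proj (hdim : finrank ℂ E = finrank ℂ G)
    {g : Projectivization ℂ E → Projectivization ℂ G} {O : Set (Projectivization ℂ E)}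
    (hO : IsOpenProj O) {f : E → G} {U : Set E} (hU : IsOpen U) {v₀ : E} (hv₀ : v₀ ≠ 0)
    (hvU : v₀ ∈ U) (hvO : v₀ ∈ cone O)
    (hg : ∀ v ∈ U, ∃ (hv : v ≠ 0) (hf : f v ≠ 0),
      g (Projectivization.mk ℂ v hv) = Projectivization.mk ℂ (f v) hf)
    (hf : ∀ v ∈ U, ContDiffAt ℂ 1 f v)
    (hD : ∀ (w : E) (a : ℂ), fderiv ℂ f v₀ w = a • f v₀ → ∃ b : ℂ, w = b • v₀) :
    ∃ O' ⊆ O, Projectivization.mk ℂ v₀ hv₀ ∈ O' ∧ IsOpenProj O' ∧ HolomorphicOnProjProj g O' ∧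
      ∃ σ : Projectivization ℂ G → Projectivization ℂ E, IsOpenProj (g '' O') ∧
        HolomorphicOnProjProj σ (g '' O') ∧ ∀ q ∈ O', σ (g q) = q := by
  classical
  obtain ⟨l, hl⟩ := SeparatingDual.exists_eq_one (R := ℂ) hv₀
  obtain ⟨-, hf₀, -⟩ := hg v₀ hvU
  obtain ⟨ν, hν⟩ := SeparatingDual.exists_eq_one (R := ℂ) hf₀
  set Ψ : E → G := fun y => (l y * (ν (f y))⁻¹) • f y with hΨ
  have hUn : U ∈ 𝓝 v₀ := hU.mem_nhds hvU
  have hfd := ((hf v₀ hvU).differentiableAt one_ne_zero).hasFDerivAt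
  have hνf : HasFDerivAt (fun y => ν (f y)) (ν.comp (fderiv ℂ f v₀)) v₀ :=
    ν.hasFDerivAt.comp v₀ hfd
  have hν0 : ν (f v₀) ≠ 0 := by rw [hν]; exact one_ne_zero
  have hΨc : ContDiffAt ℂ 1 Ψ v₀ := by
    refine ContDiffAt.smul (l.contDiff.contDiffAt.mul (ContDiffAt.inv ?_ hν0)) (hf v₀ hvU)
    exact ν.contDiff.contDiffAt.comp v₀ (hf v₀ hvU)
  have hΨν : ∀ y, ν (f y) ≠ 0 → ν (Ψ y) = l y := fun y hy => by
    simp only [hΨ, map_smul, smul_eq_mul, mul_assoc, inv_mul_cancel₀ hy, mul_one]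
  have hνU : ∀ᶠ y in 𝓝 v₀, ν (f y) ≠ 0 := hνf.continuousAt.eventually_ne hν0
  have hinj : ∀ w, fderiv ℂ Ψ v₀ w = 0 → w = 0 := by
    intro w hw
    have hΨd := (hΨc.differentiableAt one_ne_zero).hasFDerivAt
    have h1 : l w = 0 := by
      have h2 : HasFDerivAt (fun y => ν (Ψ y)) (ν.comp (fderiv ℂ Ψ v₀)) v₀ :=
        ν.hasFDerivAt.comp v₀ hΨd
      have h3 : HasFDerivAt (fun y => ν (Ψ y)) l v₀ :=
        l.hasFDerivAt.congr_of_eventuallyEq (hνU.mono hΨν)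
      have h4 := congrArg (fun L : E →L[ℂ] ℂ => L w) (h3.unique h2)
      simpa [hw] using h4
    have h2 : HasFDerivAt (fun y => ν (f y) • Ψ y)
        (ν (f v₀) • fderiv ℂ Ψ v₀ + (ν.comp (fderiv ℂ f v₀)).smulRight (Ψ v₀)) v₀ := hνf.smul hΨd
    have h3 : HasFDerivAt (fun y => l y • f y)
        (l v₀ • fderiv ℂ f v₀ + l.smulRight (f v₀)) v₀ := l.hasFDerivAt.smul hfd
    have h4 : (fun y => ν (f y) • Ψ y) =ᶠ[𝓝 v₀] fun y => l y • f y :=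
      hνU.mono fun y hy => by
        simp only [hΨ, smul_smul]
        rw [mul_comm (l y), mul_inv_cancel_left₀ hy]
    have h5 := congrArg (fun L : E →L[ℂ] G => L w) (h2.unique (h3.congr_of_eventuallyEq h4))
    have h6 : ν (fderiv ℂ f v₀ w) • Ψ v₀ = fderiv ℂ f v₀ w := by
      simpa [hw, hl, h1] using h5
    have h7 : Ψ v₀ = f v₀ := by simp [hΨ, hl, hν]
    rw [h7] at h6
    obtain ⟨b, rfl⟩ := hD w _ h6.symm
    rw [map_smul, hl, smul_eq_mul, mul_one] at h1
    rw [h1, zero_smul]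
  obtain ⟨Φ, hvΦ, hΦΨ, hΦS, hΦd, hΦs⟩ := exists_openPartialHomeomorph hΨc hdim hinj
    (inter_mem hUn (inter_mem (IsOpen.mem_nhds hO hvO) hνU))
  have hΨmk : ∀ y ∈ Φ.source, l y = 1 → ∀ hy : y ≠ 0, ∃ hy' : Ψ y ≠ 0,
      g (Projectivization.mk ℂ y hy) = Projectivization.mk ℂ (Ψ y) hy' := by
    intro y hyS hy1 hy
    obtain ⟨h3, h4, h5⟩ := hg _ (hΦS hyS).1
    have h6 : ν (Ψ y) ≠ 0 := by rw [hΨν y (hΦS hyS).2.2, hy1]; exact one_ne_zero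
    refine ⟨ne_zero_of_apply_ne_zero h6, ?_⟩
    rw [h5]
    exact (mk_smul _ _ rfl).symm
  have himg : g '' sliceProj l Φ.source = sliceProj ν Φ.target := by
    ext x
    constructor
    · rintro ⟨_, ⟨y, hyS, hy1, hy, rfl⟩, rfl⟩
      obtain ⟨hy', h⟩ := hΨmk y hyS hy1 hy
      exact ⟨Ψ y, hΦΨ y ▸ Φ.map_source hyS, by rw [hΨν y (hΦS hyS).2.2, hy1], hy', h⟩
    · rintro ⟨u, huT, hu1, hu, rfl⟩
      have h1 := Φ.right_inv huT
      have h2 := Φ.map_target huT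
      set y := Φ.symm u with hy
      rw [hΦΨ] at h1
      have h3 : l y = 1 := by rw [← hΨν y (hΦS h2).2.2, h1, hu1]
      obtain ⟨h4, -, -⟩ := hg _ (hΦS h2).1
      obtain ⟨hy', h⟩ := hΨmk y h2 h3 h4
      refine ⟨_, ⟨y, h2, h3, h4, rfl⟩, ?_⟩
      rw [h]
      congr 1
  set τ : G → E := fun u => Φ.symm ((ν u)⁻¹ • u) with hτ
  refine ⟨sliceProj l Φ.source, sliceProj_subset l fun y hy => (hΦS hy).2.1,
    ⟨v₀, hvΦ, hl, hv₀, rfl⟩, isOpenProj_sliceProj l Φ.open_source, fun v hv => ?_,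
    fun x => if h : Φ.symm (normRep ν x) ≠ 0 then
      Projectivization.mk ℂ (Φ.symm (normRep ν x)) h else Projectivization.mk ℂ v₀ hv₀, ?_, ?_, ?_⟩
  · refine ⟨_, isOpenProj_sliceProj l Φ.open_source, hv, fun y => f ((l y)⁻¹ • y),
      fun y hy => ?_, fun y hy => ?_⟩
    · obtain ⟨h1, h2⟩ := (mem_cone_sliceProj l).mp hy
      exact (DifferentiableAt.comp y (g := f) (f := fun y => (l y)⁻¹ • y)
          ((hf _ (hΦS h2).1).differentiableAt one_ne_zero)
        (differentiableAt_normalize l h1)).differentiableWithinAt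
    · obtain ⟨h1, h2⟩ := (mem_cone_sliceProj l).mp hy
      obtain ⟨h3, h4, h5⟩ := hg _ (hΦS h2).1
      refine ⟨ne_zero_of_apply_ne_zero h1, h4, ?_⟩
      rw [← h5]
      exact congrArg g (mk_smul _ _ rfl).symm
  · rw [himg]
    exact isOpenProj_sliceProj ν Φ.open_target
  · rw [himg]
    intro v hv
    refine ⟨_, isOpenProj_sliceProj ν Φ.open_target, hv, τ, fun y hy => ?_, fun y hy => ?_⟩
    · obtain ⟨h1, h2⟩ := (mem_cone_sliceProj ν).mp hy
      exact (DifferentiableAt.comp y (g := Φ.symm) (f := fun y => (ν y)⁻¹ • y)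
        ((hΦs _ h2).differentiableAt (Φ.open_target.mem_nhds h2))
        (differentiableAt_normalize ν h1)).differentiableWithinAt
    · obtain ⟨h1, h2⟩ := (mem_cone_sliceProj ν).mp hy
      obtain ⟨h3, -, -⟩ := hg _ (hΦS (Φ.map_target h2)).1
      refine ⟨ne_zero_of_apply_ne_zero h1, h3, ?_⟩
      simp only [normRep_mk]
      exact dif_pos h3
  · rintro _ ⟨y, hyS, hy1, hy, rfl⟩
    obtain ⟨hy', h⟩ := hΨmk y hyS hy1 hy
    have h1 : Φ.symm (normRep ν (g (Projectivization.mk ℂ y hy))) = y := by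
      rw [h, normRep_mk, hΨν y (hΦS hyS).2.2, hy1, inv_one, one_smul, ← hΦΨ, Φ.left_inv hyS]
    simp only [h1]
    exact dif_pos hy

end ProjectiveLocalIso

/-! ### The quotient V_n and its section z_0 = 0. -/

section QuotientSpace

variable {n : ℕ}

theorem toV_add (z w : Fin (n + 1) → ℂ) : toV (z + w) = toV z + toV w :=
  map_add (mainDiagonal n).mkQ z w

theorem toV_smul (a : ℂ) (z : Fin (n + 1) → ℂ) : toV (a • z) = a • toV z :=
  map_smul (mainDiagonal n).mkQ a z

theorem toV_const (b : ℂ) : toV (fun _ : Fin (n + 1) => b) = 0 := by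
  refine (Submodule.Quotient.mk_eq_zero _).mpr (Submodule.mem_span_singleton.mpr ⟨b, ?_⟩)
  funext
  simp

/-- The linear map `z ↦ (z_j - z_0)_j`. -/
def subFirst (n : ℕ) : (Fin (n + 1) → ℂ) →ₗ[ℂ] (Fin (n + 1) → ℂ) where
  toFun z := z - fun _ => z 0
  map_add' z w := by funext j; simp only [Pi.add_apply, Pi.sub_apply]; ring
  map_smul' a z := by
    funext j
    simp only [Pi.smul_apply, Pi.sub_apply, smul_eq_mul, RingHom.id_apply]
    ring

/-- The section `[z] ↦ (z_j - z_0)_j` of the quotient map. -/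
def sec (n : ℕ) : V n →L[ℂ] (Fin (n + 1) → ℂ) :=
  LinearMap.toContinuousLinearMap ((mainDiagonal n).liftQ (subFirst n) (by
    rw [mainDiagonal, Submodule.span_le, singleton_subset_iff]
    exact sub_self _))

theorem sec_toV (z : Fin (n + 1) → ℂ) : sec n (toV z) = z - fun _ => z 0 := rfl

theorem toV_surjective : Function.Surjective (toV : (Fin (n + 1) → ℂ) → V n) :=
  Submodule.mkQ_surjective _

theorem toV_sec (v : V n) : toV (sec n v) = v := by
  obtain ⟨z, rfl⟩ := toV_surjective v
  rw [sec_toV, sub_eq_add_neg, toV_add]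
  have : (-fun _ : Fin (n + 1) => z 0) = fun _ => -z 0 := rfl
  rw [this, toV_const, add_zero]

theorem exists_eq_sec_add (z : Fin (n + 1) → ℂ) : z = sec n (toV z) + fun _ => z 0 := by
  rw [sec_toV]
  abel

theorem finrank_V (n : ℕ) : finrank ℂ (V n) = n := by
  have h1 := Submodule.finrank_quotient_add_finrank (mainDiagonal n)
  have h2 : finrank ℂ (mainDiagonal n) = 1 := finrank_span_singleton (by
    intro h
    have := congrFun h 0
    simp at this)
  rw [h2, Module.finrank_fin_fun] at h1
  exact Nat.add_right_cancel h1

theorem LArcSystem.cls_ne_zero (hn : 0 < n) (δ : LArcSystem n) : δ.cls ≠ 0 := by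
  intro h
  have h1 := sec_toV δ.points
  rw [show toV δ.points = 0 from h, map_zero] at h1
  have h2 := congrFun h1 ⟨1, by omega⟩
  have h3 : δ.points ⟨1, by omega⟩ = δ.points 0 := (sub_eq_zero.mp h2.symm)
  have := δ.points_injective h3
  simp [Fin.ext_iff] at this

end QuotientSpace

/-! ### Branches of `F`: holomorphy, differential and homogeneity. -/

section Branches

variable {n : ℕ} {μ : Fin (n + 1) → ℝ}

theorem interp_add (z v w : Fin (n + 1) → ℂ) : interp z (v + w) = interp z v + interp z w :=
  map_add _ v w

theorem divDiff_add (z v w : Fin (n + 1) → ℂ) (j : Fin (n + 1)) :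
    divDiff z j (v + w) = divDiff z j v + divDiff z j w := by
  simp [divDiff, add_mul, Finset.sum_add_distrib]

/-- A constant displacement is interpolated by a constant, whose derivative and divided differences
vanish. This is what lets the local form descend to V_n. -/
theorem deformIntegral_add_const (δ : LArcSystem n) (v : Fin (n + 1) → ℂ) (b : ℂ) :
    deformIntegral μ δ (v + fun _ => b) = deformIntegral μ δ v := by
  funext k
  have hz := δ.points_injective
  simp only [deformIntegral, deformFactor, interp_add, divDiff_add, interp_const hz,
    divDiff_const hz, add_zero, Polynomial.derivative_add, Polynomial.derivative_C]

theorem IsContinuousFamily.isFamily {N : Set (V n)} {δ : V n → LArcSystem n}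
    (h : IsContinuousFamily N δ) : IsFamily N δ := h.2.2

theorem IsContinuousFamily.mono {N N' : Set (V n)} {δ : V n → LArcSystem n}
    (h : IsContinuousFamily N δ) (hN' : IsOpen N') (hsub : N' ⊆ N) : IsContinuousFamily N' δ :=
  ⟨hN', fun v hv => h.2.1 v (hsub hv), h.2.2.1.mono (prod_mono hsub le_rfl),
    h.2.2.2.mono (prod_mono hsub le_rfl)⟩

theorem IsBranch.mono {U U' : Set (V n)} {f : V n → Fin n → ℂ} (h : IsBranch μ U f)
    (hU' : IsOpen U') (hsub : U' ⊆ U) : IsBranch μ U' f := by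
  refine ⟨hU', fun v hv => ?_⟩
  obtain ⟨N, δ, hvN, -, hδ, hf⟩ := h.2 v (hsub hv)
  exact ⟨N ∩ U', δ, ⟨hvN, hv⟩, inter_subset_right, hδ.mono (hδ.1.inter hU') inter_subset_left,
    fun v' hv' => hf v' hv'.1⟩

/-- A branch only remembers classes in V_n; the representatives of the marked points chosen by its
arcs differ from the section by translations, which do not affect the local form. -/
theorem IsBranch.exists_local {U : Set (V n)} {f : V n → Fin n → ℂ} (h : IsBranch μ U f)
    (hμ : ∀ j, 0 < μ j ∧ μ j < 1) {v₀ : V n} (hv₀ : v₀ ∈ U) :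
    ∃ δ : LArcSystem n, δ.cls = v₀ ∧ f v₀ = F μ δ ∧
      ∀ᶠ v in 𝓝 v₀, f v = deformIntegral μ δ (sec n (v - v₀)) := by
  obtain ⟨N, δ, hvN, -, hδ, hf⟩ := h.2 v₀ hv₀
  refine ⟨δ v₀, hδ.2.1 v₀ hvN, hf v₀ hvN, ?_⟩
  have h1 := hδ.isFamily.eventually_F_eq hvN hμ
  rw [hδ.1.nhdsWithin_eq hvN] at h1
  filter_upwards [h1, hδ.1.mem_nhds hvN] with v hv hvN'
  have h2 : (δ v).points - (δ v₀).points =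
      sec n (v - v₀) + fun _ => ((δ v).points 0 - (δ v₀).points 0) := by
    have h3 : v - v₀ = toV ((δ v).points - (δ v₀).points) := by
      conv_lhs => rw [← hδ.2.1 v hvN', ← hδ.2.1 v₀ hvN]
      rfl
    rw [h3]
    exact exists_eq_sec_add ((δ v).points - (δ v₀).points)
  rw [hf v hvN', hv, h2, deformIntegral_add_const]

theorem IsBranch.exists_hasFDerivAt {U : Set (V n)} {f : V n → Fin n → ℂ} (h : IsBranch μ U f)
    (hμ : ∀ j, 0 < μ j ∧ μ j < 1) {v₀ : V n} (hv₀ : v₀ ∈ U) :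
    ContDiffAt ℂ 1 f v₀ ∧ ∃ δ : LArcSystem n, δ.cls = v₀ ∧ f v₀ = F μ δ ∧
      fderiv ℂ f v₀ = (fderiv ℂ (deformIntegral μ δ) 0).comp (sec n) := by
  obtain ⟨δ, hδ, hf, hloc⟩ := h.exists_local hμ hv₀
  have h1 := contDiffAt_deformIntegral δ hμ
  have hs : ContDiff ℂ 1 fun v : V n => sec n (v - v₀) :=
    (sec n).contDiff.comp (contDiff_id.sub contDiff_const)
  have h0 : sec n (v₀ - v₀) = 0 := by rw [sub_self, map_zero]
  have h2 : ContDiffAt ℂ 1 (fun v => deformIntegral μ δ (sec n (v - v₀))) v₀ := by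
    refine ContDiffAt.comp v₀ (g := deformIntegral μ δ) (f := fun v => sec n (v - v₀)) ?_
      hs.contDiffAt
    rw [h0]
    exact h1
  refine ⟨h2.congr_of_eventuallyEq hloc, δ, hδ, hf, ?_⟩
  have h3 : HasFDerivAt (fun v : V n => sec n (v - v₀)) (sec n) v₀ :=
    (sec n).hasFDerivAt.comp v₀ ((hasFDerivAt_id v₀).sub_const v₀)
  have h5 : HasFDerivAt (deformIntegral μ δ) (fderiv ℂ (deformIntegral μ δ) 0)
      (sec n (v₀ - v₀)) := by
    rw [h0]
    exact (h1.differentiableAt one_ne_zero).hasFDerivAt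
  have h4 := HasFDerivAt.comp v₀ (g := deformIntegral μ δ) (f := fun v => sec n (v - v₀)) h5 h3
  exact (h4.congr_of_eventuallyEq hloc).fderiv

theorem IsBranch.contDiffAt {U : Set (V n)} {f : V n → Fin n → ℂ} (h : IsBranch μ U f)
    (hμ : ∀ j, 0 < μ j ∧ μ j < 1) {v : V n} (hv : v ∈ U) : ContDiffAt ℂ 1 f v :=
  (h.exists_hasFDerivAt hμ hv).1

theorem IsBranch.ne_zero {U : Set (V n)} {f : V n → Fin n → ℂ} (h : IsBranch μ U f) (hn : 0 < n)
    {v : V n} (hv : v ∈ U) : v ≠ 0 := by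
  obtain ⟨N, δ, hvN, -, hδ, -⟩ := h.2 v hv
  rw [← hδ.2.1 v hvN]
  exact (δ v).cls_ne_zero hn

theorem IsBranch.apply_ne_zero {U : Set (V n)} {f : V n → Fin n → ℂ} (h : IsBranch μ U f)
    (hn : 0 < n) (hμ : ∀ j, 0 < μ j ∧ μ j < 1) (hint : ∀ m : ℕ, 2 ≤ m → ∑ j, μ j ≠ (m : ℝ))
    {v : V n} (hv : v ∈ U) : f v ≠ 0 := by
  obtain ⟨N, δ, hvN, -, -, hf⟩ := h.2 v hv
  rw [hf v hvN]
  exact F_ne_zero hn hμ hint _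

theorem IsBranch.parabolicForm_eq {U : Set (V n)} {f : V n → Fin n → ℂ} (h : IsBranch μ U f)
    (hμ : ∀ j, 0 < μ j ∧ μ j < 1) (h1 : ∑ j, μ j = 1) {v : V n} (hv : v ∈ U) :
    parabolicForm μ (f v) = Real.pi := by
  obtain ⟨N, δ, hvN, -, -, hf⟩ := h.2 v hv
  rw [hf v hvN]
  exact parabolicForm_F _ hμ h1

/-- In V_n the constant b₀ of an affine displacement disappears, so only the direction of v itself
remains. With a = 0 this computes the kernel of the differential; general a is what the Schwarz map
needs. -/
theorem IsBranch.fderiv_eq_smul {U : Set (V n)} {f : V n → Fin n → ℂ} (h : IsBranch μ U f)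
    (hn : 0 < n) (hμ : ∀ j, 0 < μ j ∧ μ j < 1) (hint : ∀ m : ℕ, 2 ≤ m → ∑ j, μ j ≠ (m : ℝ))
    {v : V n} (hv : v ∈ U) {w : V n} {a : ℂ} (hw : fderiv ℂ f v w = a • f v) :
    ∃ b : ℂ, w = b • v ∧ a = (1 - ∑ j, (μ j : ℂ)) * b := by
  obtain ⟨-, δ, hδ, hf, hd⟩ := h.exists_hasFDerivAt hμ hv
  rw [hd, hf] at hw
  obtain ⟨b₀, b₁, hb, ha⟩ := fderiv_deformIntegral_eq_smul δ hn hμ hint hw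
  refine ⟨b₁, ?_, ha⟩
  have h1 : sec n w = (fun _ => b₀) + b₁ • δ.points := hb
  rw [← toV_sec w, h1, toV_add, toV_const, zero_add, toV_smul, ← hδ]
  rfl

theorem IsBranch.fderiv_self {U : Set (V n)} {f : V n → Fin n → ℂ} (h : IsBranch μ U f)
    (hn : 0 < n) (hμ : ∀ j, 0 < μ j ∧ μ j < 1) {v : V n} (hv : v ∈ U) :
    fderiv ℂ f v v = (1 - ∑ j, (μ j : ℂ)) • f v := by
  obtain ⟨-, δ, hδ, hf, hd⟩ := h.exists_hasFDerivAt hμ hv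
  rw [hd, hf, ContinuousLinearMap.comp_apply, ← fderiv_deformIntegral_points δ hn hμ]
  have h1 : sec n v = δ.points + fun _ => -δ.points 0 := by
    rw [← hδ]
    exact sec_toV δ.points
  rw [h1, map_add, fderiv_deformIntegral_const δ hμ, add_zero]

theorem IsBranch.isLocalIso {U : Set (V n)} {f : V n → Fin n → ℂ} (h : IsBranch μ U f)
    (hn : 0 < n) (hμ : ∀ j, 0 < μ j ∧ μ j < 1) (hint : ∀ m : ℕ, 2 ≤ m → ∑ j, μ j ≠ (m : ℝ))
    (h1 : ∑ j, μ j ≠ 1) : IsLocalIso f U := by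
  intro v hv
  have hinj : ∀ w, fderiv ℂ f v w = 0 → w = 0 := by
    intro w hw
    obtain ⟨b, rfl, hb⟩ := h.fderiv_eq_smul hn hμ hint hv (a := 0) (by rw [hw, zero_smul])
    have h2 : (1 : ℂ) - ∑ j, (μ j : ℂ) ≠ 0 := by
      rw [sub_ne_zero]
      intro h3
      exact h1 (by exact_mod_cast h3.symm)
    rw [(mul_eq_zero.mp hb.symm).resolve_left h2, zero_smul]
  obtain ⟨Φ, hvΦ, hΦ, -, hd, hs⟩ := exists_openPartialHomeomorph (h.contDiffAt hμ hv)
    (by rw [finrank_V, Module.finrank_fin_fun]) hinj univ_mem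
  exact ⟨Φ, hvΦ, fun y _ => (hΦ y).symm, hd, hs⟩

/-- Local homogeneity of branches. -/
theorem IsBranch.eventually_smul {U : Set (V n)} {f : V n → Fin n → ℂ} (h : IsBranch μ U f)
    (hn : 0 < n) (hμ : ∀ j, 0 < μ j ∧ μ j < 1) {v₀ : V n} (hv₀ : v₀ ∈ U) :
    ∀ᶠ y : ℂ × V n in 𝓝 (1, v₀),
      f (y.1 • y.2) = Complex.exp ((1 - ∑ j, (μ j : ℂ)) * Complex.log y.1) • f y.2 := by
  set α : ℂ := 1 - ∑ j, (μ j : ℂ) with hα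
  have hcont : Tendsto (fun y : ℂ × V n => y.1 • y.2) (𝓝 (1, v₀)) (𝓝 v₀) := by
    have : Continuous fun y : ℂ × V n => y.1 • y.2 := by fun_prop
    simpa using this.tendsto (1, v₀)
  have hev := hcont.eventually (h.1.mem_nhds hv₀)
  rw [nhds_prod_eq] at hev ⊢
  obtain ⟨A, hA, B, hB, hAB⟩ := Filter.mem_prod_iff.mp hev
  obtain ⟨ε, hε, hεA⟩ := Metric.mem_nhds_iff.mp hA
  set r := min ε 1 with hr
  have hr0 : 0 < r := lt_min hε one_pos
  refine Filter.mem_prod_iff.mpr ⟨_, Metric.ball_mem_nhds 1 hr0, B, hB, ?_⟩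
  rintro ⟨c, v⟩ ⟨hc, hv⟩
  have hslit : ∀ s ∈ Metric.ball (1:ℂ) r, s ∈ Complex.slitPlane := fun s hs =>
    Complex.ball_one_subset_slitPlane (Metric.ball_subset_ball (min_le_right _ _) hs)
  set g : ℂ → Fin n → ℂ := fun s => Complex.exp (-(α * Complex.log s)) • f (s • v) with hg
  have hgd : ∀ s ∈ Metric.ball (1:ℂ) r, HasDerivAt g 0 s := by
    intro s hs
    have hsU : s • v ∈ U := hAB (show (s, v) ∈ A ×ˢ B from
      ⟨hεA (Metric.ball_subset_ball (min_le_left _ _) hs), hv⟩)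
    have hs0 : s ≠ 0 := Complex.slitPlane_ne_zero (hslit s hs)
    have h1 : HasDerivAt (fun s : ℂ => s • v) v s := by
      simpa using (hasDerivAt_id s).smul_const v
    have h2 : HasDerivAt (fun s : ℂ => f (s • v)) (fderiv ℂ f (s • v) v) s :=
      HasFDerivAt.comp_hasDerivAt s (f := fun s : ℂ => s • v)
        ((h.contDiffAt hμ hsU).differentiableAt one_ne_zero).hasFDerivAt h1
    have h3 : HasDerivAt (fun s => Complex.exp (-(α * Complex.log s)))
        (Complex.exp (-(α * Complex.log s)) * -(α * s⁻¹)) s :=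
      (((Complex.hasDerivAt_log (hslit s hs)).const_mul α).neg).cexp
    have h4 : fderiv ℂ f (s • v) v = (s⁻¹ * α) • f (s • v) := by
      have h5 := h.fderiv_self hn hμ hsU
      rw [map_smul] at h5
      rw [mul_smul, ← h5, inv_smul_smul₀ hs0]
    refine (h3.smul h2).congr_deriv ?_
    rw [h4, smul_smul, ← add_smul]
    convert zero_smul ℂ (f (s • v)) using 2
    ring_nf
  have hconst := (convex_ball (1:ℂ) r).is_const_of_fderivWithin_eq_zero (𝕜 := ℂ) (f := g)
    (fun s hs => (hgd s hs).differentiableAt.differentiableWithinAt) (fun s hs => by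
      rw [fderivWithin_of_isOpen Metric.isOpen_ball hs, (hgd s hs).hasFDerivAt.fderiv]
      ext
      simp) hc (Metric.mem_ball_self hr0)
  simp only [hg, Complex.log_one, mul_zero, neg_zero, Complex.exp_zero, one_smul] at hconst
  change f (c • v) = Complex.exp (α * Complex.log c) • f v
  rw [← hconst, smul_smul, ← Complex.exp_add, add_neg_cancel, Complex.exp_zero, one_smul]

end Branches

end Lauricella

namespace Lauricella

open Set Filter Topology MeasureTheory

/-! ### Transport of branches under scaling of the points. -/

section Scaling

variable {n : ℕ} {μ : Fin (n + 1) → ℝ}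

/-- On the part of the arc that carries the integrals all chords are multiplied by c, so each
logarithm grows by log c and dζ by the factor c. -/
theorem F_perturb_of_eq_mul (δ : LArcSystem n) {f : ℂ → ℂ} (hf : IsSmallPerturbation f) {c : ℂ}
    {R : ℝ} (hR : ∀ t ∈ Icc 0 (n : ℝ), ‖δ.path t‖ < R) (hfc : ∀ ζ, ‖ζ‖ < R → f ζ = c * ζ) :
    F μ (δ.perturb hf) = (c * Complex.exp (-((∑ j, (μ j : ℂ)) * Complex.log c))) • F μ δ := by
  funext k
  have hkn : ((k : ℕ) : ℝ) + 1 ≤ n := by exact_mod_cast k.2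
  have hk0 : (0 : ℝ) ≤ ((k : ℕ) : ℝ) := Nat.cast_nonneg _
  have hkk : ((k : ℕ) : ℝ) ≤ (k : ℕ) + 1 := by linarith
  simp only [F, Pi.smul_apply, smul_eq_mul]
  rw [← intervalIntegral.integral_const_mul, intervalIntegral.integral_of_le hkk,
    intervalIntegral.integral_of_le hkk, integral_Ioc_eq_integral_Ioo,
    integral_Ioc_eq_integral_Ioo]
  refine setIntegral_congr_fun measurableSet_Ioo fun t ht => ?_
  have ht0 : 0 < t := hk0.trans_lt ht.1
  have htn : t ≤ n := ht.2.le.trans hkn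
  have hratio : ∀ s u, s ∈ Icc 0 (n : ℝ) → u ∈ Icc 0 (n : ℝ) → (s, u) ∈ chordDomain →
      (δ.perturb hf).chordLog (s, u) = δ.chordLog (s, u) + Complex.log c := by
    intro s u hs hu hsu
    rw [δ.chordLog_perturb hf hsu, ratioLog, hfc _ (hR s hs), hfc _ (hR u hu), ← mul_sub,
      mul_div_assoc, div_self (δ.path_sub_ne_zero hsu), mul_one]
  have hlog : ∀ j, arcLog (δ.perturb hf) k j t = arcLog δ k j t + Complex.log c := by
    intro j
    have hj : ((j : ℕ) : ℝ) ∈ Icc 0 (n : ℝ) :=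
      ⟨Nat.cast_nonneg _, by exact_mod_cast Nat.lt_succ_iff.mp j.2⟩
    unfold arcLog
    split_ifs with h
    · exact hratio _ _ hj ⟨ht0.le, htn⟩ ⟨Nat.cast_nonneg _, (cast_le_of_le h).trans_lt ht.1⟩
    · exact hratio _ _ ⟨ht0.le, htn⟩ hj ⟨ht0.le, ht.2.trans_le (le_cast_of_not_le h)⟩
  have hderiv : deriv (δ.perturb hf).path t = c * deriv δ.path t := by
    have h1 : (δ.perturb hf).path =ᶠ[𝓝 t] fun u => c * δ.path u := by
      have hc : ContinuousAt δ.path t := δ.continuousOn.continuousAt (Ici_mem_nhds ht0)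
      filter_upwards [hc.norm.eventually (gt_mem_nhds (hR t ⟨ht0.le, htn⟩))] with u hu
      exact hfc _ hu
    rw [h1.deriv_eq, deriv_const_mul_field]
  simp only [integrand_eq, hlog, hderiv, mul_add, Finset.sum_add_distrib, ← Finset.sum_mul,
    neg_add, Complex.exp_add]
  ring

/-- The scalar by which `F` is multiplied under scaling of the points by `c` near `1`. -/
def scaleFactor (μ : Fin (n + 1) → ℝ) (c : ℂ) : ℂ :=
  c * Complex.exp (-((∑ j, (μ j : ℂ)) * Complex.log c))

theorem scaleFactor_ne_zero {c : ℂ} (hc : c ≠ 0) : scaleFactor μ c ≠ 0 :=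
  mul_ne_zero hc (Complex.exp_ne_zero _)

theorem scaleFactor_eq_one {c : ℂ} (hc : c ≠ 0) (h1 : ∑ j, μ j = 1) : scaleFactor μ c = 1 := by
  have h2 : (∑ j, (μ j : ℂ)) = 1 := by exact_mod_cast h1
  rw [scaleFactor, h2, one_mul, Complex.exp_neg, Complex.exp_log hc, mul_inv_cancel₀ hc]

/-- Multiplying a whole arc by c would rotate its real tail, so only a bounded part that contains
the marked points is scaled. The radius ε depends on n alone at most, so the step can be repeated.
-/
theorem exists_branch_scaling_near_one (n : ℕ) : ∃ ε > 0, ∀ c ∈ Metric.ball (1:ℂ) ε, c ≠ 0 ∧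
    ∀ (μ : Fin (n + 1) → ℝ) (U : Set (V n)) (f : V n → Fin n → ℂ), IsBranch μ U f →
      IsBranch μ ((fun v => c⁻¹ • v) ⁻¹' U) fun v => scaleFactor μ c • f (c⁻¹ • v) := by
  obtain ⟨ε, hε, hsc⟩ := exists_scaling
  refine ⟨min ε 1, lt_min hε one_pos, fun c hc => ?_⟩
  have hcε : c ∈ Metric.ball (1:ℂ) ε := Metric.ball_subset_ball (min_le_left _ _) hc
  have hc0 : c ≠ 0 := Complex.slitPlane_ne_zero (Complex.ball_one_subset_slitPlane
    (Metric.ball_subset_ball (min_le_right _ _) hc))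
  refine ⟨hc0, fun μ U f h => ?_⟩
  have hcont : Continuous fun v : V n => c⁻¹ • v := continuous_const_smul _
  refine ⟨h.1.preimage hcont, fun v hv => ?_⟩
  obtain ⟨N, δ, hvN, hNU, hδ, hf⟩ := h.2 _ hv
  have hcpt : IsCompact (Icc (0:ℝ) n) := isCompact_Icc
  obtain ⟨R, hR⟩ := (hcpt.image_of_continuousOn ((δ (c⁻¹ • v)).continuousOn.mono
    Icc_subset_Ici_self)).isBounded.exists_norm_le
  have hR0 : 0 ≤ R := (norm_nonneg _).trans (hR _ ⟨0, ⟨le_rfl, Nat.cast_nonneg n⟩, rfl⟩)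
  have hclose := eventually_uniformly_close hvN (f := fun x t => (δ x).path t) hcpt
    (hδ.isFamily.1.mono (prod_mono le_rfl Icc_subset_Ici_self)) one_pos
  rw [hδ.1.nhdsWithin_eq hvN] at hclose
  obtain ⟨M, hM, hMo, hvM⟩ := eventually_nhds_iff.mp (hclose.and (hδ.1.mem_nhds hvN))
  obtain ⟨g, hg, -, hgc⟩ := hsc (R + 1) (by linarith)
  have hgc' := hgc c hcε
  have hbound : ∀ x ∈ M, ∀ t ∈ Icc 0 (n : ℝ), ‖(δ x).path t‖ < R + 1 := by
    intro x hx t ht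
    have h1 := (hM x hx).1 t ht
    have h2 := hR _ ⟨t, ht, rfl⟩
    have h3 := norm_sub_norm_le ((δ x).path t) ((δ (c⁻¹ • v)).path t)
    linarith
  refine ⟨(fun v => c⁻¹ • v) ⁻¹' M, fun v => (δ (c⁻¹ • v)).perturb (hg c), hvM,
    fun x hx => hNU (hM _ hx).2, ⟨hMo.preimage hcont, fun x hx => ?_, ?_⟩, fun x hx => ?_⟩
  · have h1 : ((δ (c⁻¹ • x)).perturb (hg c)).points = c • (δ (c⁻¹ • x)).points := by
      funext j
      exact hgc' _ (hbound _ hx _ ⟨Nat.cast_nonneg _, by exact_mod_cast Nat.lt_succ_iff.mp j.2⟩)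
    rw [LArcSystem.cls, h1, toV_smul]
    have h2 : toV (δ (c⁻¹ • x)).points = c⁻¹ • x := hδ.2.1 _ (hM _ hx).2
    rw [h2, smul_inv_smul₀ hc0]
  · have h1 : IsFamily ((fun v : V n => c⁻¹ • v) ⁻¹' M) fun v => δ (c⁻¹ • v) :=
      hδ.isFamily.comp hcont.continuousOn fun x hx => (hM _ hx).2
    exact h1.perturb (f := fun _ => g c) (fun _ => hg c)
      ((hg c).contDiff.continuous.comp_continuousOn continuousOn_snd)
  · change scaleFactor μ c • f (c⁻¹ • x) = F μ ((δ (c⁻¹ • x)).perturb (hg c))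
    rw [hf (c⁻¹ • x) (hM _ hx).2]
    exact (F_perturb_of_eq_mul _ (hg c) (hbound _ hx) hgc').symm

/-- Scaling of branches. -/
theorem IsBranch.exists_scaling {U : Set (V n)} {f : V n → Fin n → ℂ} (h : IsBranch μ U f)
    {c : ℂ} (hc : c ≠ 0) : ∃ a : ℂ, a ≠ 0 ∧ (∑ j, μ j = 1 → a = 1) ∧
      IsBranch μ ((fun v => c⁻¹ • v) ⁻¹' U) fun v => a • f (c⁻¹ • v) := by
  obtain ⟨ε, hε, hsc⟩ := exists_branch_scaling_near_one n
  have hpow : ∀ (b : ℂ), b ∈ Metric.ball (1:ℂ) ε → ∀ m : ℕ, ∃ a : ℂ, a ≠ 0 ∧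
      (∑ j, μ j = 1 → a = 1) ∧
      IsBranch μ ((fun v => (b ^ m)⁻¹ • v) ⁻¹' U) fun v => a • f ((b ^ m)⁻¹ • v) := by
    intro b hb m
    induction m with
    | zero => exact ⟨1, one_ne_zero, fun _ => rfl, by simpa using h⟩
    | succ m ih =>
      obtain ⟨a, ha0, ha1, hbr⟩ := ih
      obtain ⟨hb0, hbs⟩ := hsc b hb
      refine ⟨scaleFactor μ b * a, mul_ne_zero (scaleFactor_ne_zero hb0) ha0,
        fun h1 => by rw [scaleFactor_eq_one hb0 h1, ha1 h1, one_mul], ?_⟩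
      have h2 := hbs μ _ _ hbr
      have h3 : ∀ v : V n, (b ^ m)⁻¹ • b⁻¹ • v = (b ^ (m + 1))⁻¹ • v := fun v => by
        rw [smul_smul, ← mul_inv, ← pow_succ]
      simpa only [preimage_preimage, h3, mul_smul] using h2
  -- A scalar c far from 1 is an m-th power of exp(log c / m), which is close to 1 for large m; so m
  -- small steps reach c.
  have hlim : Tendsto (fun m : ℕ => Complex.exp (Complex.log c / m)) atTop (𝓝 1) := by
    have h1 : Tendsto (fun m : ℕ => Complex.log c / (m : ℂ)) atTop (𝓝 0) :=
      tendsto_const_div_atTop_nhds_zero_nat _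
    have h2 := (Complex.continuous_exp.tendsto 0).comp h1
    rwa [Complex.exp_zero] at h2
  obtain ⟨m, hm, hm0⟩ := ((hlim.eventually (Metric.ball_mem_nhds 1 hε)).and
    (eventually_gt_atTop 0)).exists
  have hmc : Complex.exp (Complex.log c / m) ^ m = c := by
    rw [← Complex.exp_nat_mul, mul_div_cancel₀ _ (by exact_mod_cast hm0.ne'), Complex.exp_log hc]
  have := hpow _ hm m
  rwa [hmc] at this

end Scaling

/-! ### Existence of arc systems and of continuous families through them. -/

section Existence

variable {n : ℕ}

theorem exists_cls_eq {v : V n} (hv : v ∈ VCirc n) : ∃ δ : LArcSystem n, δ.cls = v := by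
  obtain ⟨z, hz, rfl⟩ := hv
  obtain ⟨δ, hδ⟩ := exists_points_eq hz
  exact ⟨δ, by rw [LArcSystem.cls, hδ]⟩

/-- Starting from the constant family, the marks are moved by the displacement that the section of
V_n assigns to v - [z]; at v = [z] this displacement is zero and the arc is unchanged. -/
theorem exists_isContinuousFamily (δ₀ : LArcSystem n) :
    ∃ (N : Set (V n)) (δ : V n → LArcSystem n),
      δ₀.cls ∈ N ∧ IsContinuousFamily N δ ∧ δ δ₀.cls = δ₀ := by
  obtain ⟨r, δ', hr, hfam, h0, hpt, -⟩ :=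
    (isFamily_const δ₀ (univ : Set Unit)).exists_move (mem_univ ())
  have hpt' := hpt.self_of_nhdsWithin (mem_univ ())
  have hc : Continuous fun v : V n => sec n (v - δ₀.cls) :=
    (sec n).continuous.comp (continuous_id.sub continuous_const)
  set N : Set (V n) := (fun v => sec n (v - δ₀.cls)) ⁻¹' Metric.ball 0 r with hN
  have hfam' : IsFamily N fun v => δ' ((), sec n (v - δ₀.cls)) :=
    hfam.comp (g := fun v => ((), sec n (v - δ₀.cls))) (by fun_prop) fun v hv => ⟨mem_univ _, hv⟩
  refine ⟨N, fun v => δ' ((), sec n (v - δ₀.cls)), ?_, ⟨Metric.isOpen_ball.preimage hc,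
    fun v hv => ?_, hfam'⟩, ?_⟩
  · simp only [hN, mem_preimage, sub_self, map_zero]
    exact Metric.mem_ball_self hr
  · rw [LArcSystem.cls, hpt' _ hv, toV_add, toV_sec]
    exact add_sub_cancel _ _
  · simp only [sub_self, map_zero, h0]

end Existence

end Lauricella

namespace Lauricella

open Set Filter Topology Module

/-! ### Descent of branches to projective space, and the local isomorphism statements. -/

variable {n : ℕ} {μ : Fin (n + 1) → ℝ} {U : Set (V n)} {f : V n → Fin n → ℂ}

/-- Near v₀ the normalization to the slice l = 1 multiplies by a scalar near 1, so local homogeneity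
applies; its factor c^(1-|μ|) is 1 in the parabolic case. -/
theorem IsBranch.eventually_normalize (h : IsBranch μ U f) (hn : 0 < n)
    (hμ : ∀ j, 0 < μ j ∧ μ j < 1) {l : V n →L[ℂ] ℂ} {v₀ : V n} (hv₀ : v₀ ∈ U) (hl : l v₀ = 1) :
    ∀ᶠ v in 𝓝 v₀, l v ≠ 0 ∧ (l v)⁻¹ • v ∈ U ∧
      ∃ a : ℂ, a ≠ 0 ∧ (∑ j, μ j = 1 → a = 1) ∧ f ((l v)⁻¹ • v) = a • f v := by
  have hl0 : l v₀ ≠ 0 := by rw [hl]; exact one_ne_zero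
  have hinv : ContinuousAt (fun v => (l v)⁻¹) v₀ := l.continuous.continuousAt.inv₀ hl0
  have hpair : Tendsto (fun v => ((l v)⁻¹, v)) (𝓝 v₀) (𝓝 ((1 : ℂ), v₀)) := by
    have h1 : ContinuousAt (fun v => ((l v)⁻¹, v)) v₀ := hinv.prodMk continuousAt_id
    simpa only [ContinuousAt, hl, inv_one] using h1
  have hnorm : Tendsto (fun v => (l v)⁻¹ • v) (𝓝 v₀) (𝓝 v₀) := by
    have h1 : ContinuousAt (fun v => (l v)⁻¹ • v) v₀ := hinv.smul continuousAt_id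
    simpa only [ContinuousAt, hl, inv_one, one_smul] using h1
  filter_upwards [l.continuous.continuousAt.eventually_ne hl0,
    hnorm.eventually (h.1.mem_nhds hv₀), hpair.eventually (h.eventually_smul hn hμ hv₀)]
    with v h1 h2 h3
  refine ⟨h1, h2, _, Complex.exp_ne_zero _, fun hs => ?_, h3⟩
  have h4 : (∑ j, (μ j : ℂ)) = 1 := by exact_mod_cast hs
  rw [h4, sub_self, zero_mul, Complex.exp_zero]

/-- A point y over the slice may be far from its normalization. The branch is first transported to y
by the scalar l(y), and local homogeneity then handles the points near y. -/
theorem IsBranch.exists_branch_normalize (h : IsBranch μ U f) (hn : 0 < n)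
    (hμ : ∀ j, 0 < μ j ∧ μ j < 1) {l : V n →L[ℂ] ℂ} {y : V n}
    (hy : y ∈ cone (sliceProj l U)) :
    ∃ (U' : Set (V n)) (f' : V n → Fin n → ℂ), y ∈ U' ∧ IsBranch μ U' f' ∧
      ∀ v ∈ U', l v ≠ 0 ∧ (l v)⁻¹ • v ∈ U ∧
        ∃ a : ℂ, a ≠ 0 ∧ (∑ j, μ j = 1 → a = 1) ∧ f ((l v)⁻¹ • v) = a • f' v := by
  obtain ⟨hly, hyU⟩ := (mem_cone_sliceProj l).mp hy
  obtain ⟨b, hb0, hb1, hbr⟩ := h.exists_scaling hly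
  have hcont : Continuous fun v : V n => (l y)⁻¹ • v := continuous_const_smul _
  obtain ⟨M, hM, hMo, hyM⟩ := eventually_nhds_iff.mp (hcont.continuousAt.eventually
    ((h.eventually_normalize hn hμ hyU (apply_normalize hly)).and (h.1.mem_nhds hyU)))
  refine ⟨M, _, hyM, hbr.mono hMo fun v hv => (hM v hv).2, fun v hv => ?_⟩
  obtain ⟨⟨h1, h2, a, ha0, ha1, ha⟩, -⟩ := hM v hv
  have h3 : (l ((l y)⁻¹ • v))⁻¹ • (l y)⁻¹ • v = (l v)⁻¹ • v := by
    rw [map_smul, smul_eq_mul, mul_inv, inv_inv, smul_smul, mul_right_comm,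
      mul_inv_cancel₀ hly, one_mul]
  rw [h3] at h2 ha
  refine ⟨fun h0 => h1 (by rw [map_smul, h0, smul_zero]), h2, a * b⁻¹,
    mul_ne_zero ha0 (inv_ne_zero hb0), fun hs => by rw [ha1 hs, hb1 hs, inv_one, one_mul], ?_⟩
  rw [ha, smul_smul, mul_assoc, inv_mul_cancel₀ hb0, mul_one]

/-- The descended map evaluates f at the representative in a slice through v. Off the slice its
pull-back is still a branch, namely a transported one, since all factors are 1 when |μ| = 1. -/
theorem IsBranch.exists_descendedBranch (h : IsBranch μ U f) (hn : 0 < n)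
    (hμ : ∀ j, 0 < μ j ∧ μ j < 1) (h1 : ∑ j, μ j = 1) {v : V n} (hv : v ∈ U) :
    ∃ (O : Set (Projectivization ℂ (V n))) (g : Projectivization ℂ (V n) → Fin n → ℂ)
      (N : Set (V n)), IsDescendedBranch μ O g ∧ IsOpen N ∧ v ∈ N ∧ N ⊆ U ∧
      ∀ v' ∈ N, ∃ hv : v' ≠ 0, Projectivization.mk ℂ v' hv ∈ O ∧
        f v' = g (Projectivization.mk ℂ v' hv) := by
  obtain ⟨l, hl⟩ := SeparatingDual.exists_eq_one (R := ℂ) (h.ne_zero hn hv)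
  obtain ⟨N, hN, hNo, hvN⟩ := eventually_nhds_iff.mp
    ((h.eventually_normalize hn hμ hv hl).and (h.1.mem_nhds hv))
  refine ⟨sliceProj l U, fun p => f (normRep l p), N,
    ⟨isOpenProj_sliceProj l h.1, fun y hy => ?_⟩, hNo, hvN, fun y hy => (hN y hy).2,
    fun y hy => ?_⟩
  · obtain ⟨U', f', hyU', hf', hU'⟩ := h.exists_branch_normalize hn hμ hy
    refine ⟨U', f', hyU', hf', fun v' hv' => ⟨hf'.ne_zero hn hv', ?_⟩⟩
    obtain ⟨-, -, a, -, ha1, ha⟩ := hU' v' hv'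
    beta_reduce
    rw [normRep_mk, ha, ha1 h1, one_smul]
  · obtain ⟨⟨h2, h3, a, -, ha1, ha⟩, hyU⟩ := hN y hy
    refine ⟨h.ne_zero hn hyU, ((mem_cone_sliceProj l).mpr ⟨h2, h3⟩).choose_spec, ?_⟩
    beta_reduce
    rw [normRep_mk, ha, ha1 h1, one_smul]

theorem IsBranch.exists_schwarzBranch (h : IsBranch μ U f) (hn : 0 < n)
    (hμ : ∀ j, 0 < μ j ∧ μ j < 1) (hint : ∀ m : ℕ, 2 ≤ m → ∑ j, μ j ≠ (m : ℝ))
    {v : V n} (hv : v ∈ U) :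
    ∃ (O : Set (Projectivization ℂ (V n)))
      (g : Projectivization ℂ (V n) → Projectivization ℂ (Fin n → ℂ))
      (N : Set (V n)), IsSchwarzBranch μ O g ∧ IsOpen N ∧ v ∈ N ∧ N ⊆ U ∧
      ∀ v' ∈ N, ∃ (hv : v' ≠ 0) (hf : f v' ≠ 0), Projectivization.mk ℂ v' hv ∈ O ∧
        g (Projectivization.mk ℂ v' hv) = Projectivization.mk ℂ (f v') hf := by
  classical
  obtain ⟨l, hl⟩ := SeparatingDual.exists_eq_one (R := ℂ) (h.ne_zero hn hv)
  obtain ⟨N, hN, hNo, hvN⟩ := eventually_nhds_iff.mp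
    ((h.eventually_normalize hn hμ hv hl).and (h.1.mem_nhds hv))
  -- The second alternative is a default value for points outside the slice; over the slice f does
  -- not vanish.
  set g : Projectivization ℂ (V n) → Projectivization ℂ (Fin n → ℂ) := fun p =>
    if hp : f (normRep l p) ≠ 0 then Projectivization.mk ℂ (f (normRep l p)) hp
    else Projectivization.mk ℂ (f v) (h.apply_ne_zero hn hμ hint hv) with hg
  have key : ∀ (y : V n) (hy : y ≠ 0) (a : ℂ) (x : Fin n → ℂ) (hx : x ≠ 0), a ≠ 0 →
      f ((l y)⁻¹ • y) = a • x → g (Projectivization.mk ℂ y hy) = Projectivization.mk ℂ x hx := by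
    intro y hy a x hx ha0 ha
    have h1 : f (normRep l (Projectivization.mk ℂ y hy)) = a • x := by rw [normRep_mk, ha]
    have h2 : f (normRep l (Projectivization.mk ℂ y hy)) ≠ 0 := by
      rw [h1]
      exact smul_ne_zero ha0 hx
    exact (dif_pos h2).trans (mk_smul _ _ h1)
  refine ⟨sliceProj l U, g, N, ⟨isOpenProj_sliceProj l h.1, fun y hy => ?_⟩, hNo, hvN,
    fun y hy => (hN y hy).2, fun y hy => ?_⟩
  · obtain ⟨U', f', hyU', hf', hU'⟩ := h.exists_branch_normalize hn hμ hy
    refine ⟨U', f', hyU', hf', fun v' hv' => ⟨hf'.ne_zero hn hv',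
      hf'.apply_ne_zero hn hμ hint hv', ?_⟩⟩
    obtain ⟨-, -, a, ha0, -, ha⟩ := hU' v' hv'
    exact key _ _ a _ _ ha0 ha
  · obtain ⟨⟨h2, h3, a, ha0, -, ha⟩, hyU⟩ := hN y hy
    exact ⟨h.ne_zero hn hyU, h.apply_ne_zero hn hμ hint hyU,
      ((mem_cone_sliceProj l).mpr ⟨h2, h3⟩).choose_spec, key _ _ a _ _ ha0 ha⟩

theorem finrank_V_eq (n : ℕ) : finrank ℂ (V n) = finrank ℂ (Fin n → ℂ) := by
  rw [finrank_V, Module.finrank_fin_fun]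

/-- When |μ| = 1 the kernel of df is contained in the line of v and the values satisfy the parabolic
relation, so `exists_localIso_affine` applies with c = π. -/
theorem IsDescendedBranch.isLocalIsoProjAffine {O : Set (Projectivization ℂ (V n))}
    {g : Projectivization ℂ (V n) → Fin n → ℂ} (hg : IsDescendedBranch μ O g) (hn : 0 < n)
    (hμ : ∀ j, 0 < μ j ∧ μ j < 1) (h1 : ∑ j, μ j = 1) :
    IsLocalIsoProjAffine g O (parabolicHyperplane μ) := by
  have hint : ∀ m : ℕ, 2 ≤ m → ∑ j, μ j ≠ (m : ℝ) := by
    intro m hm h2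
    rw [h1] at h2
    have h3 : (1 : ℕ) = m := by exact_mod_cast h2
    omega
  have hset : parabolicHyperplane μ = {x | parabolicForm μ x = (Real.pi : ℂ)} :=
    ext fun x => mem_parabolicHyperplane
  have hrep : ∀ p ∈ O, p.rep ∈ cone O := fun p hp =>
    ⟨p.rep_nonzero, by rwa [Projectivization.mk_rep]⟩
  constructor
  · intro p hp
    obtain ⟨U, f, hvU, hf, hgf⟩ := hg.2 _ (hrep p hp)
    obtain ⟨hv, h2⟩ := hgf _ hvU
    rw [Projectivization.mk_rep] at h2
    rw [h2, mem_parabolicHyperplane]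
    exact hf.parabolicForm_eq hμ h1 hvU
  · intro p hp
    obtain ⟨U, f, hvU, hf, hgf⟩ := hg.2 _ (hrep p hp)
    have h2 := exists_localIso_affine (finrank_V_eq n) hg.1 hf.1 p.rep_nonzero hvU (hrep p hp) hgf
      (fun v hv => hf.contDiffAt hμ hv) (ψ := parabolicForm μ) (c := (Real.pi : ℂ))
      (by exact_mod_cast Real.pi_ne_zero) (fun v hv => hf.parabolicForm_eq hμ h1 hv)
      fun w hw => by
        obtain ⟨b, hb, -⟩ := hf.fderiv_eq_smul hn hμ hint hvU (a := 0) (by rw [hw, zero_smul])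
        exact ⟨b, hb⟩
    rwa [Projectivization.mk_rep, ← hset] at h2

/-- The only directions in which f changes proportionally to itself are the multiples of v, whatever
|μ| is; so the nonparabolic and the parabolic case need no distinction here. -/
theorem IsSchwarzBranch.isLocalIsoProjProj {O : Set (Projectivization ℂ (V n))}
    {g : Projectivization ℂ (V n) → Projectivization ℂ (Fin n → ℂ)}
    (hg : IsSchwarzBranch μ O g) (hn : 0 < n) (hμ : ∀ j, 0 < μ j ∧ μ j < 1)
    (hint : ∀ m : ℕ, 2 ≤ m → ∑ j, μ j ≠ (m : ℝ)) : IsLocalIsoProjProj g O := by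
  intro p hp
  have hrep : p.rep ∈ cone O := ⟨p.rep_nonzero, by rwa [Projectivization.mk_rep]⟩
  obtain ⟨U, f, hvU, hf, hgf⟩ := hg.2 _ hrep
  have h2 := exists_localIso_proj (finrank_V_eq n) hg.1 hf.1 p.rep_nonzero hvU hrep hgf
    (fun v hv => hf.contDiffAt hμ hv) fun w a hw => by
      obtain ⟨b, hb, -⟩ := hf.fderiv_eq_smul hn hμ hint hvU hw
      exact ⟨b, hb⟩
  rwa [Projectivization.mk_rep] at h2

end Lauricella

end

/-! ### The theorem. -/

theorem mainTheorem8 (n : ℕ) (hn : 0 < n) (μ : Fin (n + 1) → ℝ)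
    (hμ : ∀ j, 0 < μ j ∧ μ j < 1)
    (hint : ∀ m : ℕ, 2 ≤ m → ∑ j, μ j ≠ (m : ℝ)) :
    -- the multivalued map is defined on `V_n°`, and its values extend to local branches
    (∀ v ∈ Lauricella.VCirc n, ∃ δ : Lauricella.LArcSystem n, δ.cls = v) ∧
    (∀ δ₀ : Lauricella.LArcSystem n,
      ∃ (N : Set (Lauricella.V n)) (δ : Lauricella.V n → Lauricella.LArcSystem n),
        δ₀.cls ∈ N ∧ Lauricella.IsContinuousFamily N δ ∧ δ δ₀.cls = δ₀) ∧
    -- nonparabolic case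
    (∑ j, μ j ≠ 1 →
      (∀ (U : Set (Lauricella.V n)) (f : Lauricella.V n → Fin n → ℂ),
        Lauricella.IsBranch μ U f → Lauricella.IsLocalIso f U) ∧
      ∀ δ : Lauricella.LArcSystem n, Lauricella.F μ δ ≠ 0) ∧
    -- parabolic case
    (∑ j, μ j = 1 →
      (∀ (U : Set (Lauricella.V n)) (f : Lauricella.V n → Fin n → ℂ),
        Lauricella.IsBranch μ U f → ∀ v ∈ U,
          ∃ (O : Set (Projectivization ℂ (Lauricella.V n)))
            (g : Projectivization ℂ (Lauricella.V n) → Fin n → ℂ)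
            (N : Set (Lauricella.V n)),
            Lauricella.IsDescendedBranch μ O g ∧ IsOpen N ∧ v ∈ N ∧ N ⊆ U ∧
            ∀ v' ∈ N, ∃ hv : v' ≠ 0, Projectivization.mk ℂ v' hv ∈ O ∧
              f v' = g (Projectivization.mk ℂ v' hv)) ∧
      ∀ (O : Set (Projectivization ℂ (Lauricella.V n)))
        (g : Projectivization ℂ (Lauricella.V n) → Fin n → ℂ),
        Lauricella.IsDescendedBranch μ O g →
          Lauricella.IsLocalIsoProjAffine g O (Lauricella.parabolicHyperplane μ)) ∧
    -- the Schwarz map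
    (∀ (U : Set (Lauricella.V n)) (f : Lauricella.V n → Fin n → ℂ),
      Lauricella.IsBranch μ U f → ∀ v ∈ U,
        ∃ (O : Set (Projectivization ℂ (Lauricella.V n)))
          (g : Projectivization ℂ (Lauricella.V n) → Projectivization ℂ (Fin n → ℂ))
          (N : Set (Lauricella.V n)),
          Lauricella.IsSchwarzBranch μ O g ∧ IsOpen N ∧ v ∈ N ∧ N ⊆ U ∧
          ∀ v' ∈ N, ∃ (hv : v' ≠ 0) (hf : f v' ≠ 0), Projectivization.mk ℂ v' hv ∈ O ∧
            g (Projectivization.mk ℂ v' hv) = Projectivization.mk ℂ (f v') hf) ∧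
    ∀ (O : Set (Projectivization ℂ (Lauricella.V n)))
      (g : Projectivization ℂ (Lauricella.V n) → Projectivization ℂ (Fin n → ℂ)),
      Lauricella.IsSchwarzBranch μ O g → Lauricella.IsLocalIsoProjProj g O := by
  refine ⟨fun v hv => Lauricella.exists_cls_eq hv, Lauricella.exists_isContinuousFamily,
    fun h1 => ⟨fun U f h => h.isLocalIso hn hμ hint h1, Lauricella.F_ne_zero hn hμ hint⟩,
    fun h1 => ⟨fun U f h v hv => h.exists_descendedBranch hn hμ h1 hv,
      fun O g hg => hg.isLocalIsoProjAffine hn hμ h1⟩,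
    fun U f h v hv => h.exists_schwarzBranch hn hμ hint hv,
    fun O g hg => hg.isLocalIsoProjProj hn hμ hint⟩
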